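/- Let $S^3\subset\mathbb R^4$ be the round unit sphere. A symmetric tensor field $K$ on a round sphere is a Killing tensor if the symmetrisation of $\nabla K$ vanishes; it is integrable if $N^\delta{}_{[\beta\gamma}g_{\alpha]\delta}=0$, $N^\delta{}_{[\beta\gamma}K_{\alpha]\delta}=0$ and $N^\delta{}_{[\beta\gamma}K_{\alpha]\varepsilon}K^\varepsilon{}_\delta=0$, where $N^\alpha{}_{\beta\gamma}=K^\alpha{}_\delta\nabla_{[\gamma}K^\delta{}_{\beta]}+\nabla_\delta K^\alpha{}_{[\gamma}K^\delta{}_{\beta]}$. An algebraic curvature tensor $R$ on $\mathbb R^{n+1}$ defines the Killing tensor $K_x(v,w)=R(x,v,x,w)$ on $S^n$. For a linear subspace $W\subset\mathbb R^{4}$, the extension (by zero) to $S^3$ of the Killing tensor with curvature tensor $R_1$ on the unit sphere $S(W)$ is the Killing tensor with curvature tensor $R_1\oplus 0$ on $W\oplus W^\perp$. Call $R$ on $\mathbb R^4$ diagonal if $R_{ijkl}=0$ unless $\{i,j\}=\{k,l\}$ in the standard basis $e_0,\dots,e_3$. Then $R_{0\alpha0\alpha}=w_\alpha+t_\alpha+\frac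 s{12}$ and $R_{\beta\gamma\beta\gamma}=w_\alpha-t_\alpha+\frac s{12}$ for the cyclic permutations $(\alpha,\beta,\gamma)$ of $(1,2,3)$, with unique $w,t\in\mathbb R^3$, $w_1+w_2+w_3=0$, $s\in\mathbb R$; associate to $R$ the matrix $$M=\begin{pmatrix}w_2-w_3&-t_3&t_2\\t_3&w_3-w_1&-t_1\\-t_2&t_1&w_1-w_2\end{pmatrix}.$$ Let $\mathcal A\cong\mathbb R^5$ be the space of real $3\times3$ matrices with diagonal, trace free symmetric part, $\mathcal V=\{M\in\mathcal A:\det M=0\}$, and let the KS-variety be $\mathbb P\mathcal V\subset\mathbb P\mathcal A\cong\mathbb P^4$. The rotation group $S_4\subset SO(3)$ of the octahedron with vertices $\pm e_i\in\mathbb R^3$ acts on it by conjugation. Up to multiples of the metric, $R\mapsto M$ is a bijection from Killing tensors on $S^3$ with diagonal curvature tensor to $\mathcal A$, the integrable ones corresponding to $\mathcal V$. **Theorem.** Let $\mathcal K(S^3)$ be the set of integrable Killing tensors on $S^3$. The projectivisation of $\mathcal K(S^3)/(\mathrm{Isom}(S^3)\times\mathbb Rg)$ is isomorphic to $\mathbb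 P\mathcal V/S_4$: there is a homeomorphism $\Phi$ of these quotient spaces, such that $\Phi([K])=[M]$ if and only if some isometry transforms $K$ to a Killing tensor with diagonal curvature tensor and associated matrix a nonzero multiple of $M$, and such that a function $F$ on $\mathbb P\mathcal V/S_4$ comes from a regular function on $\mathbb P\mathcal V$ if and only if $F\circ\Phi$ comes from a regular function on $\mathbb P(\mathcal K(S^3)/\mathbb Rg)$ (regular: a global quotient of homogeneous polynomials of equal degree with nowhere vanishing denominator). Furthermore: 1. $\mathbb P\mathcal V$ has exactly ten singular points: its points of rank one, of which there are six, and four skew symmetric ones. The rank one points are exactly the points defined by the extensions to $S^3$ of the metrics of the circles $S^1=S^3\cap\langle e_i,e_j\rangle$, and the skew symmetric singular points are exactly those defined by the extensions of the metrics of the spheres $S^2=S^3\cap e_i^\perp$. 2. Let $\mathcal S$ be a Stäckel system on $S^3$, i.e. a three-dimensional vector space of mutually commuting integrable Killing tensors. Some isometry makes the curvature tensors of all members of $\mathcal S$ simultaneously diagonal. For any such isometry the associated matrices form a two-dimensional linear subspace of $\mathcal V$ (a projective line in $\mathbb P\mathcal V$), all of whose members annihilate a common nonzero vector. Any two lines obtained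 from $\mathcal S$ in this way are equivalent under $S_4$. 3. Call a projective plane in $\mathbb P\mathcal V$ isokernel if its matrices annihilate a common nonzero vector. For each isokernel plane there is a unique $i\in\{0,1,2,3\}$, and for each $i$ there is an isokernel plane, such that a Killing tensor with diagonal curvature tensor has its matrix in (the linear span of) the plane if and only if it is, up to adding a multiple of $g$, the extension of an integrable Killing tensor on $S^2=S^3\cap e_i^\perp$. Moreover a field $K$ on $S^3$ is, up to adding a multiple of $g$, the extension of an integrable Killing tensor from some great sphere $S^2\subset S^3$ if and only if some isometry transforms it to a Killing tensor with diagonal curvature tensor whose matrix lies in an isokernel plane. 4. All antisymmetric matrices lie in $\mathcal V$. Special Killing tensors, i.e. tensors $K=L-(\operatorname{tr}L)g$ with $L$ a special conformal Killing tensor ($\nabla_\gamma L_{\alpha\beta}=\lambda_\alpha g_{\beta\gamma}+\lambda_\beta g_{\alpha\gamma}$, $\lambda=\frac12\nabla\operatorname{tr}L$), are integrable Killing tensors. A Killing tensor on $S^3$ with diagonal curvature tensor is special if and only if its matrix is antisymmetric, and a field is a special Killing tensor if and only if some isometry transforms it to a Killing tensor with diagonal curvature tensor and antisymmetric matrix.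 -/

import Mathlib

open scoped RealInnerProductSpace ContDiff LinearAlgebra.Projectivization

noncomputable section

namespace KillingStaeckel

/-! ### Tensor fields on the unit sphere of a Euclidean vector space -/

section Sphere

variable {V : Type*} [NormedAddCommGroup V] [InnerProductSpace ℝ V]

/-- Fields on the unit sphere `S(V)` with values in the endomorphisms of the ambient space `V`.
An endomorphism field of the tangent bundle is encoded by letting it act by zero on the normal line
`ℝ x`; see `IsSymmetricTensor`. -/
abbrev EndoField (V : Type*) [NormedAddCommGroup V] [InnerProductSpace ℝ V] : Type _ :=
  Metric.sphere (0 : V) 1 → (V →L[ℝ] V)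

/-- `v` lies in `T_x S(V)`, the orthogonal complement of `x`. -/
def IsTangent (x : Metric.sphere (0 : V) 1) (v : V) : Prop := ⟪(x : V), v⟫ = 0

/-- The round metric of `S(V)` as an endomorphism field: at `x` it is the identity on `T_x S(V)` and zero
on `ℝ x`, that is, the orthogonal projection onto `T_x S(V)`. -/
def metric (V : Type*) [NormedAddCommGroup V] [InnerProductSpace ℝ V] : EndoField V := fun x =>
  ContinuousLinearMap.id ℝ V - (innerSL ℝ (x : V)).smulRight (x : V)

open Classical in
/-- The extension of a field on the sphere to `V \ {0}` which is constant along rays (and zero at `0`). -/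
def radialExt (K : EndoField V) (y : V) : V →L[ℝ] V :=
  if h : y ≠ 0 then K ⟨‖y‖⁻¹ • y, by simp [norm_smul, h]⟩ else 0

/-- A (smooth) symmetric tensor field `K` on `S(V)`, regarded as a field of symmetric endomorphisms of the
tangent spaces; the bilinear form at `x` is `(v, w) ↦ ⟪K x v, w⟫`. -/
def IsSymmetricTensor (K : EndoField V) : Prop :=
  ContDiffOn ℝ ∞ (radialExt K) {0}ᶜ ∧
    (∀ x, K x (x : V) = 0) ∧
    ∀ x v w, ⟪K x v, w⟫ = ⟪v, K x w⟫

/-- `(∇_u K) v` for the Levi-Civita connection of the round metric and `u`, `v` tangent at `x`: the tangential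
part of the ambient derivative (the terms which come from differentiating the tangent vector fields in
the normal direction vanish, because `K x` kills the normal direction). -/
def nabla (K : EndoField V) (x : Metric.sphere (0 : V) 1) (u v : V) : V :=
  metric V x (fderiv ℝ (radialExt K) (x : V) u v)

/-- Killing tensors: symmetric tensor fields such that the symmetrisation of `∇ K` vanishes. As `∇ K` is
symmetric in its last two arguments, this is the vanishing of the cyclic sum. -/
def IsKilling (K : EndoField V) : Prop :=
  IsSymmetricTensor K ∧
    ∀ x u v w, IsTangent x u → IsTangent x v → IsTangent x w →
      ⟪nabla K x u v, w⟫ + ⟪nabla K x v w, u⟫ + ⟪nabla K x w u, v⟫ = 0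

/-- The Nijenhuis torsion `N^α_{βγ} v^β w^γ` where
`N^α_{βγ} = K^α_δ ∇_{[γ} K^δ_{β]} + ∇_δ K^α_{[γ} K^δ_{β]}`. -/
def nijenhuis (K : EndoField V) (x : Metric.sphere (0 : V) 1) (v w : V) : V :=
  (1 / 2 : ℝ) • (K x (nabla K x w v - nabla K x v w)) +
    (1 / 2 : ℝ) • (nabla K x (K x v) w - nabla K x (K x w) v)

/-- Vanishing of `N^δ_{[βγ} H_{α]δ}` at every point. As `N` is antisymmetric in its two arguments,
the antisymmetrisation is a multiple of the cyclic sum. -/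
def NijenhuisCondition (K H : EndoField V) : Prop :=
  ∀ x u v w, IsTangent x u → IsTangent x v → IsTangent x w →
    ⟪H x (nijenhuis K x u v), w⟫ + ⟪H x (nijenhuis K x v w), u⟫
      + ⟪H x (nijenhuis K x w u), v⟫ = 0

/-- The three Nijenhuis integrability conditions, for `H = g`, `H = K` and `H = K²`. -/
def IsIntegrable (K : EndoField V) : Prop :=
  NijenhuisCondition K (metric V) ∧ NijenhuisCondition K K ∧
    NijenhuisCondition K (fun x => (K x).comp (K x))

/-- A Stäckel system on the `n`-dimensional sphere `S(V)`, `n + 1 = dim V`: an `n`-dimensional vector space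
of mutually commuting integrable Killing tensors. -/
def IsStaeckelSystem (S : Submodule ℝ (EndoField V)) : Prop :=
  Module.finrank ℝ S + 1 = Module.finrank ℝ V ∧
    (∀ K ∈ S, IsKilling K ∧ IsIntegrable K) ∧
    ∀ K ∈ S, ∀ K' ∈ S, ∀ x, (K x).comp (K' x) = (K' x).comp (K x)

/-- The trace of a tensor field on `S(V)` (the normal direction does not contribute). -/
def trace (L : EndoField V) (x : Metric.sphere (0 : V) 1) : ℝ :=
  LinearMap.trace ℝ V (L x : V →ₗ[ℝ] V)

/-- The differential of `tr L` at `x` in the tangent direction `v`. -/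
def dTrace (L : EndoField V) (x : Metric.sphere (0 : V) 1) (v : V) : ℝ :=
  fderiv ℝ (fun y => LinearMap.trace ℝ V (radialExt L y : V →ₗ[ℝ] V)) (x : V) v

/-- Special conformal Killing tensors: the Sinjukov equation
`∇_γ L_{αβ} = λ_α g_{βγ} + λ_β g_{αγ}` with `λ = ½ ∇ tr L`. -/
def IsSpecialConformalKilling (L : EndoField V) : Prop :=
  IsSymmetricTensor L ∧
    ∀ x u v w, IsTangent x u → IsTangent x v → IsTangent x w →
      ⟪nabla L x u v, w⟫ = (1 / 2 : ℝ) * dTrace L x v * ⟪w, u⟫ + (1 / 2 : ℝ) * dTrace L x w * ⟪v, u⟫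

/-- Special Killing tensors: those of the form `L - (tr L) g`, where `L` is a special conformal Killing
tensor. -/
def IsSpecialKilling (K : EndoField V) : Prop :=
  ∃ L : EndoField V, IsSpecialConformalKilling L ∧ ∀ x, K x = L x - trace L x • metric V x

/-- The action of the isometry group `O(V)` of `S(V)` on tensor fields. -/
def pushforward (φ : V ≃ₗᵢ[ℝ] V) (K : EndoField V) : EndoField V := fun x =>
  (φ.toContinuousLinearEquiv : V →L[ℝ] V).comp
    ((K ⟨φ.symm (x : V), by simp⟩).comp (φ.symm.toContinuousLinearEquiv : V →L[ℝ] V))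

theorem pushforward_apply (φ : V ≃ₗᵢ[ℝ] V) (K : EndoField V) (x : Metric.sphere (0 : V) 1) (v : V) :
    pushforward φ K x v = φ (K ⟨φ.symm (x : V), by simp⟩ (φ.symm v)) := rfl

theorem pushforward_refl (K : EndoField V) :
    pushforward (LinearIsometryEquiv.refl ℝ V) K = K := rfl

theorem pushforward_pushforward (φ ψ : V ≃ₗᵢ[ℝ] V) (K : EndoField V) :
    pushforward φ (pushforward ψ K) = pushforward (ψ.trans φ) K := rfl

theorem pushforward_affine (φ : V ≃ₗᵢ[ℝ] V) (K : EndoField V) (c a : ℝ) :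
    pushforward φ (c • K + a • metric V) = c • pushforward φ K + a • metric V := by
  funext x; ext v
  simp [pushforward_apply, metric, ← LinearIsometryEquiv.inner_map_eq_flip]

/-! ### Algebraic curvature tensors -/

/-- Algebraic curvature tensors `R_{a₁ b₁ a₂ b₂}` on `V`. -/
structure IsAlgCurvature (R : MultilinearMap ℝ (fun _ : Fin 4 => V) ℝ) : Prop where
  antisymm_left : ∀ a b c d, R ![b, a, c, d] = -R ![a, b, c, d]
  antisymm_right : ∀ a b c d, R ![a, b, d, c] = -R ![a, b, c, d]
  pair_symm : ∀ a b c d, R ![c, d, a, b] = R ![a, b, c, d]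
  bianchi : ∀ a b c d, R ![a, b, c, d] + R ![a, c, d, b] + R ![a, d, b, c] = 0

/-- `K` is the tensor field `K_x(v, w) = R(x, v, x, w)` on `S(V)` given by the algebraic curvature
tensor `R`. (For `v = x` the right-hand side vanishes, in accordance with `K_x x = 0`.) -/
def IsFieldOf (R : MultilinearMap ℝ (fun _ : Fin 4 => V) ℝ) (K : EndoField V) : Prop :=
  ∀ x v w, ⟪K x v, w⟫ = R ![(x : V), v, (x : V), w]

/-- `K` is the extension by zero, from the subsphere `S(W)` to `S(V)`, of the Killing tensor `K₁` on `S(W)`: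
the algebraic curvature tensor of `K` is `R₁ ⊕ 0` with respect to `V = W ⊕ Wᗮ`, where `R₁` is that
of `K₁`. -/
def IsExtension (W : Submodule ℝ V) [W.HasOrthogonalProjection] (K₁ : EndoField W)
    (K : EndoField V) : Prop :=
  ∃ R₁ : MultilinearMap ℝ (fun _ : Fin 4 => W) ℝ, IsAlgCurvature R₁ ∧ IsFieldOf R₁ K₁ ∧
    IsFieldOf (R₁.compLinearMap fun _ => (W.orthogonalProjectionOnto : V →ₗ[ℝ] W)) K

end Sphere

/-! ### Diagonal algebraic curvature tensors in dimension four -/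

/-- The Euclidean space `ℝ⁴`, whose unit sphere is `S³`. -/
abbrev E4 : Type := EuclideanSpace ℝ (Fin 4)

/-- The standard orthonormal basis `e₀, e₁, e₂, e₃` of `ℝ⁴`. -/
def e (i : Fin 4) : E4 := EuclideanSpace.single i 1

/-- The coordinate subspace spanned by the `e i` with `i ∈ I`. -/
def coordSubspace (I : Finset (Fin 4)) : Submodule ℝ E4 := Submodule.span ℝ (e '' (I : Set (Fin 4)))

/-- `R_{ijkl} = 0` unless `{i, j} = {k, l}`. -/
def IsDiagonal (R : MultilinearMap ℝ (fun _ : Fin 4 => E4) ℝ) : Prop :=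
  ∀ i j k l : Fin 4, ({i, j} : Set (Fin 4)) ≠ {k, l} → R ![e i, e j, e k, e l] = 0

/-- The component `R_{ijij}`. -/
def sec (R : MultilinearMap ℝ (fun _ : Fin 4 => E4) ℝ) (i j : Fin 4) : ℝ := R ![e i, e j, e i, e j]

/-- The scalar curvature of a diagonal algebraic curvature tensor. -/
def scal (R : MultilinearMap ℝ (fun _ : Fin 4 => E4) ℝ) : ℝ :=
  2 * (sec R 0 1 + sec R 2 3 + sec R 0 2 + sec R 3 1 + sec R 0 3 + sec R 1 2)

/-- The parameters `t_α`, and below `w_α`, determined by `R_{0α0α} = w_α + t_α + s/12`,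
`R_{βγβγ} = w_α - t_α + s/12` for every cyclic permutation `(α, β, γ)` of `(1, 2, 3)`. The index
`α ∈ {1, 2, 3}` is `i.succ` with `i : Fin 3`, and then `β = (i + 1).succ`, `γ = (i + 2).succ`. -/
def tPar (R : MultilinearMap ℝ (fun _ : Fin 4 => E4) ℝ) (i : Fin 3) : ℝ :=
  (sec R 0 i.succ - sec R (i + 1).succ (i + 2).succ) / 2

/-- The parameters `w_α`. -/
def wPar (R : MultilinearMap ℝ (fun _ : Fin 4 => E4) ℝ) (i : Fin 3) : ℝ :=
  (sec R 0 i.succ + sec R (i + 1).succ (i + 2).succ) / 2 - scal R / 12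

/-- The matrix with diagonal `(w₂ - w₃, w₃ - w₁, w₁ - w₂)` and skew part given by `(t₁, t₂, t₃)`. -/
def ksMatrix (R : MultilinearMap ℝ (fun _ : Fin 4 => E4) ℝ) : Matrix (Fin 3) (Fin 3) ℝ :=
  !![wPar R 1 - wPar R 2, -tPar R 2, tPar R 1;
     tPar R 2, wPar R 2 - wPar R 0, -tPar R 0;
     -tPar R 1, tPar R 0, wPar R 0 - wPar R 1]

/-! ### The KS-variety -/

/-- The space `𝒜 ≅ ℝ⁵` of real 3×3 matrices whose symmetric part is diagonal and trace free. -/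
def KSSpace : Submodule ℝ (Matrix (Fin 3) (Fin 3) ℝ) where
  carrier := {M | (∀ i j, i ≠ j → M i j = -M j i) ∧ M.trace = 0}
  add_mem' := by
    rintro A B ⟨hA, hA'⟩ ⟨hB, hB'⟩
    refine ⟨fun i j h => ?_, by simp [hA', hB']⟩
    simp only [Matrix.add_apply, hA i j h, hB i j h]; ring
  zero_mem' := by simp
  smul_mem' := by
    rintro c A ⟨hA, hA'⟩
    refine ⟨fun i j h => ?_, by simp [hA']⟩
    simp only [Matrix.smul_apply, hA i j h, smul_neg]

/-- The affine cone `𝒱 ⊂ 𝒜` over the KS-variety. -/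
def ksCone : Set KSSpace := {M | (M : Matrix (Fin 3) (Fin 3) ℝ).det = 0}

/-- The KS-variety in `ℙ 𝒜 ≅ ℙ⁴`. -/
def ksVariety : Set (ℙ ℝ KSSpace) := {p | p.rep ∈ ksCone}

/-- The Killing tensor `K` on `S³` has a diagonal algebraic curvature tensor, with associated
matrix `M`. -/
def HasKSMatrix (K : EndoField E4) (M : KSSpace) : Prop :=
  ∃ R : MultilinearMap ℝ (fun _ : Fin 4 => E4) ℝ,
    IsAlgCurvature R ∧ IsDiagonal R ∧ IsFieldOf R K ∧ ksMatrix R = M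

/-- `K` defines the point `p` of `ℙ 𝒜`. -/
def Represents (K : EndoField E4) (p : ℙ ℝ KSSpace) : Prop :=
  ∃ M : KSSpace, M ≠ 0 ∧ M ∈ p.submodule ∧ HasKSMatrix K M

/-- The vertices `± e_i` of the regular octahedron in `ℝ³`. -/
def octahedron : Set (Fin 3 → ℝ) := {v | ∃ i, v = Pi.single i 1 ∨ v = -Pi.single i 1}

/-- The rotation group of the octahedron, a copy of `S₄` in `SO(3)`. -/
def octahedralGroup : Subgroup (Matrix.specialOrthogonalGroup (Fin 3) ℝ) where
  carrier := {Q | (fun v => (Q : Matrix (Fin 3) (Fin 3) ℝ).mulVec v) '' octahedron = octahedron}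
  mul_mem' := by
    intro P Q hP hQ
    simp only [Set.mem_ofPred_eq] at *
    conv_rhs => rw [← hP, ← hQ, Set.image_image]
    simp [Matrix.mulVec_mulVec]
  one_mem' := by simp
  inv_mem' := by
    intro Q hQ
    simp only [Set.mem_ofPred_eq] at *
    conv_lhs => rw [← hQ, Set.image_image]
    have h : ((Q⁻¹ : Matrix.specialOrthogonalGroup (Fin 3) ℝ) : Matrix (Fin 3) (Fin 3) ℝ)
        * (Q : Matrix (Fin 3) (Fin 3) ℝ) = 1 := by
      exact congrArg Subtype.val (inv_mul_cancel Q)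
    simp [Matrix.mulVec_mulVec, h]

/-- Conjugation of `M` by the rotation `Q` of the octahedron gives `M'`. -/
def IsConj (Q : octahedralGroup) (M M' : KSSpace) : Prop :=
  (M' : Matrix (Fin 3) (Fin 3) ℝ) =
    ((Q : Matrix.specialOrthogonalGroup (Fin 3) ℝ) : Matrix (Fin 3) (Fin 3) ℝ) * M *
      (((Q⁻¹ : octahedralGroup) : Matrix.specialOrthogonalGroup (Fin 3) ℝ) :
        Matrix (Fin 3) (Fin 3) ℝ)

/-! ### Polynomial functions, regular functions, singular points -/

/-- Polynomial functions on a real vector space. -/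
def IsPolynomialFun {E : Type*} [AddCommGroup E] [Module ℝ E] (f : E → ℝ) : Prop :=
  f ∈ Algebra.adjoin ℝ (Set.range fun l : Module.Dual ℝ E => (l : E → ℝ))

/-- A function `f` on a set `S`, to be thought of as a cone in `E` which is invariant under translations by
`N`, is regular on the projectivisation of `S / N ⊂ E / N` if it is a quotient of two homogeneous
polynomial functions of the same degree on `E / N`, the denominator having no zero on `S`. -/
def IsRegularOn {E : Type*} [AddCommGroup E] [Module ℝ E] (N : Submodule ℝ E) {S : Set E}
    (f : S → ℝ) : Prop :=
  ∃ (d : ℕ) (p q : E → ℝ),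
    (IsPolynomialFun p ∧ (∀ (c : ℝ) x, p (c • x) = c ^ d * p x) ∧ ∀ x, ∀ n ∈ N, p (x + n) = p x) ∧
    (IsPolynomialFun q ∧ (∀ (c : ℝ) x, q (c • x) = c ^ d * q x) ∧ ∀ x, ∀ n ∈ N, q (x + n) = q x) ∧
    ∀ x : S, q x ≠ 0 ∧ f x = p x / q x

/-- The Zariski tangent space at `x` of a real algebraic set `S`: the common kernel of the differentials at
`x` of all polynomial functions vanishing on `S`. -/
def zariskiTangent {E : Type*} [AddCommGroup E] [Module ℝ E] (S : Set E) (x : E) : Submodule ℝ E :=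
  Submodule.span ℝ {v | ∀ f : E → ℝ, IsPolynomialFun f → (∀ y ∈ S, f y = 0) →
    deriv (fun s : ℝ => f (x + s • v)) 0 = 0}

/-- Singular points of the KS-variety. Its affine cone is a hypersurface in the five-dimensional space `𝒜`, so
a point is singular if and only if the tangent space of the cone has dimension greater than four. -/
def IsSingularPoint (p : ℙ ℝ KSSpace) : Prop :=
  p ∈ ksVariety ∧ 4 < Module.finrank ℝ (zariskiTangent ksCone p.rep)

/-- The points of the KS-variety given by matrices of rank one. -/
def rankOnePoints : Set (ℙ ℝ KSSpace) :=
  {p | p ∈ ksVariety ∧ (p.rep : Matrix (Fin 3) (Fin 3) ℝ).rank = 1}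

/-- The singular points of the KS-variety given by skew symmetric matrices. -/
def skewSingularPoints : Set (ℙ ℝ KSSpace) :=
  {p | IsSingularPoint p ∧
    (p.rep : Matrix (Fin 3) (Fin 3) ℝ).transpose = -(p.rep : Matrix (Fin 3) (Fin 3) ℝ)}

/-- All matrices in `L` annihilate one and the same nonzero vector. -/
def HasCommonKernelVector (L : Submodule ℝ KSSpace) : Prop :=
  ∃ n : Fin 3 → ℝ, n ≠ 0 ∧ ∀ M ∈ L, (M : Matrix (Fin 3) (Fin 3) ℝ).mulVec n = 0

/-- Isokernel planes: projective planes in the KS-variety (three-dimensional linear subspaces of its cone)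
whose matrices annihilate a fixed nonzero vector. -/
def IsIsokernelPlane (L : Submodule ℝ KSSpace) : Prop :=
  Module.finrank ℝ L = 3 ∧ (L : Set KSSpace) ⊆ ksCone ∧ HasCommonKernelVector L

/-- Up to the addition of a multiple of the metric, `K` is the extension by zero of an integrable Killing
tensor on the subsphere `S(W)`. -/
def IsExtensionFrom (W : Submodule ℝ E4) (K : EndoField E4) : Prop :=
  ∃ (K₁ : EndoField W) (K₀ : EndoField E4) (b : ℝ),
    IsKilling K₁ ∧ IsIntegrable K₁ ∧ IsExtension W K₁ K₀ ∧ K = K₀ + b • metric E4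

/-- The isometry `φ` makes the algebraic curvature tensors of all members of `S` simultaneously diagonal, and
`L` is the space of the associated matrices. -/
def IsDiagonalisedBy (S : Submodule ℝ (EndoField E4)) (φ : E4 ≃ₗᵢ[ℝ] E4)
    (L : Submodule ℝ KSSpace) : Prop :=
  (∀ K ∈ S, ∃ M ∈ L, HasKSMatrix (pushforward φ K) M) ∧
    ∀ M ∈ L, ∃ K ∈ S, HasKSMatrix (pushforward φ K) M

/-! ### The two quotients -/

/-- Integrable Killing tensors on `S³` which are not multiples of the metric (the latter give zero
in the quotient by `ℝ g`), with the topology of pointwise convergence, which on the finite-dimensional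
vector space of Killing tensors is the standard one. -/
def killingCone : Set (EndoField E4) :=
  {K | IsKilling K ∧ IsIntegrable K ∧ ∀ a : ℝ, K ≠ a • metric E4}

/-- Equivalence under isometries, the addition of multiples of the metric, and nonzero scalars. -/
instance killingSetoid : Setoid killingCone where
  r K K' := ∃ (φ : E4 ≃ₗᵢ[ℝ] E4) (c a : ℝ), c ≠ 0 ∧
    (K' : EndoField E4) = c • pushforward φ (K : EndoField E4) + a • metric E4
  iseqv := by
    refine ⟨fun K => ⟨LinearIsometryEquiv.refl ℝ E4, 1, 0, one_ne_zero, ?_⟩, ?_, ?_⟩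
    · simp [pushforward_refl]
    · rintro K K' ⟨φ, c, a, hc, h⟩
      refine ⟨φ.symm, c⁻¹, -(c⁻¹ * a), inv_ne_zero hc, ?_⟩
      rw [h, pushforward_affine, pushforward_pushforward, LinearIsometryEquiv.self_trans_symm,
        pushforward_refl, smul_add, smul_smul, smul_smul, inv_mul_cancel₀ hc, one_smul, neg_smul,
        add_neg_cancel_right]
    · rintro K K' K'' ⟨φ, c, a, hc, h⟩ ⟨ψ, d, b, hd, h'⟩
      refine ⟨φ.trans ψ, d * c, d * a + b, mul_ne_zero hd hc, ?_⟩
      rw [h', h, pushforward_affine, pushforward_pushforward, smul_add, smul_smul, smul_smul,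
        add_smul, add_assoc]

/-- The projectivisation of the quotient `𝒦(S³) / (Isom(S³) × ℝ g)`, with the quotient topology. -/
abbrev KillingQuotient : Type := Quotient killingSetoid

/-- The cone over the KS-variety without its apex. -/
def ksPunctured : Set KSSpace := {M | M ∈ ksCone ∧ M ≠ 0}

/-- Equivalence under the action of `S₄` by conjugation and nonzero scalars. -/
instance ksSetoid : Setoid ksPunctured where
  r M M' := ∃ (Q : octahedralGroup) (c : ℝ), c ≠ 0 ∧ IsConj Q (c • (M : KSSpace)) (M' : KSSpace)
  iseqv := by
    refine ⟨fun M => ⟨1, 1, one_ne_zero, ?_⟩, ?_, ?_⟩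
    · simp [IsConj]
    · rintro M M' ⟨Q, c, hc, h⟩
      refine ⟨Q⁻¹, c⁻¹, inv_ne_zero hc, ?_⟩
      have h1 := congrArg (fun P : octahedralGroup =>
        ((P : Matrix.specialOrthogonalGroup (Fin 3) ℝ) : Matrix (Fin 3) (Fin 3) ℝ))
        (inv_mul_cancel Q)
      simp only [Subgroup.coe_mul, Submonoid.coe_mul, Subgroup.coe_one, Submonoid.coe_one] at h1
      simp only [IsConj, inv_inv, Submodule.coe_smul] at h ⊢
      rw [h]
      simp only [Matrix.mul_smul, Matrix.smul_mul, smul_smul, inv_mul_cancel₀ hc, one_smul]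
      rw [Matrix.mul_assoc, Matrix.mul_assoc, Matrix.mul_assoc, h1, Matrix.mul_one,
        ← Matrix.mul_assoc, h1, Matrix.one_mul]
    · rintro M M' M'' ⟨Q, c, hc, h⟩ ⟨P, d, hd, h'⟩
      refine ⟨P * Q, d * c, mul_ne_zero hd hc, ?_⟩
      simp only [IsConj, Submodule.coe_smul] at h h' ⊢
      rw [h', h]
      simp only [mul_inv_rev, Subgroup.coe_mul, Submonoid.coe_mul, Matrix.mul_smul,
        Matrix.smul_mul, smul_smul, Matrix.mul_assoc]

/-- The quotient of the KS-variety by its natural `S₄`-action, with the quotient topology. -/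
abbrev KSQuotient : Type := Quotient ksSetoid

/-- Regular functions on the projectivised quotient of integrable Killing tensors: those which come from
regular functions on the projectivisation of `𝒦(S³) / ℝ g`. -/
def IsRegularKilling (F : KillingQuotient → ℝ) : Prop :=
  IsRegularOn (Submodule.span ℝ {metric E4}) fun K : killingCone => F (Quotient.mk _ K)

/-- Regular functions on the quotient of the KS-variety: those which come from regular functions on the
KS-variety. -/
def IsRegularKS (F : KSQuotient → ℝ) : Prop :=
  IsRegularOn (⊥ : Submodule ℝ KSSpace) fun M : ksPunctured => F (Quotient.mk _ M)

end KillingStaeckel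

end

noncomputable section

set_option linter.unusedSectionVars false

namespace KillingStaeckel

section Curvature

variable {V : Type*} [NormedAddCommGroup V] [InnerProductSpace ℝ V]

/-- Four-linear forms in curried form. -/
abbrev Tensor4 (V : Type*) [AddCommGroup V] [Module ℝ V] : Type _ :=
  V →ₗ[ℝ] V →ₗ[ℝ] V →ₗ[ℝ] V →ₗ[ℝ] ℝ

/-- Currying of a function which is linear in each of its four arguments. -/
def Tensor4.mk (f : V → V → V → V → ℝ)
    (a₁ : ∀ a a' b c d, f (a + a') b c d = f a b c d + f a' b c d)
    (s₁ : ∀ (r : ℝ) a b c d, f (r • a) b c d = r * f a b c d)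
    (a₂ : ∀ a b b' c d, f a (b + b') c d = f a b c d + f a b' c d)
    (s₂ : ∀ (r : ℝ) a b c d, f a (r • b) c d = r * f a b c d)
    (a₃ : ∀ a b c c' d, f a b (c + c') d = f a b c d + f a b c' d)
    (s₃ : ∀ (r : ℝ) a b c d, f a b (r • c) d = r * f a b c d)
    (a₄ : ∀ a b c d d', f a b c (d + d') = f a b c d + f a b c d')
    (s₄ : ∀ (r : ℝ) a b c d, f a b c (r • d) = r * f a b c d) : Tensor4 V :=
  LinearMap.mk₂ ℝ (fun a b => LinearMap.mk₂ ℝ (f a b) (a₃ a b) (fun r c d => s₃ r a b c d)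
    (a₄ a b) (fun r c d => s₄ r a b c d))
    (fun a a' b => by ext c d; simp [a₁]) (fun r a b => by ext c d; simp [s₁])
    (fun a b b' => by ext c d; simp [a₂]) (fun r a b => by ext c d; simp [s₂])

@[simp] theorem Tensor4.mk_apply (f : V → V → V → V → ℝ) (a₁ s₁ a₂ s₂ a₃ s₃ a₄ s₄) (a b c d : V) :
    Tensor4.mk f a₁ s₁ a₂ s₂ a₃ s₃ a₄ s₄ a b c d = f a b c d := rfl

/-- Algebraic curvature tensors in curried form. -/
structure IsCurv (C : Tensor4 V) : Prop where
  left : ∀ a b c d, C b a c d = -C a b c d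
  right : ∀ a b c d, C a b d c = -C a b c d
  pair : ∀ a b c d, C c d a b = C a b c d
  bianchi : ∀ a b c d, C a b c d + C a c d b + C a d b c = 0

/-- `K` is the field `K_x(v, w) = C(x, v, x, w)`. -/
def IsField (C : Tensor4 V) (K : EndoField V) : Prop :=
  ∀ x v w, ⟪K x v, w⟫ = C (x : V) v (x : V) w

theorem update_vec4_zero (a b c d x : V) : Function.update ![a, b, c, d] 0 x = ![x, b, c, d] := by
  ext j; fin_cases j <;> rfl

theorem update_vec4_one (a b c d x : V) : Function.update ![a, b, c, d] 1 x = ![a, x, c, d] := by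
  ext j; fin_cases j <;> rfl

theorem update_vec4_two (a b c d x : V) : Function.update ![a, b, c, d] 2 x = ![a, b, x, d] := by
  ext j; fin_cases j <;> rfl

theorem update_vec4_three (a b c d x : V) : Function.update ![a, b, c, d] 3 x = ![a, b, c, x] := by
  ext j; fin_cases j <;> rfl

theorem eq_vec4 (m : Fin 4 → V) : m = ![m 0, m 1, m 2, m 3] := by
  ext j; fin_cases j <;> rfl

/-- The multilinear map given by a curried four-linear form. -/
def toMulti (C : Tensor4 V) : MultilinearMap ℝ (fun _ : Fin 4 => V) ℝ where
  toFun m := C (m 0) (m 1) (m 2) (m 3)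
  map_update_add' := by
    intro inst m i x y
    rw [Subsingleton.elim inst (fun a b => instDecidableEqFin 4 a b), eq_vec4 m]
    fin_cases i
    · simp only [Fin.zero_eta, update_vec4_zero]; simp
    · simp only [Fin.mk_one, update_vec4_one]; simp
    · simp only [Fin.reduceFinMk, update_vec4_two]; simp
    · simp only [Fin.reduceFinMk, update_vec4_three]; simp
  map_update_smul' := by
    intro inst m i c x
    rw [Subsingleton.elim inst (fun a b => instDecidableEqFin 4 a b), eq_vec4 m]
    fin_cases i
    · simp only [Fin.zero_eta, update_vec4_zero]; simp
    · simp only [Fin.mk_one, update_vec4_one]; simp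
    · simp only [Fin.reduceFinMk, update_vec4_two]; simp
    · simp only [Fin.reduceFinMk, update_vec4_three]; simp

/-- The curried form of a multilinear map in four arguments. -/
def curry (R : MultilinearMap ℝ (fun _ : Fin 4 => V) ℝ) : Tensor4 V :=
  Tensor4.mk (fun a b c d => R ![a, b, c, d])
    (fun a a' b c d => by
      have h := R.map_update_add ![a, b, c, d] 0 a a'
      simp only [update_vec4_zero] at h; exact h)
    (fun r a b c d => by
      have h := R.map_update_smul ![a, b, c, d] 0 r a
      simp only [update_vec4_zero] at h; exact h)
    (fun a b b' c d => by
      have h := R.map_update_add ![a, b, c, d] 1 b b'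
      simp only [update_vec4_one] at h; exact h)
    (fun r a b c d => by
      have h := R.map_update_smul ![a, b, c, d] 1 r b
      simp only [update_vec4_one] at h; exact h)
    (fun a b c c' d => by
      have h := R.map_update_add ![a, b, c, d] 2 c c'
      simp only [update_vec4_two] at h; exact h)
    (fun r a b c d => by
      have h := R.map_update_smul ![a, b, c, d] 2 r c
      simp only [update_vec4_two] at h; exact h)
    (fun a b c d d' => by
      have h := R.map_update_add ![a, b, c, d] 3 d d'
      simp only [update_vec4_three] at h; exact h)
    (fun r a b c d => by
      have h := R.map_update_smul ![a, b, c, d] 3 r d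
      simp only [update_vec4_three] at h; exact h)

@[simp] theorem toMulti_curry (R : MultilinearMap ℝ (fun _ : Fin 4 => V) ℝ) :
    toMulti (curry R) = R := by
  ext m
  change R ![m 0, m 1, m 2, m 3] = R m
  rw [← eq_vec4]

theorem isCurv_curry {R : MultilinearMap ℝ (fun _ : Fin 4 => V) ℝ} (h : IsAlgCurvature R) :
    IsCurv (curry R) :=
  ⟨h.antisymm_left, h.antisymm_right, h.pair_symm, h.bianchi⟩

theorem isAlgCurvature_toMulti {C : Tensor4 V} (h : IsCurv C) : IsAlgCurvature (toMulti C) :=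
  ⟨h.left, h.right, h.pair, h.bianchi⟩

theorem IsCurv.add {C C' : Tensor4 V} (h : IsCurv C) (h' : IsCurv C') : IsCurv (C + C') where
  left a b c d := by simp only [LinearMap.add_apply, h.left a b, h'.left a b]; ring
  right a b c d := by simp only [LinearMap.add_apply, h.right a b c, h'.right a b c]; ring
  pair a b c d := by simp only [LinearMap.add_apply, h.pair a b, h'.pair a b]
  bianchi a b c d := by
    have := h.bianchi a b c d
    have := h'.bianchi a b c d
    simp only [LinearMap.add_apply]; linarith

theorem IsCurv.smul {C : Tensor4 V} (h : IsCurv C) (r : ℝ) : IsCurv (r • C) where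
  left a b c d := by simp only [LinearMap.smul_apply, smul_eq_mul, h.left a b]; ring
  right a b c d := by simp only [LinearMap.smul_apply, smul_eq_mul, h.right a b c]; ring
  pair a b c d := by simp only [LinearMap.smul_apply, smul_eq_mul, h.pair a b]
  bianchi a b c d := by
    have := h.bianchi a b c d
    simp only [LinearMap.smul_apply, smul_eq_mul, ← mul_add, this, mul_zero]

theorem IsField.unique {C : Tensor4 V} {K K' : EndoField V} (h : IsField C K)
    (h' : IsField C K') : K = K' := by
  funext x; ext v
  exact ext_inner_right ℝ fun w => by rw [h x v w, h' x v w]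

theorem IsCurv.self_left {C : Tensor4 V} (h : IsCurv C) (a c d : V) : C a a c d = 0 := by
  linarith [h.left a a c d]

theorem IsCurv.self_right {C : Tensor4 V} (h : IsCurv C) (a b c : V) : C a b c c = 0 := by
  linarith [h.right a b c c]

theorem IsCurv.eq_zero {C : Tensor4 V} (h : IsCurv C) (h0 : ∀ x v w, C x v x w = 0) : C = 0 := by
  have pol : ∀ a b c d, C a b c d + C c b a d = 0 := fun a b c d => by
    have h1 := h0 (a + c) b d
    simp only [map_add, LinearMap.add_apply, h0] at h1
    linarith
  ext a b c d
  have h1 := h.bianchi a b c d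
  have h2 := pol a b c d
  have h3 := pol a b d c
  have h4 := h.pair c b a d
  have h5 := h.left a d c b
  have h6 := h.right d a c b
  have h7 := h.right a b c d
  have h8 := h.pair d b a c
  have h9 := h.right a c b d
  have h10 := h.left a d b c
  simp only [LinearMap.zero_apply]
  have h11 := h.right a d c b
  linarith

theorem exists_eq_smul_sphere {x : V} (hx : x ≠ 0) :
    ∃ y : Metric.sphere (0 : V) 1, x = ‖x‖ • (y : V) := by
  have hn : ‖x‖ ≠ 0 := norm_ne_zero_iff.2 hx
  exact ⟨⟨‖x‖⁻¹ • x, by simp [norm_smul, hn]⟩, by simp [smul_smul, hn]⟩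

/-- An algebraic curvature tensor is determined by its field. -/
theorem IsField.curv_unique {C C' : Tensor4 V} {K : EndoField V} (hC : IsCurv C) (hC' : IsCurv C')
    (h : IsField C K) (h' : IsField C' K) : C = C' := by
  have hd : IsCurv (C + (-1 : ℝ) • C') := hC.add (hC'.smul _)
  have := hd.eq_zero fun x v w => by
    by_cases hx : x = 0
    · simp [hx]
    · obtain ⟨y, hy⟩ := exists_eq_smul_sphere hx
      generalize ‖x‖ = r at hy
      subst hy
      simp [← h y v w, ← h' y v w]
  ext a b c d
  have h2 := congrArg (fun D : Tensor4 V => D a b c d) this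
  simp only [LinearMap.add_apply, LinearMap.smul_apply, LinearMap.zero_apply, smul_eq_mul] at h2
  linarith

/-- The curvature tensor of the round metric. -/
def gCurv (V : Type*) [NormedAddCommGroup V] [InnerProductSpace ℝ V] : Tensor4 V :=
  Tensor4.mk (fun a b c d => ⟪a, c⟫ * ⟪b, d⟫ - ⟪a, d⟫ * ⟪b, c⟫)
    (fun a a' b c d => by simp only [inner_add_left]; ring)
    (fun r a b c d => by simp only [real_inner_smul_left]; ring)
    (fun a b b' c d => by simp only [inner_add_left]; ring)
    (fun r a b c d => by simp only [real_inner_smul_left]; ring)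
    (fun a b c c' d => by simp only [inner_add_right]; ring)
    (fun r a b c d => by simp only [real_inner_smul_right]; ring)
    (fun a b c d d' => by simp only [inner_add_right]; ring)
    (fun r a b c d => by simp only [real_inner_smul_right]; ring)

@[simp] theorem gCurv_apply (a b c d : V) :
    gCurv V a b c d = ⟪a, c⟫ * ⟪b, d⟫ - ⟪a, d⟫ * ⟪b, c⟫ := rfl

theorem isCurv_gCurv : IsCurv (gCurv V) where
  left a b c d := by simp only [gCurv_apply]; ring
  right a b c d := by simp only [gCurv_apply]; ring
  pair a b c d := by
    simp only [gCurv_apply, real_inner_comm a c, real_inner_comm b d, real_inner_comm a d,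
      real_inner_comm b c]; ring
  bianchi a b c d := by
    simp only [gCurv_apply, real_inner_comm b c, real_inner_comm b d, real_inner_comm c d]; ring

theorem metric_apply (x : Metric.sphere (0 : V) 1) (v : V) :
    metric V x v = v - ⟪(x : V), v⟫ • (x : V) := by simp [metric]

theorem sphere_inner_self (x : Metric.sphere (0 : V) 1) : ⟪(x : V), (x : V)⟫ = 1 := by
  rw [real_inner_self_eq_norm_sq, norm_eq_of_mem_sphere]; norm_num

theorem isField_metric : IsField (gCurv V) (metric V) := fun x v w => by
  rw [metric_apply, inner_sub_left, real_inner_smul_left, gCurv_apply, sphere_inner_self,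
    real_inner_comm v (x : V)]
  ring

/-- The pullback of a four-linear form. -/
def Tensor4.pull {V' : Type*} [NormedAddCommGroup V'] [InnerProductSpace ℝ V'] (C : Tensor4 V) (f : V' →ₗ[ℝ] V) :
    Tensor4 V' :=
  Tensor4.mk (fun a b c d => C (f a) (f b) (f c) (f d))
    (by simp) (by simp) (by simp) (by simp) (by simp) (by simp) (by simp) (by simp)

@[simp] theorem Tensor4.pull_apply {V' : Type*} [NormedAddCommGroup V'] [InnerProductSpace ℝ V']
    (C : Tensor4 V)
    (f : V' →ₗ[ℝ] V) (a b c d : V') : C.pull f a b c d = C (f a) (f b) (f c) (f d) := rfl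

theorem IsCurv.pull {V' : Type*} [NormedAddCommGroup V'] [InnerProductSpace ℝ V'] {C : Tensor4 V}
    (h : IsCurv C) (f : V' →ₗ[ℝ] V) : IsCurv (C.pull f) :=
  ⟨fun _ _ _ _ => h.left _ _ _ _, fun _ _ _ _ => h.right _ _ _ _, fun _ _ _ _ => h.pair _ _ _ _,
    fun _ _ _ _ => h.bianchi _ _ _ _⟩

theorem IsField.pushforward {C : Tensor4 V} {K : EndoField V} (h : IsField C K) (φ : V ≃ₗᵢ[ℝ] V) :
    IsField (C.pull (φ.symm.toLinearEquiv : V →ₗ[ℝ] V)) (pushforward φ K) := fun x v w => by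
  rw [pushforward_apply, LinearIsometryEquiv.inner_map_eq_flip, h]
  rfl

/-! ### Fields of curvature tensors are Killing tensors -/

theorem IsField.radialExt_inner {C : Tensor4 V} {K : EndoField V} (h : IsField C K) {y : V}
    (hy : y ≠ 0) (v w : V) : ⟪radialExt K y v, w⟫ = (‖y‖ ^ 2)⁻¹ * C y v y w := by
  rw [radialExt, dif_pos hy, h]
  simp only [map_smul, LinearMap.smul_apply, smul_eq_mul]
  field_simp

theorem radialExt_sphere (K : EndoField V) (x : Metric.sphere (0 : V) 1) :
    radialExt K (x : V) = K x := by
  have hx : (x : V) ≠ 0 := ne_zero_of_mem_unit_sphere x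
  rw [radialExt, dif_pos hx]
  congr 1
  ext
  simp

end Curvature

section Smoothness

variable {V : Type*} [NormedAddCommGroup V] [InnerProductSpace ℝ V] [FiniteDimensional ℝ V]

theorem Tensor4.contDiff_quadratic (C : Tensor4 V) (v w : V) :
    ContDiff ℝ ∞ fun y : V => C y v y w := by
  let B : V →L[ℝ] V →L[ℝ] ℝ := LinearMap.toContinuousLinearMap
    ((LinearMap.toContinuousLinearMap : (V →ₗ[ℝ] ℝ) ≃ₗ[ℝ] (V →L[ℝ] ℝ)).toLinearMap ∘ₗ
      LinearMap.mk₂ ℝ (fun y z => C y v z w) (by simp) (by simp) (by simp) (by simp))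
  have h : (fun y : V => C y v y w) = fun y => B y y := rfl
  rw [h]
  exact B.contDiff.clm_apply contDiff_id

theorem IsField.contDiffOn_inner {C : Tensor4 V} {K : EndoField V} (h : IsField C K) (v w : V) :
    ContDiffOn ℝ ∞ (fun y => ⟪radialExt K y v, w⟫) {0}ᶜ := by
  have h1 : ContDiffOn ℝ ∞ (fun y : V => (‖y‖ ^ 2)⁻¹ * C y v y w) {0}ᶜ := by
    refine ContDiffOn.mul (ContDiffOn.inv (contDiff_norm_sq ℝ).contDiffOn ?_)
      (C.contDiff_quadratic v w).contDiffOn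
    intro y hy
    exact pow_ne_zero 2 (norm_ne_zero_iff.2 hy)
  exact h1.congr fun y hy => h.radialExt_inner hy v w

theorem IsField.contDiffOn {C : Tensor4 V} {K : EndoField V} (h : IsField C K) :
    ContDiffOn ℝ ∞ (radialExt K) {0}ᶜ := by
  rw [contDiffOn_clm_apply]
  intro v
  let b := stdOrthonormalBasis ℝ V
  have : (fun y => radialExt K y v) = fun y => ∑ i, ⟪radialExt K y v, b i⟫ • b i := by
    funext y
    conv_lhs => rw [← b.sum_repr (radialExt K y v)]
    simp only [b.repr_apply_apply, real_inner_comm]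
  rw [this]
  exact ContDiffOn.sum fun i _ => (h.contDiffOn_inner v (b i)).smul contDiffOn_const

theorem differentiableAt_radialExt {K : EndoField V} (h : ContDiffOn ℝ ∞ (radialExt K) {0}ᶜ)
    {y : V} (hy : y ≠ 0) : DifferentiableAt ℝ (radialExt K) y :=
  (h.differentiableOn (by simp)).differentiableAt (isOpen_compl_singleton.mem_nhds hy)

theorem hasDerivAt_radialExt_inner {K : EndoField V} (h : ContDiffOn ℝ ∞ (radialExt K) {0}ᶜ)
    (x : Metric.sphere (0 : V) 1) (u v w : V) :
    HasDerivAt (fun s : ℝ => ⟪radialExt K ((x : V) + s • u) v, w⟫)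
      ⟪fderiv ℝ (radialExt K) (x : V) u v, w⟫ 0 := by
  have hd := (differentiableAt_radialExt h (ne_zero_of_mem_unit_sphere x)).hasFDerivAt
  have hl : HasDerivAt (fun s : ℝ => (x : V) + s • u) u 0 := by
    simpa using ((hasDerivAt_id (0 : ℝ)).smul_const u).const_add (x : V)
  have h1 : HasDerivAt (fun s : ℝ => radialExt K ((x : V) + s • u))
      (fderiv ℝ (radialExt K) (x : V) u) 0 := by
    have hd' : HasFDerivAt (radialExt K) (fderiv ℝ (radialExt K) (x : V))
        ((x : V) + (0 : ℝ) • u) := by simpa using hd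
    exact hd'.comp_hasDerivAt (0 : ℝ) hl
  have h2 := (h1.clm_apply (hasDerivAt_const (0 : ℝ) v)).inner ℝ (hasDerivAt_const (0 : ℝ) w)
  simpa using h2

theorem inner_metric_of_tangent (x : Metric.sphere (0 : V) 1) (v : V) {w : V}
    (hw : IsTangent x w) : ⟪metric V x v, w⟫ = ⟪v, w⟫ := by
  rw [metric_apply, inner_sub_left, real_inner_smul_left, show ⟪(x : V), w⟫ = 0 from hw]
  ring

theorem IsField.inner_fderiv {C : Tensor4 V} {K : EndoField V} (h : IsField C K)
    (x : Metric.sphere (0 : V) 1) {u : V} (hu : IsTangent x u) (v w : V) :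
    ⟪fderiv ℝ (radialExt K) (x : V) u v, w⟫ = C u v x w + C x v u w := by
  have h1 := hasDerivAt_radialExt_inner h.contDiffOn x u v w
  have hn : ∀ s : ℝ, ‖(x : V) + s • u‖ ^ 2 = 1 + s ^ 2 * ‖u‖ ^ 2 := fun s => by
    rw [@norm_add_sq_real, norm_eq_of_mem_sphere, real_inner_smul_right,
      show ⟪(x : V), u⟫ = 0 from hu, norm_smul, mul_pow, Real.norm_eq_abs, sq_abs]
    ring
  have h2 : (fun s : ℝ => ⟪radialExt K ((x : V) + s • u) v, w⟫) = fun s =>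
      (1 + s ^ 2 * ‖u‖ ^ 2)⁻¹ *
        (C x v x w + s * (C u v x w + C x v u w) + s ^ 2 * C u v u w) := by
    funext s
    have hne : (x : V) + s • u ≠ 0 := by
      intro h0
      have := hn s
      rw [h0] at this
      have : 0 ≤ s ^ 2 * ‖u‖ ^ 2 := by positivity
      simp at *
      linarith
    rw [h.radialExt_inner hne, hn]
    simp only [map_add, map_smul, LinearMap.add_apply, LinearMap.smul_apply, smul_eq_mul]
    ring
  rw [h2] at h1
  have h3 : HasDerivAt (fun s : ℝ => (1 + s ^ 2 * ‖u‖ ^ 2)⁻¹ *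
        (C x v x w + s * (C u v x w + C x v u w) + s ^ 2 * C u v u w))
        (C u v x w + C x v u w) 0 := by
    have ha : HasDerivAt (fun s : ℝ => s ^ 2) 0 0 := by simpa using hasDerivAt_pow 2 (0 : ℝ)
    have hb := ((ha.mul_const (‖u‖ ^ 2)).const_add 1).inv (by simp)
    have hc := (((hasDerivAt_id (0 : ℝ)).mul_const (C u v x w + C x v u w)).const_add
      (C x v x w)).add (ha.mul_const (C u v u w))
    refine (hb.mul hc).congr_deriv ?_
    simp
  exact h1.unique h3

theorem IsField.inner_nabla {C : Tensor4 V} {K : EndoField V} (h : IsField C K)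
    (x : Metric.sphere (0 : V) 1) {u w : V} (hu : IsTangent x u) (hw : IsTangent x w) (v : V) :
    ⟪nabla K x u v, w⟫ = C u v x w + C x v u w := by
  rw [nabla, inner_metric_of_tangent x _ hw, h.inner_fderiv x hu]

theorem IsField.isKilling {C : Tensor4 V} {K : EndoField V} (hC : IsCurv C) (h : IsField C K) :
    IsKilling K := by
  refine ⟨⟨h.contDiffOn, fun x => ?_, fun x v w => ?_⟩, fun x u v w hu hv hw => ?_⟩
  · refine ext_inner_right ℝ fun w => ?_
    rw [h, hC.self_left, inner_zero_left]
  · rw [h, real_inner_comm, h, hC.pair]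
  · rw [h.inner_nabla x hu hw, h.inner_nabla x hv hu, h.inner_nabla x hw hv]
    have h1 := hC.bianchi x u v w
    have h2 := hC.pair u v x w
    have h3 := hC.pair v w x u
    have h4 := hC.pair w u x v
    have h5 := hC.pair x v u w
    have h6 := hC.left x v u w
    have h7 := hC.right x v u w
    have h8 := hC.right x w v u
    have h9 := hC.right x u w v
    linarith

end Smoothness


section Classification

variable {V : Type*} [NormedAddCommGroup V] [InnerProductSpace ℝ V]

/-- A family of symmetric bilinear forms `B x` with `B x v v = B v x x` and `B x x = 0` comes from
an algebraic curvature tensor. -/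
theorem exists_isCurv_of_symmetric (B : V → V →ₗ[ℝ] V →ₗ[ℝ] ℝ) (hs : ∀ x v w, B x v w = B x w v)
    (hx : ∀ x v, B x v v = B v x x) (h0 : ∀ x v, B x x v = 0) :
    ∃ C : Tensor4 V, IsCurv C ∧ ∀ x v w, C x v x w = B x v w := by
  let S : V → V → V → V → ℝ := fun a c b d => B (a + c) b d - B a b d - B c b d
  have pol : ∀ x b d, B x b d = (B (b + d) x x - B b x x - B d x x) / 2 := fun x b d => by
    rw [← hx x (b + d), ← hx x b, ← hx x d]
    simp only [map_add, LinearMap.add_apply, hs x d b]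
    ring
  have Sab : ∀ a c b d, S a c b d = S c a b d := fun a c b d => by
    simp only [S, add_comm c a]; ring
  have Sswap : ∀ a c b d, S a c b d = S b d a c := fun a c b d => by
    simp only [S, pol (a + c), pol a, pol c]
    simp only [map_add, LinearMap.add_apply]
    rw [hs _ c a, hs _ c a, hs _ c a]
    ring
  have add3 : ∀ a c b b' d, S a c (b + b') d = S a c b d + S a c b' d := fun a c b b' d => by
    simp only [S, map_add, LinearMap.add_apply]; ring
  have smul3 : ∀ (r : ℝ) a c b d, S a c (r • b) d = r * S a c b d := fun r a c b d => by
    simp only [S, map_smul, LinearMap.smul_apply, smul_eq_mul]; ring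
  have Scd : ∀ a c b d, S a c b d = S a c d b := fun a c b d => by
    rw [Sswap, Sab, Sswap]
  have add1 : ∀ a a' c b d, S (a + a') c b d = S a c b d + S a' c b d := fun a a' c b d => by
    rw [Sswap, Scd, Sswap, Sab, Sswap, add3]
    rw [Sswap _ _ a, Sswap _ _ a']
  have smul1 : ∀ (r : ℝ) a c b d, S (r • a) c b d = r * S a c b d := fun r a c b d => by
    rw [Sswap, Scd, Sswap, Sab, Sswap, smul3, Sswap _ _ a]
  have add2 : ∀ a c c' b d, S a (c + c') b d = S a c b d + S a c' b d := fun a c c' b d => by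
    rw [Sab, add1, Sab c, Sab c']
  have smul2 : ∀ (r : ℝ) a c b d, S a (r • c) b d = r * S a c b d := fun r a c b d => by
    rw [Sab, smul1, Sab]
  have add4 : ∀ a c b d d', S a c b (d + d') = S a c b d + S a c b d' := fun a c b d d' => by
    rw [Scd, add3, Scd a c d, Scd a c d']
  have smul4 : ∀ (r : ℝ) a c b d, S a c b (r • d) = r * S a c b d := fun r a c b d => by
    rw [Scd, smul3, Scd]
  have diag : ∀ x v w, S x x v w = 2 * B x v w := fun x v w => by
    have h4 : ∀ u, B (x + x) u u = 4 * B x u u := fun u => by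
      rw [hx, hx x u]; simp only [map_add, LinearMap.add_apply]; ring
    have p1 := h4 (v + w)
    have p2 := h4 v
    have p3 := h4 w
    simp only [map_add, LinearMap.add_apply, hs _ w v] at p1
    simp only [S]
    linarith
  have cyc0 : ∀ x w, S x x x w = 0 := fun x w => by rw [diag, h0, mul_zero]
  have cyc : ∀ x v w, S x x v w = -2 * S v x x w := fun x v w => by
    have h1 := cyc0 (x + v) w
    have h2 := cyc0 (x + (-1 : ℝ) • v) w
    simp only [add1, add2, add3, smul1, smul2, smul3, cyc0, Sab x v] at h1 h2
    linarith
  refine ⟨Tensor4.mk (fun a b c d => (S a c b d - S b c a d) / 3) ?_ ?_ ?_ ?_ ?_ ?_ ?_ ?_,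
    ⟨?_, ?_, ?_, ?_⟩, ?_⟩
  · intros; simp only [add1, add3]; ring
  · intros; simp only [smul1, smul3]; ring
  · intros; simp only [add1, add3]; ring
  · intros; simp only [smul1, smul3]; ring
  · intros; simp only [add2]; ring
  · intros; simp only [smul2]; ring
  · intros; simp only [add4]; ring
  · intros; simp only [smul4]; ring
  · intros; simp only [Tensor4.mk_apply]; ring
  · intro a b c d; simp only [Tensor4.mk_apply]
    rw [Sswap a d b c, Sswap b d a c]; ring
  · intro a b c d; simp only [Tensor4.mk_apply]
    rw [Sab c a, Scd a c d b, Sab d a c b, Sswap a d c b, Sab c b]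
  · intro a b c d; simp only [Tensor4.mk_apply]
    rw [Sswap d b, Scd a c d b, Sswap c d, Scd a b c d, Scd a d c b, Sswap a d]; ring
  · intro x v w
    simp only [Tensor4.mk_apply]
    have := cyc x v w
    have := diag x v w
    linarith

end Classification

section Geodesics

variable {V : Type*} [NormedAddCommGroup V] [InnerProductSpace ℝ V] [FiniteDimensional ℝ V]

/-- The unit speed great circle through `x` with initial velocity `v`. -/
def greatCircle (x v : V) (s : ℝ) : V := Real.cos s • x + Real.sin s • v

theorem hasDerivAt_greatCircle (x v : V) (s : ℝ) :
    HasDerivAt (greatCircle x v) (greatCircle v (-x) s) s := by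
  have := ((Real.hasDerivAt_cos s).smul_const x).add ((Real.hasDerivAt_sin s).smul_const v)
  refine this.congr_deriv ?_
  simp only [greatCircle, smul_neg, neg_smul]
  abel

theorem norm_greatCircle {x v : V} (hx : ‖x‖ = 1) (hv : ‖v‖ = 1) (h : ⟪x, v⟫ = 0) (s : ℝ) :
    ‖greatCircle x v s‖ = 1 := by
  have : ‖greatCircle x v s‖ ^ 2 = 1 := by
    rw [greatCircle, @norm_add_sq_real, norm_smul, norm_smul, real_inner_smul_left,
      real_inner_smul_right, h, hx, hv]
    simp [Real.cos_sq_add_sin_sq]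
  nlinarith [norm_nonneg (greatCircle x v s)]

theorem IsKilling.const_along_geodesics {K : EndoField V} (hK : IsKilling K) {x v : V}
    (hx : ‖x‖ = 1) (hv : ‖v‖ = 1) (h : ⟪x, v⟫ = 0) (s : ℝ) :
    ⟪radialExt K (greatCircle x v s) (greatCircle v (-x) s), greatCircle v (-x) s⟫
      = ⟪radialExt K x v, v⟫ := by
  obtain ⟨⟨hsm, hker, hsym⟩, hcyc⟩ := hK
  have hder : ∀ s, HasDerivAt (fun s => ⟪radialExt K (greatCircle x v s) (greatCircle v (-x) s),
      greatCircle v (-x) s⟫) 0 s := by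
    intro s
    let y : Metric.sphere (0 : V) 1 := ⟨greatCircle x v s, by simpa using norm_greatCircle hx hv h s⟩
    set u := greatCircle v (-x) s with hu
    have htan : IsTangent y u := by
      change ⟪greatCircle x v s, u⟫ = 0
      simp only [hu, greatCircle, inner_add_left, inner_add_right, real_inner_smul_left,
        real_inner_smul_right, inner_neg_right, real_inner_self_eq_norm_sq, hx, hv, h,
        real_inner_comm x v]
      ring
    have hacc : greatCircle (-x) (-v) s = -(y : V) := by
      simp only [greatCircle, y, smul_neg]; abel
    have h1 : HasDerivAt (fun s => radialExt K (greatCircle x v s))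
        (fderiv ℝ (radialExt K) (y : V) u) s :=
      HasFDerivAt.comp_hasDerivAt (f := greatCircle x v) s
        (differentiableAt_radialExt hsm (ne_zero_of_mem_unit_sphere y)).hasFDerivAt
        (hasDerivAt_greatCircle x v s)
    have h2 : HasDerivAt (greatCircle v (-x)) (-(y : V)) s := by
      rw [← hacc]; exact hasDerivAt_greatCircle v (-x) s
    have h3 := (h1.clm_apply h2).inner ℝ h2
    refine h3.congr_deriv ?_
    have e1 : radialExt K (greatCircle x v s) = K y := radialExt_sphere K y
    rw [e1, ← hu]
    have e2 := hcyc y u u u htan htan htan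
    rw [nabla, inner_metric_of_tangent y _ htan] at e2
    have e3 : ⟪K y u, (y : V)⟫ = 0 := by rw [hsym, hker, inner_zero_right]
    rw [inner_neg_right, e3, map_neg, hker]
    simp only [neg_zero, add_zero, zero_add]
    linarith
  have hc := is_const_of_deriv_eq_zero (fun s => (hder s).differentiableAt)
    (fun s => (hder s).deriv) s 0
  simpa [greatCircle] using hc

/-- The family of bilinear forms `|y|² K_{y/|y|}`. -/
def coneForm (K : EndoField V) (y : V) : V →ₗ[ℝ] V →ₗ[ℝ] ℝ :=
  LinearMap.mk₂ ℝ (fun v w => ‖y‖ ^ 2 * ⟪radialExt K y v, w⟫)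
    (fun _ _ _ => by simp only [map_add, inner_add_left]; ring)
    (fun _ _ _ => by simp only [map_smul, real_inner_smul_left, smul_eq_mul]; ring)
    (fun _ _ _ => by simp only [inner_add_right]; ring)
    (fun _ _ _ => by simp only [real_inner_smul_right, smul_eq_mul]; ring)

theorem coneForm_apply (K : EndoField V) (y v w : V) :
    coneForm K y v w = ‖y‖ ^ 2 * ⟪radialExt K y v, w⟫ := rfl

theorem radialExt_smul (K : EndoField V) {r : ℝ} (hr : 0 < r) (y : V) :
    radialExt K (r • y) = radialExt K y := by
  by_cases hy : y = 0
  · simp [hy]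
  · have : r • y ≠ 0 := smul_ne_zero hr.ne' hy
    rw [radialExt, dif_pos this, radialExt, dif_pos hy]
    congr 1
    ext
    simp only [norm_smul, Real.norm_eq_abs, abs_of_pos hr, smul_smul]
    congr 1
    field_simp

theorem coneForm_symm {K : EndoField V} (hK : IsKilling K) (y v w : V) :
    coneForm K y v w = coneForm K y w v := by
  by_cases hy : y = 0
  · simp [coneForm_apply, hy]
  · rw [coneForm_apply, coneForm_apply, radialExt, dif_pos hy, hK.1.2.2, real_inner_comm]

theorem coneForm_self {K : EndoField V} (hK : IsKilling K) (y w : V) :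
    coneForm K y y w = 0 := by
  by_cases hy : y = 0
  · simp [hy]
  · obtain ⟨z, hz⟩ := exists_eq_smul_sphere hy
    have hpos : 0 < ‖y‖ := norm_pos_iff.2 hy
    generalize ‖y‖ = r at hz hpos
    subst hz
    rw [coneForm_apply, radialExt_smul K hpos, radialExt_sphere, map_smul, hK.1.2.1]
    simp

theorem coneForm_smul_self {K : EndoField V} (hK : IsKilling K) (y w : V) (r : ℝ) :
    coneForm K y (r • y) w = 0 := by
  rw [map_smul, LinearMap.smul_apply, coneForm_self hK, smul_zero]

theorem coneForm_add_smul {K : EndoField V} (hK : IsKilling K) (y u : V) (a r : ℝ) :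
    coneForm K y (a • y + r • u) (a • y + r • u) = r ^ 2 * coneForm K y u u := by
  simp only [map_add, map_smul, LinearMap.add_apply, LinearMap.smul_apply, smul_eq_mul,
    coneForm_self hK]
  rw [coneForm_symm hK y u y, coneForm_self hK]
  ring

theorem coneForm_swap {K : EndoField V} (hK : IsKilling K) (x v : V) :
    coneForm K x v v = coneForm K v x x := by
  by_cases hx : x = 0
  · subst hx; simp [coneForm_apply]
  obtain ⟨z, hz⟩ := exists_eq_smul_sphere hx
  have hpos : 0 < ‖x‖ := norm_pos_iff.2 hx
  generalize ‖x‖ = ρ at hz hpos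
  subst hz
  set a : ℝ := ⟪(z : V), v⟫ with ha
  have hzn : ‖(z : V)‖ = 1 := norm_eq_of_mem_sphere z
  set p := v - a • (z : V) with hp
  have hzp : ⟪(z : V), p⟫ = 0 := by
    rw [hp, inner_sub_right, real_inner_smul_right, sphere_inner_self]; simp [ha]
  by_cases hp0 : p = 0
  · have hv : v = a • (z : V) := sub_eq_zero.1 hp0
    rw [hv]
    have h1 : coneForm K (ρ • (z : V)) (a • (z : V)) (a • (z : V)) = 0 := by
      have : a • (z : V) = (a / ρ) • (ρ • (z : V)) := by rw [smul_smul]; congr 1; field_simp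
      rw [this, coneForm_smul_self hK]
    rw [h1]
    by_cases ha0 : a = 0
    · simp [ha0, coneForm_apply]
    · have : ρ • (z : V) = (ρ / a) • (a • (z : V)) := by rw [smul_smul]; congr 1; field_simp
      rw [this, coneForm_smul_self hK]
  · obtain ⟨u, hu⟩ := exists_eq_smul_sphere hp0
    have hr : 0 < ‖p‖ := norm_pos_iff.2 hp0
    generalize ‖p‖ = r at hu hr
    have hun : ‖(u : V)‖ = 1 := norm_eq_of_mem_sphere u
    have hzu : ⟪(z : V), (u : V)⟫ = 0 := by
      rw [hu, real_inner_smul_right] at hzp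
      exact (mul_eq_zero.1 hzp).resolve_left hr.ne'
    have hv : v = a • (z : V) + r • (u : V) := by rw [← hu, hp]; abel
    obtain ⟨N, θ, hNa, hNr⟩ : ∃ N θ : ℝ, a = N * Real.cos θ ∧ r = N * Real.sin θ := by
      refine ⟨‖(⟨a, r⟩ : ℂ)‖, Complex.arg ⟨a, r⟩, ?_, ?_⟩
      · rw [Complex.norm_mul_cos_arg]
      · rw [Complex.norm_mul_sin_arg]
    have hcs := Real.cos_sq_add_sin_sq θ
    wlog hN : 0 < N generalizing N θ with H
    · refine H (-N) (θ + Real.pi) (by rw [Real.cos_add_pi, hNa]; ring)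
        (by rw [Real.sin_add_pi, hNr]; ring) (Real.cos_sq_add_sin_sq _) ?_
      have : N ≠ 0 := by rintro rfl; simp at hNr; exact hr.ne' hNr
      have := lt_of_le_of_ne (not_lt.1 hN) this
      linarith
    have hvN : v = N • greatCircle (z : V) u θ := by
      rw [hv, hNa, hNr, greatCircle, smul_add, smul_smul, smul_smul]
    have hgeo := hK.const_along_geodesics hzn hun hzu θ
    set g := greatCircle (z : V) u θ with hg
    set g' := greatCircle (u : V) (-(z : V)) θ with hg'
    have hgn : ‖g‖ = 1 := norm_greatCircle hzn hun hzu θ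
    have hxg : ρ • (z : V) = (ρ * Real.cos θ / N) • v + (-(ρ * Real.sin θ)) • g' := by
      rw [hvN, smul_smul, div_mul_cancel₀ _ hN.ne', hg, hg', greatCircle, greatCircle]
      simp only [smul_add, smul_smul, smul_neg]
      have : (z : V) = (Real.cos θ ^ 2 + Real.sin θ ^ 2) • (z : V) := by rw [hcs, one_smul]
      conv_lhs => rw [this]
      module
    have hl : coneForm K (ρ • (z : V)) v v = r ^ 2 * (ρ ^ 2 * ⟪radialExt K (z : V) u, u⟫) := by
      have : v = (a / ρ) • (ρ • (z : V)) + r • (u : V) := by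
        rw [smul_smul, div_mul_cancel₀ _ hpos.ne', ← hv]
      conv_lhs => rw [this]
      rw [coneForm_add_smul hK, coneForm_apply, radialExt_smul K hpos, norm_smul, hzn,
        Real.norm_eq_abs, mul_one, sq_abs]
    rw [hl]
    conv_rhs => rw [hxg]
    rw [coneForm_add_smul hK, coneForm_apply, hvN, radialExt_smul K hN, norm_smul, hgn,
      Real.norm_eq_abs, mul_one, sq_abs, hgeo, hNr]
    ring

/-- Every Killing tensor on a round sphere comes from an algebraic curvature tensor. -/
theorem IsKilling.exists_isField {K : EndoField V} (hK : IsKilling K) :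
    ∃ C : Tensor4 V, IsCurv C ∧ IsField C K := by
  obtain ⟨C, hC, h⟩ := exists_isCurv_of_symmetric (coneForm K) (coneForm_symm hK)
    (coneForm_swap hK) (coneForm_self hK)
  refine ⟨C, hC, fun x v w => ?_⟩
  rw [h, coneForm_apply, radialExt_sphere, norm_eq_of_mem_sphere]
  ring

end Geodesics


section Nijenhuis

variable {V : Type*} [NormedAddCommGroup V] [InnerProductSpace ℝ V]

/-- The cyclic sum in the Nijenhuis condition. -/
def nijenhuisCyc (K H : EndoField V) (x : Metric.sphere (0 : V) 1) (u v w : V) : ℝ :=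
  ⟪H x (nijenhuis K x u v), w⟫ + ⟪H x (nijenhuis K x v w), u⟫ + ⟪H x (nijenhuis K x w u), v⟫

theorem nabla_add_left (K : EndoField V) (x : Metric.sphere (0 : V) 1) (u u' v : V) :
    nabla K x (u + u') v = nabla K x u v + nabla K x u' v := by
  simp [nabla]

theorem nabla_smul_left (K : EndoField V) (x : Metric.sphere (0 : V) 1) (r : ℝ) (u v : V) :
    nabla K x (r • u) v = r • nabla K x u v := by
  simp [nabla]

theorem nabla_add_right (K : EndoField V) (x : Metric.sphere (0 : V) 1) (u v v' : V) :
    nabla K x u (v + v') = nabla K x u v + nabla K x u v' := by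
  simp [nabla]

theorem nabla_smul_right (K : EndoField V) (x : Metric.sphere (0 : V) 1) (r : ℝ) (u v : V) :
    nabla K x u (r • v) = r • nabla K x u v := by
  simp [nabla]

theorem nijenhuis_swap (K : EndoField V) (x : Metric.sphere (0 : V) 1) (u v : V) :
    nijenhuis K x v u = -nijenhuis K x u v := by
  simp only [nijenhuis, map_sub]
  module

theorem nijenhuis_add (K : EndoField V) (x : Metric.sphere (0 : V) 1) (u u' v : V) :
    nijenhuis K x (u + u') v = nijenhuis K x u v + nijenhuis K x u' v := by
  simp only [nijenhuis, nabla_add_left, nabla_add_right, map_add, map_sub]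
  module

theorem nijenhuis_smul (K : EndoField V) (x : Metric.sphere (0 : V) 1) (r : ℝ) (u v : V) :
    nijenhuis K x (r • u) v = r • nijenhuis K x u v := by
  simp only [nijenhuis, nabla_smul_left, nabla_smul_right, map_smul, map_sub]
  module

/-- A function which is invariant under cyclic permutations of its three arguments, alternating, and
linear in the first argument vanishes on the span of three vectors if it vanishes on these. -/
theorem eq_zero_of_cyclic_alternating {f : V → V → V → ℝ} (hc : ∀ u v w, f u v w = f v w u)
    (h0 : ∀ u w, f u u w = 0) (ha : ∀ u u' v w, f (u + u') v w = f u v w + f u' v w)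
    (hs : ∀ (r : ℝ) u v w, f (r • u) v w = r * f u v w) {b₁ b₂ b₃ : V} (hb : f b₁ b₂ b₃ = 0)
    (u₁ u₂ u₃ v₁ v₂ v₃ w₁ w₂ w₃ : ℝ) :
    f (u₁ • b₁ + u₂ • b₂ + u₃ • b₃) (v₁ • b₁ + v₂ • b₂ + v₃ • b₃) (w₁ • b₁ + w₂ • b₂ + w₃ • b₃)
      = 0 := by
  have ha2 : ∀ u v v' w, f u (v + v') w = f u v w + f u v' w := fun u v v' w => by
    rw [hc, ha, hc v, hc v', hc w u v, hc w u v']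
  have ha3 : ∀ u v w w', f u v (w + w') = f u v w + f u v w' := fun u v w w' => by
    rw [hc, hc, ha, hc w u v, hc w' u v]
  have hs2 : ∀ (r : ℝ) u v w, f u (r • v) w = r * f u v w := fun r u v w => by
    rw [hc, hs, hc v, hc w u v]
  have hs3 : ∀ (r : ℝ) u v w, f u v (r • w) = r * f u v w := fun r u v w => by
    rw [hc, hs2, ← hc]
  have h01 : ∀ u w, f w u u = 0 := fun u w => by rw [hc, h0]
  have h02 : ∀ u w, f u w u = 0 := fun u w => by rw [hc, hc, h0]
  have hsw : ∀ u v w, f u v w = -f v u w := fun u v w => by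
    have := h0 (u + v) w
    simp only [ha, ha2, h0] at this
    linarith
  have e1 : f b₂ b₃ b₁ = 0 := by rw [← hc, hb]
  have e2 : f b₃ b₁ b₂ = 0 := by rw [← hc, e1]
  have e3 : f b₂ b₁ b₃ = 0 := by rw [hsw, hb, neg_zero]
  have e4 : f b₃ b₂ b₁ = 0 := by rw [hsw, e1, neg_zero]
  have e5 : f b₁ b₃ b₂ = 0 := by rw [hsw, e2, neg_zero]
  simp only [ha, ha2, ha3, hs, hs2, hs3, h0, h01, h02, hb, e1, e2, e3, e4, e5]
  ring

theorem nijenhuisCyc_eq_zero {K H : EndoField V} {x : Metric.sphere (0 : V) 1} {b₁ b₂ b₃ : V}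
    (hb : nijenhuisCyc K H x b₁ b₂ b₃ = 0) (u₁ u₂ u₃ v₁ v₂ v₃ w₁ w₂ w₃ : ℝ) :
    nijenhuisCyc K H x (u₁ • b₁ + u₂ • b₂ + u₃ • b₃) (v₁ • b₁ + v₂ • b₂ + v₃ • b₃)
      (w₁ • b₁ + w₂ • b₂ + w₃ • b₃) = 0 := by
  have hself : ∀ u, nijenhuis K x u u = 0 := fun u => by
    have h1 := nijenhuis_swap K x u u
    have h2 : (2 : ℝ) • nijenhuis K x u u = 0 := by
      rw [two_smul]; nth_rewrite 2 [h1]; exact add_neg_cancel _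
    exact (smul_eq_zero.1 h2).resolve_left two_ne_zero
  have hadd : ∀ u v v', nijenhuis K x u (v + v') = nijenhuis K x u v + nijenhuis K x u v' :=
    fun u v v' => by
      rw [nijenhuis_swap, nijenhuis_add, nijenhuis_swap K x u v, nijenhuis_swap K x u v']; abel
  have hsm : ∀ (r : ℝ) u v, nijenhuis K x u (r • v) = r • nijenhuis K x u v := fun r u v => by
    rw [nijenhuis_swap, nijenhuis_smul, nijenhuis_swap K x u v, smul_neg, neg_neg]
  refine eq_zero_of_cyclic_alternating (f := nijenhuisCyc K H x) ?_ ?_ ?_ ?_ hb ..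
  · intro u v w; simp only [nijenhuisCyc]; ring
  · intro u w
    simp only [nijenhuisCyc, hself, map_zero, inner_zero_left, nijenhuis_swap K x u w, map_neg,
      inner_neg_left]
    ring
  · intro u u' v w
    simp only [nijenhuisCyc, nijenhuis_add, hadd, map_add, inner_add_left, inner_add_right]
    ring
  · intro r u v w
    simp only [nijenhuisCyc, nijenhuis_smul, hsm, map_smul, real_inner_smul_left,
      real_inner_smul_right]
    ring

/-- On a two-dimensional sphere every field is integrable. -/
theorem isIntegrable_of_finrank_eq_three [FiniteDimensional ℝ V] (hV : Module.finrank ℝ V = 3)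
    (K : EndoField V) : IsIntegrable K := by
  have key : ∀ H, NijenhuisCondition K H := by
    intro H x u v w hu hv hw
    have hx0 : (x : V) ≠ 0 := ne_zero_of_mem_unit_sphere x
    have hf : Module.finrank ℝ (ℝ ∙ (x : V))ᗮ = 2 := by
      have := Submodule.finrank_add_finrank_orthogonal (ℝ ∙ (x : V))
      rw [finrank_span_singleton hx0, hV] at this
      omega
    let b := Module.finBasisOfFinrankEq ℝ _ hf
    have hrep : ∀ y, IsTangent x y → ∃ p q : ℝ, y = p • (b 0 : V) + q • (b 1 : V) + (0 : ℝ) • (0 : V) := by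
      intro y hy
      have hy' : y ∈ (ℝ ∙ (x : V))ᗮ := by
        rw [Submodule.mem_orthogonal_singleton_iff_inner_right]; exact hy
      have := b.sum_repr ⟨y, hy'⟩
      rw [Fin.sum_univ_two] at this
      refine ⟨b.repr ⟨y, hy'⟩ 0, b.repr ⟨y, hy'⟩ 1, ?_⟩
      have h2 := congrArg (Subtype.val) this
      simp only [Submodule.coe_add, Submodule.coe_smul] at h2
      rw [h2]; simp
    obtain ⟨u₁, u₂, rfl⟩ := hrep u hu
    obtain ⟨v₁, v₂, rfl⟩ := hrep v hv
    obtain ⟨w₁, w₂, rfl⟩ := hrep w hw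
    refine nijenhuisCyc_eq_zero ?_ ..
    have z1 : ∀ y, nijenhuis K x 0 y = 0 := fun y => by
      simpa using nijenhuis_smul K x 0 (0 : V) y
    have z2 : ∀ y, nijenhuis K x y 0 = 0 := fun y => by rw [nijenhuis_swap, z1, neg_zero]
    simp [nijenhuisCyc, z1, z2]
  exact ⟨key _, key _, key _⟩

end Nijenhuis

section Frames

variable {V : Type*} [NormedAddCommGroup V] [InnerProductSpace ℝ V]

/-- The components `C(f₀, f_α, f₀, f_β)`. -/
def kMat (C : Tensor4 V) (f : Fin 4 → V) : Matrix (Fin 3) (Fin 3) ℝ :=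
  Matrix.of fun α β => C (f 0) (f α.succ) (f 0) (f β.succ)

/-- The components `C(f₀, f_α, f_γ, f_δ)` for `(β, γ, δ)` cyclic. -/
def bMat (C : Tensor4 V) (f : Fin 4 → V) : Matrix (Fin 3) (Fin 3) ℝ :=
  Matrix.of fun α β => C (f 0) (f α.succ) (f (β + 1).succ) (f (β + 2).succ)

theorem bMat_trace {C : Tensor4 V} (hC : IsCurv C) (f : Fin 4 → V) :
    bMat C f 0 0 + bMat C f 1 1 + bMat C f 2 2 = 0 := by
  have := hC.bianchi (f 0) (f 1) (f 2) (f 3)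
  exact this

theorem kMat_symm {C : Tensor4 V} (hC : IsCurv C) (f : Fin 4 → V) (α β : Fin 3) :
    kMat C f α β = kMat C f β α := hC.pair ..

end Frames

section FrameComputation

variable {V : Type*} [NormedAddCommGroup V] [InnerProductSpace ℝ V] [FiniteDimensional ℝ V]

theorem tangent_expand (f : OrthonormalBasis (Fin 4) ℝ V) {v : V} (hv : ⟪f 0, v⟫ = 0) :
    v = ∑ α : Fin 3, ⟪v, f α.succ⟫ • f α.succ := by
  conv_lhs => rw [← f.sum_repr v, Fin.sum_univ_succ]
  simp only [f.repr_apply_apply, hv, zero_smul, zero_add, real_inner_comm]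

variable {C : Tensor4 V} {K : EndoField V} (f : OrthonormalBasis (Fin 4) ℝ V)
  {x : Metric.sphere (0 : V) 1}

theorem frame_tangent (hx : (x : V) = f 0) (α : Fin 3) : IsTangent x (f α.succ) := by
  change ⟪(x : V), f α.succ⟫ = 0
  rw [hx]
  exact f.orthonormal.2 (Fin.succ_ne_zero α).symm

theorem field_frame (hC : IsCurv C) (h : IsField C K) (hx : (x : V) = f 0) (α : Fin 3) :
    K x (f α.succ) = ∑ β : Fin 3, kMat C f α β • f β.succ := by
  have h0 : ⟪f 0, K x (f α.succ)⟫ = 0 := by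
    rw [real_inner_comm, h, hx, hC.self_right]
  rw [tangent_expand f h0]
  simp only [h x, hx, kMat, Matrix.of_apply]

/-- The components of `∇ K` in terms of the curvature tensor. -/
def nablaComp (C : Tensor4 V) (f : Fin 4 → V) (α β γ : Fin 3) : ℝ :=
  C (f α.succ) (f β.succ) (f 0) (f γ.succ) + C (f 0) (f β.succ) (f α.succ) (f γ.succ)

theorem nabla_frame (h : IsField C K) (hx : (x : V) = f 0) (α β γ : Fin 3) :
    ⟪nabla K x (f α.succ) (f β.succ), f γ.succ⟫ = nablaComp C f α β γ := by
  rw [h.inner_nabla x (frame_tangent f hx α) (frame_tangent f hx γ), hx, nablaComp]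

theorem nijenhuis_frame (hC : IsCurv C) (h : IsField C K) (hx : (x : V) = f 0) (β γ δ : Fin 3) :
    ⟪nijenhuis K x (f β.succ) (f γ.succ), f δ.succ⟫ =
      (1 / 2) * (∑ ε, kMat C f δ ε * (nablaComp C f γ β ε - nablaComp C f β γ ε)) +
      (1 / 2) * (∑ ε, (kMat C f β ε * nablaComp C f ε γ δ - kMat C f γ ε * nablaComp C f ε β δ)) := by
  have hsym := (h.isKilling hC).1.2.2
  simp only [nijenhuis, inner_add_left, real_inner_smul_left, hsym, field_frame f hC h hx,
    inner_add_right, inner_sub_left, real_inner_smul_right, Fin.sum_univ_three, nabla_add_left,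
    nabla_smul_left, nabla_frame f h hx]
  ring

theorem nablaComp_eq (hC : IsCurv C) (f : Fin 4 → V) (α β γ : Fin 3) :
    nablaComp C f α β γ = C (f 0) (f γ.succ) (f α.succ) (f β.succ)
      + C (f 0) (f β.succ) (f α.succ) (f γ.succ) := by
  rw [nablaComp, hC.pair]

theorem nablaComp_table (hC : IsCurv C) (f : Fin 4 → V) :
    (∀ α, nablaComp C f α α α = 0) ∧ (∀ α β γ, nablaComp C f α β γ = nablaComp C f α γ β) ∧
    (∀ α, nablaComp C f α (α + 1) (α + 1) = 2 * bMat C f (α + 1) (α + 2)) ∧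
    (∀ α, nablaComp C f α (α + 2) (α + 2) = -2 * bMat C f (α + 2) (α + 1)) ∧
    (∀ α, nablaComp C f α α (α + 1) = bMat C f α (α + 2)) ∧
    (∀ α, nablaComp C f α α (α + 2) = -bMat C f α (α + 1)) ∧
    (∀ α, nablaComp C f α (α + 1) (α + 2) = bMat C f (α + 2) (α + 2) - bMat C f (α + 1) (α + 1)) := by
  have e1 : ∀ α : Fin 3, α + 2 + 1 = α := by decide
  have e2 : ∀ α : Fin 3, α + 2 + 2 = α + 1 := by decide
  have e3 : ∀ α : Fin 3, α + 1 + 1 = α + 2 := by decide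
  have e4 : ∀ α : Fin 3, α + 1 + 2 = α := by decide
  refine ⟨fun α => ?_, fun α β γ => ?_, fun α => ?_, fun α => ?_, fun α => ?_, fun α => ?_,
    fun α => ?_⟩ <;> simp only [nablaComp_eq hC, bMat, Matrix.of_apply, hC.self_right, e1, e2, e3, e4]
  · ring
  · ring
  · ring
  · rw [hC.right _ _ (f (α + 2).succ)]; ring
  · ring
  · rw [hC.right _ _ (f (α + 2).succ)]; ring
  · rw [hC.right _ _ (f (α + 2).succ)]; ring

end FrameComputation


section Integrability

variable {V : Type*} [NormedAddCommGroup V] [InnerProductSpace ℝ V] [FiniteDimensional ℝ V]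
variable {C : Tensor4 V} {K : EndoField V} (f : OrthonormalBasis (Fin 4) ℝ V)
  {x : Metric.sphere (0 : V) 1}

/-- The components of the Nijenhuis torsion in a frame. -/
def nijenhuisComp (C : Tensor4 V) (f : Fin 4 → V) (β γ δ : Fin 3) : ℝ :=
  (1 / 2) * (∑ ε, kMat C f δ ε * (nablaComp C f γ β ε - nablaComp C f β γ ε)) +
      (1 / 2) * (∑ ε, (kMat C f β ε * nablaComp C f ε γ δ - kMat C f γ ε * nablaComp C f ε β δ))

theorem nijenhuisCyc_frame (hC : IsCurv C) (h : IsField C K) (hx : (x : V) = f 0)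
    {H : EndoField V} (hH : ∀ v w, ⟪H x v, w⟫ = ⟪v, H x w⟫) {m : Matrix (Fin 3) (Fin 3) ℝ}
    (hm : ∀ α : Fin 3, H x (f α.succ) = ∑ β : Fin 3, m α β • f β.succ) :
    nijenhuisCyc K H x (f (0 : Fin 3).succ) (f (1 : Fin 3).succ) (f (2 : Fin 3).succ) =
      ∑ ε, m 2 ε * nijenhuisComp C f 0 1 ε + ∑ ε, m 0 ε * nijenhuisComp C f 1 2 ε
        + ∑ ε, m 1 ε * nijenhuisComp C f 2 0 ε := by
  simp only [nijenhuisCyc, hH, hm, Fin.sum_univ_three (M := V), inner_add_right,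
    real_inner_smul_right, nijenhuis_frame f hC h hx, nijenhuisComp, Fin.sum_univ_three (M := ℝ)]

theorem nablaComp_values (hC : IsCurv C) (f : Fin 4 → V) {b : Matrix (Fin 3) (Fin 3) ℝ}
    (hb : bMat C f = b) :
    (nablaComp C f 0 = !![0, b 0 2, -b 0 1; b 0 2, 2 * b 1 2, b 2 2 - b 1 1;
      -b 0 1, b 2 2 - b 1 1, -2 * b 2 1]) ∧
    (nablaComp C f 1 = !![-2 * b 0 2, -b 1 2, b 0 0 - b 2 2; -b 1 2, 0, b 1 0;
      b 0 0 - b 2 2, b 1 0, 2 * b 2 0]) ∧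
    (nablaComp C f 2 = !![2 * b 0 1, b 1 1 - b 0 0, b 2 1; b 1 1 - b 0 0, -2 * b 1 0, -b 2 0;
      b 2 1, -b 2 0, 0]) := by
  obtain ⟨h0, hs, h1, h2, h3, h4, h5⟩ := nablaComp_table hC f
  rw [hb] at h1 h2 h3 h4 h5
  refine ⟨?_, ?_, ?_⟩ <;> ext i j <;> fin_cases i <;> fin_cases j <;>
    simp only [Fin.zero_eta, Fin.mk_one, Fin.reduceFinMk, Matrix.of_apply, Matrix.cons_val', Matrix.cons_val]
  · exact h0 0
  · exact h3 0
  · exact h4 0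
  · rw [hs]; exact h3 0
  · exact h1 0
  · exact h5 0
  · rw [hs]; exact h4 0
  · rw [hs]; exact h5 0
  · exact h2 0
  · exact h2 1
  · rw [hs]; exact h4 1
  · rw [hs]; exact h5 1
  · exact h4 1
  · exact h0 1
  · exact h3 1
  · exact h5 1
  · rw [hs]; exact h3 1
  · exact h1 1
  · exact h1 2
  · exact h5 2
  · rw [hs]; exact h3 2
  · rw [hs]; exact h5 2
  · exact h2 2
  · rw [hs]; exact h4 2
  · exact h3 2
  · exact h4 2
  · exact h0 2

/-- `tr(k b)` in a frame. -/
def firstObstruction (C : Tensor4 V) (f : Fin 4 → V) : ℝ := (kMat C f * bMat C f).trace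

/-- `tr(k² b)` in a frame. -/
def secondObstruction (C : Tensor4 V) (f : Fin 4 → V) : ℝ :=
  (kMat C f * kMat C f * bMat C f).trace

theorem kMat_eq (hC : IsCurv C) (f : Fin 4 → V) : ∃ a b c d e g : ℝ,
    kMat C f = !![a, b, c; b, d, e; c, e, g] := by
  refine ⟨kMat C f 0 0, kMat C f 0 1, kMat C f 0 2, kMat C f 1 1, kMat C f 1 2, kMat C f 2 2, ?_⟩
  conv_lhs => rw [Matrix.eta_fin_three (kMat C f), kMat_symm hC f 1 0, kMat_symm hC f 2 0,
    kMat_symm hC f 2 1]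

theorem bMat_eq (hC : IsCurv C) (f : Fin 4 → V) : ∃ a b c d e g h i : ℝ,
    bMat C f = !![a, b, c; d, e, g; h, i, -a-e] := by
  refine ⟨bMat C f 0 0, bMat C f 0 1, bMat C f 0 2, bMat C f 1 0, bMat C f 1 1, bMat C f 1 2,
    bMat C f 2 0, bMat C f 2 1, ?_⟩
  conv_lhs => rw [Matrix.eta_fin_three (bMat C f),
    show bMat C f 2 2 = -bMat C f 0 0 - bMat C f 1 1 by linarith [bMat_trace hC f]]

theorem cyc_one (hC : IsCurv C) (f : Fin 4 → V) {m : Matrix (Fin 3) (Fin 3) ℝ} (hm : m = 1) :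
    ∑ ε, m 2 ε * nijenhuisComp C f 0 1 ε + ∑ ε, m 0 ε * nijenhuisComp C f 1 2 ε
        + ∑ ε, m 1 ε * nijenhuisComp C f 2 0 ε = -(3 / 2) * firstObstruction C f := by
  obtain ⟨a, b, c, d, e, g, hk⟩ := kMat_eq hC f
  obtain ⟨b1, b2, b3, b4, b5, b6, b7, b8, hb⟩ := bMat_eq hC f
  obtain ⟨n0, n1, n2⟩ := nablaComp_values hC f hb
  rw [hm]
  simp only [nijenhuisComp, firstObstruction, hk, hb, n0, n1, n2, Fin.sum_univ_three, Matrix.one_fin_three,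
    Matrix.trace_fin_three, Matrix.mul_apply, Matrix.of_apply, Matrix.cons_val', Matrix.cons_val]
  ring

theorem cyc_kMat (hC : IsCurv C) (f : Fin 4 → V) {m : Matrix (Fin 3) (Fin 3) ℝ}
    (hm : m = kMat C f) :
    ∑ ε, m 2 ε * nijenhuisComp C f 0 1 ε + ∑ ε, m 0 ε * nijenhuisComp C f 1 2 ε
        + ∑ ε, m 1 ε * nijenhuisComp C f 2 0 ε =
      -(3 / 2) * (2 * secondObstruction C f - (kMat C f).trace * firstObstruction C f) := by
  obtain ⟨a, b, c, d, e, g, hk⟩ := kMat_eq hC f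
  obtain ⟨b1, b2, b3, b4, b5, b6, b7, b8, hb⟩ := bMat_eq hC f
  obtain ⟨n0, n1, n2⟩ := nablaComp_values hC f hb
  rw [hm]
  simp only [nijenhuisComp, firstObstruction, secondObstruction, hk, hb, n0, n1, n2, Fin.sum_univ_three,
    Matrix.trace_fin_three, Matrix.mul_apply, Matrix.of_apply, Matrix.cons_val', Matrix.cons_val]
  ring

theorem cyc_kMat_sq (hC : IsCurv C) (f : Fin 4 → V) {m : Matrix (Fin 3) (Fin 3) ℝ}
    (hm : m = kMat C f * kMat C f) :
    ∑ ε, m 2 ε * nijenhuisComp C f 0 1 ε + ∑ ε, m 0 ε * nijenhuisComp C f 1 2 ε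
        + ∑ ε, m 1 ε * nijenhuisComp C f 2 0 ε =
      -(2 * (kMat C f).trace) * secondObstruction C f +
        (1 / 2) * (3 * (kMat C f).trace ^ 2 - 2 * (kMat C f * kMat C f).trace) * firstObstruction C f := by
  obtain ⟨a, b, c, d, e, g, hk⟩ := kMat_eq hC f
  obtain ⟨b1, b2, b3, b4, b5, b6, b7, b8, hb⟩ := bMat_eq hC f
  obtain ⟨n0, n1, n2⟩ := nablaComp_values hC f hb
  rw [hm]
  simp only [nijenhuisComp, firstObstruction, secondObstruction, hk, hb, n0, n1, n2, Fin.sum_univ_three,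
    Matrix.trace_fin_three, Matrix.mul_apply, Matrix.of_apply, Matrix.cons_val', Matrix.cons_val]
  ring

/-- Integrability in terms of the components of the curvature tensor in frames. -/
theorem isIntegrable_iff (F : Metric.sphere (0 : V) 1 → OrthonormalBasis (Fin 4) ℝ V)
    (hF : ∀ x : Metric.sphere (0 : V) 1, (x : V) = F x 0) (hC : IsCurv C) (h : IsField C K) :
    IsIntegrable K ↔ ∀ x, firstObstruction C (F x) = 0 ∧ secondObstruction C (F x) = 0 := by
  have hKs := (h.isKilling hC).1.2.2
  have c1 : ∀ x, nijenhuisCyc K (metric V) x (F x (0 : Fin 3).succ) (F x (1 : Fin 3).succ)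
      (F x (2 : Fin 3).succ) = -(3 / 2) * firstObstruction C (F x) := fun x => by
    rw [nijenhuisCyc_frame (F x) hC h (hF x) ((isField_metric.isKilling isCurv_gCurv).1.2.2 x)
      (m := 1), cyc_one hC _ rfl]
    intro α
    rw [metric_apply, frame_tangent (F x) (hF x) α]
    simp [Matrix.one_apply]
  have c2 : ∀ x, nijenhuisCyc K K x (F x (0 : Fin 3).succ) (F x (1 : Fin 3).succ)
      (F x (2 : Fin 3).succ) = -(3 / 2) * (2 * secondObstruction C (F x)
        - (kMat C (F x)).trace * firstObstruction C (F x)) := fun x => by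
    rw [nijenhuisCyc_frame (F x) hC h (hF x) (hKs x) (field_frame (F x) hC h (hF x)),
      cyc_kMat hC _ rfl]
  have c3 : ∀ x, nijenhuisCyc K (fun x => (K x).comp (K x)) x (F x (0 : Fin 3).succ)
      (F x (1 : Fin 3).succ) (F x (2 : Fin 3).succ) =
      -(2 * (kMat C (F x)).trace) * secondObstruction C (F x) + (1 / 2) *
        (3 * (kMat C (F x)).trace ^ 2 - 2 * (kMat C (F x) * kMat C (F x)).trace) *
          firstObstruction C (F x) := fun x => by
    rw [nijenhuisCyc_frame (F x) hC h (hF x) (m := kMat C (F x) * kMat C (F x)),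
      cyc_kMat_sq hC _ rfl]
    · intro v w
      simp only [ContinuousLinearMap.comp_apply, hKs]
    · intro α
      simp only [ContinuousLinearMap.comp_apply, field_frame (F x) hC h (hF x), map_add, map_smul,
        Matrix.mul_apply, Fin.sum_univ_three]
      module
  have full : ∀ H, (∀ x, nijenhuisCyc K H x (F x (0 : Fin 3).succ) (F x (1 : Fin 3).succ)
      (F x (2 : Fin 3).succ) = 0) → NijenhuisCondition K H := by
    intro H h0 x u v w hu hv hw
    have hex : ∀ y, IsTangent x y → ∃ p q r : ℝ, y = p • F x (0 : Fin 3).succ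
        + q • F x (1 : Fin 3).succ + r • F x (2 : Fin 3).succ := fun y hy => by
      have := tangent_expand (F x) (v := y) (by rw [← hF x]; exact hy)
      rw [Fin.sum_univ_three] at this
      exact ⟨_, _, _, this⟩
    obtain ⟨u₁, u₂, u₃, rfl⟩ := hex u hu
    obtain ⟨v₁, v₂, v₃, rfl⟩ := hex v hv
    obtain ⟨w₁, w₂, w₃, rfl⟩ := hex w hw
    exact nijenhuisCyc_eq_zero (h0 x) ..
  constructor
  · rintro ⟨h1, h2, -⟩ x
    have ht := frame_tangent (F x) (hF x)
    have e1 := h1 x _ _ _ (ht 0) (ht 1) (ht 2)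
    have e2 := h2 x _ _ _ (ht 0) (ht 1) (ht 2)
    have e1' := (c1 x).symm.trans e1
    have e2' := (c2 x).symm.trans e2
    have e3 : firstObstruction C (F x) = 0 := by linarith
    rw [e3] at e2'
    exact ⟨e3, by linarith⟩
  · intro h0
    refine ⟨full _ fun x => ?_, full _ fun x => ?_, full _ fun x => ?_⟩
    · rw [c1, (h0 x).1, mul_zero]
    · rw [c2, (h0 x).1, (h0 x).2]; ring
    · rw [c3, (h0 x).1, (h0 x).2]; ring

end Integrability


section Blocks

variable {V : Type*} [NormedAddCommGroup V] [InnerProductSpace ℝ V]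

/-- Value of a bilinear form on `f₀ ∧ f_α + σ f_β ∧ f_γ` with `(α, β, γ)` cyclic. -/
def dualPair (B : V →ₗ[ℝ] V →ₗ[ℝ] ℝ) (f : Fin 4 → V) (σ : ℝ) (α : Fin 3) : ℝ :=
  B (f 0) (f α.succ) + σ * B (f (α + 1).succ) (f (α + 2).succ)

/-- The blocks of a curvature operator with respect to the splitting of the bivectors into selfdual
and antiselfdual ones. -/
def block (C : Tensor4 V) (f : Fin 4 → V) (σ τ : ℝ) : Matrix (Fin 3) (Fin 3) ℝ :=
  Matrix.of fun α β => (1 / 2) *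
    (dualPair (C (f 0) (f α.succ)) f τ β + σ * dualPair (C (f (α + 1).succ) (f (α + 2).succ)) f τ β)

/-- The selfdual block. -/
def blockP (C : Tensor4 V) (f : Fin 4 → V) : Matrix (Fin 3) (Fin 3) ℝ := block C f 1 1

/-- The mixed block. -/
def blockT (C : Tensor4 V) (f : Fin 4 → V) : Matrix (Fin 3) (Fin 3) ℝ := block C f 1 (-1)

/-- The antiselfdual block. -/
def blockD (C : Tensor4 V) (f : Fin 4 → V) : Matrix (Fin 3) (Fin 3) ℝ := block C f (-1) (-1)

/-- Left multiplication of a frame by a quaternion. -/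
def leftFrame (p : Fin 4 → ℝ) (f : Fin 4 → V) : Fin 4 → V :=
  ![p 0 • f 0 + p 1 • f 1 + p 2 • f 2 + p 3 • f 3,
    -p 1 • f 0 + p 0 • f 1 + p 3 • f 2 - p 2 • f 3,
    -p 2 • f 0 - p 3 • f 1 + p 0 • f 2 + p 1 • f 3,
    -p 3 • f 0 + p 2 • f 1 - p 1 • f 2 + p 0 • f 3]

/-- The rotation of three-space given by a quaternion. -/
def rot (p : Fin 4 → ℝ) : Matrix (Fin 3) (Fin 3) ℝ :=
  !![p 0 ^ 2 + p 1 ^ 2 - p 2 ^ 2 - p 3 ^ 2, 2 * (p 1 * p 2 + p 0 * p 3), 2 * (p 1 * p 3 - p 0 * p 2);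
     2 * (p 1 * p 2 - p 0 * p 3), p 0 ^ 2 - p 1 ^ 2 + p 2 ^ 2 - p 3 ^ 2, 2 * (p 2 * p 3 + p 0 * p 1);
     2 * (p 1 * p 3 + p 0 * p 2), 2 * (p 2 * p 3 - p 0 * p 1), p 0 ^ 2 - p 1 ^ 2 - p 2 ^ 2 + p 3 ^ 2]

/-- Reversal of the last three vectors of a frame. -/
def reflectFrame (f : Fin 4 → V) : Fin 4 → V := ![f 0, -f 1, -f 2, -f 3]

theorem dualPair_zero (B : V →ₗ[ℝ] V →ₗ[ℝ] ℝ) (f : Fin 4 → V) (σ : ℝ) :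
    dualPair B f σ 0 = B (f 0) (f 1) + σ * B (f 2) (f 3) := rfl

theorem dualPair_one (B : V →ₗ[ℝ] V →ₗ[ℝ] ℝ) (f : Fin 4 → V) (σ : ℝ) :
    dualPair B f σ 1 = B (f 0) (f 2) + σ * B (f 3) (f 1) := rfl

theorem dualPair_two (B : V →ₗ[ℝ] V →ₗ[ℝ] ℝ) (f : Fin 4 → V) (σ : ℝ) :
    dualPair B f σ 2 = B (f 0) (f 3) + σ * B (f 1) (f 2) := rfl

theorem dualPair_leftFrame {B : V →ₗ[ℝ] V →ₗ[ℝ] ℝ} (hB : ∀ a b, B b a = -B a b) (p : Fin 4 → ℝ)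
    (f : Fin 4 → V) (α : Fin 3) :
    dualPair B (leftFrame p f) 1 α = ∑ β, rot p α β * dualPair B f 1 β := by
  have hs : ∀ a, B a a = 0 := fun a => by linarith [hB a a]
  have e10 := hB (f 0) (f 1)
  have e20 := hB (f 0) (f 2)
  have e30 := hB (f 0) (f 3)
  have e21 := hB (f 1) (f 2)
  have e31 := hB (f 1) (f 3)
  have e32 := hB (f 2) (f 3)
  rw [Fin.sum_univ_three]
  fin_cases α <;>
    simp only [Fin.zero_eta, Fin.mk_one, Fin.reduceFinMk, dualPair_zero, dualPair_one, dualPair_two,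
      leftFrame, rot, Matrix.of_apply, Matrix.cons_val', Matrix.cons_val, map_add, map_sub, map_smul,
      LinearMap.add_apply, LinearMap.sub_apply, LinearMap.smul_apply, smul_eq_mul, hs, e10, e20, e30,
      e21, e31, e32, neg_smul, map_neg, LinearMap.neg_apply] <;> ring

theorem dualPair_leftFrame_neg {B : V →ₗ[ℝ] V →ₗ[ℝ] ℝ} (hB : ∀ a b, B b a = -B a b)
    {p : Fin 4 → ℝ} (hp : p 0 ^ 2 + p 1 ^ 2 + p 2 ^ 2 + p 3 ^ 2 = 1) (f : Fin 4 → V) (α : Fin 3) :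
    dualPair B (leftFrame p f) (-1) α = dualPair B f (-1) α := by
  have hs : ∀ a, B a a = 0 := fun a => by linarith [hB a a]
  have e10 := hB (f 0) (f 1)
  have e20 := hB (f 0) (f 2)
  have e30 := hB (f 0) (f 3)
  have e21 := hB (f 1) (f 2)
  have e31 := hB (f 1) (f 3)
  have e32 := hB (f 2) (f 3)
  fin_cases α <;>
    simp only [Fin.zero_eta, Fin.mk_one, Fin.reduceFinMk, dualPair_zero, dualPair_one, dualPair_two,
      leftFrame, Matrix.cons_val, map_add, map_sub, map_smul,
      LinearMap.add_apply, LinearMap.sub_apply, LinearMap.smul_apply, smul_eq_mul, hs, e10, e20, e30,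
      e21, e31, e32, neg_smul, map_neg, LinearMap.neg_apply]
  · linear_combination (B (f 0) (f 1) - B (f 2) (f 3)) * hp
  · linear_combination (B (f 0) (f 2) + B (f 1) (f 3)) * hp
  · linear_combination (B (f 0) (f 3) - B (f 1) (f 2)) * hp

theorem dualPair_reflectFrame (B : V →ₗ[ℝ] V →ₗ[ℝ] ℝ) (f : Fin 4 → V) (σ : ℝ) (α : Fin 3) :
    dualPair B (reflectFrame f) σ α = -dualPair B f (-σ) α := by
  fin_cases α <;>
    simp only [Fin.zero_eta, Fin.mk_one, Fin.reduceFinMk, dualPair_zero, dualPair_one, dualPair_two,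
      reflectFrame, Matrix.cons_val, map_neg, LinearMap.neg_apply] <;> ring

/-- Evaluation of the second pair of arguments of `C` at a basis vector of the (anti)selfdual
bivectors. -/
def contractRight (C : Tensor4 V) (f : Fin 4 → V) (τ : ℝ) (β : Fin 3) : V →ₗ[ℝ] V →ₗ[ℝ] ℝ :=
  LinearMap.mk₂ ℝ (fun a b => dualPair (C a b) f τ β)
    (fun _ _ _ => by simp only [dualPair, map_add, LinearMap.add_apply]; ring)
    (fun _ _ _ => by simp only [dualPair, map_smul, LinearMap.smul_apply, smul_eq_mul]; ring)
    (fun _ _ _ => by simp only [dualPair, map_add, LinearMap.add_apply]; ring)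
    (fun _ _ _ => by simp only [dualPair, map_smul, LinearMap.smul_apply, smul_eq_mul]; ring)

theorem contractRight_apply (C : Tensor4 V) (f : Fin 4 → V) (τ : ℝ) (β : Fin 3) (a b : V) :
    contractRight C f τ β a b = dualPair (C a b) f τ β := rfl

theorem contractRight_anti {C : Tensor4 V} (hC : IsCurv C) (f : Fin 4 → V) (τ : ℝ) (β : Fin 3)
    (a b : V) : contractRight C f τ β b a = -contractRight C f τ β a b := by
  simp only [contractRight_apply, dualPair, hC.left a b]; ring

theorem block_apply (C : Tensor4 V) (f : Fin 4 → V) (σ τ : ℝ) (α β : Fin 3) :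
    block C f σ τ α β = (1 / 2) * dualPair (contractRight C f τ β) f σ α := rfl

theorem block_transpose {C : Tensor4 V} (hC : IsCurv C) (f : Fin 4 → V) (σ τ : ℝ) :
    (block C f σ τ).transpose = block C f τ σ := by
  ext α β
  simp only [Matrix.transpose_apply, block, Matrix.of_apply, dualPair]
  rw [hC.pair (f 0) (f α.succ) (f 0) (f β.succ), hC.pair (f 0) (f α.succ) (f (β + 1).succ),
    hC.pair (f (α + 1).succ) _ (f 0) (f β.succ), hC.pair (f (α + 1).succ) _ (f (β + 1).succ)]
  ring

theorem contractRight_leftFrame {C : Tensor4 V} (hC : IsCurv C) (p : Fin 4 → ℝ) (f : Fin 4 → V)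
    (β : Fin 3) :
    contractRight C (leftFrame p f) 1 β = ∑ γ, rot p β γ • contractRight C f 1 γ := by
  ext a b
  simp only [contractRight_apply, LinearMap.sum_apply, LinearMap.smul_apply, smul_eq_mul]
  exact dualPair_leftFrame (fun c d => hC.right a b c d) p f β

theorem contractRight_leftFrame_neg {C : Tensor4 V} (hC : IsCurv C) {p : Fin 4 → ℝ}
    (hp : p 0 ^ 2 + p 1 ^ 2 + p 2 ^ 2 + p 3 ^ 2 = 1) (f : Fin 4 → V) (β : Fin 3) :
    contractRight C (leftFrame p f) (-1) β = contractRight C f (-1) β := by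
  ext a b
  exact dualPair_leftFrame_neg (fun c d => hC.right a b c d) hp f β

theorem dualPair_sum (f : Fin 4 → V) (σ : ℝ) (α : Fin 3) (c : Fin 3 → ℝ)
    (B : Fin 3 → V →ₗ[ℝ] V →ₗ[ℝ] ℝ) :
    dualPair (∑ γ, c γ • B γ) f σ α = ∑ γ, c γ * dualPair (B γ) f σ α := by
  simp only [dualPair, LinearMap.add_apply, LinearMap.smul_apply, smul_eq_mul, Fin.sum_univ_three]
  ring

theorem blockP_leftFrame {C : Tensor4 V} (hC : IsCurv C) (p : Fin 4 → ℝ) (f : Fin 4 → V) :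
    blockP C (leftFrame p f) = rot p * blockP C f * (rot p).transpose := by
  ext α β
  simp only [blockP, block_apply, contractRight_leftFrame hC, dualPair_sum,
    dualPair_leftFrame (contractRight_anti hC f _ _)]
  simp only [Matrix.mul_apply, Matrix.transpose_apply, block_apply, Fin.sum_univ_three]
  ring

theorem blockT_leftFrame {C : Tensor4 V} (hC : IsCurv C) {p : Fin 4 → ℝ}
    (hp : p 0 ^ 2 + p 1 ^ 2 + p 2 ^ 2 + p 3 ^ 2 = 1) (f : Fin 4 → V) :
    blockT C (leftFrame p f) = rot p * blockT C f := by
  ext α β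
  simp only [blockT, block_apply, contractRight_leftFrame_neg hC hp,
    dualPair_leftFrame (contractRight_anti hC f _ _), Matrix.mul_apply,
    Fin.sum_univ_three]
  ring

theorem blockD_leftFrame {C : Tensor4 V} (hC : IsCurv C) {p : Fin 4 → ℝ}
    (hp : p 0 ^ 2 + p 1 ^ 2 + p 2 ^ 2 + p 3 ^ 2 = 1) (f : Fin 4 → V) :
    blockD C (leftFrame p f) = blockD C f := by
  ext α β
  simp only [blockD, block_apply, contractRight_leftFrame_neg hC hp,
    dualPair_leftFrame_neg (contractRight_anti hC f _ _) hp]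

theorem block_reflectFrame (C : Tensor4 V) (f : Fin 4 → V) (σ τ : ℝ) :
    block C (reflectFrame f) σ τ = block C f (-σ) (-τ) := by
  have h1 : ∀ β, contractRight C (reflectFrame f) τ β = (-1 : ℝ) • contractRight C f (-τ) β := by
    intro β
    ext a b
    simp only [contractRight_apply, LinearMap.smul_apply, smul_eq_mul, dualPair_reflectFrame]
    ring
  ext α β
  rw [block_apply, block_apply, h1, dualPair_reflectFrame]
  simp only [dualPair, LinearMap.smul_apply, smul_eq_mul]
  ring

theorem blockP_reflectFrame (C : Tensor4 V) (f : Fin 4 → V) :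
    blockP C (reflectFrame f) = blockD C f := block_reflectFrame C f  1 1

theorem blockD_reflectFrame (C : Tensor4 V) (f : Fin 4 → V) :
    blockD C (reflectFrame f) = blockP C f := by
  rw [blockD, block_reflectFrame, neg_neg, blockP]

theorem blockT_reflectFrame {C : Tensor4 V} (hC : IsCurv C) (f : Fin 4 → V) :
    blockT C (reflectFrame f) = (blockT C f).transpose := by
  rw [blockT, block_reflectFrame, neg_neg, blockT,
    block_transpose hC]

theorem blockP_symm {C : Tensor4 V} (hC : IsCurv C) (f : Fin 4 → V) :
    (blockP C f).transpose = blockP C f := block_transpose hC f 1 1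

theorem blockD_symm {C : Tensor4 V} (hC : IsCurv C) (f : Fin 4 → V) :
    (blockD C f).transpose = blockD C f := block_transpose hC f (-1) (-1)

theorem kMat_eq_blocks {C : Tensor4 V} (hC : IsCurv C) (f : Fin 4 → V) : kMat C f =
    (1 / 2 : ℝ) • (blockP C f + blockT C f + (blockT C f).transpose + blockD C f) := by
  rw [blockT, block_transpose hC]
  ext α β
  simp only [blockP, blockD, kMat, block, Matrix.add_apply, Matrix.smul_apply, Matrix.of_apply, smul_eq_mul,
    dualPair]
  ring

theorem bMat_eq_blocks {C : Tensor4 V} (hC : IsCurv C) (f : Fin 4 → V) : bMat C f =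
    (1 / 2 : ℝ) • (blockP C f - blockT C f + (blockT C f).transpose - blockD C f) := by
  rw [blockT, block_transpose hC]
  ext α β
  simp only [blockP, blockD, bMat, block, Matrix.add_apply, Matrix.sub_apply, Matrix.smul_apply,
    Matrix.of_apply, smul_eq_mul, dualPair]
  ring

theorem block_trace_eq {C : Tensor4 V} (hC : IsCurv C) (f : Fin 4 → V) :
    (blockP C f).trace = (blockD C f).trace := by
  have h := bMat_trace hC f
  rw [bMat_eq_blocks hC] at h
  simp only [Matrix.add_apply, Matrix.sub_apply, Matrix.smul_apply, Matrix.transpose_apply,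
    smul_eq_mul] at h
  simp only [Matrix.trace_fin_three]
  linarith

end Blocks

section RotationMatrices

theorem rot_mul_transpose {p : Fin 4 → ℝ} (hp : p 0 ^ 2 + p 1 ^ 2 + p 2 ^ 2 + p 3 ^ 2 = 1) :
    rot p * (rot p).transpose = 1 := by
  have h2 : (p 0 ^ 2 + p 1 ^ 2 + p 2 ^ 2 + p 3 ^ 2) ^ 2 = 1 := by rw [hp]; norm_num
  ext i j
  fin_cases i <;> fin_cases j <;>
    simp only [rot, Fin.zero_eta, Fin.mk_one, Fin.reduceFinMk, Matrix.mul_apply,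
      Fin.sum_univ_three, Matrix.transpose_apply, Matrix.of_apply, Matrix.cons_val', Matrix.cons_val,
      Matrix.one_fin_three] <;>
    first | linear_combination h2 | ring

theorem rot_smul (r : ℝ) (p : Fin 4 → ℝ) : rot (r • p) = r ^ 2 • rot p := by
  ext i j
  fin_cases i <;> fin_cases j <;>
    simp only [rot, Fin.zero_eta, Fin.mk_one, Fin.reduceFinMk, Matrix.of_apply, Matrix.cons_val',
      Matrix.cons_val, Matrix.smul_apply, Pi.smul_apply, smul_eq_mul] <;> ring

/-- Every rotation is given by a quaternion. -/
theorem exists_rot_eq {O : Matrix (Fin 3) (Fin 3) ℝ} (hO : O * O.transpose = 1) (hd : O.det = 1) :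
    ∃ p : Fin 4 → ℝ, p 0 ^ 2 + p 1 ^ 2 + p 2 ^ 2 + p 3 ^ 2 = 1 ∧ rot p = O := by
  have main : ∀ O : Matrix (Fin 3) (Fin 3) ℝ, O * O.transpose = 1 → O.det = 1 → 1 + O.trace ≠ 0 →
      ∃ p : Fin 4 → ℝ, p 0 ^ 2 + p 1 ^ 2 + p 2 ^ 2 + p 3 ^ 2 = 1 ∧ rot p = O := by
    intro O hO hd hne
    have hadj : O.adjugate = O.transpose := by
      have h1 : O.adjugate * (O * O.transpose) = O.transpose := by
        rw [← Matrix.mul_assoc, Matrix.adjugate_mul, hd, one_smul, Matrix.one_mul]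
      rw [hO, Matrix.mul_one] at h1
      exact h1
    have hO' : O.transpose * O = 1 := by
      rw [← hadj, Matrix.adjugate_mul, hd, one_smul]
    have hc := fun i j => congrFun (congrFun hadj i) j
    have hr := fun i j => congrFun (congrFun hO i) j
    have hl := fun i j => congrFun (congrFun hO' i) j
    simp only [Matrix.adjugate_fin_three, Matrix.transpose_apply] at hc
    simp only [Matrix.mul_apply, Matrix.transpose_apply, Fin.sum_univ_three, Matrix.one_apply] at hr hl
    have c00 := hc 0 0; have c01 := hc 0 1; have c02 := hc 0 2
    have c10 := hc 1 0; have c11 := hc 1 1; have c12 := hc 1 2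
    have c20 := hc 2 0; have c21 := hc 2 1; have c22 := hc 2 2
    have r00 := hr 0 0; have r01 := hr 0 1; have r02 := hr 0 2
    have r11 := hr 1 1; have r12 := hr 1 2; have r22 := hr 2 2
    have l00 := hl 0 0; have l01 := hl 0 1; have l02 := hl 0 2
    have l11 := hl 1 1; have l12 := hl 1 2; have l22 := hl 2 2
    simp [Fin.isValue] at c00 c01 c02 c10 c11 c12 c20 c21 c22 r00 r01 r02 r11 r12 r22 l00 l01 l02 l11 l12 l22
    let q : Fin 4 → ℝ := ![1 + O.trace, O 1 2 - O 2 1, O 2 0 - O 0 2, O 0 1 - O 1 0]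
    have hq : rot q = (4 * (1 + O.trace)) • O := by
      ext i j
      fin_cases i <;> fin_cases j <;>
        simp only [q, rot, Fin.zero_eta, Fin.mk_one, Fin.reduceFinMk, Matrix.of_apply,
          Matrix.cons_val', Matrix.cons_val, Matrix.smul_apply, smul_eq_mul, Matrix.trace_fin_three]
      · linear_combination 2 * c00 - 2 * c11 - 2 * c22 + r11 + r22 - 2 * l00 - r00
      · linear_combination 2 * c10 + 2 * c01 - 2 * r01 - 2 * l01
      · linear_combination 2 * c20 + 2 * c02 - 2 * r02 - 2 * l02
      · linear_combination 2 * c10 + 2 * c01 - 2 * r01 - 2 * l01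
      · linear_combination 2 * c11 - 2 * c00 - 2 * c22 + r00 + r22 - 2 * l11 - r11
      · linear_combination 2 * c21 + 2 * c12 - 2 * r12 - 2 * l12
      · linear_combination 2 * c20 + 2 * c02 - 2 * r02 - 2 * l02
      · linear_combination 2 * c21 + 2 * c12 - 2 * r12 - 2 * l12
      · linear_combination 2 * c22 - 2 * c00 - 2 * c11 + r00 + r11 - 2 * l22 - r22
    have hn : q 0 ^ 2 + q 1 ^ 2 + q 2 ^ 2 + q 3 ^ 2 = 4 * (1 + O.trace) := by
      simp only [q, Matrix.cons_val, Matrix.trace_fin_three]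
      linear_combination r00 + r11 + r22 + 2 * c00 + 2 * c11 + 2 * c22
    have hpos : 0 < 4 * (1 + O.trace) := by
      refine lt_of_le_of_ne ?_ (by simpa using fun h => hne h)
      rw [← hn]; positivity
    refine ⟨(Real.sqrt (4 * (1 + O.trace)))⁻¹ • q, ?_, ?_⟩
    · have := Real.sq_sqrt hpos.le
      simp only [Pi.smul_apply, smul_eq_mul, mul_pow, inv_pow, this, ← mul_add, hn]
      exact inv_mul_cancel₀ hpos.ne'
    · rw [rot_smul, hq, inv_pow, Real.sq_sqrt hpos.le, smul_smul, inv_mul_cancel₀ hpos.ne', one_smul]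
  have twist : ∀ (D : Matrix (Fin 3) (Fin 3) ℝ) (_ : D * D = 1) (_ : D.transpose = D) (_ : D.det = 1)
      (tw : (Fin 4 → ℝ) → Fin 4 → ℝ) (_ : ∀ p, rot (tw p) = rot p * D)
      (_ : ∀ p, tw p 0 ^ 2 + tw p 1 ^ 2 + tw p 2 ^ 2 + tw p 3 ^ 2
        = p 0 ^ 2 + p 1 ^ 2 + p 2 ^ 2 + p 3 ^ 2), 1 + (O * D).trace ≠ 0 →
      ∃ p : Fin 4 → ℝ, p 0 ^ 2 + p 1 ^ 2 + p 2 ^ 2 + p 3 ^ 2 = 1 ∧ rot p = O := by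
    intro D hD hDt hDd tw hrot hnorm hne
    obtain ⟨p, hp, hr⟩ := main (O * D) (by
      rw [Matrix.transpose_mul, hDt, Matrix.mul_assoc, ← Matrix.mul_assoc D, hD, Matrix.one_mul, hO])
      (by rw [Matrix.det_mul, hd, hDd, one_mul]) hne
    exact ⟨tw p, (hnorm p).trans hp, by rw [hrot, hr, Matrix.mul_assoc, hD, Matrix.mul_one]⟩
  by_cases h0 : 1 + O.trace = 0
  swap
  · exact main O hO hd h0
  by_cases h1 : 1 + (O * !![1, 0, 0; 0, -1, 0; 0, 0, -1]).trace = 0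
  swap
  · refine twist _ ?_ ?_ ?_ (fun p => ![-p 1, p 0, -p 3, p 2]) (fun p => ?_) (fun p => ?_) h1
    · ext i j; fin_cases i <;> fin_cases j <;> simp [Matrix.mul_apply, Fin.sum_univ_three]
    · ext i j; fin_cases i <;> fin_cases j <;> rfl
    · simp [Matrix.det_fin_three]
    · ext i j; fin_cases i <;> fin_cases j <;> simp [rot, Matrix.mul_apply, Fin.sum_univ_three] <;> ring
    · simp; ring
  by_cases h2 : 1 + (O * !![-1, 0, 0; 0, 1, 0; 0, 0, -1]).trace = 0
  swap
  · refine twist _ ?_ ?_ ?_ (fun p => ![-p 2, p 3, p 0, -p 1]) (fun p => ?_) (fun p => ?_) h2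
    · ext i j; fin_cases i <;> fin_cases j <;> simp [Matrix.mul_apply, Fin.sum_univ_three]
    · ext i j; fin_cases i <;> fin_cases j <;> rfl
    · simp [Matrix.det_fin_three]
    · ext i j; fin_cases i <;> fin_cases j <;> simp [rot, Matrix.mul_apply, Fin.sum_univ_three] <;> ring
    · simp; ring
  refine twist !![-1, 0, 0; 0, -1, 0; 0, 0, 1] ?_ ?_ ?_ (fun p => ![-p 3, -p 2, p 1, p 0]) (fun p => ?_) (fun p => ?_) ?_
  · ext i j; fin_cases i <;> fin_cases j <;> simp [Matrix.mul_apply, Fin.sum_univ_three]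
  · ext i j; fin_cases i <;> fin_cases j <;> rfl
  · simp [Matrix.det_fin_three]
  · ext i j; fin_cases i <;> fin_cases j <;> simp [rot, Matrix.mul_apply, Fin.sum_univ_three] <;> ring
  · simp; ring
  · simp [Matrix.trace_fin_three, Matrix.mul_apply, Fin.sum_univ_three] at h0 h1 h2 ⊢
    intro h3
    linarith

end RotationMatrices


section OrthonormalFrames

variable {V : Type*} [NormedAddCommGroup V] [InnerProductSpace ℝ V]

theorem leftFrame_eq_sum (p : Fin 4 → ℝ) (f : Fin 4 → V) (i : Fin 4) :
    leftFrame p f i = ∑ j, (!![p 0, p 1, p 2, p 3; -p 1, p 0, p 3, -p 2; -p 2, -p 3, p 0, p 1;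
      -p 3, p 2, -p 1, p 0] : Matrix (Fin 4) (Fin 4) ℝ) i j • f j := by
  fin_cases i <;> simp [leftFrame, Fin.sum_univ_four] <;> abel

theorem orthonormal_leftFrame {p : Fin 4 → ℝ} (hp : p 0 ^ 2 + p 1 ^ 2 + p 2 ^ 2 + p 3 ^ 2 = 1)
    {f : Fin 4 → V} (hf : Orthonormal ℝ f) : Orthonormal ℝ (leftFrame p f) := by
  rw [orthonormal_iff_ite]
  intro i j
  rw [leftFrame_eq_sum, leftFrame_eq_sum, hf.inner_sum, Fin.sum_univ_four]
  fin_cases i <;> fin_cases j <;>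
    simp only [Fin.zero_eta, Fin.mk_one, Fin.reduceFinMk, Matrix.of_apply, Matrix.cons_val',
      Matrix.cons_val, conj_trivial, Fin.reduceEq, if_true, if_false] <;>
    first | linear_combination hp | ring

theorem orthonormal_reflectFrame {f : Fin 4 → V} (hf : Orthonormal ℝ f) :
    Orthonormal ℝ (reflectFrame f) := by
  rw [orthonormal_iff_ite] at hf ⊢
  intro i j
  fin_cases i <;> fin_cases j <;>
    simp only [Fin.zero_eta, Fin.mk_one, Fin.reduceFinMk, reflectFrame, Matrix.cons_val,
      inner_neg_left, inner_neg_right, hf, Fin.reduceEq, if_true, if_false, neg_neg, neg_zero]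

/-- An orthonormal frame of a four-dimensional space as a basis. -/
def frameBasis [FiniteDimensional ℝ V] (hV : Module.finrank ℝ V = 4) {f : Fin 4 → V}
    (hf : Orthonormal ℝ f) : OrthonormalBasis (Fin 4) ℝ V :=
  OrthonormalBasis.mk hf
    (hf.linearIndependent.span_eq_top_of_card_eq_finrank' (by simp [hV])).ge

@[simp] theorem coe_frameBasis [FiniteDimensional ℝ V] (hV : Module.finrank ℝ V = 4)
    {f : Fin 4 → V} (hf : Orthonormal ℝ f) : ⇑(frameBasis hV hf) = f :=
  OrthonormalBasis.coe_mk hf _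

theorem orthonormal_e : Orthonormal ℝ e := by
  have he : e = ⇑(EuclideanSpace.basisFun (Fin 4) ℝ) := by funext i; simp [e]
  rw [he]
  exact (EuclideanSpace.basisFun (Fin 4) ℝ).orthonormal

theorem finrank_E4 : Module.finrank ℝ E4 = 4 := by simp

theorem sum_sq_sphere (x : Metric.sphere (0 : E4) 1) :
    (x : E4) 0 ^ 2 + (x : E4) 1 ^ 2 + (x : E4) 2 ^ 2 + (x : E4) 3 ^ 2 = 1 := by
  have h := sphere_inner_self x
  rw [PiLp.inner_apply] at h
  simp only [Fin.sum_univ_four, RCLike.inner_apply, conj_trivial] at h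
  linarith

theorem sum_coord_e (x : E4) : x = ∑ i, x i • e i := by
  have := (EuclideanSpace.basisFun (Fin 4) ℝ).sum_repr x
  conv_lhs => rw [← this]
  simp [e]

theorem leftFrame_e_zero (x : E4) : leftFrame x e 0 = x := by
  conv_rhs => rw [sum_coord_e x, Fin.sum_univ_four]
  simp [leftFrame]

/-- The left invariant frame on the three-sphere. -/
def sphereFrame (x : Metric.sphere (0 : E4) 1) : OrthonormalBasis (Fin 4) ℝ E4 :=
  frameBasis finrank_E4 (orthonormal_leftFrame (sum_sq_sphere x) orthonormal_e)

theorem coe_sphereFrame (x : Metric.sphere (0 : E4) 1) : ⇑(sphereFrame x) = leftFrame (x : E4) e :=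
  coe_frameBasis _ _

theorem sphereFrame_zero (x : Metric.sphere (0 : E4) 1) : (x : E4) = sphereFrame x 0 := by
  rw [coe_sphereFrame, leftFrame_e_zero]

end OrthonormalFrames

section Obstructions

open Matrix

theorem symm_eq {P : Matrix (Fin 3) (Fin 3) ℝ} (hP : Pᵀ = P) : ∃ a b c d e g : ℝ,
    P = !![a, b, c; b, d, e; c, e, g] := by
  have h := fun i j => congrFun (congrFun hP i) j
  simp only [Matrix.transpose_apply] at h
  refine ⟨P 0 0, P 0 1, P 0 2, P 1 1, P 1 2, P 2 2, ?_⟩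
  conv_lhs => rw [Matrix.eta_fin_three P, h 0 1, h 0 2, h 1 2]

theorem trace_first {P T D : Matrix (Fin 3) (Fin 3) ℝ} (hP : Pᵀ = P) (hD : Dᵀ = D) :
    (((1 / 2 : ℝ) • (P + T + Tᵀ + D)) * ((1 / 2 : ℝ) • (P - T + Tᵀ - D))).trace =
      (1 / 4) * ((P * P).trace - (D * D).trace + 2 * (P * T - T * D).trace) := by
  obtain ⟨a, b, c, d, e, g, rfl⟩ := symm_eq hP
  obtain ⟨a', b', c', d', e', g', rfl⟩ := symm_eq hD
  rw [Matrix.eta_fin_three T]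
  simp only [Matrix.trace_fin_three, Matrix.mul_apply, Fin.sum_univ_three, Matrix.add_apply,
    Matrix.sub_apply, Matrix.smul_apply, Matrix.transpose_apply, Matrix.of_apply, Matrix.cons_val',
    Matrix.cons_val, smul_eq_mul]
  ring

theorem trace_second {P T D : Matrix (Fin 3) (Fin 3) ℝ} (hP : Pᵀ = P) (hD : Dᵀ = D)
    (h : P * T = T * D) :
    (((1 / 2 : ℝ) • (P + T + Tᵀ + D)) * ((1 / 2 : ℝ) • (P + T + Tᵀ + D)) *
      ((1 / 2 : ℝ) • (P - T + Tᵀ - D))).trace =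
      (1 / 8) * ((P * P * P).trace - (D * D * D).trace + (P * P * D).trace - (P * D * D).trace
        + (Tᵀ * T * P).trace - (T * Tᵀ * D).trace) := by
  have h1 : (P * (P * T - T * D)).trace = 0 := by simp [h]
  have h2 : ((P * T - T * D) * D).trace = 0 := by simp [h]
  have h3 : ((P * T - T * D) * T).trace = 0 := by simp [h]
  have h4 : (Tᵀ * (P * T - T * D)).trace = 0 := by simp [h]
  clear h
  obtain ⟨a, b, c, d, e, g, rfl⟩ := symm_eq hP
  obtain ⟨a', b', c', d', e', g', rfl⟩ := symm_eq hD
  rw [Matrix.eta_fin_three T] at *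
  simp only [Matrix.trace_fin_three, Matrix.mul_apply, Fin.sum_univ_three, Matrix.add_apply,
    Matrix.sub_apply, Matrix.smul_apply, Matrix.transpose_apply, Matrix.of_apply, Matrix.cons_val',
    Matrix.cons_val, smul_eq_mul] at *
  linear_combination (1 / 2) * h1 + (1 / 2) * h2 + (1 / 4) * h3 + (1 / 8) * h4

end Obstructions


open Matrix

section BlockConditions

theorem rot_det {p : Fin 4 → ℝ} (hp : p 0 ^ 2 + p 1 ^ 2 + p 2 ^ 2 + p 3 ^ 2 = 1) :
    (rot p).det = 1 := by
  have : (rot p).det = (p 0 ^ 2 + p 1 ^ 2 + p 2 ^ 2 + p 3 ^ 2) ^ 3 := by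
    rw [Matrix.det_fin_three]
    simp only [rot, Matrix.of_apply, Matrix.cons_val', Matrix.cons_val]
    ring
  rw [this, hp, one_pow]

theorem trace_conj_diagonal (O : Matrix (Fin 3) (Fin 3) ℝ) (x q : Fin 3 → ℝ) :
    (O * diagonal x * Oᵀ * diagonal q).trace = ∑ i, ∑ j, O i j ^ 2 * x j * q i := by
  simp only [Matrix.trace, Matrix.diag, Matrix.mul_diagonal]
  refine Finset.sum_congr rfl fun i _ => ?_
  rw [Matrix.mul_apply, Finset.sum_mul]
  refine Finset.sum_congr rfl fun j _ => ?_
  rw [Matrix.mul_diagonal, Matrix.transpose_apply]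
  ring

theorem isIntegrable_iff_blocks {C : Tensor4 E4} {K : EndoField E4} (hC : IsCurv C)
    (h : IsField C K) {P T D : Matrix (Fin 3) (Fin 3) ℝ} (hP : blockP C e = P)
    (hT : blockT C e = T) (hD : blockD C e = D) :
    IsIntegrable K ↔ ∀ O : Matrix (Fin 3) (Fin 3) ℝ, O * Oᵀ = 1 → O.det = 1 →
      (((1 / 2 : ℝ) • (O * P * Oᵀ + O * T + (O * T)ᵀ + D)) *
        ((1 / 2 : ℝ) • (O * P * Oᵀ - O * T + (O * T)ᵀ - D))).trace = 0 ∧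
      (((1 / 2 : ℝ) • (O * P * Oᵀ + O * T + (O * T)ᵀ + D)) *
        ((1 / 2 : ℝ) • (O * P * Oᵀ + O * T + (O * T)ᵀ + D)) *
        ((1 / 2 : ℝ) • (O * P * Oᵀ - O * T + (O * T)ᵀ - D))).trace = 0 := by
  subst hP hT hD
  have key : ∀ p : Fin 4 → ℝ, p 0 ^ 2 + p 1 ^ 2 + p 2 ^ 2 + p 3 ^ 2 = 1 →
      kMat C (leftFrame p e) = (1 / 2 : ℝ) • (rot p * blockP C e * (rot p)ᵀ + rot p * blockT C e +
        (rot p * blockT C e)ᵀ + blockD C e) ∧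
      bMat C (leftFrame p e) = (1 / 2 : ℝ) • (rot p * blockP C e * (rot p)ᵀ - rot p * blockT C e +
        (rot p * blockT C e)ᵀ - blockD C e) := fun p hp => by
    rw [kMat_eq_blocks hC, bMat_eq_blocks hC, blockP_leftFrame hC, blockT_leftFrame hC hp,
      blockD_leftFrame hC hp]
    exact ⟨rfl, rfl⟩
  rw [isIntegrable_iff sphereFrame sphereFrame_zero hC h]
  simp only [firstObstruction, secondObstruction, coe_sphereFrame]
  constructor
  · intro H O hO hd
    obtain ⟨p, hp, rfl⟩ := exists_rot_eq hO hd
    have hn : ‖(WithLp.toLp 2 p : E4)‖ = 1 := by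
      rw [EuclideanSpace.norm_eq, Fin.sum_univ_four]
      simp [hp]
    have H' := H ⟨WithLp.toLp 2 p, by simp [hn]⟩
    rw [(key p hp).1, (key p hp).2] at H'
    exact H'
  · intro H x
    have hx := sum_sq_sphere x
    obtain ⟨h1, h2⟩ := key _ hx
    rw [h1, h2]
    exact H _ (rot_mul_transpose hx) (rot_det hx)

/-- The twelve rotations of the tetrahedron, in three cosets of the diagonal ones. -/
def tetraRot (k : Fin 3) (a b c : ℝ) : Matrix (Fin 3) (Fin 3) ℝ :=
  ![!![a, 0, 0; 0, b, 0; 0, 0, c], !![0, a, 0; 0, 0, b; c, 0, 0], !![0, 0, a; b, 0, 0; 0, c, 0]] k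

theorem tetraRot_mul_transpose (k : Fin 3) {a b c : ℝ} (ha : a * a = 1) (hb : b * b = 1)
    (hc : c * c = 1) : tetraRot k a b c * (tetraRot k a b c)ᵀ = 1 := by
  ext i j
  fin_cases k <;> fin_cases i <;> fin_cases j <;>
    simp [tetraRot, Matrix.mul_apply, Fin.sum_univ_three, ha, hb, hc]

theorem tetraRot_det (k : Fin 3) {a b c : ℝ} (h : a * b * c = 1) : (tetraRot k a b c).det = 1 := by
  fin_cases k <;> simp [tetraRot, Matrix.det_fin_three] <;> linarith

/-- A function on `SO(3)` evaluated at the rotations of the tetrahedron. -/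
theorem forall_tetraRot {p : Matrix (Fin 3) (Fin 3) ℝ → Prop}
    (H : ∀ O : Matrix (Fin 3) (Fin 3) ℝ, O * Oᵀ = 1 → O.det = 1 → p O) (k : Fin 3) :
    p (tetraRot k 1 1 1) ∧ p (tetraRot k 1 (-1) (-1)) ∧ p (tetraRot k (-1) 1 (-1)) ∧
      p (tetraRot k (-1) (-1) 1) := by
  refine ⟨?_, ?_, ?_, ?_⟩ <;>
    exact H _ (tetraRot_mul_transpose k (by norm_num) (by norm_num) (by norm_num))
      (tetraRot_det k (by norm_num))

theorem eq_zero_of_forall_trace {c : ℝ} {X : Matrix (Fin 3) (Fin 3) ℝ}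
    (H : ∀ O : Matrix (Fin 3) (Fin 3) ℝ, O * Oᵀ = 1 → O.det = 1 → c + 2 * (O * X).trace = 0) :
    c = 0 ∧ X = 0 := by
  have h0 := forall_tetraRot H 0
  have h1 := forall_tetraRot H 1
  have h2 := forall_tetraRot H 2
  simp only [tetraRot, Matrix.trace_fin_three, Matrix.mul_apply, Fin.sum_univ_three,
    Matrix.of_apply, Matrix.cons_val', Matrix.cons_val, zero_mul, one_mul, neg_mul, zero_add,
    add_zero] at h0 h1 h2
  obtain ⟨a1, a2, a3, a4⟩ := h0
  obtain ⟨b1, b2, b3, b4⟩ := h1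
  obtain ⟨c1, c2, c3, c4⟩ := h2
  refine ⟨by linarith, ?_⟩
  ext i j
  fin_cases i <;> fin_cases j <;>
    simp only [Fin.zero_eta, Fin.mk_one, Fin.reduceFinMk, Matrix.zero_apply] <;> linarith

theorem trace_eq_of_forall {c : ℝ} {X Y P D : Matrix (Fin 3) (Fin 3) ℝ}
    (hP : P.trace = D.trace) (hX : X.trace = Y.trace)
    (H : ∀ O : Matrix (Fin 3) (Fin 3) ℝ, O * Oᵀ = 1 → O.det = 1 →
      c + (O * X * Oᵀ * D).trace - (O * P * Oᵀ * Y).trace = 0) : c = 0 := by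
  have h0 := forall_tetraRot H 0
  have h1 := forall_tetraRot H 1
  have h2 := forall_tetraRot H 2
  clear H
  simp only [tetraRot, Matrix.trace_fin_three, Matrix.mul_apply, Fin.sum_univ_three,
    Matrix.of_apply, Matrix.cons_val', Matrix.cons_val, zero_mul, one_mul, neg_mul, zero_add,
    add_zero, Matrix.transpose_apply, mul_zero, mul_one, mul_neg, neg_neg] at h0 h1 h2 hP hX
  obtain ⟨a1, a2, a3, a4⟩ := h0
  obtain ⟨b1, b2, b3, b4⟩ := h1
  obtain ⟨c1, c2, c3, c4⟩ := h2
  have hS : 12 * c + 4 * (X 0 0 + X 1 1 + X 2 2) * (D 0 0 + D 1 1 + D 2 2) -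
    4 * (P 0 0 + P 1 1 + P 2 2) * (Y 0 0 + Y 1 1 + Y 2 2) = 0 := by linarith
  rw [hP, hX] at hS
  linarith

theorem conj_simp {O : Matrix (Fin 3) (Fin 3) ℝ} (hO : Oᵀ * O = 1) (X Y : Matrix (Fin 3) (Fin 3) ℝ) :
    O * X * Oᵀ * (O * Y) = O * (X * Y) := by
  rw [Matrix.mul_assoc _ Oᵀ, ← Matrix.mul_assoc Oᵀ, hO, Matrix.one_mul, Matrix.mul_assoc]

theorem trace_conj {O : Matrix (Fin 3) (Fin 3) ℝ} (hO : Oᵀ * O = 1) (X : Matrix (Fin 3) (Fin 3) ℝ) :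
    (O * X * Oᵀ).trace = X.trace := by
  rw [Matrix.trace_mul_comm, ← Matrix.mul_assoc, hO, Matrix.one_mul]

theorem trace_first_rot {O P T D : Matrix (Fin 3) (Fin 3) ℝ} (hO : O * Oᵀ = 1) (hP : Pᵀ = P)
    (hD : Dᵀ = D) :
    (((1 / 2 : ℝ) • (O * P * Oᵀ + O * T + (O * T)ᵀ + D)) *
        ((1 / 2 : ℝ) • (O * P * Oᵀ - O * T + (O * T)ᵀ - D))).trace =
    (1 / 4) * ((P * P).trace - (D * D).trace + 2 * (O * (P * T - T * D)).trace) := by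
  have hO' := mul_eq_one_comm.mp hO
  rw [trace_first (by simp [hP, Matrix.mul_assoc]) hD, ← Matrix.mul_assoc (O * P * Oᵀ) (O * P) Oᵀ,
    conj_simp hO', conj_simp hO', trace_conj hO', Matrix.mul_sub, Matrix.mul_assoc]

theorem trace_second_rot {O P T D : Matrix (Fin 3) (Fin 3) ℝ} (hO : O * Oᵀ = 1) (hP : Pᵀ = P)
    (hD : Dᵀ = D) (h : P * T = T * D) :
    (((1 / 2 : ℝ) • (O * P * Oᵀ + O * T + (O * T)ᵀ + D)) *
        ((1 / 2 : ℝ) • (O * P * Oᵀ + O * T + (O * T)ᵀ + D)) *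
        ((1 / 2 : ℝ) • (O * P * Oᵀ - O * T + (O * T)ᵀ - D))).trace =
    (1 / 8) * ((P * P * P).trace - (D * D * D).trace + (O * (P * P - T * Tᵀ) * Oᵀ * D).trace
      - (O * P * Oᵀ * (D * D - Tᵀ * T)).trace) := by
  have hO' := mul_eq_one_comm.mp hO
  have h1 : O * P * Oᵀ * (O * P * Oᵀ) = O * (P * P) * Oᵀ := by
    rw [← Matrix.mul_assoc (O * P * Oᵀ) (O * P) Oᵀ, conj_simp hO']
  have h2 : O * (P * P) * Oᵀ * (O * P * Oᵀ) = O * (P * P * P) * Oᵀ := by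
    rw [← Matrix.mul_assoc (O * (P * P) * Oᵀ) (O * P) Oᵀ, conj_simp hO']
  have h3 : (O * T)ᵀ * (O * T) = Tᵀ * T := by
    rw [Matrix.transpose_mul, Matrix.mul_assoc, ← Matrix.mul_assoc Oᵀ, hO', Matrix.one_mul]
  have h4 : O * T * (O * T)ᵀ = O * (T * Tᵀ) * Oᵀ := by
    simp only [Matrix.transpose_mul, Matrix.mul_assoc]
  rw [trace_second (by simp [hP, Matrix.mul_assoc]) hD (by
    rw [conj_simp hO', h, Matrix.mul_assoc]), h1, h2, h3, h4, trace_conj hO',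
    Matrix.trace_mul_comm (Tᵀ * T)]
  simp only [Matrix.mul_sub, Matrix.sub_mul, Matrix.trace_sub, Matrix.mul_assoc]
  ring

variable {C : Tensor4 E4} {K : EndoField E4}

theorem IsIntegrable.block_conditions (hK : IsIntegrable K) (hC : IsCurv C) (h : IsField C K) :
    blockP C e * blockT C e = blockT C e * blockD C e ∧
    (blockP C e * blockP C e).trace = (blockD C e * blockD C e).trace ∧
    (blockP C e * blockP C e * blockP C e).trace =
      (blockD C e * blockD C e * blockD C e).trace := by
  have H := (isIntegrable_iff_blocks hC h rfl rfl rfl).mp hK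
  have hP := blockP_symm hC e
  have hD := blockD_symm hC e
  have h1 := eq_zero_of_forall_trace (c := (blockP C e * blockP C e).trace -
      (blockD C e * blockD C e).trace) (X := blockP C e * blockT C e - blockT C e * blockD C e)
      fun O hO hd => by
    have := (H O hO hd).1
    rw [trace_first_rot hO hP hD] at this
    linarith
  have h2 : blockP C e * blockT C e = blockT C e * blockD C e := sub_eq_zero.mp h1.2
  refine ⟨h2, by linarith [h1.1], ?_⟩
  have h3 := trace_eq_of_forall (c := (blockP C e * blockP C e * blockP C e).trace -
      (blockD C e * blockD C e * blockD C e).trace)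
      (X := blockP C e * blockP C e - blockT C e * (blockT C e)ᵀ)
      (Y := blockD C e * blockD C e - (blockT C e)ᵀ * blockT C e) (block_trace_eq hC e) (by
        rw [Matrix.trace_sub, Matrix.trace_sub, Matrix.trace_mul_comm (blockT C e)]
        linarith [h1.1]) fun O hO hd => by
    have := (H O hO hd).2
    rw [trace_second_rot hO hP hD h2] at this
    linarith
  linarith

theorem isIntegrable_of_scalar_blocks (hC : IsCurv C) (h : IsField C K) {σ : ℝ}
    (hP : blockP C e = σ • (1 : Matrix (Fin 3) (Fin 3) ℝ))
    (hD : blockD C e = σ • (1 : Matrix (Fin 3) (Fin 3) ℝ)) : IsIntegrable K := by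
  rw [isIntegrable_iff_blocks hC h hP rfl hD]
  intro O hO hd
  have hO' := mul_eq_one_comm.mp hO
  rw [trace_first_rot hO (by simp) (by simp), trace_second_rot hO (by simp) (by simp) (by simp)]
  constructor
  · simp
  · simp only [Matrix.mul_smul, Matrix.smul_mul, Matrix.mul_one, Matrix.one_mul, hO,
      Matrix.trace_smul, trace_conj hO', Matrix.trace_sub, Matrix.trace_mul_comm (blockT C e)]
    simp

theorem isIntegrable_iff_of_diagonal_blocks (hC : IsCurv C) (h : IsField C K) {p t : Fin 3 → ℝ}
    (hP : blockP C e = diagonal p) (hT : blockT C e = diagonal t) (hD : blockD C e = diagonal p) :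
    IsIntegrable K ↔ (p 1 - p 2) * (p 2 - p 0) * (p 0 - p 1) + (p 1 - p 2) * t 0 ^ 2
      + (p 2 - p 0) * t 1 ^ 2 + (p 0 - p 1) * t 2 ^ 2 = 0 := by
  have hc : (diagonal p : Matrix (Fin 3) (Fin 3) ℝ) * diagonal t = diagonal t * diagonal p := by
    simp [Matrix.diagonal_mul_diagonal, mul_comm]
  have h2 : ∀ O : Matrix (Fin 3) (Fin 3) ℝ, O * Oᵀ = 1 →
      (O * (diagonal p * diagonal p - diagonal t * (diagonal t)ᵀ) * Oᵀ * diagonal p).trace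
      - (O * diagonal p * Oᵀ * (diagonal p * diagonal p - (diagonal t)ᵀ * diagonal t)).trace =
      (O 0 1 ^ 2 - O 1 0 ^ 2) * ((p 1 - p 2) * (p 2 - p 0) * (p 0 - p 1) + (p 1 - p 2) * t 0 ^ 2
      + (p 2 - p 0) * t 1 ^ 2 + (p 0 - p 1) * t 2 ^ 2) := by
    intro O hO
    have hO' := mul_eq_one_comm.mp hO
    have r := fun i => congrFun (congrFun hO i) i
    have c := fun i => congrFun (congrFun hO' i) i
    simp only [Matrix.mul_apply, Matrix.transpose_apply, Fin.sum_univ_three, Matrix.one_apply_eq]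
      at r c
    have r0 := r 0
    have r1 := r 1
    have r2 := r 2
    have c0 := c 0
    have c1 := c 1
    have c2 := c 2
    have e1 : O 1 2 ^ 2 = O 2 1 ^ 2 + (O 0 1 ^ 2 - O 1 0 ^ 2) := by linarith
    have e2 : O 2 0 ^ 2 = O 0 2 ^ 2 + (O 0 1 ^ 2 - O 1 0 ^ 2) := by linarith
    simp only [Matrix.diagonal_transpose, Matrix.diagonal_mul_diagonal, Matrix.diagonal_sub,
      trace_conj_diagonal, Fin.sum_univ_three]
    linear_combination ((p 2 * p 2 - t 2 * t 2) * p 1 - p 2 * (p 1 * p 1 - t 1 * t 1)) * e1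
      + ((p 0 * p 0 - t 0 * t 0) * p 2 - p 0 * (p 2 * p 2 - t 2 * t 2)) * e2
  rw [isIntegrable_iff_blocks hC h hP hT hD]
  constructor
  · intro H
    have H1 := (H (tetraRot 1 1 1 1) (tetraRot_mul_transpose 1 (by norm_num) (by norm_num)
      (by norm_num)) (tetraRot_det 1 (by norm_num))).2
    rw [trace_second_rot (tetraRot_mul_transpose 1 (by norm_num) (by norm_num)
      (by norm_num)) (by simp) (by simp) hc, sub_self, zero_add, h2 _ (tetraRot_mul_transpose 1
      (by norm_num) (by norm_num) (by norm_num))] at H1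
    simp only [tetraRot, Matrix.of_apply, Matrix.cons_val', Matrix.cons_val] at H1
    linarith
  · intro H O hO hd
    rw [trace_first_rot hO (by simp) (by simp), trace_second_rot hO (by simp) (by simp) hc]
    constructor
    · simp [hc]
    · rw [sub_self, zero_add, h2 O hO, H]
      simp

end BlockConditions


open Matrix

section SimultaneousNormalForm

theorem exists_commuting_diagonalisation {n : ℕ} {P S : Matrix (Fin n) (Fin n) ℝ} (hP : Pᵀ = P)
    (hS : Sᵀ = S) (hc : P * S = S * P) : ∃ (U : Matrix (Fin n) (Fin n) ℝ) (p t : Fin n → ℝ),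
      U * Uᵀ = 1 ∧ U * P * Uᵀ = diagonal p ∧ U * S * Uᵀ = diagonal t := by
  classical
  have hA : (toEuclideanLin P).IsSymmetric := Matrix.isSymmetric_toEuclideanLin_iff.mpr
    (by rw [Matrix.IsHermitian, Matrix.conjTranspose_eq_transpose_of_trivial, hP])
  have hB : (toEuclideanLin S).IsSymmetric := Matrix.isSymmetric_toEuclideanLin_iff.mpr
    (by rw [Matrix.IsHermitian, Matrix.conjTranspose_eq_transpose_of_trivial, hS])
  have hAB : Commute (toEuclideanLin P) (toEuclideanLin S) := by
    refine LinearMap.ext fun v => ?_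
    simp only [Module.End.mul_apply, Matrix.toLpLin_apply, Matrix.mulVec_mulVec, hc]
  have hint := LinearMap.IsSymmetric.directSum_isInternal_of_commute hA hB hAB
  have hort := LinearMap.IsSymmetric.orthogonalFamily_eigenspace_inf_eigenspace hA hB
  have hint' := (DirectSum.isInternal_ne_bot_iff).mpr hint
  have hfin := WellFoundedGT.finite_ne_bot_of_iSupIndep hint.submodule_iSupIndep
  have : Fintype {i : ℝ × ℝ // (Module.End.eigenspace (toEuclideanLin P) i.2 ⊓
    Module.End.eigenspace (toEuclideanLin S) i.1 : Submodule ℝ (EuclideanSpace ℝ (Fin n))) ≠ ⊥} :=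
    hfin.fintype
  have hort' := hort.comp (γ := {i : ℝ × ℝ // (Module.End.eigenspace (toEuclideanLin P) i.2 ⊓
    Module.End.eigenspace (toEuclideanLin S) i.1 : Submodule ℝ (EuclideanSpace ℝ (Fin n))) ≠ ⊥})
    Subtype.val_injective
  have hn : Module.finrank ℝ (EuclideanSpace ℝ (Fin n)) = n := by simp
  set b := hint'.subordinateOrthonormalBasis hn hort' with hb
  have hmem := fun a => hint'.subordinateOrthonormalBasis_subordinate hn a hort'
  have hU : (Matrix.of fun a k => b a k) * (Matrix.of fun a k => b a k)ᵀ =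
      (1 : Matrix (Fin n) (Fin n) ℝ) := by
    ext j k
    have := orthonormal_iff_ite.mp b.orthonormal j k
    rw [PiLp.inner_apply] at this
    rw [Matrix.mul_apply, Matrix.one_apply, ← this]
    exact Finset.sum_congr rfl fun l _ => by simp [mul_comm]
  have key : ∀ (M : Matrix (Fin n) (Fin n) ℝ) (q : Fin n → ℝ),
      (∀ a, toEuclideanLin M (b a) = q a • b a) →
      (Matrix.of fun a k => b a k) * M * (Matrix.of fun a k => b a k)ᵀ = diagonal q := by
    intro M q hq
    have h1 : M * (Matrix.of fun a k => b a k)ᵀ =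
        (Matrix.of fun a k => b a k)ᵀ * diagonal q := by
      ext k a
      have := congrArg (fun v : EuclideanSpace ℝ (Fin n) => v k) (hq a)
      simp only [Matrix.toLpLin_apply, Matrix.mulVec, dotProduct, PiLp.smul_apply,
        smul_eq_mul] at this
      rw [Matrix.mul_apply, Matrix.mul_diagonal]
      simp only [Matrix.transpose_apply, Matrix.of_apply]
      rw [this, mul_comm]
    rw [Matrix.mul_assoc, h1, ← Matrix.mul_assoc, hU, Matrix.one_mul]
  refine ⟨Matrix.of fun a k => b a k, 
    fun a => (hint'.subordinateOrthonormalBasisIndex hn a hort').1.2,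
    fun a => (hint'.subordinateOrthonormalBasisIndex hn a hort').1.1, hU, key _ _ fun a => ?_,
    key _ _ fun a => ?_⟩
  · exact Module.End.mem_eigenspace_iff.mp (hmem a).1
  · exact Module.End.mem_eigenspace_iff.mp (hmem a).2

theorem charpoly_eq_of_traces {P D : Matrix (Fin 3) (Fin 3) ℝ} (h1 : P.trace = D.trace)
    (h2 : (P * P).trace = (D * D).trace) (h3 : (P * P * P).trace = (D * D * D).trace) :
    P.charpoly = D.charpoly := by
  have key : ∀ (M : Matrix (Fin 3) (Fin 3) ℝ) (x : ℝ), M.charpoly.eval x =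
      x ^ 3 - x ^ 2 * M.trace + x * ((M.trace ^ 2 - (M * M).trace) / 2)
      - (M.trace ^ 3 - 3 * M.trace * (M * M).trace + 2 * (M * M * M).trace) / 6 := by
    intro M x
    rw [Matrix.eval_charpoly, Matrix.det_fin_three]
    simp only [Matrix.trace_fin_three, Matrix.mul_apply, Fin.sum_univ_three, Matrix.sub_apply,
      Matrix.scalar_apply, Matrix.diagonal_apply, Fin.reduceEq, if_true, if_false]
    ring
  refine Polynomial.funext fun x => ?_
  rw [key, key, h1, h2, h3]

theorem exists_orthogonal_intertwiner {P D : Matrix (Fin 3) (Fin 3) ℝ} (hP : Pᵀ = P) (hD : Dᵀ = D)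
    (h : P.charpoly = D.charpoly) :
    ∃ W : Matrix (Fin 3) (Fin 3) ℝ, W * Wᵀ = 1 ∧ D * W = W * P := by
  have hP' : P.IsHermitian := by
    rw [Matrix.IsHermitian, Matrix.conjTranspose_eq_transpose_of_trivial, hP]
  have hD' : D.IsHermitian := by
    rw [Matrix.IsHermitian, Matrix.conjTranspose_eq_transpose_of_trivial, hD]
  have he := (Matrix.IsHermitian.eigenvalues_eq_eigenvalues_iff hP' hD').mpr h
  have sP := hP'.spectral_theorem
  have sD := hD'.spectral_theorem
  rw [Unitary.conjStarAlgAut_apply] at sP sD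
  set U : Matrix (Fin 3) (Fin 3) ℝ := (hP'.eigenvectorUnitary : Matrix (Fin 3) (Fin 3) ℝ)
  set V : Matrix (Fin 3) (Fin 3) ℝ := (hD'.eigenvectorUnitary : Matrix (Fin 3) (Fin 3) ℝ)
  have hU1 : star U * U = 1 := Unitary.coe_star_mul_self _
  have hV1 : star V * V = 1 := Unitary.coe_star_mul_self _
  have hV2 : V * star V = 1 := Unitary.coe_mul_star_self _
  have hs : ∀ X : Matrix (Fin 3) (Fin 3) ℝ, star X = Xᵀ := fun X => by
    rw [Matrix.star_eq_conjTranspose, Matrix.conjTranspose_eq_transpose_of_trivial]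
  rw [hs] at hU1 hV1 hV2 sP sD
  refine ⟨V * Uᵀ, ?_, ?_⟩
  · rw [Matrix.transpose_mul, Matrix.transpose_transpose, Matrix.mul_assoc, ← Matrix.mul_assoc Uᵀ,
      hU1, Matrix.one_mul, hV2]
  · conv_lhs => rw [sD]
    conv_rhs => rw [sP]
    rw [he]
    simp only [Matrix.mul_assoc]
    rw [← Matrix.mul_assoc Vᵀ V, hV1, Matrix.one_mul, ← Matrix.mul_assoc Uᵀ U, hU1, Matrix.one_mul]

/-- The rotation with axis and angle given by a skew matrix and a parameter. -/
theorem exists_rotation_of_skew {X : Matrix (Fin 3) (Fin 3) ℝ} (hX : Xᵀ = -X) (s : ℝ) :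
    ∃ r : ℝ, 0 < r ∧ (1 + (r * s) • X + (r * s ^ 2) • (X * X)) *
      (1 + (r * s) • X + (r * s ^ 2) • (X * X))ᵀ = 1 := by
  have h := fun i j => congrFun (congrFun hX i) j
  simp only [Matrix.transpose_apply, Matrix.neg_apply] at h
  have h00 := h 0 0
  have h11 := h 1 1
  have h22 := h 2 2
  set n := X 0 1 ^ 2 + X 0 2 ^ 2 + X 1 2 ^ 2 with hn
  have hX3 : X * X * X = -n • X := by
    have e00 : X 0 0 = 0 := by linarith
    have e11 : X 1 1 = 0 := by linarith
    have e22 : X 2 2 = 0 := by linarith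
    ext i j
    fin_cases i <;> fin_cases j <;>
      simp only [Fin.zero_eta, Fin.mk_one, Fin.reduceFinMk, Matrix.mul_apply, Fin.sum_univ_three,
        Matrix.smul_apply, smul_eq_mul, e00, e11, e22, hn, h 0 1, h 0 2, h 1 2] <;> ring
  have hpos : 0 < 1 + s ^ 2 * n := by positivity
  refine ⟨2 / (1 + s ^ 2 * n), by positivity, ?_⟩
  set r := 2 / (1 + s ^ 2 * n) with hr
  have hr' : r * (1 + s ^ 2 * n) = 2 := by rw [hr]; field_simp
  simp only [Matrix.transpose_add, Matrix.transpose_smul, Matrix.transpose_mul, hX,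
    Matrix.transpose_one, neg_mul_neg]
  simp only [Matrix.add_mul, Matrix.mul_add, Matrix.one_mul, Matrix.mul_one, Matrix.smul_mul,
    Matrix.mul_smul, smul_smul, ← Matrix.mul_assoc, Matrix.mul_neg, hX3]
  have : (2 * (r * s ^ 2) - (r * s) ^ 2 - n * (r * s ^ 2) ^ 2) = 0 := by
    linear_combination (-r * s ^ 2) * hr'
  rw [← sub_eq_zero]
  calc _ = (2 * (r * s ^ 2) - (r * s) ^ 2 - n * (r * s ^ 2) ^ 2) • (X * X) := by module
    _ = 0 := by rw [this, zero_smul]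

theorem eq_zero_of_forall_quadratic_le {τ κ : ℝ} (h : ∀ s : ℝ, s * τ + s ^ 2 * κ ≤ 0) : τ = 0 := by
  by_contra hne
  have hpos : 0 < τ ^ 2 := by positivity
  have hk : 0 < |κ| + 1 := by positivity
  have h1 := h (τ / (|κ| + 1))
  have h2 : τ / (|κ| + 1) * τ + (τ / (|κ| + 1)) ^ 2 * κ =
      τ ^ 2 / (|κ| + 1) ^ 2 * (|κ| + 1 + κ) := by field_simp
  rw [h2] at h1
  have : 0 < |κ| + 1 + κ := by linarith [neg_abs_le κ]
  have : 0 < τ ^ 2 / (|κ| + 1) ^ 2 * (|κ| + 1 + κ) := by positivity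
  linarith

theorem isCompact_intertwiners (P D : Matrix (Fin 3) (Fin 3) ℝ) :
    IsCompact {W : Matrix (Fin 3) (Fin 3) ℝ | W * Wᵀ = 1 ∧ D * W = W * P} := by
  have hK : IsCompact (Set.univ.pi fun _ : Fin 3 => Set.univ.pi fun _ : Fin 3 =>
      Set.Icc (-1 : ℝ) 1) :=
    isCompact_univ_pi fun _ => isCompact_univ_pi fun _ => isCompact_Icc
  refine hK.of_isClosed_subset ?_ ?_
  · exact (isClosed_eq (by fun_prop) continuous_const).inter (isClosed_eq (by fun_prop) (by fun_prop))
  · intro (W : Matrix (Fin 3) (Fin 3) ℝ) ⟨hW, _⟩ i _ j _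
    have := congrFun (congrFun hW i) i
    rw [Matrix.mul_apply, Matrix.one_apply_eq] at this
    have h1 : W i j * W i j ≤ 1 := by
      rw [← this]
      exact Finset.single_le_sum (f := fun j => W i j * Wᵀ j i)
        (fun k _ => mul_self_nonneg (W i k)) (Finset.mem_univ j)
    exact abs_le.mp (abs_le_one_iff_mul_self_le_one.mpr h1)

theorem exists_symmetric_mul {P T D : Matrix (Fin 3) (Fin 3) ℝ} (hP : Pᵀ = P) (hD : Dᵀ = D)
    (h : P * T = T * D) (hc : P.charpoly = D.charpoly) :
    ∃ W : Matrix (Fin 3) (Fin 3) ℝ, W * Wᵀ = 1 ∧ D * W = W * P ∧ (T * W)ᵀ = T * W := by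
  obtain ⟨W, ⟨hW, hDW⟩, hmax⟩ := (isCompact_intertwiners P D).exists_isMaxOn
    (exists_orthogonal_intertwiner hP hD hc) (f := fun W => (T * W).trace)
    (Continuous.continuousOn (by fun_prop))
  refine ⟨W, hW, hDW, ?_⟩
  set S := T * W with hS
  have hPS : P * S = S * P := by
    rw [hS, ← Matrix.mul_assoc, h, Matrix.mul_assoc, hDW, Matrix.mul_assoc]
  have hPS' : P * Sᵀ = Sᵀ * P := by
    have := congrArg Matrix.transpose hPS
    rw [Matrix.transpose_mul P S, Matrix.transpose_mul S P, hP] at this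
    exact this.symm
  have hX : (S - Sᵀ)ᵀ = -(S - Sᵀ) := by simp
  have hPX : P * (S - Sᵀ) = (S - Sᵀ) * P := by rw [Matrix.mul_sub, Matrix.sub_mul, hPS, hPS']
  have htr : (S * (S - Sᵀ)).trace = 0 := by
    refine eq_zero_of_forall_quadratic_le (κ := (S * ((S - Sᵀ) * (S - Sᵀ))).trace) fun s => ?_
    obtain ⟨r, hr, hR⟩ := exists_rotation_of_skew hX s
    set R := 1 + (r * s) • (S - Sᵀ) + (r * s ^ 2) • ((S - Sᵀ) * (S - Sᵀ)) with hRdef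
    have hPR : P * R = R * P := by
      simp only [hRdef, Matrix.mul_add, Matrix.add_mul, Matrix.mul_one, Matrix.one_mul,
        Matrix.mul_smul, Matrix.smul_mul, hPX]
      rw [← Matrix.mul_assoc, hPX, Matrix.mul_assoc, hPX, Matrix.mul_assoc]
    have hmem : W * R ∈ {W : Matrix (Fin 3) (Fin 3) ℝ | W * Wᵀ = 1 ∧ D * W = W * P} := by
      refine ⟨?_, ?_⟩
      · rw [Matrix.transpose_mul, Matrix.mul_assoc, ← Matrix.mul_assoc R, hR, Matrix.one_mul, hW]
      · rw [← Matrix.mul_assoc, hDW, Matrix.mul_assoc, hPR, Matrix.mul_assoc]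
    have h1 : (T * (W * R)).trace ≤ S.trace := hmax hmem
    rw [← Matrix.mul_assoc, ← hS, hRdef, Matrix.mul_add, Matrix.mul_add, Matrix.trace_add,
      Matrix.trace_add, Matrix.mul_one, Matrix.mul_smul, Matrix.mul_smul, Matrix.trace_smul,
      Matrix.trace_smul, smul_eq_mul, smul_eq_mul] at h1
    have h2 : r * (s * (S * (S - Sᵀ)).trace + s ^ 2 * (S * ((S - Sᵀ) * (S - Sᵀ))).trace) ≤ 0 := by
      linarith
    exact nonpos_of_mul_nonpos_right h2 hr
  have hz : ((S - Sᵀ) * (S - Sᵀ)ᵀ).trace = 0 := by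
    have h1 : (Sᵀ * (S - Sᵀ)).trace = -(S * (S - Sᵀ)).trace := by
      rw [← Matrix.trace_transpose, Matrix.transpose_mul, hX, Matrix.transpose_transpose,
        Matrix.neg_mul, Matrix.trace_neg, Matrix.trace_mul_comm]
    rw [hX, Matrix.mul_neg, Matrix.trace_neg, Matrix.sub_mul, Matrix.trace_sub, h1, htr]
    simp
  have : S - Sᵀ = 0 := by
    rw [← Matrix.trace_mul_conjTranspose_self_eq_zero_iff]
    rwa [Matrix.conjTranspose_eq_transpose_of_trivial]
  exact (sub_eq_zero.mp this).symm

theorem exists_special_orthogonal_sign {U : Matrix (Fin 3) (Fin 3) ℝ} (hU : U * Uᵀ = 1) :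
    ∃ ε : ℝ, ε * ε = 1 ∧ (ε • U).det = 1 := by
  have : U.det * U.det = 1 := by
    have := congrArg Matrix.det hU
    rwa [Matrix.det_mul, Matrix.det_transpose, Matrix.det_one] at this
  refine ⟨U.det, this, ?_⟩
  rw [Matrix.det_smul, Fintype.card_fin]
  linear_combination (U.det * U.det + 1) * this

/-- Simultaneous diagonalisation of `P`, `D` and the intertwiner `T` by rotations. -/
theorem exists_block_normal_form {P T D : Matrix (Fin 3) (Fin 3) ℝ} (hP : Pᵀ = P) (hD : Dᵀ = D)
    (h : P * T = T * D) (h1 : P.trace = D.trace) (h2 : (P * P).trace = (D * D).trace)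
    (h3 : (P * P * P).trace = (D * D * D).trace) :
    ∃ (U V : Matrix (Fin 3) (Fin 3) ℝ) (p t : Fin 3 → ℝ), U * Uᵀ = 1 ∧ U.det = 1 ∧ V * Vᵀ = 1 ∧
      V.det = 1 ∧ U * P * Uᵀ = diagonal p ∧ U * T * Vᵀ = diagonal t ∧ V * D * Vᵀ = diagonal p := by
  obtain ⟨W, hW, hDW, hS⟩ := exists_symmetric_mul hP hD h (charpoly_eq_of_traces h1 h2 h3)
  have hPS : P * (T * W) = T * W * P := by
    rw [← Matrix.mul_assoc, h, Matrix.mul_assoc, hDW, Matrix.mul_assoc]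
  obtain ⟨U, p, t, hU, hp, ht⟩ := exists_commuting_diagonalisation hP hS hPS
  have hV : U * Wᵀ * (U * Wᵀ)ᵀ = 1 := by
    rw [Matrix.transpose_mul, Matrix.transpose_transpose, Matrix.mul_assoc,
      ← Matrix.mul_assoc Wᵀ, mul_eq_one_comm.mp hW, Matrix.one_mul, hU]
  obtain ⟨ε, hε, hεd⟩ := exists_special_orthogonal_sign hU
  obtain ⟨δ, hδ, hδd⟩ := exists_special_orthogonal_sign hV
  have hWD : Wᵀ * D * W = P := by
    rw [Matrix.mul_assoc, hDW, ← Matrix.mul_assoc, mul_eq_one_comm.mp hW, Matrix.one_mul]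
  refine ⟨ε • U, δ • (U * Wᵀ), p, (ε * δ) • t, ?_, hεd, ?_, hδd, ?_, ?_, ?_⟩
  · rw [Matrix.transpose_smul, Matrix.smul_mul, Matrix.mul_smul, smul_smul, hε, one_smul, hU]
  · rw [Matrix.transpose_smul, Matrix.smul_mul, Matrix.mul_smul, smul_smul, hδ, one_smul, hV]
  · rw [Matrix.transpose_smul, Matrix.smul_mul, Matrix.smul_mul, Matrix.mul_smul, smul_smul, hε,
      one_smul, hp]
  · rw [Matrix.transpose_smul, Matrix.smul_mul, Matrix.smul_mul, Matrix.mul_smul, smul_smul,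
      Matrix.transpose_mul, Matrix.transpose_transpose, ← Matrix.mul_assoc, Matrix.mul_assoc U, ht,
      Matrix.diagonal_smul]
  · rw [Matrix.transpose_smul, Matrix.smul_mul, Matrix.smul_mul, Matrix.mul_smul, smul_smul, hδ,
      one_smul, Matrix.transpose_mul, Matrix.transpose_transpose, ← Matrix.mul_assoc,
      Matrix.mul_assoc U, Matrix.mul_assoc U, hWD, hp]

end SimultaneousNormalForm


open Matrix

section FieldOf

variable {V : Type*} [NormedAddCommGroup V] [InnerProductSpace ℝ V] [FiniteDimensional ℝ V]

/-- The endomorphism field `K_x(v, w) = C(x, v, x, w)` of a four-linear form. -/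
def fieldOf : Tensor4 V →ₗ[ℝ] EndoField V where
  toFun C := fun x => LinearMap.toContinuousLinearMap
    (∑ i, (((C (x : V)).flip (x : V)).flip (stdOrthonormalBasis ℝ V i)).smulRight
      (stdOrthonormalBasis ℝ V i))
  map_add' C C' := by
    funext x; ext v
    simp [add_smul, Finset.sum_add_distrib]
  map_smul' r C := by
    funext x; ext v
    simp [mul_smul, Finset.smul_sum]

theorem isField_fieldOf (C : Tensor4 V) : IsField C (fieldOf C) := fun x v w => by
  have : ∀ l : V →ₗ[ℝ] ℝ, ∑ i, l (stdOrthonormalBasis ℝ V i) * ⟪stdOrthonormalBasis ℝ V i, w⟫ =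
      l w := fun l => by
    conv_rhs => rw [← (stdOrthonormalBasis ℝ V).sum_repr w]
    simp [OrthonormalBasis.repr_apply_apply, mul_comm]
  rw [← this (C (x : V) v (x : V))]
  simp [fieldOf, sum_inner, real_inner_smul_left]

theorem IsField.eq_fieldOf {C : Tensor4 V} {K : EndoField V} (h : IsField C K) : K = fieldOf C :=
  h.unique (isField_fieldOf C)

theorem fieldOf_gCurv : fieldOf (gCurv V) = metric V := (isField_metric.eq_fieldOf).symm

theorem IsKilling.exists_eq_fieldOf {K : EndoField V} (h : IsKilling K) :
    ∃ C, IsCurv C ∧ K = fieldOf C := by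
  obtain ⟨C, hC, hK⟩ := h.exists_isField
  exact ⟨C, hC, hK.eq_fieldOf⟩

theorem fieldOf_injective {C C' : Tensor4 V} (hC : IsCurv C) (hC' : IsCurv C')
    (h : fieldOf C = fieldOf C') : C = C' :=
  (isField_fieldOf C).curv_unique hC hC' (h ▸ isField_fieldOf C')

theorem isKilling_fieldOf {C : Tensor4 V} (hC : IsCurv C) : IsKilling (fieldOf C) :=
  (isField_fieldOf C).isKilling hC

theorem pushforward_fieldOf (φ : V ≃ₗᵢ[ℝ] V) (C : Tensor4 V) :
    pushforward φ (fieldOf C) = fieldOf (C.pull (φ.symm.toLinearEquiv : V →ₗ[ℝ] V)) :=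
  ((isField_fieldOf C).pushforward φ).eq_fieldOf

end FieldOf

section Diagonal

theorem Tensor4.ext_e {C C' : Tensor4 E4}
    (h : ∀ i j k l, C (e i) (e j) (e k) (e l) = C' (e i) (e j) (e k) (e l)) : C = C' := by
  have he : e = ⇑(EuclideanSpace.basisFun (Fin 4) ℝ).toBasis := by funext i; simp [e]
  rw [he] at h
  exact Module.Basis.ext _ fun i => Module.Basis.ext _ fun j => Module.Basis.ext _ fun k =>
    Module.Basis.ext _ fun l => h i j k l

theorem e_apply (i j : Fin 4) : (e i : E4) j = if j = i then 1 else 0 := by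
  simp [e]

/-- The diagonal curvature tensor with prescribed components `R_{ijij}`. -/
def diagCurv (s : Fin 4 → Fin 4 → ℝ) : Tensor4 E4 :=
  Tensor4.mk (fun a b c d => ∑ i, ∑ j,
      1 / 2 * s i j * (a i * b j - a j * b i) * (c i * d j - c j * d i))
    (fun a a' b c d => by
      simp only [← Finset.sum_add_distrib, PiLp.add_apply]
      exact Finset.sum_congr rfl fun i _ => Finset.sum_congr rfl fun j _ => by ring)
    (fun r a b c d => by
      simp only [Finset.mul_sum, PiLp.smul_apply, smul_eq_mul]
      exact Finset.sum_congr rfl fun i _ => Finset.sum_congr rfl fun j _ => by ring)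
    (fun a a' b c d => by
      simp only [← Finset.sum_add_distrib, PiLp.add_apply]
      exact Finset.sum_congr rfl fun i _ => Finset.sum_congr rfl fun j _ => by ring)
    (fun r a b c d => by
      simp only [Finset.mul_sum, PiLp.smul_apply, smul_eq_mul]
      exact Finset.sum_congr rfl fun i _ => Finset.sum_congr rfl fun j _ => by ring)
    (fun a a' b c d => by
      simp only [← Finset.sum_add_distrib, PiLp.add_apply]
      exact Finset.sum_congr rfl fun i _ => Finset.sum_congr rfl fun j _ => by ring)
    (fun r a b c d => by
      simp only [Finset.mul_sum, PiLp.smul_apply, smul_eq_mul]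
      exact Finset.sum_congr rfl fun i _ => Finset.sum_congr rfl fun j _ => by ring)
    (fun a a' b c d => by
      simp only [← Finset.sum_add_distrib, PiLp.add_apply]
      exact Finset.sum_congr rfl fun i _ => Finset.sum_congr rfl fun j _ => by ring)
    (fun r a b c d => by
      simp only [Finset.mul_sum, PiLp.smul_apply, smul_eq_mul]
      exact Finset.sum_congr rfl fun i _ => Finset.sum_congr rfl fun j _ => by ring)

theorem diagCurv_apply (s : Fin 4 → Fin 4 → ℝ) (a b c d : E4) : diagCurv s a b c d = ∑ i, ∑ j,
    1 / 2 * s i j * (a i * b j - a j * b i) * (c i * d j - c j * d i) := rfl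

theorem isCurv_diagCurv (s : Fin 4 → Fin 4 → ℝ) : IsCurv (diagCurv s) where
  left a b c d := by
    simp only [diagCurv_apply, ← Finset.sum_neg_distrib]
    exact Finset.sum_congr rfl fun i _ => Finset.sum_congr rfl fun j _ => by ring
  right a b c d := by
    simp only [diagCurv_apply, ← Finset.sum_neg_distrib]
    exact Finset.sum_congr rfl fun i _ => Finset.sum_congr rfl fun j _ => by ring
  pair a b c d := by
    simp only [diagCurv_apply]
    exact Finset.sum_congr rfl fun i _ => Finset.sum_congr rfl fun j _ => by ring
  bianchi a b c d := by
    simp only [diagCurv_apply, ← Finset.sum_add_distrib]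
    exact Finset.sum_eq_zero fun i _ => Finset.sum_eq_zero fun j _ => by ring

theorem diagCurv_e (s : Fin 4 → Fin 4 → ℝ) (i j k l : Fin 4) :
    diagCurv s (e i) (e j) (e k) (e l) =
      1 / 2 * (s i j + s j i) * ((if i = k ∧ j = l then 1 else 0) - if i = l ∧ j = k then 1 else 0) := by
  have : ∀ m n : Fin 4, 1 / 2 * s m n * (e i m * e j n - e i n * e j m) *
      (e k m * e l n - e k n * e l m) =
      (if m = i then if n = j then 1 / 2 * s i j * (e k i * e l j - e k j * e l i) else 0 else 0) -
      (if m = j then if n = i then 1 / 2 * s j i * (e k j * e l i - e k i * e l j) else 0 else 0) := by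
    intro m n
    rw [e_apply i m, e_apply j n, e_apply i n, e_apply j m]
    split_ifs <;> subst_vars <;> ring
  rw [diagCurv_apply]
  simp only [this, Finset.sum_sub_distrib, Finset.sum_ite_eq', Finset.mem_univ, if_true,
    Finset.sum_ite_irrel, Finset.sum_const_zero]
  have h1 : (e k i * e l j : ℝ) = if i = k ∧ j = l then 1 else 0 := by
    rw [e_apply, e_apply, ite_and]; split_ifs <;> simp
  have h2 : (e k j * e l i : ℝ) = if i = l ∧ j = k then 1 else 0 := by
    rw [e_apply, e_apply, ite_and]; split_ifs <;> simp
  rw [h1, h2]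
  ring

/-- Diagonality for curried curvature tensors. -/
def IsDiagCurv (C : Tensor4 E4) : Prop :=
  ∀ i j k l : Fin 4, ({i, j} : Set (Fin 4)) ≠ {k, l} → C (e i) (e j) (e k) (e l) = 0

theorem isDiagCurv_diagCurv (s : Fin 4 → Fin 4 → ℝ) : IsDiagCurv (diagCurv s) := by
  intro i j k l h
  rw [diagCurv_e, if_neg, if_neg, sub_zero, mul_zero]
  · rintro ⟨rfl, rfl⟩; exact h (Set.pair_comm _ _)
  · rintro ⟨rfl, rfl⟩; exact h rfl

theorem diagCurv_sec {s : Fin 4 → Fin 4 → ℝ} (hs : ∀ i j, s i j = s j i) {i j : Fin 4}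
    (hij : i ≠ j) : diagCurv s (e i) (e j) (e i) (e j) = s i j := by
  rw [diagCurv_e, if_pos ⟨rfl, rfl⟩, if_neg (fun h => hij h.1), hs j i]
  ring

theorem IsDiagCurv.eq_diagCurv {C : Tensor4 E4} (hd : IsDiagCurv C) (hC : IsCurv C) {s : Fin 4 → Fin 4 → ℝ}
    (hs : ∀ i j, i ≠ j → s i j = C (e i) (e j) (e i) (e j)) : C = diagCurv s := by
  have hsymm : ∀ i j, i ≠ j → s j i = s i j := fun i j h => by
    rw [hs i j h, hs j i h.symm, hC.left, hC.right, neg_neg]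
  refine Tensor4.ext_e fun i j k l => ?_
  rw [diagCurv_e]
  by_cases hij : i = j
  · subst hij
    rw [hC.self_left]
    simp [and_comm]
  by_cases h1 : i = k ∧ j = l
  · obtain ⟨rfl, rfl⟩ := h1
    rw [if_pos ⟨rfl, rfl⟩, if_neg (fun h => hij h.1), hsymm i j hij, hs i j hij]
    ring
  by_cases h2 : i = l ∧ j = k
  · obtain ⟨rfl, rfl⟩ := h2
    rw [if_neg h1, if_pos ⟨rfl, rfl⟩, hsymm i j hij, hC.right, hs i j hij]
    ring
  rw [if_neg h1, if_neg h2, sub_zero, mul_zero]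
  refine hd i j k l fun h => ?_
  rcases Set.pair_eq_pair_iff.mp h with h | h
  · exact h1 h
  · exact h2 h

/-- The sectional curvatures belonging to the parameters `p_α = w_α + s / 12` and `t_α`. -/
def secMat (p t : Fin 3 → ℝ) : Fin 4 → Fin 4 → ℝ :=
  ![![0, p 0 + t 0, p 1 + t 1, p 2 + t 2], ![p 0 + t 0, 0, p 2 - t 2, p 1 - t 1],
    ![p 1 + t 1, p 2 - t 2, 0, p 0 - t 0], ![p 2 + t 2, p 1 - t 1, p 0 - t 0, 0]]

theorem secMat_symm (p t : Fin 3 → ℝ) (i j : Fin 4) : secMat p t i j = secMat p t j i := by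
  fin_cases i <;> fin_cases j <;> rfl

theorem block_diagCurv (p t : Fin 3 → ℝ) (σ τ : ℝ) : block (diagCurv (secMat p t)) e σ τ =
    diagonal fun α => (1 / 2) * ((p α + t α) + σ * τ * (p α - t α)) := by
  ext α β
  fin_cases α <;> fin_cases β <;>
    simp [block, dualPair, diagCurv_e, secMat] <;> ring

theorem blockP_diagCurv (p t : Fin 3 → ℝ) : blockP (diagCurv (secMat p t)) e = diagonal p := by
  rw [blockP, block_diagCurv]; congr 1; ext; ring

theorem blockT_diagCurv (p t : Fin 3 → ℝ) : blockT (diagCurv (secMat p t)) e = diagonal t := by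
  rw [blockT, block_diagCurv]; congr 1; ext; ring

theorem blockD_diagCurv (p t : Fin 3 → ℝ) : blockD (diagCurv (secMat p t)) e = diagonal p := by
  rw [blockD, block_diagCurv]; congr 1; ext; ring

end Diagonal


open Matrix

section KSMatrices

/-- The parameters `w` of a matrix in `𝒜`. -/
def wVec (M : KSSpace) : Fin 3 → ℝ :=
  ![((M : Matrix (Fin 3) (Fin 3) ℝ) 2 2 - (M : Matrix (Fin 3) (Fin 3) ℝ) 1 1) / 3,
    ((M : Matrix (Fin 3) (Fin 3) ℝ) 0 0 - (M : Matrix (Fin 3) (Fin 3) ℝ) 2 2) / 3,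
    ((M : Matrix (Fin 3) (Fin 3) ℝ) 1 1 - (M : Matrix (Fin 3) (Fin 3) ℝ) 0 0) / 3]

/-- The parameters `t` of a matrix in `𝒜`. -/
def tVec (M : KSSpace) : Fin 3 → ℝ :=
  ![(M : Matrix (Fin 3) (Fin 3) ℝ) 2 1, (M : Matrix (Fin 3) (Fin 3) ℝ) 0 2,
    (M : Matrix (Fin 3) (Fin 3) ℝ) 1 0]

/-- The matrix in `𝒜` with given parameters. -/
def ofParams (w t : Fin 3 → ℝ) : KSSpace :=
  ⟨!![w 1 - w 2, -t 2, t 1; t 2, w 2 - w 0, -t 0; -t 1, t 0, w 0 - w 1], by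
    refine ⟨fun i j h => ?_, ?_⟩
    · fin_cases i <;> fin_cases j <;> simp at h ⊢
    · simp [Matrix.trace_fin_three]⟩

theorem coe_ofParams (w t : Fin 3 → ℝ) : (ofParams w t : Matrix (Fin 3) (Fin 3) ℝ) =
    !![w 1 - w 2, -t 2, t 1; t 2, w 2 - w 0, -t 0; -t 1, t 0, w 0 - w 1] := rfl

theorem sum_wVec (M : KSSpace) : wVec M 0 + wVec M 1 + wVec M 2 = 0 := by
  simp [wVec]; ring

theorem ksSpace_trace (M : KSSpace) : (M : Matrix (Fin 3) (Fin 3) ℝ) 0 0 +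
    (M : Matrix (Fin 3) (Fin 3) ℝ) 1 1 + (M : Matrix (Fin 3) (Fin 3) ℝ) 2 2 = 0 := by
  rw [← Matrix.trace_fin_three]; exact M.2.2

theorem ofParams_vec (M : KSSpace) : ofParams (wVec M) (tVec M) = M := by
  have h := M.2.1
  have ht := ksSpace_trace M
  refine Subtype.ext ?_
  rw [coe_ofParams]
  ext i j
  fin_cases i <;> fin_cases j <;>
    simp only [Fin.zero_eta, Fin.mk_one, Fin.reduceFinMk, Matrix.of_apply, Matrix.cons_val',
      Matrix.cons_val, wVec, tVec] <;>
    first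
      | linarith
      | exact (h _ _ (by decide)).symm

theorem tVec_ofParams (w t : Fin 3 → ℝ) : tVec (ofParams w t) = t := by
  ext i; fin_cases i <;> rfl

theorem wVec_ofParams {w : Fin 3 → ℝ} (hw : w 0 + w 1 + w 2 = 0) (t : Fin 3 → ℝ) :
    wVec (ofParams w t) = w := by
  ext i; fin_cases i <;> simp [wVec, coe_ofParams] <;> linarith

theorem det_ofParams (w t : Fin 3 → ℝ) : (ofParams w t : Matrix (Fin 3) (Fin 3) ℝ).det =
    (w 1 - w 2) * (w 2 - w 0) * (w 0 - w 1) + (w 1 - w 2) * t 0 ^ 2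
      + (w 2 - w 0) * t 1 ^ 2 + (w 0 - w 1) * t 2 ^ 2 := by
  rw [coe_ofParams, Matrix.det_fin_three]
  simp only [Matrix.of_apply, Matrix.cons_val', Matrix.cons_val]
  ring

theorem wVec_add (M N : KSSpace) : wVec (M + N) = wVec M + wVec N := by
  ext i; fin_cases i <;> simp [wVec] <;> ring

theorem wVec_smul (c : ℝ) (M : KSSpace) : wVec (c • M) = c • wVec M := by
  ext i; fin_cases i <;> simp [wVec] <;> ring

theorem tVec_add (M N : KSSpace) : tVec (M + N) = tVec M + tVec N := by
  ext i; fin_cases i <;> simp [tVec]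

theorem tVec_smul (c : ℝ) (M : KSSpace) : tVec (c • M) = c • tVec M := by
  ext i; fin_cases i <;> simp [tVec]

theorem ofParams_add (w t w' t' : Fin 3 → ℝ) :
    ofParams (w + w') (t + t') = ofParams w t + ofParams w' t' := by
  refine Subtype.ext ?_
  rw [Submodule.coe_add, coe_ofParams, coe_ofParams, coe_ofParams]
  ext i j
  fin_cases i <;> fin_cases j <;> simp <;> ring

theorem ofParams_smul (c : ℝ) (w t : Fin 3 → ℝ) :
    ofParams (c • w) (c • t) = c • ofParams w t := by
  refine Subtype.ext ?_
  rw [Submodule.coe_smul, coe_ofParams, coe_ofParams]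
  ext i j
  fin_cases i <;> fin_cases j <;> simp <;> ring

theorem ksMatrix_diagCurv (p t : Fin 3 → ℝ) :
    ksMatrix (toMulti (diagCurv (secMat p t))) = ofParams p t := by
  have hs : ∀ i j : Fin 4, i ≠ j → sec (toMulti (diagCurv (secMat p t))) i j = secMat p t i j :=
    fun i j h => diagCurv_sec (secMat_symm p t) h
  have h1 : sec (toMulti (diagCurv (secMat p t))) 0 1 = p 0 + t 0 := hs 0 1 (by decide)
  have h2 : sec (toMulti (diagCurv (secMat p t))) 0 2 = p 1 + t 1 := hs 0 2 (by decide)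
  have h3 : sec (toMulti (diagCurv (secMat p t))) 0 3 = p 2 + t 2 := hs 0 3 (by decide)
  have h4 : sec (toMulti (diagCurv (secMat p t))) 2 3 = p 0 - t 0 := hs 2 3 (by decide)
  have h5 : sec (toMulti (diagCurv (secMat p t))) 3 1 = p 1 - t 1 := hs 3 1 (by decide)
  have h6 : sec (toMulti (diagCurv (secMat p t))) 1 2 = p 2 - t 2 := hs 1 2 (by decide)
  rw [coe_ofParams]
  ext i j
  fin_cases i <;> fin_cases j <;>
    simp [ksMatrix, wPar, tPar, h1, h2, h3, h4, h5, h6, -one_div]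

theorem IsDiagCurv.eq_secMat {C : Tensor4 E4} (hd : IsDiagCurv C) (hC : IsCurv C) :
    C = diagCurv (secMat (fun i => wPar (toMulti C) i + scal (toMulti C) / 12)
      (tPar (toMulti C))) := by
  refine hd.eq_diagCurv hC ?_
  have hs : ∀ i j, C (e i) (e j) (e i) (e j) = sec (toMulti C) i j := fun i j => rfl
  have hsym : ∀ i j, sec (toMulti C) i j = sec (toMulti C) j i := fun i j => by
    rw [← hs, ← hs, hC.left, hC.right, neg_neg]
  intro i j hij
  rw [hs]
  fin_cases i <;> fin_cases j <;> first | exact absurd rfl hij | skip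
  all_goals
    simp [secMat, wPar, tPar, scal, hsym 1 0, hsym 2 0, hsym 3 0, hsym 2 1, hsym 3 1, hsym 3 2]
  all_goals ring

theorem hasKSMatrix_iff_params {K : EndoField E4} {M : KSSpace} : HasKSMatrix K M ↔
    ∃ p t : Fin 3 → ℝ, K = fieldOf (diagCurv (secMat p t)) ∧ M = ofParams p t := by
  constructor
  · rintro ⟨R, hR, hd, hK, hM⟩
    have hC := isCurv_curry hR
    have hd' : IsDiagCurv (curry R) := hd
    have hK' : IsField (curry R) K := hK
    have h := hd'.eq_secMat hC
    refine ⟨fun i => wPar (toMulti (curry R)) i + scal (toMulti (curry R)) / 12,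
      tPar (toMulti (curry R)), ?_, Subtype.ext ?_⟩
    · rw [hK'.eq_fieldOf]
      exact congrArg fieldOf h
    · rw [← hM, ← ksMatrix_diagCurv, ← h, toMulti_curry]
  · rintro ⟨p, t, rfl, rfl⟩
    exact ⟨toMulti (diagCurv (secMat p t)), isAlgCurvature_toMulti (isCurv_diagCurv _),
      isDiagCurv_diagCurv _, isField_fieldOf _, ksMatrix_diagCurv p t⟩

theorem ofParams_add_const (p t : Fin 3 → ℝ) (c : ℝ) :
    ofParams (fun i => p i + c) t = ofParams p t := by
  refine Subtype.ext ?_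
  rw [coe_ofParams, coe_ofParams]
  ext i j
  fin_cases i <;> fin_cases j <;> simp

theorem diagCurv_secMat_add (p t p' t' : Fin 3 → ℝ) : diagCurv (secMat (p + p') (t + t')) =
    diagCurv (secMat p t) + diagCurv (secMat p' t') := by
  refine Tensor4.ext_e fun i j k l => ?_
  simp only [LinearMap.add_apply, diagCurv_e]
  have : ∀ i j, secMat (p + p') (t + t') i j = secMat p t i j + secMat p' t' i j := by
    intro i j
    fin_cases i <;> fin_cases j <;> simp [secMat] <;> ring
  rw [this, this]
  ring

theorem diagCurv_secMat_smul (c : ℝ) (p t : Fin 3 → ℝ) : diagCurv (secMat (c • p) (c • t)) =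
    c • diagCurv (secMat p t) := by
  refine Tensor4.ext_e fun i j k l => ?_
  simp only [LinearMap.smul_apply, diagCurv_e]
  have : ∀ i j, secMat (c • p) (c • t) i j = c * secMat p t i j := by
    intro i j
    fin_cases i <;> fin_cases j <;> simp [secMat] <;> ring
  rw [this, this, smul_eq_mul]
  ring

theorem inner_e (i j : Fin 4) : ⟪(e i : E4), e j⟫ = if i = j then (1 : ℝ) else 0 :=
  orthonormal_iff_ite.mp orthonormal_e i j

theorem gCurv_eq_diagCurv : gCurv E4 = diagCurv (secMat (fun _ => 1) 0) := by
  have hd : IsDiagCurv (gCurv E4) := by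
    intro i j k l h
    simp only [gCurv_apply, inner_e]
    have h1 : ¬ (i = k ∧ j = l) := by rintro ⟨rfl, rfl⟩; exact h rfl
    have h2 : ¬ (i = l ∧ j = k) := by rintro ⟨rfl, rfl⟩; exact h (Set.pair_comm _ _)
    have h3 : (if i = k then (1 : ℝ) else 0) * (if j = l then 1 else 0) = 0 := by
      split_ifs <;> simp_all
    have h4 : (if i = l then (1 : ℝ) else 0) * (if j = k then 1 else 0) = 0 := by
      split_ifs <;> simp_all
    rw [h3, h4, sub_zero]
  refine hd.eq_diagCurv isCurv_gCurv fun i j h => ?_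
  simp only [gCurv_apply, inner_e, if_true, if_neg h, if_neg h.symm]
  fin_cases i <;> fin_cases j <;> first | exact absurd rfl h | simp [secMat]

/-- The field with matrix `M` and vanishing scalar curvature. -/
def ksField : KSSpace →ₗ[ℝ] EndoField E4 where
  toFun M := fieldOf (diagCurv (secMat (wVec M) (tVec M)))
  map_add' M N := by rw [wVec_add, tVec_add, diagCurv_secMat_add, map_add]
  map_smul' c M := by rw [wVec_smul, tVec_smul, diagCurv_secMat_smul, map_smul]; rfl

theorem ksField_apply (M : KSSpace) :
    ksField M = fieldOf (diagCurv (secMat (wVec M) (tVec M))) := rfl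

theorem hasKSMatrix_iff {K : EndoField E4} {M : KSSpace} : HasKSMatrix K M ↔
    ∃ b : ℝ, K = ksField M + b • metric E4 := by
  have key : ∀ (p t : Fin 3 → ℝ) (b : ℝ), fieldOf (diagCurv (secMat (fun i => p i + b) t)) =
      fieldOf (diagCurv (secMat p t)) + b • metric E4 := fun p t b => by
    rw [← fieldOf_gCurv, gCurv_eq_diagCurv, ← map_smul, ← map_add, ← diagCurv_secMat_smul,
      ← diagCurv_secMat_add]
    congr 3
    · ext i; simp
    · simp
  rw [hasKSMatrix_iff_params]
  constructor
  · rintro ⟨p, t, rfl, rfl⟩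
    set m := (p 0 + p 1 + p 2) / 3 with hm
    refine ⟨m, ?_⟩
    have h : ofParams p t = ofParams (fun i => p i + -m) t := (ofParams_add_const p t _).symm
    rw [ksField_apply, h, wVec_ofParams (by rw [hm]; ring), tVec_ofParams, ← key]
    congr 4
    ext i; ring
  · rintro ⟨b, rfl⟩
    refine ⟨fun i => wVec M i + b, tVec M, by rw [key, ksField_apply], ?_⟩
    rw [ofParams_add_const, ofParams_vec]

theorem hasKSMatrix_ksField (M : KSSpace) : HasKSMatrix (ksField M) M :=
  hasKSMatrix_iff.mpr ⟨0, by simp⟩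

theorem fieldOf_diagCurv_injective {p t p' t' : Fin 3 → ℝ}
    (h : fieldOf (diagCurv (secMat p t)) = fieldOf (diagCurv (secMat p' t'))) :
    p = p' ∧ t = t' := by
  have h' := fieldOf_injective (isCurv_diagCurv _) (isCurv_diagCurv _) h
  have hp := blockP_diagCurv p t
  have ht := blockT_diagCurv p t
  rw [h', blockP_diagCurv] at hp
  rw [h', blockT_diagCurv] at ht
  exact ⟨(Matrix.diagonal_injective hp).symm, (Matrix.diagonal_injective ht).symm⟩

theorem eq_zero_of_ksField_eq {M : KSSpace} {b : ℝ} (h : ksField M + b • metric E4 = 0) :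
    M = 0 ∧ b = 0 := by
  have h1 : HasKSMatrix 0 M := hasKSMatrix_iff.mpr ⟨b, h.symm⟩
  obtain ⟨p, t, h2, h3⟩ := hasKSMatrix_iff_params.mp h1
  have h4 : fieldOf (diagCurv (secMat p t)) = fieldOf (diagCurv (secMat 0 0)) := by
    rw [← h2, show (secMat 0 0) = secMat ((0 : ℝ) • 0) ((0 : ℝ) • 0) by simp,
      diagCurv_secMat_smul, zero_smul, map_zero]
  obtain ⟨rfl, rfl⟩ := fieldOf_diagCurv_injective h4
  have hM : M = 0 := by
    rw [h3, show ofParams 0 0 = ofParams ((0 : ℝ) • 0) ((0 : ℝ) • 0) by simp, ofParams_smul,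
      zero_smul]
  refine ⟨hM, ?_⟩
  rw [hM, map_zero, zero_add] at h
  have := congrArg (fun K : EndoField E4 => ⟪K ⟨e 0, by simp [e]⟩ (e 1), e 1⟫) h
  have he : (e 1 : E4) ≠ 0 := orthonormal_e.ne_zero 1
  simpa [metric_apply, inner_e, inner_sub_left, real_inner_smul_left, he] using this

theorem HasKSMatrix.smul_iff {K K' : EndoField E4} {M M' : KSSpace} (h : HasKSMatrix K M)
    (h' : HasKSMatrix K' M') (c : ℝ) : M' = c • M ↔ ∃ b : ℝ, K' = c • K + b • metric E4 := by
  obtain ⟨b, rfl⟩ := hasKSMatrix_iff.mp h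
  obtain ⟨b', rfl⟩ := hasKSMatrix_iff.mp h'
  constructor
  · rintro rfl
    refine ⟨b' - c * b, ?_⟩
    rw [map_smul]
    module
  · rintro ⟨a, ha⟩
    have : ksField (M' - c • M) + (b' - c * b - a) • metric E4 = 0 := by
      rw [map_sub, map_smul]
      have := sub_eq_zero.mpr ha
      rw [← this]
      module
    exact sub_eq_zero.mp (eq_zero_of_ksField_eq this).1

theorem HasKSMatrix.unique {K : EndoField E4} {M M' : KSSpace} (h : HasKSMatrix K M)
    (h' : HasKSMatrix K M') : M' = M := by
  have := (h.smul_iff h' 1).mpr ⟨0, by simp⟩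
  simpa using this

theorem HasKSMatrix.isKilling {K : EndoField E4} {M : KSSpace} (h : HasKSMatrix K M) :
    IsKilling K := by
  obtain ⟨p, t, rfl, rfl⟩ := hasKSMatrix_iff_params.mp h
  exact isKilling_fieldOf (isCurv_diagCurv _)

theorem HasKSMatrix.isIntegrable_iff {K : EndoField E4} {M : KSSpace} (h : HasKSMatrix K M) :
    IsIntegrable K ↔ M ∈ ksCone := by
  obtain ⟨p, t, rfl, rfl⟩ := hasKSMatrix_iff_params.mp h
  rw [isIntegrable_iff_of_diagonal_blocks (isCurv_diagCurv _) (isField_fieldOf _)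
    (blockP_diagCurv p t) (blockT_diagCurv p t) (blockD_diagCurv p t)]
  change _ ↔ (ofParams p t : Matrix (Fin 3) (Fin 3) ℝ).det = 0
  rw [det_ofParams]

end KSMatrices


open Matrix

section Frames

theorem block_pull (C : Tensor4 E4) (g : E4 →ₗ[ℝ] E4) (f : Fin 4 → E4) (σ τ : ℝ) :
    block (C.pull g) f σ τ = block C (fun i => g (f i)) σ τ := rfl

theorem block_sub_smul (C C' : Tensor4 E4) (f : Fin 4 → E4) (σ τ : ℝ) :
    block (C + (-1 : ℝ) • C') f σ τ = block C f σ τ - block C' f σ τ := by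
  ext α β
  simp only [block, dualPair, LinearMap.add_apply, LinearMap.smul_apply, smul_eq_mul,
    Matrix.of_apply, Matrix.sub_apply]
  ring

theorem eq_zero_of_blocks {C : Tensor4 E4} (hC : IsCurv C) (hP : blockP C e = 0)
    (hT : blockT C e = 0) (hD : blockD C e = 0) : C = 0 := by
  have hK := isField_fieldOf C
  have h0 : IsField (0 : Tensor4 E4) (fieldOf C) := by
    intro x v w
    have hk : kMat C (sphereFrame x) = 0 := by
      rw [kMat_eq_blocks hC, coe_sphereFrame, blockP_leftFrame hC,
        blockT_leftFrame hC (sum_sq_sphere x), blockD_leftFrame hC (sum_sq_sphere x), hP, hT, hD]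
      simp
    have hz : fieldOf C x (x : E4) = 0 := ext_inner_right ℝ fun w => by
      rw [hK x, hC.self_left, inner_zero_left]
    have hv : fieldOf C x v = 0 := by
      conv_lhs => rw [← (sphereFrame x).sum_repr v, Fin.sum_univ_succ]
      rw [map_add, map_smul, ← sphereFrame_zero, hz, smul_zero, zero_add, map_sum]
      refine Finset.sum_eq_zero fun α _ => ?_
      rw [map_smul, field_frame (sphereFrame x) hC hK (sphereFrame_zero x), hk]
      simp
    rw [hv]
    simp
  exact hK.curv_unique hC ⟨by simp, by simp, by simp, by simp⟩ h0

theorem eq_of_blocks {C C' : Tensor4 E4} (hC : IsCurv C) (hC' : IsCurv C')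
    (hP : blockP C e = blockP C' e) (hT : blockT C e = blockT C' e)
    (hD : blockD C e = blockD C' e) : C = C' := by
  have h := eq_zero_of_blocks (hC.add (hC'.smul (-1)))
    (by rw [blockP, block_sub_smul]; exact sub_eq_zero.mpr hP)
    (by rw [blockT, block_sub_smul]; exact sub_eq_zero.mpr hT)
    (by rw [blockD, block_sub_smul]; exact sub_eq_zero.mpr hD)
  refine Tensor4.ext_e fun i j k l => ?_
  have := congrArg (fun X : Tensor4 E4 => X (e i) (e j) (e k) (e l)) h
  simp only [LinearMap.add_apply, LinearMap.smul_apply, smul_eq_mul, LinearMap.zero_apply] at this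
  linarith

/-- The isometry which maps an orthonormal frame to the standard basis. -/
def frameIsometry {f : Fin 4 → E4} (hf : Orthonormal ℝ f) : E4 ≃ₗᵢ[ℝ] E4 :=
  (frameBasis finrank_E4 hf).repr

theorem frameIsometry_symm_e {f : Fin 4 → E4} (hf : Orthonormal ℝ f) (i : Fin 4) :
    (frameIsometry hf).symm (e i) = f i := by
  rw [frameIsometry, e, OrthonormalBasis.repr_symm_single, coe_frameBasis]

theorem orthonormal_symm_e (φ : E4 ≃ₗᵢ[ℝ] E4) : Orthonormal ℝ fun i => φ.symm (e i) :=
  orthonormal_e.comp_linearIsometryEquiv φ.symm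

/-- The pullback of a curvature tensor which describes the pushforward of its field. -/
abbrev Tensor4.push (C : Tensor4 E4) (φ : E4 ≃ₗᵢ[ℝ] E4) : Tensor4 E4 :=
  C.pull (φ.symm.toLinearEquiv : E4 →ₗ[ℝ] E4)

theorem exists_isometry_blocks {U V : Matrix (Fin 3) (Fin 3) ℝ}
    (hU : U * Uᵀ = 1) (hUd : U.det = 1) (hV : V * Vᵀ = 1) (hVd : V.det = 1) :
    ∃ φ : E4 ≃ₗᵢ[ℝ] E4, ∀ C : Tensor4 E4, IsCurv C → blockP (C.push φ) e = U * blockP C e * Uᵀ ∧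
      blockT (C.push φ) e = U * blockT C e * Vᵀ ∧
      blockD (C.push φ) e = V * blockD C e * Vᵀ := by
  obtain ⟨p, hp, rfl⟩ := exists_rot_eq hU hUd
  obtain ⟨q, hq, rfl⟩ := exists_rot_eq hV hVd
  have hf : Orthonormal ℝ (reflectFrame (leftFrame q (reflectFrame (leftFrame p e)))) :=
    orthonormal_reflectFrame (orthonormal_leftFrame hq (orthonormal_reflectFrame
      (orthonormal_leftFrame hp orthonormal_e)))
  refine ⟨frameIsometry hf, fun C hC => ?_⟩
  have hb : ∀ σ τ, block (C.push (frameIsometry hf)) e σ τ =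
      block C (reflectFrame (leftFrame q (reflectFrame (leftFrame p e)))) σ τ := fun σ τ => by
    rw [block_pull]
    congr 1
    funext i
    exact frameIsometry_symm_e hf i
  rw [blockP, blockT, blockD, hb, hb, hb, ← blockP, ← blockT, ← blockD]
  rw [blockP_reflectFrame, blockD_leftFrame hC hq, blockD_reflectFrame, blockP_leftFrame hC,
    blockT_reflectFrame hC, blockT_leftFrame hC hq, blockT_reflectFrame hC, blockT_leftFrame hC hp,
    blockD_reflectFrame, blockP_leftFrame hC, blockP_reflectFrame, blockD_leftFrame hC hp,
    Matrix.transpose_mul, Matrix.transpose_transpose]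
  exact ⟨rfl, rfl, rfl⟩

theorem cofactor_eq {Q : Matrix (Fin 3) (Fin 3) ℝ} (hQ : Q * Qᵀ = 1) (hd : Q.det = 1) (β δ : Fin 3) :
    Q (β + 1) (δ + 1) * Q (β + 2) (δ + 2) - Q (β + 1) (δ + 2) * Q (β + 2) (δ + 1) = Q β δ := by
  have h : Q.adjugate = Qᵀ := by
    have h1 := Matrix.adjugate_mul Q
    rw [hd, one_smul] at h1
    calc Q.adjugate = Q.adjugate * (Q * Qᵀ) := by rw [hQ, Matrix.mul_one]
      _ = Qᵀ := by rw [← Matrix.mul_assoc, h1, Matrix.one_mul]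
  have h2 := congrFun (congrFun h δ) β
  rw [Matrix.adjugate_fin_three] at h2
  fin_cases β <;> fin_cases δ <;>
    simp [Matrix.transpose_apply] at h2 ⊢ <;> linarith

theorem dualPair_rotate {B : E4 →ₗ[ℝ] E4 →ₗ[ℝ] ℝ} (hB : ∀ a b, B b a = -B a b)
    {Q : Matrix (Fin 3) (Fin 3) ℝ} (hQ : Q * Qᵀ = 1) (hd : Q.det = 1) {f g : Fin 4 → E4}
    (h0 : f 0 = g 0) (h : ∀ α : Fin 3, f α.succ = ∑ β, Q α β • g β.succ) (σ : ℝ) (α : Fin 3) :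
    dualPair B f σ α = ∑ β, Q α β * dualPair B g σ β := by
  have hc := cofactor_eq hQ hd α
  have c0 := hc 0
  have c1 := hc 1
  have c2 := hc 2
  simp only [Fin.reduceAdd, zero_add] at c0 c1 c2
  simp only [dualPair, h0, h, Fin.sum_univ_three, map_add, map_smul, LinearMap.add_apply,
    LinearMap.smul_apply, smul_eq_mul, zero_add, Fin.reduceAdd]
  have s : ∀ a, B a a = 0 := fun a => by linarith [hB a a]
  rw [s, s, s, hB (g (Fin.succ 0)) (g (Fin.succ 1)), hB (g (Fin.succ 0)) (g (Fin.succ 2)),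
    hB (g (Fin.succ 1)) (g (Fin.succ 2))]
  linear_combination σ * B (g (Fin.succ 1)) (g (Fin.succ 2)) * c0 -
    σ * B (g (Fin.succ 0)) (g (Fin.succ 2)) * c1 + σ * B (g (Fin.succ 0)) (g (Fin.succ 1)) * c2

theorem block_rotate {C : Tensor4 E4} (hC : IsCurv C)
    {Q : Matrix (Fin 3) (Fin 3) ℝ} (hQ : Q * Qᵀ = 1) (hd : Q.det = 1) {f g : Fin 4 → E4}
    (h0 : f 0 = g 0) (h : ∀ α : Fin 3, f α.succ = ∑ β, Q α β • g β.succ) (σ τ : ℝ) :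
    block C f σ τ = Q * block C g σ τ * Qᵀ := by
  have hr : ∀ β, contractRight C f τ β = ∑ γ, Q β γ • contractRight C g τ γ := fun β => by
    refine LinearMap.ext fun a => LinearMap.ext fun b => ?_
    simp only [contractRight_apply, LinearMap.sum_apply, LinearMap.smul_apply, smul_eq_mul]
    exact dualPair_rotate (fun c d => hC.right a b c d) hQ hd h0 h τ β
  ext α β
  simp only [block_apply, hr, dualPair_sum,
    dualPair_rotate (contractRight_anti hC g _ _) hQ hd h0 h]
  simp only [Matrix.mul_apply, Matrix.transpose_apply, block_apply, Fin.sum_univ_three]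
  ring

theorem exists_blocks_of_orthonormal {f : Fin 4 → E4} (hf : Orthonormal ℝ f) :
    ∃ U V : Matrix (Fin 3) (Fin 3) ℝ, U * Uᵀ = 1 ∧ U.det = 1 ∧ V * Vᵀ = 1 ∧ V.det = 1 ∧
      ((∀ C : Tensor4 E4, IsCurv C → blockP C f = U * blockP C e * Uᵀ ∧
        blockT C f = U * blockT C e * Vᵀ ∧ blockD C f = V * blockD C e * Vᵀ) ∨
      (∀ C : Tensor4 E4, IsCurv C → blockP C f = V * blockD C e * Vᵀ ∧
        blockT C f = (U * blockT C e * Vᵀ)ᵀ ∧ blockD C f = U * blockP C e * Uᵀ)) := by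
  have hn : ‖f 0‖ = 1 := hf.1 0
  set x : Metric.sphere (0 : E4) 1 := ⟨f 0, by simp [hn]⟩ with hx
  have hp := sum_sq_sphere x
  set g := sphereFrame x with hg
  have hg' : ⇑g = leftFrame (x : E4) e := coe_sphereFrame x
  have hg0 : f 0 = g 0 := sphereFrame_zero x
  set Q : Matrix (Fin 3) (Fin 3) ℝ := Matrix.of fun α β => ⟪f α.succ, g β.succ⟫ with hQdef
  have hfQ : ∀ α : Fin 3, f α.succ = ∑ β, Q α β • g β.succ := fun α =>
    tangent_expand g (by rw [← hg0]; exact hf.2 (Fin.succ_ne_zero α).symm)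
  have hQ : Q * Qᵀ = 1 := by
    ext α β
    have h1 := orthonormal_iff_ite.mp hf α.succ β.succ
    rw [hfQ β, inner_sum] at h1
    simp only [real_inner_smul_right, Fin.succ_inj] at h1
    rw [Matrix.one_apply, ← h1, Matrix.mul_apply]
    exact Finset.sum_congr rfl fun γ _ => mul_comm _ _
  have hdet : Q.det * Q.det = 1 := by
    have := congrArg Matrix.det hQ
    rwa [Matrix.det_mul, Matrix.det_transpose, Matrix.det_one] at this
  have hO := rot_mul_transpose hp
  rcases mul_self_eq_one_iff.mp hdet with hd | hd
  · refine ⟨Q * rot (x : E4), Q, ?_, ?_, hQ, hd, Or.inl fun C hC => ?_⟩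
    · rw [Matrix.transpose_mul, Matrix.mul_assoc, ← Matrix.mul_assoc (rot _), hO, Matrix.one_mul, hQ]
    · rw [Matrix.det_mul, hd, rot_det hp, one_mul]
    · rw [blockP, blockT, blockD, block_rotate hC hQ hd hg0 hfQ, block_rotate hC hQ hd hg0 hfQ,
        block_rotate hC hQ hd hg0 hfQ, ← blockP, ← blockT, ← blockD, hg', blockP_leftFrame hC,
        blockT_leftFrame hC hp, blockD_leftFrame hC hp]
      simp only [Matrix.transpose_mul, Matrix.mul_assoc, and_self]
  · have hQ' : -Q * (-Q)ᵀ = 1 := by simp [hQ]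
    have hd' : (-Q).det = 1 := by rw [Matrix.det_neg, hd]; norm_num
    have hr0 : reflectFrame f 0 = g 0 := hg0
    have hr : ∀ α : Fin 3, reflectFrame f α.succ = ∑ β, (-Q) α β • g β.succ := fun α => by
      simp only [Matrix.neg_apply, neg_smul, Finset.sum_neg_distrib, ← hfQ]
      fin_cases α <;> rfl
    refine ⟨-Q * rot (x : E4), -Q, ?_, ?_, hQ', hd', Or.inr fun C hC => ?_⟩
    · rw [Matrix.transpose_mul, Matrix.mul_assoc, ← Matrix.mul_assoc (rot _), hO, Matrix.one_mul, hQ']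
    · rw [Matrix.det_mul, hd', rot_det hp, one_mul]
    · have e1 := blockD_reflectFrame C f
      have e2 := blockT_reflectFrame hC f
      have e3 := blockP_reflectFrame C f
      rw [← e1, ← e3, ← Matrix.transpose_transpose (blockT C f), ← e2, blockP, blockT, blockD,
        block_rotate hC hQ' hd' hr0 hr, block_rotate hC hQ' hd' hr0 hr,
        block_rotate hC hQ' hd' hr0 hr, ← blockP, ← blockT, ← blockD, hg', blockP_leftFrame hC,
        blockT_leftFrame hC hp, blockD_leftFrame hC hp]
      simp only [Matrix.transpose_mul, Matrix.mul_assoc, and_self]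

theorem exists_push_blocks (φ : E4 ≃ₗᵢ[ℝ] E4) :
    ∃ U V : Matrix (Fin 3) (Fin 3) ℝ, U * Uᵀ = 1 ∧ U.det = 1 ∧ V * Vᵀ = 1 ∧ V.det = 1 ∧
      ((∀ C : Tensor4 E4, IsCurv C → blockP (C.push φ) e = U * blockP C e * Uᵀ ∧
        blockT (C.push φ) e = U * blockT C e * Vᵀ ∧ blockD (C.push φ) e = V * blockD C e * Vᵀ) ∨
      (∀ C : Tensor4 E4, IsCurv C → blockP (C.push φ) e = V * blockD C e * Vᵀ ∧
        blockT (C.push φ) e = (U * blockT C e * Vᵀ)ᵀ ∧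
        blockD (C.push φ) e = U * blockP C e * Uᵀ)) := by
  have h := exists_blocks_of_orthonormal (orthonormal_symm_e φ)
  simp only [blockP, blockT, blockD] at h ⊢
  exact h

/-- Integrable Killing tensors on the three-sphere are diagonalisable. -/
theorem IsIntegrable.exists_hasKSMatrix {K : EndoField E4} (hK : IsKilling K)
    (hI : IsIntegrable K) : ∃ (φ : E4 ≃ₗᵢ[ℝ] E4) (M : KSSpace), HasKSMatrix (pushforward φ K) M := by
  obtain ⟨C, hC, rfl⟩ := hK.exists_eq_fieldOf
  obtain ⟨h1, h2, h3⟩ := hI.block_conditions hC (isField_fieldOf C)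
  obtain ⟨U, V, p, t, hU, hUd, hV, hVd, hp, ht, hd⟩ := exists_block_normal_form
    (blockP_symm hC e) (blockD_symm hC e) h1 (block_trace_eq hC e) h2 h3
  obtain ⟨φ, hφ⟩ := exists_isometry_blocks hU hUd hV hVd
  obtain ⟨hp', ht', hd'⟩ := hφ C hC
  refine ⟨φ, ofParams p t, hasKSMatrix_iff_params.mpr ⟨p, t, ?_, rfl⟩⟩
  rw [pushforward_fieldOf]
  congr 1
  refine eq_of_blocks (hC.pull _) (isCurv_diagCurv _) ?_ ?_ ?_
  · rw [blockP_diagCurv]; exact hp'.trans hp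
  · rw [blockT_diagCurv]; exact ht'.trans ht
  · rw [blockD_diagCurv]; exact hd'.trans hd

end Frames


open Matrix

section Octahedron

/-- Signed permutation matrices. -/
def signedPerm (σ : Equiv.Perm (Fin 3)) (η : Fin 3 → ℝ) : Matrix (Fin 3) (Fin 3) ℝ :=
  Matrix.of fun i j => if j = σ i then η i else 0

theorem signedPerm_apply (σ : Equiv.Perm (Fin 3)) (η : Fin 3 → ℝ) (i j : Fin 3) :
    signedPerm σ η i j = if j = σ i then η i else 0 := rfl

theorem signedPerm_conj_apply (σ : Equiv.Perm (Fin 3)) (η η' : Fin 3 → ℝ)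
    (A : Matrix (Fin 3) (Fin 3) ℝ) (i j : Fin 3) :
    (signedPerm σ η * A * (signedPerm σ η')ᵀ) i j = η i * A (σ i) (σ j) * η' j := by
  rw [Matrix.mul_apply]
  simp only [Matrix.transpose_apply, signedPerm_apply, Matrix.mul_apply, mul_ite, mul_zero,
    Finset.sum_ite_eq', Finset.mem_univ, if_true, ite_mul, zero_mul]

theorem signedPerm_conj_diagonal (σ : Equiv.Perm (Fin 3)) (η η' d : Fin 3 → ℝ) :
    signedPerm σ η * diagonal d * (signedPerm σ η')ᵀ = diagonal fun i => η i * d (σ i) * η' i := by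
  ext i j
  rw [signedPerm_conj_apply, Matrix.diagonal_apply, Matrix.diagonal_apply]
  by_cases h : i = j
  · subst h; simp
  · rw [if_neg (fun h' => h (σ.injective h')), if_neg h]; simp

theorem signedPerm_mul_transpose (σ : Equiv.Perm (Fin 3)) {η : Fin 3 → ℝ}
    (hη : ∀ i, η i * η i = 1) : signedPerm σ η * (signedPerm σ η)ᵀ = 1 := by
  have h := signedPerm_conj_diagonal σ η η 1
  rw [show (diagonal 1 : Matrix (Fin 3) (Fin 3) ℝ) = 1 from Matrix.diagonal_one, Matrix.mul_one] at h
  rw [h, ← Matrix.diagonal_one]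
  congr 1
  funext i
  rw [Pi.one_apply, mul_one, hη]

/-- The sign of a permutation as a real number. -/
def rsign (σ : Equiv.Perm (Fin 3)) : ℝ := ((Equiv.Perm.sign σ : ℤ) : ℝ)

theorem perm_cases (σ : Equiv.Perm (Fin 3)) :
    (σ 0 = 0 ∧ σ 1 = 1 ∧ σ 2 = 2 ∧ rsign σ = 1) ∨ (σ 0 = 1 ∧ σ 1 = 2 ∧ σ 2 = 0 ∧ rsign σ = 1) ∨
    (σ 0 = 2 ∧ σ 1 = 0 ∧ σ 2 = 1 ∧ rsign σ = 1) ∨ (σ 0 = 1 ∧ σ 1 = 0 ∧ σ 2 = 2 ∧ rsign σ = -1) ∨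
    (σ 0 = 0 ∧ σ 1 = 2 ∧ σ 2 = 1 ∧ rsign σ = -1) ∨ (σ 0 = 2 ∧ σ 1 = 1 ∧ σ 2 = 0 ∧ rsign σ = -1) := by
  have h : ∀ σ : Equiv.Perm (Fin 3),
      (σ 0 = 0 ∧ σ 1 = 1 ∧ σ 2 = 2 ∧ Equiv.Perm.sign σ = 1) ∨
      (σ 0 = 1 ∧ σ 1 = 2 ∧ σ 2 = 0 ∧ Equiv.Perm.sign σ = 1) ∨
      (σ 0 = 2 ∧ σ 1 = 0 ∧ σ 2 = 1 ∧ Equiv.Perm.sign σ = 1) ∨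
      (σ 0 = 1 ∧ σ 1 = 0 ∧ σ 2 = 2 ∧ Equiv.Perm.sign σ = -1) ∨
      (σ 0 = 0 ∧ σ 1 = 2 ∧ σ 2 = 1 ∧ Equiv.Perm.sign σ = -1) ∨
      (σ 0 = 2 ∧ σ 1 = 1 ∧ σ 2 = 0 ∧ Equiv.Perm.sign σ = -1) := by decide
  rcases h σ with ⟨a, b, c, d⟩ | ⟨a, b, c, d⟩ | ⟨a, b, c, d⟩ | ⟨a, b, c, d⟩ | ⟨a, b, c, d⟩ |
    ⟨a, b, c, d⟩ <;> simp [a, b, c, rsign, d]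

theorem rsign_mul_self (σ : Equiv.Perm (Fin 3)) : rsign σ * rsign σ = 1 := by
  rcases perm_cases σ with h | h | h | h | h | h <;> simp [h]

theorem signedPerm_det (σ : Equiv.Perm (Fin 3)) (η : Fin 3 → ℝ) :
    (signedPerm σ η).det = rsign σ * (η 0 * η 1 * η 2) := by
  rw [Matrix.det_fin_three]
  simp only [signedPerm_apply]
  rcases perm_cases σ with ⟨a, b, c, d⟩ | ⟨a, b, c, d⟩ | ⟨a, b, c, d⟩ | ⟨a, b, c, d⟩ | ⟨a, b, c, d⟩ |
    ⟨a, b, c, d⟩ <;> simp [a, b, c, d]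

/-- Conjugation by a rotation of the octahedron in terms of the parameters. -/
theorem signedPerm_conj_ofParams (σ : Equiv.Perm (Fin 3)) {ε : Fin 3 → ℝ}
    (hε : ∀ i, ε i * ε i = 1) (hp : ε 0 * ε 1 * ε 2 = 1) (p t : Fin 3 → ℝ) :
    signedPerm σ (rsign σ • ε) * (ofParams p t : Matrix (Fin 3) (Fin 3) ℝ) *
      (signedPerm σ (rsign σ • ε))ᵀ =
    rsign σ • (ofParams (p ∘ σ) (ε * (t ∘ σ)) : Matrix (Fin 3) (Fin 3) ℝ) := by
  have h01 : ε 0 * ε 1 = ε 2 := by linear_combination ε 2 * hp - ε 0 * ε 1 * hε 2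
  have h12 : ε 1 * ε 2 = ε 0 := by linear_combination ε 0 * hp - ε 1 * ε 2 * hε 0
  have h02 : ε 0 * ε 2 = ε 1 := by linear_combination ε 1 * hp - ε 0 * ε 2 * hε 1
  have h0 := hε 0
  have h1 := hε 1
  have h2 := hε 2
  ext i j
  rw [signedPerm_conj_apply, Matrix.smul_apply, coe_ofParams, coe_ofParams, Pi.smul_apply,
    Pi.smul_apply, smul_eq_mul, smul_eq_mul, smul_eq_mul,
    show ∀ x a y : ℝ, rsign σ * x * a * (rsign σ * y) = rsign σ * rsign σ * (x * y * a) from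
      fun _ _ _ => by ring, rsign_mul_self, one_mul]
  rcases perm_cases σ with ⟨a, b, c, d⟩ | ⟨a, b, c, d⟩ | ⟨a, b, c, d⟩ | ⟨a, b, c, d⟩ | ⟨a, b, c, d⟩ |
    ⟨a, b, c, d⟩ <;> fin_cases i <;> fin_cases j <;>
    simp only [Fin.zero_eta, Fin.mk_one, Fin.reduceFinMk, a, b, c, d, Matrix.of_apply,
      Matrix.cons_val', Matrix.cons_val, Function.comp_apply, Pi.mul_apply, h0, h1, h2, h01, h02,
      h12, mul_comm (ε 1) (ε 0), mul_comm (ε 2) (ε 0), mul_comm (ε 2) (ε 1)] <;> ring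

theorem mulVec_signedPerm_single (σ : Equiv.Perm (Fin 3)) (η : Fin 3 → ℝ) (i : Fin 3) :
    (signedPerm σ η).mulVec (Pi.single (σ i) 1) = η i • Pi.single i 1 := by
  ext k
  simp only [Matrix.mulVec_single, MulOpposite.op_one, one_smul, Matrix.col_apply, signedPerm_apply,
    Pi.smul_apply, Pi.single_apply, smul_eq_mul, mul_ite, mul_one, mul_zero, σ.injective.eq_iff]
  by_cases h : k = i
  · subst h; simp
  · rw [if_neg (Ne.symm h), if_neg h]

theorem coe_inv_specialOrthogonal (Q : Matrix.specialOrthogonalGroup (Fin 3) ℝ) :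
    ((Q⁻¹ : Matrix.specialOrthogonalGroup (Fin 3) ℝ) : Matrix (Fin 3) (Fin 3) ℝ) =
      (Q : Matrix (Fin 3) (Fin 3) ℝ)ᵀ := by
  have h1 : (Q : Matrix (Fin 3) (Fin 3) ℝ) * (Q : Matrix (Fin 3) (Fin 3) ℝ)ᵀ = 1 := by
    have := (Matrix.mem_specialOrthogonalGroup_iff.mp Q.2).1
    rw [Matrix.mem_orthogonalGroup_iff] at this
    simpa [Matrix.star_eq_conjTranspose] using this
  have h2 := congrArg Subtype.val (inv_mul_cancel Q)
  have h2' : ((Q⁻¹ : Matrix.specialOrthogonalGroup (Fin 3) ℝ) : Matrix (Fin 3) (Fin 3) ℝ) *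
    (Q : Matrix (Fin 3) (Fin 3) ℝ) = 1 := h2
  calc _ = ((Q⁻¹ : Matrix.specialOrthogonalGroup (Fin 3) ℝ) : Matrix (Fin 3) (Fin 3) ℝ) *
      ((Q : Matrix (Fin 3) (Fin 3) ℝ) * (Q : Matrix (Fin 3) (Fin 3) ℝ)ᵀ) := by
        rw [h1, Matrix.mul_one]
    _ = _ := by rw [← Matrix.mul_assoc, h2', Matrix.one_mul]

theorem neg_or_of_mul_self {a : ℝ} (h : a * a = 1) : a = 1 ∨ a = -1 := mul_self_eq_one_iff.mp h

theorem exists_octahedralGroup_eq (σ : Equiv.Perm (Fin 3)) {η : Fin 3 → ℝ}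
    (hη : ∀ i, η i * η i = 1) (hd : rsign σ * (η 0 * η 1 * η 2) = 1) :
    ∃ Q : octahedralGroup, ((Q : Matrix.specialOrthogonalGroup (Fin 3) ℝ) :
      Matrix (Fin 3) (Fin 3) ℝ) = signedPerm σ η := by
  have hmem : signedPerm σ η ∈ Matrix.specialOrthogonalGroup (Fin 3) ℝ := by
    rw [Matrix.mem_specialOrthogonalGroup_iff, Matrix.mem_orthogonalGroup_iff]
    refine ⟨?_, by rw [signedPerm_det, hd]⟩
    have := signedPerm_mul_transpose σ hη
    simpa [Matrix.star_eq_conjTranspose] using this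
  refine ⟨⟨⟨signedPerm σ η, hmem⟩, ?_⟩, rfl⟩
  change (fun v => (signedPerm σ η).mulVec v) '' octahedron = octahedron
  refine Set.Subset.antisymm ?_ ?_
  · rintro _ ⟨v, ⟨j, hv⟩, rfl⟩
    obtain ⟨i, rfl⟩ := σ.surjective j
    refine ⟨i, ?_⟩
    have h1 := mulVec_signedPerm_single σ η i
    rcases neg_or_of_mul_self (hη i) with h | h <;> rcases hv with rfl | rfl <;>
      simp [h1, h, Matrix.mulVec_neg]
  · rintro v ⟨i, hv⟩
    have h1 := mulVec_signedPerm_single σ η i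
    have h2 : (signedPerm σ η).mulVec (-Pi.single (σ i) 1) = -(η i • Pi.single i 1) := by
      rw [Matrix.mulVec_neg, h1]
    rcases neg_or_of_mul_self (hη i) with h | h <;> rcases hv with rfl | rfl
    · exact ⟨_, ⟨σ i, Or.inl rfl⟩, by simp [h1, h]⟩
    · exact ⟨_, ⟨σ i, Or.inr rfl⟩, by simp [h2, h]⟩
    · exact ⟨_, ⟨σ i, Or.inr rfl⟩, by simp [h2, h]⟩
    · exact ⟨_, ⟨σ i, Or.inl rfl⟩, by simp [h1, h]⟩

theorem octahedralGroup_eq_signedPerm (Q : octahedralGroup) :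
    ∃ (σ : Equiv.Perm (Fin 3)) (η : Fin 3 → ℝ), (∀ i, η i * η i = 1) ∧
      rsign σ * (η 0 * η 1 * η 2) = 1 ∧ ((Q : Matrix.specialOrthogonalGroup (Fin 3) ℝ) :
      Matrix (Fin 3) (Fin 3) ℝ) = signedPerm σ η := by
  set A : Matrix (Fin 3) (Fin 3) ℝ := ((Q : Matrix.specialOrthogonalGroup (Fin 3) ℝ) :
      Matrix (Fin 3) (Fin 3) ℝ) with hA
  have hmem := Matrix.mem_specialOrthogonalGroup_iff.mp
    (Q : Matrix.specialOrthogonalGroup (Fin 3) ℝ).2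
  have hAA : Aᵀ * A = 1 := by
    have := hmem.1
    rw [Matrix.mem_orthogonalGroup_iff'] at this
    simpa [Matrix.star_eq_conjTranspose] using this
  have hQ : (fun v => A.mulVec v) '' octahedron = octahedron := Q.2
  have hcol : ∀ j, ∃ i, ∃ s : ℝ, s * s = 1 ∧ ∀ k, A k j = if k = i then s else 0 := by
    intro j
    have : A.mulVec (Pi.single j 1) ∈ octahedron := by
      rw [← hQ]; exact ⟨_, ⟨j, Or.inl rfl⟩, rfl⟩
    obtain ⟨i, hi⟩ := this
    rcases hi with hi | hi
    · refine ⟨i, 1, by norm_num, fun k => ?_⟩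
      have := congrFun hi k
      simpa [Pi.single_apply] using this
    · refine ⟨i, -1, by norm_num, fun k => ?_⟩
      have := congrFun hi k
      simp only [Matrix.mulVec_single, MulOpposite.op_one, one_smul, Matrix.col_apply, Pi.neg_apply,
        Pi.single_apply] at this
      rw [this]; split_ifs <;> simp
  choose τ s hs hτ using hcol
  have hinj : Function.Injective τ := by
    intro j j' h
    by_contra hne
    have h1 := congrFun (congrFun hAA j) j'
    rw [Matrix.one_apply_ne hne, Matrix.mul_apply] at h1
    simp only [Matrix.transpose_apply, hτ, h, ite_mul, zero_mul, Finset.sum_ite_eq',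
      Finset.mem_univ, if_true] at h1
    rcases mul_eq_zero.mp h1 with h2 | h2
    · have := hs j; rw [h2] at this; simp at this
    · have := hs j'; rw [h2] at this; simp at this
  set σ' : Equiv.Perm (Fin 3) := Equiv.ofBijective τ (Finite.injective_iff_bijective.mp hinj)
  have hAeq : A = signedPerm σ'.symm (s ∘ σ'.symm) := by
    ext k j
    rw [signedPerm_apply, hτ]
    by_cases h : k = τ j
    · have : σ'.symm k = j := by rw [Equiv.symm_apply_eq]; exact h
      rw [if_pos h, if_pos this.symm, Function.comp_apply, this]
    · have : j ≠ σ'.symm k := fun h' => h (by rw [h']; exact (σ'.apply_symm_apply k).symm)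
      rw [if_neg h, if_neg this]
  refine ⟨σ'.symm, s ∘ σ'.symm, fun i => hs _, ?_, hAeq⟩
  rw [← signedPerm_det, ← hAeq]
  exact hmem.2

theorem isConj_iff {Q : octahedralGroup} {M M' : KSSpace} : IsConj Q M M' ↔
    (M' : Matrix (Fin 3) (Fin 3) ℝ) =
    ((Q : Matrix.specialOrthogonalGroup (Fin 3) ℝ) : Matrix (Fin 3) (Fin 3) ℝ) * M *
      (((Q : Matrix.specialOrthogonalGroup (Fin 3) ℝ) : Matrix (Fin 3) (Fin 3) ℝ))ᵀ := by
  rw [IsConj, Subgroup.coe_inv, coe_inv_specialOrthogonal]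

/-- Every equivalence of parameters is induced by a rotation of the octahedron. -/
theorem exists_isConj (σ : Equiv.Perm (Fin 3)) {ε : Fin 3 → ℝ}
    (hε : ∀ i, ε i * ε i = 1) (hp : ε 0 * ε 1 * ε 2 = 1) :
    ∃ Q : octahedralGroup, ∀ p t : Fin 3 → ℝ,
      IsConj Q (rsign σ • ofParams p t) (ofParams (p ∘ σ) (ε * (t ∘ σ))) := by
  have hs := rsign_mul_self σ
  obtain ⟨Q, hQ⟩ := exists_octahedralGroup_eq σ (η := rsign σ • ε)
    (fun i => by simp only [Pi.smul_apply, smul_eq_mul]; linear_combination hε i + ε i * ε i * hs)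
    (by simp only [Pi.smul_apply, smul_eq_mul]
        linear_combination rsign σ ^ 4 * hp + (rsign σ * rsign σ + 1) * hs)
  refine ⟨Q, fun p t => ?_⟩
  rw [isConj_iff, hQ, Submodule.coe_smul, Matrix.mul_smul, Matrix.smul_mul,
    signedPerm_conj_ofParams σ hε hp, smul_smul, hs, one_smul]

/-- Every rotation of the octahedron acts by an equivalence of parameters. -/
theorem exists_perm_of_octahedralGroup (Q : octahedralGroup) :
    ∃ (σ : Equiv.Perm (Fin 3)) (ε : Fin 3 → ℝ), (∀ i, ε i * ε i = 1) ∧ ε 0 * ε 1 * ε 2 = 1 ∧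
      ∀ p t : Fin 3 → ℝ, IsConj Q (ofParams p t) (rsign σ • ofParams (p ∘ σ) (ε * (t ∘ σ))) := by
  obtain ⟨σ, η, hη, hd, hQ⟩ := octahedralGroup_eq_signedPerm Q
  have hs := rsign_mul_self σ
  have hε : ∀ i, (rsign σ • η) i * (rsign σ • η) i = 1 := fun i => by
    simp only [Pi.smul_apply, smul_eq_mul]; linear_combination hη i + η i * η i * hs
  have hp : (rsign σ • η) 0 * (rsign σ • η) 1 * (rsign σ • η) 2 = 1 := by
    simp only [Pi.smul_apply, smul_eq_mul]
    linear_combination rsign σ ^ 2 * hd + hs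
  refine ⟨σ, rsign σ • η, hε, hp, fun p t => ?_⟩
  rw [isConj_iff, hQ, Submodule.coe_smul, ← signedPerm_conj_ofParams σ hε hp, smul_smul, hs,
    one_smul]

end Octahedron

section Equivalence

open Polynomial in
theorem exists_perm_of_prod_eq {n : ℕ} {x y : Fin n → ℝ}
    (h : ∏ i, (X - C (x i)) = ∏ i, (X - C (y i))) : ∃ σ : Equiv.Perm (Fin n), y = x ∘ σ := by
  have hr : ∀ z : Fin n → ℝ, (∏ i, (X - C (z i))).roots = Finset.univ.val.map z := fun z => by
    rw [← Polynomial.roots_multiset_prod_X_sub_C (Finset.univ.val.map z), Multiset.map_map]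
    rfl
  have hm : Finset.univ.val.map y = Finset.univ.val.map x := by rw [← hr, ← hr, h]
  have hc : ∀ c : ℝ, Nonempty ({a // y a = c} ≃ {b // x b = c}) := fun c => by
    refine ⟨Fintype.equivOfCardEq ?_⟩
    have := congrArg (Multiset.count c) hm
    rw [Multiset.count_map, Multiset.count_map] at this
    rw [Fintype.card_subtype, Fintype.card_subtype]
    simpa [Finset.card_def, eq_comm] using this
  exact ⟨Equiv.ofFiberEquiv fun c => (hc c).some,
    funext fun a => (Equiv.ofFiberEquiv_map (fun c => (hc c).some) a).symm⟩

theorem exists_perm_of_conj_eq {n : ℕ} {x y : Fin n → ℝ} {U U' : Matrix (Fin n) (Fin n) ℝ}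
    (hU : U * Uᵀ = 1) (hU' : U' * U'ᵀ = 1)
    (h : U * diagonal x * Uᵀ = U' * diagonal y * U'ᵀ) : ∃ σ : Equiv.Perm (Fin n), y = x ∘ σ := by
  refine exists_perm_of_prod_eq ?_
  have key : ∀ (W : Matrix (Fin n) (Fin n) ℝ) (z : Fin n → ℝ), W * Wᵀ = 1 →
      (W * diagonal z * Wᵀ).charpoly = ∏ i, (Polynomial.X - Polynomial.C (z i)) := fun W z hW => by
    rw [Matrix.charpoly_mul_comm, ← Matrix.mul_assoc, mul_eq_one_comm.mp hW, Matrix.one_mul,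
      Matrix.charpoly_diagonal]
  rw [← key U x hU, h, key U' y hU']

theorem exists_perm_of_blocks_eq {p t p' t' : Fin 3 → ℝ} {U V U' V' : Matrix (Fin 3) (Fin 3) ℝ}
    (hU : U * Uᵀ = 1) (hUd : U.det = 1) (hV : V * Vᵀ = 1) (hVd : V.det = 1)
    (hU' : U' * U'ᵀ = 1) (hUd' : U'.det = 1) (hV' : V' * V'ᵀ = 1) (hVd' : V'.det = 1)
    (hp : U * diagonal p * Uᵀ = U' * diagonal p' * U'ᵀ)
    (ht : U * diagonal t * Vᵀ = U' * diagonal t' * V'ᵀ) :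
    ∃ (σ : Equiv.Perm (Fin 3)) (ε : Fin 3 → ℝ), (∀ i, ε i * ε i = 1) ∧ ε 0 * ε 1 * ε 2 = 1 ∧
      p' = p ∘ σ ∧ t' = ε * (t ∘ σ) := by
  have ht2 : U * diagonal (t * t) * Uᵀ = U' * diagonal (t' * t') * U'ᵀ := by
    have key : ∀ (W Z : Matrix (Fin 3) (Fin 3) ℝ) (z : Fin 3 → ℝ), Z * Zᵀ = 1 →
        W * diagonal z * Zᵀ * (W * diagonal z * Zᵀ)ᵀ = W * diagonal (z * z) * Wᵀ :=
      fun W Z z hZ => by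
        rw [Matrix.transpose_mul, Matrix.transpose_mul, Matrix.transpose_transpose,
          Matrix.diagonal_transpose, Matrix.mul_assoc, ← Matrix.mul_assoc Zᵀ,
          mul_eq_one_comm.mp hZ, Matrix.one_mul, ← Matrix.mul_assoc, Matrix.mul_assoc W,
          Matrix.diagonal_mul_diagonal]
        rfl
    rw [← key U V t hV, ht, key U' V' t' hV']
  have hdet : t 0 * t 1 * t 2 = t' 0 * t' 1 * t' 2 := by
    have := congrArg Matrix.det ht
    simpa [Matrix.det_mul, Matrix.det_transpose, hUd, hVd, hUd', hVd', Fin.prod_univ_three] using this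
  have hl : ∀ n : ℕ, ∃ σ : Equiv.Perm (Fin 3),
      p' + (n : ℝ) • (t' * t') = (p + (n : ℝ) • (t * t)) ∘ σ := fun n => by
    refine exists_perm_of_conj_eq hU hU' ?_
    have key : ∀ (W : Matrix (Fin 3) (Fin 3) ℝ) (a b : Fin 3 → ℝ),
        W * diagonal (a + (n : ℝ) • b) * Wᵀ = W * diagonal a * Wᵀ + (n : ℝ) • (W * diagonal b * Wᵀ) :=
      fun W a b => by
        rw [show diagonal (a + (n : ℝ) • b) = diagonal a + (n : ℝ) • diagonal b by
          rw [← Matrix.diagonal_smul, Matrix.diagonal_add]; rfl, Matrix.mul_add, Matrix.add_mul,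
          Matrix.mul_smul, Matrix.smul_mul]
    rw [key, key, hp, ht2]
  choose τ hτ using hl
  obtain ⟨n, m, hnm, hστ⟩ := Finite.exists_ne_map_eq_of_infinite τ
  have hne : (n : ℝ) - m ≠ 0 := sub_ne_zero.mpr (by exact_mod_cast hnm)
  set σ := τ n
  have h1 := fun i => congrFun (hτ n) i
  have h2 := fun i => congrFun (hτ m) i
  rw [← hστ] at h2
  simp only [Pi.add_apply, Pi.smul_apply, Pi.mul_apply, smul_eq_mul, Function.comp_apply] at h1 h2
  have ht' : ∀ i, t' i * t' i = t (σ i) * t (σ i) := fun i => by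
    have : ((n : ℝ) - m) * (t' i * t' i - t (σ i) * t (σ i)) = 0 := by linarith [h1 i, h2 i]
    rcases mul_eq_zero.mp this with h | h
    · exact absurd h hne
    · linarith
  have hp' : p' = p ∘ σ := funext fun i => by
    have := h1 i
    rw [ht' i] at this
    simp only [Function.comp_apply]; linarith
  have hsig : ∀ i, ∃ s : ℝ, s * s = 1 ∧ t' i = s * t (σ i) := fun i => by
    rcases mul_self_eq_mul_self_iff.mp (ht' i) with h | h
    · exact ⟨1, by norm_num, by rw [h, one_mul]⟩
    · exact ⟨-1, by norm_num, by rw [h]; ring⟩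
  choose ε hε hεt using hsig
  have hprod : t (σ 0) * t (σ 1) * t (σ 2) = t 0 * t 1 * t 2 := by
    rcases perm_cases σ with ⟨a, b, c, d⟩ | ⟨a, b, c, d⟩ | ⟨a, b, c, d⟩ | ⟨a, b, c, d⟩ |
      ⟨a, b, c, d⟩ | ⟨a, b, c, d⟩ <;> rw [a, b, c] <;> ring
  by_cases hz : ∃ i, t (σ i) = 0
  · obtain ⟨i, hi⟩ := hz
    set π := ε 0 * ε 1 * ε 2 with hπ
    have hππ : π * π = 1 := by
      rw [hπ]
      linear_combination (ε 1 * ε 1 * (ε 2 * ε 2)) * hε 0 + ε 2 * ε 2 * hε 1 + hε 2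
    refine ⟨σ, Function.update ε i (π * ε i), fun j => ?_, ?_, hp', funext fun j => ?_⟩
    · by_cases h : j = i
      · subst h; simp only [Function.update_self]; linear_combination hε j + ε j * ε j * hππ
      · rw [Function.update_of_ne h]; exact hε j
    · fin_cases i <;> simp <;> linear_combination hππ
    · by_cases h : j = i
      · subst h; rw [hεt j, Pi.mul_apply, Function.comp_apply, hi]; simp
      · rw [Pi.mul_apply, Function.update_of_ne h]; exact hεt j
  · push Not at hz
    refine ⟨σ, ε, hε, ?_, hp', funext fun j => hεt j⟩
    rw [hεt, hεt, hεt, ← hprod] at hdet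
    have hne' : t (σ 0) * t (σ 1) * t (σ 2) ≠ 0 :=
      mul_ne_zero (mul_ne_zero (hz 0) (hz 1)) (hz 2)
    have : (ε 0 * ε 1 * ε 2 - 1) * (t (σ 0) * t (σ 1) * t (σ 2)) = 0 := by linarith
    rcases mul_eq_zero.mp this with h | h
    · linarith
    · exact absurd h hne'

end Equivalence


open Matrix

section Equivariance

theorem pushforward_symm_pushforward (φ : E4 ≃ₗᵢ[ℝ] E4) (K : EndoField E4) :
    pushforward φ.symm (pushforward φ K) = K := by
  rw [pushforward_pushforward, LinearIsometryEquiv.self_trans_symm, pushforward_refl]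

theorem IsKilling.pushforward {K : EndoField E4} (h : IsKilling K) (φ : E4 ≃ₗᵢ[ℝ] E4) :
    IsKilling (pushforward φ K) := by
  obtain ⟨C, hC, rfl⟩ := h.exists_eq_fieldOf
  rw [pushforward_fieldOf]
  exact isKilling_fieldOf (hC.pull _)

theorem IsIntegrable.pushforward {K : EndoField E4} (hK : IsKilling K) (h : IsIntegrable K)
    (φ : E4 ≃ₗᵢ[ℝ] E4) : IsIntegrable (pushforward φ K) := by
  obtain ⟨C, hC, rfl⟩ := hK.exists_eq_fieldOf
  have h1 := (isIntegrable_iff sphereFrame sphereFrame_zero hC (isField_fieldOf C)).mp h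
  rw [isIntegrable_iff (fun x => (sphereFrame ⟨φ.symm (x : E4), by simp⟩).map φ) ?_ (hC.pull _)
    ((isField_fieldOf C).pushforward φ)]
  · intro x
    have h2 := h1 ⟨φ.symm (x : E4), by simp⟩
    have hk : kMat (C.push φ) ((sphereFrame ⟨φ.symm (x : E4), by simp⟩).map φ) =
        kMat C (sphereFrame ⟨φ.symm (x : E4), by simp⟩) := by
      ext α β; simp [kMat]
    have hb : bMat (C.push φ) ((sphereFrame ⟨φ.symm (x : E4), by simp⟩).map φ) =
        bMat C (sphereFrame ⟨φ.symm (x : E4), by simp⟩) := by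
      ext α β; simp [bMat]
    rw [firstObstruction, secondObstruction] at h2 ⊢
    rw [hk, hb]
    exact h2
  · intro x
    rw [OrthonormalBasis.map_apply, ← sphereFrame_zero]
    exact (φ.apply_symm_apply _).symm

theorem exists_params (M : KSSpace) : ∃ p t, M = ofParams p t :=
  ⟨wVec M, tVec M, (ofParams_vec M).symm⟩

theorem eq_ofParams_add_const {p t p' t' : Fin 3 → ℝ} (h : ofParams p t = ofParams p' t') :
    ∃ c : ℝ, p' = (fun i => p i + c) ∧ t' = t := by
  have h1 : tVec (ofParams p t) = tVec (ofParams p' t') := by rw [h]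
  rw [tVec_ofParams, tVec_ofParams] at h1
  have h2 := congrArg Subtype.val h
  rw [coe_ofParams, coe_ofParams] at h2
  have a := congrFun (congrFun h2 0) 0
  have b := congrFun (congrFun h2 1) 1
  simp only [Matrix.of_apply, Matrix.cons_val', Matrix.cons_val] at a b
  refine ⟨p' 0 - p 0, funext fun i => ?_, h1.symm⟩
  fin_cases i <;> simp <;> linarith

/-- The blocks of the curvature tensor of a field which some isometry makes diagonal. -/
theorem exists_blocks_of_hasKSMatrix {K : EndoField E4} {M : KSSpace} {φ : E4 ≃ₗᵢ[ℝ] E4}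
    (h : HasKSMatrix (pushforward φ K) M) : ∃ (C : Tensor4 E4) (U V : Matrix (Fin 3) (Fin 3) ℝ)
      (p t : Fin 3 → ℝ), IsCurv C ∧ K = fieldOf C ∧ M = ofParams p t ∧
      U * Uᵀ = 1 ∧ U.det = 1 ∧ V * Vᵀ = 1 ∧ V.det = 1 ∧
      blockP C e = U * diagonal p * Uᵀ ∧ blockT C e = U * diagonal t * Vᵀ ∧
      blockD C e = V * diagonal p * Vᵀ := by
  obtain ⟨p, t, hK, rfl⟩ := hasKSMatrix_iff_params.mp h
  have hC := isCurv_diagCurv (secMat p t)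
  have hK' : K = fieldOf ((diagCurv (secMat p t)).push φ.symm) := by
    rw [← pushforward_fieldOf, ← hK, pushforward_symm_pushforward]
  obtain ⟨U, V, hU, hUd, hV, hVd, hb | hb⟩ := exists_push_blocks φ.symm
  · obtain ⟨h1, h2, h3⟩ := hb _ hC
    rw [blockP_diagCurv] at h1
    rw [blockT_diagCurv] at h2
    rw [blockD_diagCurv] at h3
    exact ⟨_, U, V, p, t, hC.pull _, hK', rfl, hU, hUd, hV, hVd, h1, h2, h3⟩
  · obtain ⟨h1, h2, h3⟩ := hb _ hC
    rw [blockD_diagCurv] at h1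
    rw [blockT_diagCurv] at h2
    rw [blockP_diagCurv] at h3
    refine ⟨_, V, U, p, t, hC.pull _, hK', rfl, hV, hVd, hU, hUd, h1, ?_, h3⟩
    rw [h2, Matrix.transpose_mul, Matrix.transpose_mul, Matrix.transpose_transpose,
      Matrix.diagonal_transpose, Matrix.mul_assoc]

theorem HasKSMatrix.exists_perm {K : EndoField E4} {M M' : KSSpace} {φ φ' : E4 ≃ₗᵢ[ℝ] E4}
    (h : HasKSMatrix (pushforward φ K) M) (h' : HasKSMatrix (pushforward φ' K) M') :
    ∃ (σ : Equiv.Perm (Fin 3)) (ε p t : Fin 3 → ℝ), (∀ i, ε i * ε i = 1) ∧ ε 0 * ε 1 * ε 2 = 1 ∧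
      M = ofParams p t ∧ M' = ofParams (p ∘ σ) (ε * (t ∘ σ)) := by
  obtain ⟨C, U, V, p, t, hC, rfl, rfl, hU, hUd, hV, hVd, hP, hT, -⟩ :=
    exists_blocks_of_hasKSMatrix h
  obtain ⟨C', U', V', p', t', hC', hK, rfl, hU', hUd', hV', hVd', hP', hT', -⟩ :=
    exists_blocks_of_hasKSMatrix h'
  obtain rfl := fieldOf_injective hC hC' hK
  rw [hP] at hP'
  rw [hT] at hT'
  obtain ⟨σ, ε, hε, hp, rfl, rfl⟩ :=
    exists_perm_of_blocks_eq hU hUd hV hVd hU' hUd' hV' hVd' hP' hT'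
  exact ⟨σ, ε, p, t, hε, hp, rfl, rfl⟩

theorem exists_isometry_perm (σ : Equiv.Perm (Fin 3)) {ε : Fin 3 → ℝ}
    (hε : ∀ i, ε i * ε i = 1) (hp : ε 0 * ε 1 * ε 2 = 1) :
    ∃ φ : E4 ≃ₗᵢ[ℝ] E4, ∀ (K : EndoField E4) (p t : Fin 3 → ℝ), HasKSMatrix K (ofParams p t) →
      HasKSMatrix (pushforward φ K) (ofParams (p ∘ σ) (ε * (t ∘ σ))) := by
  have hs := rsign_mul_self σ
  have hη : ∀ i, (rsign σ • ε) i * (rsign σ • ε) i = 1 := fun i => by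
    simp only [Pi.smul_apply, smul_eq_mul]; linear_combination hε i + ε i * ε i * hs
  obtain ⟨φ, hφ⟩ := exists_isometry_blocks (U := signedPerm σ fun _ => rsign σ)
    (V := signedPerm σ (rsign σ • ε)) (signedPerm_mul_transpose σ fun _ => hs)
    (by rw [signedPerm_det]; linear_combination (rsign σ * rsign σ + 1) * hs)
    (signedPerm_mul_transpose σ hη)
    (by rw [signedPerm_det]; simp only [Pi.smul_apply, smul_eq_mul]
        linear_combination rsign σ ^ 4 * hp + (rsign σ * rsign σ + 1) * hs)
  refine ⟨φ, fun K p t hK => ?_⟩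
  obtain ⟨p', t', rfl, h'⟩ := hasKSMatrix_iff_params.mp hK
  obtain ⟨c, rfl, rfl⟩ := eq_ofParams_add_const h'
  have hC := isCurv_diagCurv (secMat (fun i => p i + c) t')
  obtain ⟨h1, h2, h3⟩ := hφ _ hC
  refine hasKSMatrix_iff_params.mpr ⟨(fun i => p i + c) ∘ σ, ε * (t' ∘ σ), ?_,
    (ofParams_add_const (p ∘ σ) _ c).symm⟩
  rw [pushforward_fieldOf]
  congr 1
  refine eq_of_blocks (hC.pull _) (isCurv_diagCurv _) ?_ ?_ ?_
  · refine h1.trans ?_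
    rw [blockP_diagCurv, blockP_diagCurv, signedPerm_conj_diagonal]
    congr 1; funext i
    simp only [Function.comp_apply]; linear_combination (p (σ i) + c) * hs
  · refine h2.trans ?_
    rw [blockT_diagCurv, blockT_diagCurv, signedPerm_conj_diagonal]
    congr 1; funext i
    simp only [Function.comp_apply, Pi.smul_apply, smul_eq_mul, Pi.mul_apply]
    linear_combination (t' (σ i) * ε i) * hs
  · refine h3.trans ?_
    rw [blockD_diagCurv, blockD_diagCurv, signedPerm_conj_diagonal]
    congr 1; funext i
    simp only [Function.comp_apply]; linear_combination (p (σ i) + c) * hη i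

end Equivariance

section QuotientBijection

theorem HasKSMatrix.smul {K : EndoField E4} {M : KSSpace} (h : HasKSMatrix K M) (c a : ℝ) :
    HasKSMatrix (c • K + a • metric E4) (c • M) := by
  obtain ⟨b, rfl⟩ := hasKSMatrix_iff.mp h
  refine hasKSMatrix_iff.mpr ⟨c * b + a, ?_⟩
  rw [map_smul]; module

theorem IsConj.right_unique {Q : octahedralGroup} {M M' M'' : KSSpace} (h : IsConj Q M M')
    (h' : IsConj Q M M'') : M' = M'' :=
  Subtype.ext (Eq.trans h (Eq.symm h'))

theorem IsConj.smul {Q : octahedralGroup} {M M' : KSSpace} (h : IsConj Q M M') (c : ℝ) :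
    IsConj Q (c • M) (c • M') := by
  rw [isConj_iff] at h ⊢
  rw [Submodule.coe_smul, Submodule.coe_smul, h, Matrix.mul_smul, Matrix.smul_mul]

theorem rsign_ne_zero (σ : Equiv.Perm (Fin 3)) : rsign σ ≠ 0 := fun h => by
  have := rsign_mul_self σ
  rw [h] at this; simp at this

/-- The action of a rotation of the octahedron is induced by an isometry, up to sign. -/
theorem IsConj.exists_isometry {Q : octahedralGroup} {M M' : KSSpace} (h : IsConj Q M M') :
    ∃ (φ : E4 ≃ₗᵢ[ℝ] E4) (s : ℝ), s ≠ 0 ∧ ∀ K : EndoField E4, HasKSMatrix K M →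
      HasKSMatrix (pushforward φ K) (s • M') := by
  obtain ⟨σ, ε, hε, hp, hQ⟩ := exists_perm_of_octahedralGroup Q
  obtain ⟨p, t, rfl⟩ := exists_params M
  obtain rfl := h.right_unique (hQ p t)
  obtain ⟨φ, hφ⟩ := exists_isometry_perm σ hε hp
  refine ⟨φ, rsign σ, rsign_ne_zero σ, fun K hK => ?_⟩
  rw [smul_smul, rsign_mul_self, one_smul]
  exact hφ K p t hK

theorem HasKSMatrix.exists_isConj {K : EndoField E4} {M M' : KSSpace} {φ φ' : E4 ≃ₗᵢ[ℝ] E4}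
    (h : HasKSMatrix (pushforward φ K) M) (h' : HasKSMatrix (pushforward φ' K) M') :
    ∃ (Q : octahedralGroup) (s : ℝ), s ≠ 0 ∧ IsConj Q (s • M) M' := by
  obtain ⟨σ, ε, p, t, hε, hp, rfl, rfl⟩ := h.exists_perm h'
  obtain ⟨Q, hQ⟩ := KillingStaeckel.exists_isConj σ hε hp
  exact ⟨Q, rsign σ, rsign_ne_zero σ, hQ p t⟩

theorem ksField_mem_killingCone (M : ksPunctured) : ksField M ∈ killingCone := by
  have h := hasKSMatrix_ksField (M : KSSpace)
  refine ⟨h.isKilling, h.isIntegrable_iff.mpr M.2.1, fun a ha => M.2.2 ?_⟩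
  refine (eq_zero_of_ksField_eq (b := -a) ?_).1
  rw [ha]; module

/-- The map from the quotient of the KS-variety to the quotient of the integrable Killing tensors. -/
def quotientMap : KSQuotient → KillingQuotient :=
  Quotient.map (fun M => ⟨ksField M, ksField_mem_killingCone M⟩) (by
    rintro M M' ⟨Q, c, hc, h⟩
    obtain ⟨φ, s, hs, hφ⟩ := h.exists_isometry
    have h1 := hφ _ ((hasKSMatrix_ksField (M : KSSpace)).smul c 0)
    obtain ⟨b, hb⟩ := hasKSMatrix_iff.mp h1
    rw [pushforward_affine, map_smul] at hb
    refine ⟨φ, s⁻¹ * c, -(s⁻¹ * b), mul_ne_zero (inv_ne_zero hs) hc, ?_⟩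
    change ksField M' = _
    have h2 : s⁻¹ • (c • pushforward φ (ksField M) + (0 : ℝ) • metric E4) =
        ksField M' + (s⁻¹ * b) • metric E4 := by
      rw [hb, smul_add, smul_smul, smul_smul, inv_mul_cancel₀ hs, one_smul]
    calc ksField M' = ksField M' + (s⁻¹ * b) • metric E4 - (s⁻¹ * b) • metric E4 := by abel
      _ = _ := by rw [← h2]; module)

theorem quotientMap_mk (M : ksPunctured) : quotientMap (Quotient.mk _ M) =
    Quotient.mk _ (⟨ksField M, ksField_mem_killingCone M⟩ : killingCone) := rfl

theorem mk_eq_quotientMap_iff (K : killingCone) (M : ksPunctured) :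
    Quotient.mk _ K = quotientMap (Quotient.mk _ M) ↔
      ∃ (φ : E4 ≃ₗᵢ[ℝ] E4) (c : ℝ), c ≠ 0 ∧
        HasKSMatrix (pushforward φ (K : EndoField E4)) (c • (M : KSSpace)) := by
  rw [quotientMap_mk, Quotient.eq]
  constructor
  · rintro ⟨φ, c, a, hc, h⟩
    change ksField M = _ at h
    refine ⟨φ, c⁻¹, inv_ne_zero hc, hasKSMatrix_iff.mpr ⟨-(c⁻¹ * a), ?_⟩⟩
    rw [map_smul, h, smul_add, smul_smul, smul_smul, inv_mul_cancel₀ hc, one_smul]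
    module
  · rintro ⟨φ, c, hc, h⟩
    obtain ⟨b, hb⟩ := hasKSMatrix_iff.mp h
    refine ⟨φ, c⁻¹, -(c⁻¹ * b), inv_ne_zero hc, ?_⟩
    change ksField M = _
    rw [hb, map_smul, smul_add, smul_smul, smul_smul, inv_mul_cancel₀ hc, one_smul]
    module

theorem exists_mem_ksPunctured (K : killingCone) :
    ∃ (φ : E4 ≃ₗᵢ[ℝ] E4) (M : ksPunctured), HasKSMatrix (pushforward φ (K : EndoField E4)) M := by
  obtain ⟨hK, hI, hne⟩ := K.2
  obtain ⟨φ, M, hM⟩ := hI.exists_hasKSMatrix hK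
  refine ⟨φ, ⟨M, hM.isIntegrable_iff.mp (hI.pushforward hK φ), ?_⟩, hM⟩
  rintro rfl
  obtain ⟨b, hb⟩ := hasKSMatrix_iff.mp hM
  refine hne b ?_
  rw [map_zero, zero_add] at hb
  have h1 := congrArg (pushforward φ.symm) hb
  rw [pushforward_symm_pushforward] at h1
  have h2 := pushforward_affine φ.symm (metric E4) 0 b
  rw [zero_smul, zero_add, zero_smul, zero_add] at h2
  rw [h1, h2]

theorem quotientMap_bijective : Function.Bijective quotientMap := by
  constructor
  · intro x y
    induction x using Quotient.inductionOn with | _ M => ?_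
    induction y using Quotient.inductionOn with | _ M' => ?_
    intro h
    rw [quotientMap_mk, mk_eq_quotientMap_iff] at h
    obtain ⟨φ, c, hc, h⟩ := h
    have h0 : HasKSMatrix (pushforward (LinearIsometryEquiv.refl ℝ E4) (ksField M)) M := by
      rw [pushforward_refl]; exact hasKSMatrix_ksField _
    obtain ⟨Q, s, hs, hQ⟩ := h0.exists_isConj h
    refine Quotient.sound ⟨Q, c⁻¹ * s, mul_ne_zero (inv_ne_zero hc) hs, ?_⟩
    have := hQ.smul c⁻¹
    rwa [smul_smul, smul_smul, inv_mul_cancel₀ hc, one_smul] at this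
  · intro x
    induction x using Quotient.inductionOn with | _ K => ?_
    obtain ⟨φ, M, hM⟩ := exists_mem_ksPunctured K
    exact ⟨Quotient.mk _ M, ((mk_eq_quotientMap_iff K M).mpr
      ⟨φ, 1, one_ne_zero, by rwa [one_smul]⟩).symm⟩

end QuotientBijection


open Matrix

section InvariantPolynomials

theorem IsPolynomialFun.comp_linear {E E' : Type*} [AddCommGroup E] [Module ℝ E] [AddCommGroup E']
    [Module ℝ E'] {f : E → ℝ} (hf : IsPolynomialFun f) (L : E' →ₗ[ℝ] E) :
    IsPolynomialFun fun x => f (L x) := by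
  refine Algebra.adjoin_induction (p := fun f _ => IsPolynomialFun fun x => f (L x)) ?_ ?_ ?_ ?_ hf
  · rintro _ ⟨l, rfl⟩
    exact Algebra.subset_adjoin ⟨l.comp L, rfl⟩
  · intro r
    exact (Algebra.adjoin ℝ _).algebraMap_mem r
  · intro f g _ _ h1 h2
    exact (Algebra.adjoin ℝ _).add_mem h1 h2
  · intro f g _ _ h1 h2
    exact (Algebra.adjoin ℝ _).mul_mem h1 h2

/-- Continuous homogeneous polynomial functions which are invariant under the addition of multiples
of the metric. -/
structure IsForm (n : ℕ) (F : EndoField E4 → ℝ) : Prop where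
  poly : IsPolynomialFun F
  cont : Continuous F
  homog : ∀ (c : ℝ) K, F (c • K) = c ^ n * F K
  inv : ∀ K (b : ℝ), F (K + b • metric E4) = F K

theorem IsForm.mul {n m : ℕ} {F G : EndoField E4 → ℝ} (hF : IsForm n F) (hG : IsForm m G) :
    IsForm (n + m) fun K => F K * G K where
  poly := (Algebra.adjoin ℝ _).mul_mem hF.poly hG.poly
  cont := hF.cont.mul hG.cont
  homog c K := by rw [hF.homog, hG.homog, pow_add]; ring
  inv K b := by rw [hF.inv, hG.inv]

theorem IsForm.add {n : ℕ} {F G : EndoField E4 → ℝ} (hF : IsForm n F) (hG : IsForm n G) :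
    IsForm n fun K => F K + G K where
  poly := (Algebra.adjoin ℝ _).add_mem hF.poly hG.poly
  cont := hF.cont.add hG.cont
  homog c K := by rw [hF.homog, hG.homog]; ring
  inv K b := by rw [hF.inv, hG.inv]

theorem isForm_const (c : ℝ) : IsForm 0 fun _ => c where
  poly := (Algebra.adjoin ℝ _).algebraMap_mem c
  cont := continuous_const
  homog := by simp
  inv _ _ := rfl

theorem IsForm.const_mul {n : ℕ} {F : EndoField E4 → ℝ} (hF : IsForm n F) (c : ℝ) :
    IsForm n fun K => c * F K := by
  simpa using (isForm_const c).mul hF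

theorem isForm_zero (n : ℕ) : IsForm n fun _ => 0 where
  poly := (Algebra.adjoin ℝ _).zero_mem
  cont := continuous_const
  homog := by simp
  inv _ _ := rfl

theorem IsForm.sum {ι : Type*} {n : ℕ} (s : Finset ι) {F : ι → EndoField E4 → ℝ}
    (hF : ∀ i ∈ s, IsForm n (F i)) : IsForm n fun K => ∑ i ∈ s, F i K := by
  classical
  induction s using Finset.induction_on with
  | empty => simpa using isForm_zero n
  | insert a s ha ih =>
    simp only [Finset.sum_insert ha]
    exact (hF a (Finset.mem_insert_self a s)).add (ih fun i hi => hF i (Finset.mem_insert_of_mem hi))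

/-- Matrices of forms. -/
def IsFormMat (n : ℕ) (A : EndoField E4 → Matrix (Fin 3) (Fin 3) ℝ) : Prop :=
  ∀ i j, IsForm n fun K => A K i j

theorem IsFormMat.mul {n m : ℕ} {A B : EndoField E4 → Matrix (Fin 3) (Fin 3) ℝ}
    (hA : IsFormMat n A) (hB : IsFormMat m B) : IsFormMat (n + m) fun K => A K * B K := fun i j => by
  simp only [Matrix.mul_apply]
  exact IsForm.sum _ fun k _ => (hA i k).mul (hB k j)

theorem IsFormMat.pow {n : ℕ} {A : EndoField E4 → Matrix (Fin 3) (Fin 3) ℝ} (hA : IsFormMat n A)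
    (k : ℕ) : IsFormMat (k * n) fun K => A K ^ k := by
  induction k with
  | zero =>
    intro i j
    simp only [pow_zero, zero_mul]
    exact isForm_const _
  | succ k ih =>
    simp only [pow_succ, Nat.succ_mul]
    exact ih.mul hA

theorem IsFormMat.trace {n : ℕ} {A : EndoField E4 → Matrix (Fin 3) (Fin 3) ℝ}
    (hA : IsFormMat n A) : IsForm n fun K => (A K).trace :=
  IsForm.sum _ fun i _ => hA i i

theorem IsFormMat.det {n : ℕ} {A : EndoField E4 → Matrix (Fin 3) (Fin 3) ℝ}
    (hA : IsFormMat n A) : IsForm (n + n + n) fun K => (A K).det := by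
  simp only [Matrix.det_apply']
  refine IsForm.sum _ fun σ _ => ?_
  simp only [Fin.prod_univ_three]
  exact (((hA _ _).mul (hA _ _)).mul (hA _ _)).const_mul _

/-- The value of the quadratic form of a field, extended to the ambient space. -/
def quadValue (y b d : E4) : EndoField E4 →ₗ[ℝ] ℝ where
  toFun K := ‖y‖ ^ 2 * ⟪radialExt K y b, d⟫
  map_add' K K' := by
    unfold radialExt
    split_ifs <;> simp [inner_add_left, mul_add]
  map_smul' c K := by
    unfold radialExt
    split_ifs <;> simp [real_inner_smul_left]; ring

theorem quadValue_fieldOf (C : Tensor4 E4) (y b d : E4) :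
    quadValue y b d (fieldOf C) = C y b y d := by
  by_cases hy : y = 0
  · simp [quadValue, hy]
  · change ‖y‖ ^ 2 * ⟪radialExt (fieldOf C) y b, d⟫ = _
    rw [(isField_fieldOf C).radialExt_inner hy b d]
    have : ‖y‖ ≠ 0 := norm_ne_zero_iff.mpr hy
    field_simp

theorem continuous_quadValue (y b d : E4) : Continuous (quadValue y b d) := by
  change Continuous fun K : EndoField E4 => ‖y‖ ^ 2 * ⟪radialExt K y b, d⟫
  unfold radialExt
  split_ifs
  · refine continuous_const.mul (Continuous.inner ?_ continuous_const)
    exact (continuous_apply _).clm_apply continuous_const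
  · exact continuous_const

/-- The component of the curvature tensor as a linear functional of the field. -/
def curvComp (a b c d : E4) : EndoField E4 →ₗ[ℝ] ℝ :=
  (1 / 3 : ℝ) • (quadValue (a + c) b d - quadValue a b d - quadValue c b d
    - (quadValue (b + c) a d - quadValue b a d - quadValue c a d))

theorem curvComp_fieldOf {C : Tensor4 E4} (hC : IsCurv C) (a b c d : E4) :
    curvComp a b c d (fieldOf C) = C a b c d := by
  simp only [curvComp, LinearMap.smul_apply, LinearMap.sub_apply, quadValue_fieldOf, map_add,
    LinearMap.add_apply, smul_eq_mul]
  have h1 := hC.bianchi d a b c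
  have h2 : C c b a d = C d a b c := by rw [hC.pair a d c b, hC.left, hC.right, neg_neg]
  have h3 : C c a b d = -C d b c a := by rw [hC.pair b d c a, hC.left]
  have h4 : C a b c d = -C d c a b := by rw [hC.pair, hC.left]
  have h5 := hC.left a b c d
  linear_combination (1 / 3) * h2 - (1 / 3) * h3 + (1 / 3) * h1 - (1 / 3) * h4 - (1 / 3) * h5

theorem continuous_curvComp (a b c d : E4) : Continuous (curvComp a b c d) := by
  have := continuous_quadValue
  change Continuous fun K => (1 / 3 : ℝ) • (quadValue (a + c) b d K - quadValue a b d K -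
    quadValue c b d K - (quadValue (b + c) a d K - quadValue b a d K - quadValue c a d K))
  fun_prop

/-- The blocks of the curvature operator as functions of the field. -/
def fieldBlock (σ τ : ℝ) (K : EndoField E4) : Matrix (Fin 3) (Fin 3) ℝ :=
  Matrix.of fun α β => (1 / 2) * (curvComp (e 0) (e α.succ) (e 0) (e β.succ) K +
    τ * curvComp (e 0) (e α.succ) (e (β + 1).succ) (e (β + 2).succ) K +
    σ * (curvComp (e (α + 1).succ) (e (α + 2).succ) (e 0) (e β.succ) K +
    τ * curvComp (e (α + 1).succ) (e (α + 2).succ) (e (β + 1).succ) (e (β + 2).succ) K))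

theorem fieldBlock_fieldOf {C : Tensor4 E4} (hC : IsCurv C) (σ τ : ℝ) :
    fieldBlock σ τ (fieldOf C) = block C e σ τ := by
  ext α β
  simp only [fieldBlock, Matrix.of_apply, curvComp_fieldOf hC]
  rfl

theorem fieldBlock_add_smul (σ τ : ℝ) (K K' : EndoField E4) (b : ℝ) :
    fieldBlock σ τ (K + b • K') = fieldBlock σ τ K + b • fieldBlock σ τ K' := by
  ext α β
  simp only [fieldBlock, Matrix.of_apply, map_add, map_smul, Matrix.add_apply, Matrix.smul_apply,
    smul_eq_mul]
  ring

theorem fieldBlock_smul (σ τ : ℝ) (K : EndoField E4) (b : ℝ) :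
    fieldBlock σ τ (b • K) = b • fieldBlock σ τ K := by
  ext α β
  simp only [fieldBlock, Matrix.of_apply, map_smul, Matrix.smul_apply, smul_eq_mul]
  ring

theorem continuous_fieldBlock (σ τ : ℝ) (α β : Fin 3) :
    Continuous fun K => fieldBlock σ τ K α β := by
  have := continuous_curvComp
  simp only [fieldBlock, Matrix.of_apply]
  fun_prop

theorem isPolynomialFun_linear {E : Type*} [AddCommGroup E] [Module ℝ E] (l : E →ₗ[ℝ] ℝ) :
    IsPolynomialFun fun x => l x :=
  Algebra.subset_adjoin ⟨l, rfl⟩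

theorem isPolynomialFun_fieldBlock (σ τ : ℝ) (α β : Fin 3) :
    IsPolynomialFun fun K => fieldBlock σ τ K α β :=
  isPolynomialFun_linear
    { toFun := fun K => fieldBlock σ τ K α β
      map_add' := fun K K' => by
        have := fieldBlock_add_smul σ τ K K' 1
        rw [one_smul, one_smul] at this
        rw [this]; rfl
      map_smul' := fun b K => by rw [fieldBlock_smul]; rfl }

theorem fieldBlock_metric (σ τ : ℝ) : fieldBlock σ τ (metric E4) =
    diagonal fun _ => (1 / 2) * (1 + σ * τ) := by
  rw [← fieldOf_gCurv, fieldBlock_fieldOf isCurv_gCurv, gCurv_eq_diagCurv, block_diagCurv]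
  congr 1; ext; simp

/-- The trace free part of the selfdual block. -/
def fieldW (K : EndoField E4) : Matrix (Fin 3) (Fin 3) ℝ :=
  fieldBlock 1 1 K - ((fieldBlock 1 1 K).trace / 3) • 1

theorem isFormMat_fieldW : IsFormMat 1 fieldW := fun i j => by
  have hp := isPolynomialFun_fieldBlock 1 1
  have hc := continuous_fieldBlock 1 1
  have hf : (fun K => fieldW K i j) = fun K => fieldBlock 1 1 K i j + (-(1 : Matrix (Fin 3) (Fin 3) ℝ) i j / 3) *
      (fieldBlock 1 1 K 0 0 + fieldBlock 1 1 K 1 1 + fieldBlock 1 1 K 2 2) := by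
    funext K
    simp only [fieldW, Matrix.sub_apply, Matrix.smul_apply, smul_eq_mul, Matrix.trace_fin_three]
    ring
  refine ⟨?_, ?_, fun c K => ?_, fun K b => ?_⟩
  · rw [hf]
    exact (Algebra.adjoin ℝ _).add_mem (hp i j) ((Algebra.adjoin ℝ _).mul_mem
      ((Algebra.adjoin ℝ _).algebraMap_mem _) ((Algebra.adjoin ℝ _).add_mem
        ((Algebra.adjoin ℝ _).add_mem (hp 0 0) (hp 1 1)) (hp 2 2)))
  · rw [hf]
    fun_prop
  · simp only [fieldW, fieldBlock_smul, Matrix.trace_smul, Matrix.sub_apply, Matrix.smul_apply,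
      smul_eq_mul]
    ring
  · simp only [fieldW, fieldBlock_add_smul, fieldBlock_metric, Matrix.trace_add, Matrix.trace_smul,
      Matrix.sub_apply, Matrix.smul_apply, smul_eq_mul, Matrix.add_apply, Matrix.trace_fin_three,
      Matrix.diagonal_apply, Matrix.one_apply, if_true]
    split_ifs <;> ring

theorem isFormMat_fieldT : IsFormMat 1 (fieldBlock 1 (-1)) := fun i j => by
  refine ⟨isPolynomialFun_fieldBlock _ _ _ _, continuous_fieldBlock _ _ _ _, fun c K => ?_,
    fun K b => ?_⟩
  · simp only [fieldBlock_smul, Matrix.smul_apply, smul_eq_mul, pow_one]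
  · rw [fieldBlock_add_smul, fieldBlock_metric]
    simp

/-- The polarised power sums of the pairs `(w_α, t_α²)`. -/
def powerForm (a b : ℕ) (K : EndoField E4) : ℝ :=
  (fieldW K ^ a * (fieldBlock 1 (-1) K * (fieldBlock 1 (-1) K)ᵀ) ^ b).trace

theorem isForm_powerForm (a b : ℕ) : IsForm (a + 2 * b) (powerForm a b) := by
  have hT : IsFormMat 1 fun K => (fieldBlock 1 (-1) K)ᵀ := fun i j => isFormMat_fieldT j i
  have := ((isFormMat_fieldW.pow a).mul ((isFormMat_fieldT.mul hT).pow b)).trace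
  rw [show a + 2 * b = a * 1 + b * (1 + 1) by ring]
  exact this

theorem conj_diagonal_pow {U : Matrix (Fin 3) (Fin 3) ℝ} (hU : U * Uᵀ = 1) (d : Fin 3 → ℝ) (a : ℕ) :
    (U * diagonal d * Uᵀ) ^ a = U * diagonal (d ^ a) * Uᵀ := by
  induction a with
  | zero =>
    rw [pow_zero, pow_zero, show (diagonal (1 : Fin 3 → ℝ)) = 1 from Matrix.diagonal_one,
      Matrix.mul_one, hU]
  | succ a ih =>
    rw [pow_succ, ih, ← Matrix.mul_assoc _ (U * diagonal d), conj_simp (mul_eq_one_comm.mp hU),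
      Matrix.diagonal_mul_diagonal, pow_succ]
    rfl

theorem HasKSMatrix.form_values {K : EndoField E4} {M : KSSpace} {φ : E4 ≃ₗᵢ[ℝ] E4}
    (h : HasKSMatrix (pushforward φ K) M) :
    (∀ a b, powerForm a b K = ∑ i, wVec M i ^ a * (tVec M i ^ 2) ^ b) ∧
      (fieldBlock 1 (-1) K).det = tVec M 0 * tVec M 1 * tVec M 2 := by
  obtain ⟨C, U, V, p, t, hC, rfl, rfl, hU, hUd, hV, hVd, hP, hT, -⟩ :=
    exists_blocks_of_hasKSMatrix h
  have hUU := mul_eq_one_comm.mp hU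
  have hT' : fieldBlock 1 (-1) (fieldOf C) = U * diagonal t * Vᵀ := by
    rw [fieldBlock_fieldOf hC]; exact hT
  have hP' : fieldBlock 1 1 (fieldOf C) = U * diagonal p * Uᵀ := by
    rw [fieldBlock_fieldOf hC]; exact hP
  rw [tVec_ofParams]
  have hw : wVec (ofParams p t) = fun i => p i - (p 0 + p 1 + p 2) / 3 := by
    rw [← ofParams_add_const p t (-((p 0 + p 1 + p 2) / 3)), wVec_ofParams (by ring)]
    rfl
  constructor
  · intro a b
    have hW : fieldW (fieldOf C) = U * diagonal (wVec (ofParams p t)) * Uᵀ := by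
      rw [fieldW, hP', trace_conj hUU, hw, Matrix.trace_diagonal, Fin.sum_univ_three]
      rw [show (diagonal fun i => p i - (p 0 + p 1 + p 2) / 3) =
        diagonal p - ((p 0 + p 1 + p 2) / 3) • (1 : Matrix (Fin 3) (Fin 3) ℝ) by
          rw [← Matrix.diagonal_one, ← Matrix.diagonal_smul, Matrix.diagonal_sub]
          congr 1; ext; simp]
      rw [Matrix.mul_sub, Matrix.sub_mul, Matrix.mul_smul, Matrix.smul_mul, Matrix.mul_one, hU]
    have hTT : fieldBlock 1 (-1) (fieldOf C) * (fieldBlock 1 (-1) (fieldOf C))ᵀ =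
        U * diagonal (t ^ 2) * Uᵀ := by
      rw [hT', Matrix.transpose_mul, Matrix.transpose_mul, Matrix.transpose_transpose,
        Matrix.diagonal_transpose, Matrix.mul_assoc, ← Matrix.mul_assoc Vᵀ, mul_eq_one_comm.mp hV,
        Matrix.one_mul, ← Matrix.mul_assoc, Matrix.mul_assoc U, Matrix.diagonal_mul_diagonal, sq]
      rfl
    rw [powerForm, hW, hTT, conj_diagonal_pow hU, conj_diagonal_pow hU,
      ← Matrix.mul_assoc _ (U * _), conj_simp hUU, trace_conj hUU, Matrix.diagonal_mul_diagonal,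
      Matrix.trace_diagonal]
    rfl
  · rw [hT', Matrix.det_mul, Matrix.det_mul, Matrix.det_transpose, hUd, hVd, Matrix.det_diagonal,
      Fin.prod_univ_three]
    ring

end InvariantPolynomials


open Matrix

section Extension

/-- The permutations of three letters. -/
def perm6 : Fin 6 → Equiv.Perm (Fin 3) :=
  ![1, Equiv.swap 0 1, Equiv.swap 0 2, Equiv.swap 1 2, Equiv.swap 0 1 * Equiv.swap 1 2,
    Equiv.swap 1 2 * Equiv.swap 0 1]

/-- The sign vectors with product one. -/
def sign4 : Fin 4 → Fin 3 → ℝ := ![![1, 1, 1], ![1, -1, -1], ![-1, 1, -1], ![-1, -1, 1]]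

theorem sign4_mul_self (l : Fin 4) (i : Fin 3) : sign4 l i * sign4 l i = 1 := by
  fin_cases l <;> fin_cases i <;> simp [sign4]

theorem sign4_prod (l : Fin 4) : sign4 l 0 * sign4 l 1 * sign4 l 2 = 1 := by
  fin_cases l <;> simp [sign4]

/-- The action of permutations and signs on the parameters. -/
def actParam (g : Fin 6 × Fin 4) (M : KSSpace) : KSSpace :=
  ofParams (wVec M ∘ perm6 g.1) (sign4 g.2 * (tVec M ∘ perm6 g.1))

theorem tVec_actParam (g : Fin 6 × Fin 4) (M : KSSpace) :
    tVec (actParam g M) = sign4 g.2 * (tVec M ∘ perm6 g.1) := tVec_ofParams _ _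

theorem wVec_actParam (g : Fin 6 × Fin 4) (M : KSSpace) :
    wVec (actParam g M) = wVec M ∘ perm6 g.1 := by
  refine wVec_ofParams ?_ _
  have h := sum_wVec M
  simp only [Function.comp_apply]
  rcases perm_cases (perm6 g.1) with ⟨a, b, c, d⟩ | ⟨a, b, c, d⟩ | ⟨a, b, c, d⟩ | ⟨a, b, c, d⟩ |
    ⟨a, b, c, d⟩ | ⟨a, b, c, d⟩ <;> rw [a, b, c] <;> linarith

theorem actParam_zero (M : KSSpace) : actParam (0, 0) M = M := by
  have h1 : sign4 0 * (tVec M ∘ perm6 0) = tVec M := by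
    ext i; fin_cases i <;> simp [sign4, perm6]
  rw [actParam, h1]
  exact ofParams_vec M

theorem exists_isConj_actParam (g : Fin 6 × Fin 4) : ∃ (Q : octahedralGroup) (s : ℝ), s ≠ 0 ∧
    ∀ M, IsConj Q (s • M) (actParam g M) := by
  obtain ⟨Q, hQ⟩ := exists_isConj (perm6 g.1) (sign4_mul_self g.2) (sign4_prod g.2)
  refine ⟨Q, _, rsign_ne_zero (perm6 g.1), fun M => ?_⟩
  have := hQ (wVec M) (tVec M)
  rwa [ofParams_vec] at this

theorem sum_sign4 (c : Fin 3 → ℕ) : (∑ l, (sign4 l 0 ^ c 0 * sign4 l 1 ^ c 1 * sign4 l 2 ^ c 2)) =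
    1 + (-1) ^ c 1 * (-1) ^ c 2 + (-1) ^ c 0 * (-1) ^ c 2 + (-1) ^ c 0 * (-1) ^ c 1 := by
  simp [Fin.sum_univ_four, sign4]

theorem sum_perm6 (x y z : Fin 3 → ℝ) :
    ∑ k, x (perm6 k 0) * y (perm6 k 1) * z (perm6 k 2) =
      (∑ i, x i) * (∑ i, y i) * (∑ i, z i) - (∑ i, x i * y i) * (∑ i, z i)
      - (∑ i, x i * z i) * (∑ i, y i) - (∑ i, y i * z i) * (∑ i, x i)
      + 2 * ∑ i, x i * y i * z i := by
  have h : ∀ i, (perm6 1 i, perm6 2 i, perm6 3 i, perm6 4 i, perm6 5 i) =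
      (![1, 0, 2] i, ![2, 1, 0] i, ![0, 2, 1] i, ![1, 2, 0] i, ![2, 0, 1] i) := by decide
  simp only [Prod.mk.injEq] at h
  have h0 : ∀ i, perm6 0 i = i := fun i => rfl
  simp only [Fin.sum_univ_six, Fin.sum_univ_three, h, h0, Matrix.cons_val]
  ring

theorem IsForm.congr {n m : ℕ} {F G : EndoField E4 → ℝ} (h : IsForm n F) (hnm : n = m)
    (hFG : ∀ K, F K = G K) : IsForm m G := by
  obtain rfl : F = G := funext hFG
  exact hnm ▸ h

/-- The symmetrisation of a monomial in the `w_α` and the `t_α²`. -/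
theorem exists_form_even (a b : Fin 3 → ℕ) :
    ∃ F, IsForm (a 0 + a 1 + a 2 + 2 * (b 0 + b 1 + b 2)) F ∧
      ∀ (K : EndoField E4) (M : KSSpace) (φ : E4 ≃ₗᵢ[ℝ] E4), HasKSMatrix (pushforward φ K) M →
        F K = ∑ k, (wVec M (perm6 k 0) ^ a 0 * (tVec M (perm6 k 0) ^ 2) ^ b 0) *
          (wVec M (perm6 k 1) ^ a 1 * (tVec M (perm6 k 1) ^ 2) ^ b 1) *
          (wVec M (perm6 k 2) ^ a 2 * (tVec M (perm6 k 2) ^ 2) ^ b 2) := by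
  have h1 := ((isForm_powerForm (a 0) (b 0)).mul (isForm_powerForm (a 1) (b 1))).mul
    (isForm_powerForm (a 2) (b 2))
  have h2 := (isForm_powerForm (a 0 + a 1) (b 0 + b 1)).mul (isForm_powerForm (a 2) (b 2))
  have h3 := (isForm_powerForm (a 0 + a 2) (b 0 + b 2)).mul (isForm_powerForm (a 1) (b 1))
  have h4 := (isForm_powerForm (a 1 + a 2) (b 1 + b 2)).mul (isForm_powerForm (a 0) (b 0))
  have h5 := isForm_powerForm (a 0 + a 1 + a 2) (b 0 + b 1 + b 2)
  refine ⟨_, ((((h1.congr (by ring) fun _ => rfl).add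
    ((h2.const_mul (-1)).congr (by ring) fun _ => rfl)).add
    ((h3.const_mul (-1)).congr (by ring) fun _ => rfl)).add
    ((h4.const_mul (-1)).congr (by ring) fun _ => rfl)).add
    ((h5.const_mul 2).congr (by ring) fun _ => rfl), fun K M φ hM => ?_⟩
  have hv := hM.form_values.1
  rw [sum_perm6 (fun j => wVec M j ^ a 0 * (tVec M j ^ 2) ^ b 0)
    (fun j => wVec M j ^ a 1 * (tVec M j ^ 2) ^ b 1)
    (fun j => wVec M j ^ a 2 * (tVec M j ^ 2) ^ b 2)]
  have hm : ∀ (m n m' n' : ℕ) (j : Fin 3), wVec M j ^ m * (tVec M j ^ 2) ^ n *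
      (wVec M j ^ m' * (tVec M j ^ 2) ^ n') = wVec M j ^ (m + m') * (tVec M j ^ 2) ^ (n + n') :=
    fun m n m' n' j => by rw [pow_add, pow_add]; ring
  simp only [hv, hm]
  ring

/-- The symmetrisation of a monomial in the `w_α` and the `t_α`. -/
theorem exists_form_monomial (a c : Fin 3 → ℕ) :
    ∃ F, IsForm (a 0 + a 1 + a 2 + (c 0 + c 1 + c 2)) F ∧
      ∀ (K : EndoField E4) (M : KSSpace) (φ : E4 ≃ₗᵢ[ℝ] E4), HasKSMatrix (pushforward φ K) M →
        F K = ∑ g, ∏ i, (wVec (actParam g M) i ^ a i * tVec (actParam g M) i ^ c i) := by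
  have hsum : ∀ M : KSSpace, ∑ g, ∏ i, (wVec (actParam g M) i ^ a i * tVec (actParam g M) i ^ c i) =
      (1 + (-1) ^ c 1 * (-1) ^ c 2 + (-1) ^ c 0 * (-1) ^ c 2 + (-1) ^ c 0 * (-1) ^ c 1) *
      ∑ k, (wVec M (perm6 k 0) ^ a 0 * tVec M (perm6 k 0) ^ c 0) *
          (wVec M (perm6 k 1) ^ a 1 * tVec M (perm6 k 1) ^ c 1) *
          (wVec M (perm6 k 2) ^ a 2 * tVec M (perm6 k 2) ^ c 2) := by
    intro M
    rw [← sum_sign4, Finset.sum_mul_sum, Fintype.sum_prod_type, Finset.sum_comm]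
    refine Finset.sum_congr rfl fun l _ => Finset.sum_congr rfl fun k _ => ?_
    rw [wVec_actParam, tVec_actParam, Fin.prod_univ_three]
    simp only [Function.comp_apply, Pi.mul_apply, mul_pow]
    ring
  simp only [hsum]
  obtain ⟨b0, h0⟩ := Nat.even_or_odd' (c 0)
  obtain ⟨b1, h1⟩ := Nat.even_or_odd' (c 1)
  obtain ⟨b2, h2⟩ := Nat.even_or_odd' (c 2)
  have hpe : ∀ b : ℕ, (-1 : ℝ) ^ (2 * b) = 1 := fun b => by simp
  have hpo : ∀ b : ℕ, (-1 : ℝ) ^ (2 * b + 1) = -1 := fun b => by simp [pow_succ]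
  obtain ⟨F, hF, hv⟩ := exists_form_even a ![b0, b1, b2]
  simp only [Matrix.cons_val] at hF hv
  rcases h0 with h0 | h0 <;> rcases h1 with h1 | h1 <;> rcases h2 with h2 | h2 <;>
    simp only [h0, h1, h2, hpe, hpo]
  · refine ⟨_, (hF.const_mul 4).congr (by ring) fun _ => rfl, fun K M φ hM => ?_⟩
    rw [hv K M φ hM]
    norm_num [pow_mul]
  all_goals try
    refine ⟨_, isForm_zero _, fun K M φ hM => ?_⟩
    norm_num
    done
  refine ⟨_, ((isFormMat_fieldT.det.mul hF).const_mul 4).congr (by ring) fun _ => rfl,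
    fun K M φ hM => ?_⟩
  rw [hv K M φ hM, hM.form_values.2, Finset.mul_sum, Finset.mul_sum, Finset.mul_sum]
  refine Finset.sum_congr rfl fun k _ => ?_
  have hprod : tVec M 0 * tVec M 1 * tVec M 2 =
      tVec M (perm6 k 0) * tVec M (perm6 k 1) * tVec M (perm6 k 2) := by
    rcases perm_cases (perm6 k) with ⟨a, b, c, d⟩ | ⟨a, b, c, d⟩ | ⟨a, b, c, d⟩ | ⟨a, b, c, d⟩ |
      ⟨a, b, c, d⟩ | ⟨a, b, c, d⟩ <;> rw [a, b, c] <;> ring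
  rw [hprod]
  simp only [pow_succ, pow_mul]
  ring

/-- The coordinates on `𝒜`. -/
def ksCoord (M : KSSpace) : Fin 3 ⊕ Fin 3 → ℝ := Sum.elim (wVec M) (tVec M)

theorem ksCoord_smul (c : ℝ) (M : KSSpace) : ksCoord (c • M) = c • ksCoord M := by
  ext i; cases i <;> simp [ksCoord, wVec_smul, tVec_smul]

theorem IsPolynomialFun.exists_mvPolynomial {f : KSSpace → ℝ} (hf : IsPolynomialFun f) :
    ∃ P : MvPolynomial (Fin 3 ⊕ Fin 3) ℝ, ∀ M, f M = MvPolynomial.eval (ksCoord M) P := by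
  refine Algebra.adjoin_induction (p := fun f _ => ∃ P : MvPolynomial (Fin 3 ⊕ Fin 3) ℝ,
    ∀ M, f M = MvPolynomial.eval (ksCoord M) P) ?_ ?_ ?_ ?_ hf
  · rintro _ ⟨l, rfl⟩
    refine ⟨∑ i, MvPolynomial.C (l (ofParams (Pi.single i 1) 0)) * MvPolynomial.X (Sum.inl i) +
      ∑ i, MvPolynomial.C (l (ofParams 0 (Pi.single i 1))) * MvPolynomial.X (Sum.inr i),
      fun M => ?_⟩
    have hM : M = ∑ i, wVec M i • ofParams (Pi.single i 1) 0 +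
        ∑ i, tVec M i • ofParams 0 (Pi.single i 1) := by
      conv_lhs => rw [← ofParams_vec M]
      simp only [← ofParams_smul, Fin.sum_univ_three, ← ofParams_add]
      congr 1 <;> ext i <;> fin_cases i <;> simp
    conv_lhs => rw [hM]
    simp [ksCoord, mul_comm]
  · intro r
    exact ⟨MvPolynomial.C r, fun M => by simp⟩
  · rintro f g _ _ ⟨P, hP⟩ ⟨Q, hQ⟩
    exact ⟨P + Q, fun M => by simp [hP, hQ]⟩
  · rintro f g _ _ ⟨P, hP⟩ ⟨Q, hQ⟩
    exact ⟨P * Q, fun M => by simp [hP, hQ]⟩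

theorem eval_smul_of_isHomogeneous {P : MvPolynomial (Fin 3 ⊕ Fin 3) ℝ} {n : ℕ}
    (hP : P.IsHomogeneous n) (c : ℝ) (x : Fin 3 ⊕ Fin 3 → ℝ) :
    MvPolynomial.eval (c • x) P = c ^ n * MvPolynomial.eval x P := by
  rw [MvPolynomial.eval_eq, MvPolynomial.eval_eq, Finset.mul_sum]
  refine Finset.sum_congr rfl fun m hm => ?_
  have := hP (MvPolynomial.mem_support_iff.mp hm)
  rw [← this, Finsupp.weight_apply, Finsupp.sum, ← Finset.prod_pow_eq_pow_sum]
  simp only [Pi.smul_apply, smul_eq_mul, mul_pow, Finset.prod_mul_distrib, Pi.one_apply, mul_one]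
  ring

theorem exists_homogeneous {f : KSSpace → ℝ} (hf : IsPolynomialFun f) {n : ℕ}
    (hn : ∀ (c : ℝ) M, f (c • M) = c ^ n * f M) :
    ∃ P : MvPolynomial (Fin 3 ⊕ Fin 3) ℝ, P.IsHomogeneous n ∧
      ∀ M, f M = MvPolynomial.eval (ksCoord M) P := by
  obtain ⟨P, hP⟩ := hf.exists_mvPolynomial
  refine ⟨MvPolynomial.homogeneousComponent n P, MvPolynomial.homogeneousComponent_isHomogeneous n P,
    fun M => ?_⟩
  set N := P.totalDegree + 1 with hN
  set v : ℕ → ℝ := fun i => MvPolynomial.eval (ksCoord M) (MvPolynomial.homogeneousComponent i P)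
    with hv
  have hc : ∀ c : ℝ, c ^ n * f M = ∑ i ∈ Finset.range N, c ^ i * v i := fun c => by
    rw [← hn, hP]
    conv_lhs => rw [← MvPolynomial.sum_homogeneousComponent P, map_sum]
    refine Finset.sum_congr rfl fun i _ => ?_
    rw [ksCoord_smul]
    exact eval_smul_of_isHomogeneous (MvPolynomial.homogeneousComponent_isHomogeneous i P) c _
  have hpoly : Polynomial.C (f M) * Polynomial.X ^ n =
      ∑ i ∈ Finset.range N, Polynomial.C (v i) * Polynomial.X ^ i := by
    refine Polynomial.funext fun c => ?_
    have := hc c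
    simp only [Polynomial.eval_mul, Polynomial.eval_C, Polynomial.eval_pow, Polynomial.eval_X,
      Polynomial.eval_finsetSum]
    rw [mul_comm, this]
    exact Finset.sum_congr rfl fun i _ => mul_comm _ _
  have hco := congrArg (fun q : Polynomial ℝ => q.coeff n) hpoly
  simp only [Polynomial.coeff_C_mul_X_pow, Polynomial.finsetSum_coeff, if_true] at hco
  rw [hco]
  by_cases hnN : n ∈ Finset.range N
  · rw [Finset.sum_eq_single n (fun i _ hi => if_neg (Ne.symm hi)) (fun h => absurd hnN h), if_pos rfl]
  · rw [Finset.sum_eq_zero fun i hi => if_neg fun h : n = i => hnN (h ▸ hi)]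
    rw [MvPolynomial.homogeneousComponent_eq_zero, map_zero]
    simp at hnN; omega

/-- The symmetrisation of a homogeneous polynomial on `𝒜` extends to the space of fields. -/
theorem exists_form {f : KSSpace → ℝ} (hf : IsPolynomialFun f) {n : ℕ}
    (hn : ∀ (c : ℝ) M, f (c • M) = c ^ n * f M) :
    ∃ F, IsForm n F ∧ ∀ (K : EndoField E4) (M : KSSpace) (φ : E4 ≃ₗᵢ[ℝ] E4),
      HasKSMatrix (pushforward φ K) M → F K = ∑ g, f (actParam g M) := by
  obtain ⟨P, hP, hfP⟩ := exists_homogeneous hf hn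
  choose G hG hGv using fun m : Fin 3 ⊕ Fin 3 →₀ ℕ =>
    exists_form_monomial (fun i => m (Sum.inl i)) (fun i => m (Sum.inr i))
  refine ⟨fun K => ∑ m ∈ P.support, P.coeff m * G m K, IsForm.sum _ fun m hm => ?_,
    fun K M φ hM => ?_⟩
  · refine ((hG m).const_mul (P.coeff m)).congr ?_ fun _ => rfl
    have := hP (MvPolynomial.mem_support_iff.mp hm)
    rw [← this, Finsupp.weight_apply, Finsupp.sum_fintype _ _ (by simp), Fintype.sum_sum_type,
      Fin.sum_univ_three, Fin.sum_univ_three]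
    simp
  · simp only [hfP, MvPolynomial.eval_eq]
    rw [Finset.sum_comm]
    refine Finset.sum_congr rfl fun m _ => ?_
    rw [hGv m K M φ hM, Finset.mul_sum]
    refine Finset.sum_congr rfl fun g _ => ?_
    rw [Finset.prod_mul_distrib]
    congr 1
    rw [Finset.prod_subset (Finset.subset_univ m.support) (fun i _ hi => by
      rw [Finsupp.notMem_support_iff.mp hi, pow_zero]), Fintype.prod_sum_type]
    rfl

end Extension


open Matrix

section Homeomorphism

theorem continuous_ksField : Continuous ksField :=
  LinearMap.continuous_of_finiteDimensional ksField

theorem continuous_quotientMap : Continuous quotientMap := by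
  refine Continuous.quotient_map' ?_ _
  exact (continuous_ksField.comp continuous_subtype_val).subtype_mk _

/-- Representatives of all points of the quotient with normalised parameters. -/
def unitParams : Set ((Fin 3 → ℝ) × (Fin 3 → ℝ)) :=
  {x | x.1 0 + x.1 1 + x.1 2 = 0 ∧ (∑ i, x.1 i ^ 2) + (∑ i, x.2 i ^ 2) = 1 ∧
    (x.1 1 - x.1 2) * (x.1 2 - x.1 0) * (x.1 0 - x.1 1) + (x.1 1 - x.1 2) * x.2 0 ^ 2
      + (x.1 2 - x.1 0) * x.2 1 ^ 2 + (x.1 0 - x.1 1) * x.2 2 ^ 2 = 0}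

theorem isCompact_unitParams : IsCompact unitParams := by
  refine (isCompact_closedBall (0 : (Fin 3 → ℝ) × (Fin 3 → ℝ)) 1).of_isClosed_subset ?_ ?_
  · refine (isClosed_eq (by fun_prop) continuous_const).inter
      ((isClosed_eq (by fun_prop) continuous_const).inter (isClosed_eq (by fun_prop) continuous_const))
  · rintro ⟨w, t⟩ ⟨-, h, -⟩
    simp only at h
    rw [mem_closedBall_zero_iff, Prod.norm_mk, max_le_iff, pi_norm_le_iff_of_nonneg zero_le_one,
      pi_norm_le_iff_of_nonneg zero_le_one]
    have hw : ∀ i, w i ^ 2 ≤ ∑ i, w i ^ 2 := fun i =>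
      Finset.single_le_sum (f := fun i => w i ^ 2) (fun j _ => sq_nonneg _) (Finset.mem_univ i)
    have ht : ∀ i, t i ^ 2 ≤ ∑ i, t i ^ 2 := fun i =>
      Finset.single_le_sum (f := fun i => t i ^ 2) (fun j _ => sq_nonneg _) (Finset.mem_univ i)
    have hw0 : 0 ≤ ∑ i, w i ^ 2 := Finset.sum_nonneg fun i _ => sq_nonneg _
    have ht0 : 0 ≤ ∑ i, t i ^ 2 := Finset.sum_nonneg fun i _ => sq_nonneg _
    refine ⟨fun i => ?_, fun i => ?_⟩
    · rw [Real.norm_eq_abs, ← sq_le_one_iff_abs_le_one]; linarith [hw i]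
    · rw [Real.norm_eq_abs, ← sq_le_one_iff_abs_le_one]; linarith [ht i]

/-- The square of the norm of the parameters. -/
def paramNormSq (M : KSSpace) : ℝ := ∑ i, ksCoord M i ^ 2

theorem paramNormSq_eq (M : KSSpace) :
    paramNormSq M = (∑ i, wVec M i ^ 2) + ∑ i, tVec M i ^ 2 := by
  rw [paramNormSq, Fintype.sum_sum_type]; rfl

theorem ksCoord_injective : Function.Injective ksCoord := fun M N h => by
  rw [← ofParams_vec M, ← ofParams_vec N]
  congr 1
  · exact funext fun i => congrFun h (Sum.inl i)
  · exact funext fun i => congrFun h (Sum.inr i)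

theorem ksCoord_zero : ksCoord 0 = 0 := by
  have := ksCoord_smul 0 0
  rwa [zero_smul, zero_smul] at this

theorem paramNormSq_pos {M : KSSpace} (hM : M ≠ 0) : 0 < paramNormSq M := by
  refine lt_of_le_of_ne (Finset.sum_nonneg fun i _ => sq_nonneg _) fun h => hM ?_
  refine ksCoord_injective ?_
  rw [ksCoord_zero]
  funext i
  have := (Finset.sum_eq_zero_iff_of_nonneg fun i _ => sq_nonneg _).mp h.symm i (Finset.mem_univ i)
  exact pow_eq_zero_iff (two_ne_zero) |>.mp this

theorem mem_ksCone_iff (M : KSSpace) : M ∈ ksCone ↔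
    (wVec M 1 - wVec M 2) * (wVec M 2 - wVec M 0) * (wVec M 0 - wVec M 1)
      + (wVec M 1 - wVec M 2) * tVec M 0 ^ 2 + (wVec M 2 - wVec M 0) * tVec M 1 ^ 2
      + (wVec M 0 - wVec M 1) * tVec M 2 ^ 2 = 0 := by
  rw [← det_ofParams, ofParams_vec]; rfl

theorem ofParams_mem_ksPunctured (x : unitParams) :
    ofParams (x : (Fin 3 → ℝ) × (Fin 3 → ℝ)).1 (x : (Fin 3 → ℝ) × (Fin 3 → ℝ)).2 ∈ ksPunctured := by
  obtain ⟨⟨w, t⟩, h1, h2, h3⟩ := x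
  refine ⟨?_, fun h => ?_⟩
  · rw [mem_ksCone_iff, wVec_ofParams h1, tVec_ofParams]; exact h3
  · have := paramNormSq_eq (ofParams w t)
    rw [wVec_ofParams h1, tVec_ofParams] at this
    rw [h] at this
    simp only at h2
    rw [h2] at this
    simp [paramNormSq, ksCoord_zero] at this

theorem continuous_ofParams : Continuous fun x : (Fin 3 → ℝ) × (Fin 3 → ℝ) => ofParams x.1 x.2 := by
  refine Continuous.subtype_mk ?_ _
  refine continuous_matrix fun i j => ?_
  fin_cases i <;> fin_cases j <;> simp <;> fun_prop

instance : CompactSpace KSQuotient := by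
  have hc : CompactSpace unitParams := isCompact_iff_compactSpace.mp isCompact_unitParams
  have hcont : Continuous fun x : unitParams =>
      (Quotient.mk _ (⟨_, ofParams_mem_ksPunctured x⟩ : ksPunctured) : KSQuotient) :=
    continuous_quotient_mk'.comp
      ((continuous_ofParams.comp continuous_subtype_val).subtype_mk ofParams_mem_ksPunctured)
  have hs : Function.Surjective fun x : unitParams =>
      (Quotient.mk _ (⟨_, ofParams_mem_ksPunctured x⟩ : ksPunctured) : KSQuotient) := by
    intro y
    induction y using Quotient.inductionOn with | _ M => ?_
    have hpos := paramNormSq_pos M.2.2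
    set r := (Real.sqrt (paramNormSq (M : KSSpace)))⁻¹ with hr
    have hr2 : r ^ 2 * paramNormSq (M : KSSpace) = 1 := by
      rw [hr, inv_pow, Real.sq_sqrt hpos.le, inv_mul_cancel₀ hpos.ne']
    have hr0 : r ≠ 0 := fun h => by rw [h] at hr2; simp at hr2
    have hcone := (mem_ksCone_iff (M : KSSpace)).mp M.2.1
    refine ⟨⟨(r • wVec M, r • tVec M), ?_, ?_, ?_⟩, Quotient.sound ?_⟩
    · simp only [Pi.smul_apply, smul_eq_mul]
      linear_combination r * sum_wVec (M : KSSpace)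
    · rw [paramNormSq_eq] at hr2
      rw [← hr2]
      simp only [Pi.smul_apply, smul_eq_mul, Fin.sum_univ_three]
      ring
    · simp only [Pi.smul_apply, smul_eq_mul]
      linear_combination r ^ 3 * hcone
    · refine ⟨1, r⁻¹, inv_ne_zero hr0, ?_⟩
      rw [isConj_iff]
      simp only [ofParams_smul, ofParams_vec, smul_smul, inv_mul_cancel₀ hr0, one_smul]
      simp
  rw [← isCompact_univ_iff, ← hs.range_eq]
  exact isCompact_range hcont

theorem isPolynomialFun_ksCoord (i : Fin 3 ⊕ Fin 3) : IsPolynomialFun fun M => ksCoord M i :=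
  isPolynomialFun_linear
    { toFun := fun M => ksCoord M i
      map_add' := fun M N => by cases i <;> simp [ksCoord, wVec_add, tVec_add]
      map_smul' := fun c M => by rw [ksCoord_smul]; rfl }

theorem IsPolynomialFun.pow {E : Type*} [AddCommGroup E] [Module ℝ E] {f : E → ℝ}
    (hf : IsPolynomialFun f) (n : ℕ) : IsPolynomialFun fun x => f x ^ n :=
  (Algebra.adjoin ℝ _).pow_mem hf n

theorem IsPolynomialFun.sum {ι E : Type*} [AddCommGroup E] [Module ℝ E] (s : Finset ι)
    {f : ι → E → ℝ} (hf : ∀ i ∈ s, IsPolynomialFun (f i)) :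
    IsPolynomialFun fun x => ∑ i ∈ s, f i x := by
  have := (Algebra.adjoin ℝ (Set.range fun l : Module.Dual ℝ E => (l : E → ℝ))).sum_mem hf
  simpa only [IsPolynomialFun, Finset.sum_fn] using this

theorem IsPolynomialFun.prod {ι E : Type*} [AddCommGroup E] [Module ℝ E] (s : Finset ι)
    {f : ι → E → ℝ} (hf : ∀ i ∈ s, IsPolynomialFun (f i)) :
    IsPolynomialFun fun x => ∏ i ∈ s, f i x := by
  have := (Algebra.adjoin ℝ (Set.range fun l : Module.Dual ℝ E => (l : E → ℝ))).prod_mem hf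
  simpa only [IsPolynomialFun, Finset.prod_fn] using this

theorem IsPolynomialFun.mul {E : Type*} [AddCommGroup E] [Module ℝ E] {f g : E → ℝ}
    (hf : IsPolynomialFun f) (hg : IsPolynomialFun g) : IsPolynomialFun fun x => f x * g x :=
  (Algebra.adjoin ℝ _).mul_mem hf hg

/-- The sum of the squares of the minors of two vectors of parameters. -/
def minorSq (N M : KSSpace) : ℝ :=
  ∑ i, ∑ j, (ksCoord M i * ksCoord N j - ksCoord M j * ksCoord N i) ^ 2

theorem minorSq_nonneg (N M : KSSpace) : 0 ≤ minorSq N M :=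
  Finset.sum_nonneg fun _ _ => Finset.sum_nonneg fun _ _ => sq_nonneg _

theorem minorSq_self (M : KSSpace) : minorSq M M = 0 :=
  Finset.sum_eq_zero fun i _ => Finset.sum_eq_zero fun j _ => by ring

theorem minorSq_smul (N M : KSSpace) (c : ℝ) : minorSq N (c • M) = c ^ 2 * minorSq N M := by
  simp only [minorSq, ksCoord_smul, Pi.smul_apply, smul_eq_mul, Finset.mul_sum]
  exact Finset.sum_congr rfl fun i _ => Finset.sum_congr rfl fun j _ => by ring

theorem exists_smul_of_minorSq {N M : KSSpace} (hN : N ≠ 0) (h : minorSq N M = 0) :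
    ∃ c : ℝ, M = c • N := by
  obtain ⟨j, hj⟩ : ∃ j, ksCoord N j ≠ 0 := by
    by_contra hcon
    push Not at hcon
    exact hN (ksCoord_injective (by rw [ksCoord_zero]; exact funext hcon))
  refine ⟨ksCoord M j / ksCoord N j, ksCoord_injective (funext fun i => ?_)⟩
  have h1 := (Finset.sum_eq_zero_iff_of_nonneg fun _ _ => Finset.sum_nonneg fun _ _ =>
    sq_nonneg _).mp h i (Finset.mem_univ i)
  have h2 := (Finset.sum_eq_zero_iff_of_nonneg fun _ _ => sq_nonneg _).mp h1 j (Finset.mem_univ j)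
  have h3 := pow_eq_zero_iff (two_ne_zero) |>.mp h2
  rw [ksCoord_smul, Pi.smul_apply, smul_eq_mul]
  field_simp
  linarith

theorem isPolynomialFun_minorSq (N : KSSpace) : IsPolynomialFun (minorSq N) := by
  refine IsPolynomialFun.sum _ fun i _ => IsPolynomialFun.sum _ fun j _ => IsPolynomialFun.pow ?_ 2
  have h : ∀ i j, IsPolynomialFun fun M => ksCoord M i * ksCoord N j := fun i j =>
    (isPolynomialFun_ksCoord i).mul ((Algebra.adjoin ℝ _).algebraMap_mem (ksCoord N j))
  exact (Algebra.adjoin ℝ _).sub_mem (h i j) (h j i)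

theorem ksSetoid_actParam (M : ksPunctured) (g : Fin 6 × Fin 4) (M' : ksPunctured)
    (h : ∃ c : ℝ, (M' : KSSpace) = c • actParam g M) :
    (Quotient.mk _ M : KSQuotient) = Quotient.mk _ M' := by
  obtain ⟨c, hc⟩ := h
  obtain ⟨Q, s, hs, hQ⟩ := exists_isConj_actParam g
  have hc0 : c ≠ 0 := fun h => M'.2.2 (by rw [hc, h, zero_smul])
  refine Quotient.sound ⟨Q, c * s, mul_ne_zero hc0 hs, ?_⟩
  rw [hc, mul_smul]
  exact (hQ M).smul c

theorem quotient_eq_of_hasKSMatrix {K : killingCone} {M : ksPunctured} {φ : E4 ≃ₗᵢ[ℝ] E4}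
    (h : HasKSMatrix (pushforward φ (K : EndoField E4)) M) :
    Quotient.mk _ K = quotientMap (Quotient.mk _ M) :=
  (mk_eq_quotientMap_iff K M).mpr ⟨φ, 1, one_ne_zero, by rwa [one_smul]⟩

theorem IsConj.mem_ksPunctured {Q : octahedralGroup} {M M' : KSSpace} (h : IsConj Q M M')
    (hM : M ∈ ksPunctured) : M' ∈ ksPunctured := by
  have hQ := (Matrix.mem_specialOrthogonalGroup_iff.mp
    (Q : Matrix.specialOrthogonalGroup (Fin 3) ℝ).2).1
  rw [Matrix.mem_orthogonalGroup_iff'] at hQ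
  have h1 := isConj_iff.mp h
  refine ⟨?_, fun h0 => hM.2 (Subtype.ext ?_)⟩
  · change (M' : Matrix (Fin 3) (Fin 3) ℝ).det = 0
    have : (M : Matrix (Fin 3) (Fin 3) ℝ).det = 0 := hM.1
    rw [h1, det_mul, det_mul, this, mul_zero, zero_mul]
  · rw [h0] at h1
    have h2 := congrArg (fun A => ((Q : Matrix.specialOrthogonalGroup (Fin 3) ℝ) :
      Matrix (Fin 3) (Fin 3) ℝ)ᵀ * A * ((Q : Matrix.specialOrthogonalGroup (Fin 3) ℝ) :
      Matrix (Fin 3) (Fin 3) ℝ)) h1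
    simp only [Matrix.mul_assoc] at h2
    have hQ' : ((Q : Matrix.specialOrthogonalGroup (Fin 3) ℝ) : Matrix (Fin 3) (Fin 3) ℝ)ᵀ *
      ((Q : Matrix.specialOrthogonalGroup (Fin 3) ℝ) : Matrix (Fin 3) (Fin 3) ℝ) = 1 := hQ
    rw [hQ', Matrix.mul_one, ← Matrix.mul_assoc _ _ (M : Matrix (Fin 3) (Fin 3) ℝ), hQ', Matrix.one_mul] at h2
    rw [← h2]; simp

theorem actParam_mem_ksPunctured (g : Fin 6 × Fin 4) {M : KSSpace} (hM : M ∈ ksPunctured) :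
    actParam g M ∈ ksPunctured := by
  obtain ⟨Q, s, hs, hQ⟩ := exists_isConj_actParam g
  refine (hQ M).mem_ksPunctured ⟨?_, smul_ne_zero hs hM.2⟩
  have : (M : Matrix (Fin 3) (Fin 3) ℝ).det = 0 := hM.1
  change ((s • M : KSSpace) : Matrix (Fin 3) (Fin 3) ℝ).det = 0
  rw [Submodule.coe_smul, det_smul, this, mul_zero]

/-- Quotients of forms of the same degree descend to the quotient. -/
theorem form_div_eq {n : ℕ} {F G : EndoField E4 → ℝ} {u v : KSSpace → ℝ}
    (hF : IsForm n F) (hG : IsForm n G)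
    (hFu : ∀ (K : EndoField E4) (M : KSSpace) (φ : E4 ≃ₗᵢ[ℝ] E4),
      HasKSMatrix (pushforward φ K) M → F K = ∑ g, u (actParam g M))
    (hGv : ∀ (K : EndoField E4) (M : KSSpace) (φ : E4 ≃ₗᵢ[ℝ] E4),
      HasKSMatrix (pushforward φ K) M → G K = ∑ g, v (actParam g M))
    (K K' : killingCone) (h : K ≈ K') : F K / G K = F K' / G K' := by
  obtain ⟨φ, c, a, hc, hK'⟩ := h
  obtain ⟨ψ, M, hM⟩ := exists_mem_ksPunctured K
  have hM' : HasKSMatrix (pushforward (φ.symm.trans ψ) (pushforward φ (K : EndoField E4))) M := by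
    rw [← pushforward_pushforward, pushforward_symm_pushforward]; exact hM
  rw [hK', hF.inv, hG.inv, hF.homog, hG.homog, hFu _ _ _ hM', hGv _ _ _ hM', ← hFu _ _ _ hM,
    ← hGv _ _ _ hM, mul_div_mul_left _ _ (pow_ne_zero n hc)]

instance : T2Space KillingQuotient := by
  refine ⟨fun x y hxy => ?_⟩
  induction x using Quotient.inductionOn with | _ K => ?_
  induction y using Quotient.inductionOn with | _ K' => ?_
  obtain ⟨φ, M, hM⟩ := exists_mem_ksPunctured K
  obtain ⟨φ', M', hM'⟩ := exists_mem_ksPunctured K'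
  have hne : ∀ g, minorSq (actParam g M) M' ≠ 0 := fun g hg => by
    have h0 : actParam g M ≠ 0 := (actParam_mem_ksPunctured g M.2).2
    obtain ⟨c, hc⟩ := exists_smul_of_minorSq h0 hg
    refine hxy ?_
    rw [quotient_eq_of_hasKSMatrix hM, quotient_eq_of_hasKSMatrix hM',
      ksSetoid_actParam M g M' ⟨c, hc⟩]
  set f : KSSpace → ℝ := fun X => ∏ g, minorSq (actParam g M) X with hf
  obtain ⟨F, hF, hFf⟩ := exists_form (f := f) (n := 48)
    (IsPolynomialFun.prod _ fun g _ => isPolynomialFun_minorSq _) (fun c X => by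
      simp only [hf, minorSq_smul, Finset.prod_mul_distrib, Finset.prod_const, ← pow_mul]
      rfl)
  obtain ⟨G, hG, hGf⟩ := exists_form (f := fun X => paramNormSq X ^ 24) (n := 48)
    ((IsPolynomialFun.sum _ fun i _ => (isPolynomialFun_ksCoord i).pow 2).pow 24) (fun c X => by
      have : paramNormSq (c • X) = c ^ 2 * paramNormSq X := by
        simp only [paramNormSq, ksCoord_smul, Pi.smul_apply, smul_eq_mul, Finset.mul_sum, mul_pow]
      rw [this, mul_pow, ← pow_mul])
  have hGpos : ∀ K : killingCone, 0 < G K := fun K => by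
    obtain ⟨φ, M, hM⟩ := exists_mem_ksPunctured K
    rw [hGf _ _ _ hM]
    refine lt_of_lt_of_le ?_ (Finset.single_le_sum (f := fun g => paramNormSq (actParam g M) ^ 24)
      (fun g _ => ?_) (Finset.mem_univ (0, 0)))
    · rw [actParam_zero]; exact pow_pos (paramNormSq_pos M.2.2) 24
    · exact pow_nonneg (Finset.sum_nonneg fun _ _ => sq_nonneg _) 24
  set H : KillingQuotient → ℝ := Quotient.lift (fun K : killingCone => F K / G K)
    (form_div_eq (u := f) (v := fun X => paramNormSq X ^ 24) hF hG hFf hGf) with hH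
  have hHc : Continuous H := by
    refine Continuous.quotient_lift ?_ _
    exact (hF.cont.comp continuous_subtype_val).div (hG.cont.comp continuous_subtype_val)
      fun K => (hGpos K).ne'
  refine separated_by_continuous hHc ?_
  have h0 : F K = 0 := by
    rw [hFf _ _ _ hM]
    exact Finset.sum_eq_zero fun g _ => Finset.prod_eq_zero (Finset.mem_univ g) (minorSq_self _)
  have h1 : 0 < F K' := by
    rw [hFf _ _ _ hM']
    refine lt_of_lt_of_le ?_ (Finset.single_le_sum (f := fun g => f (actParam g M'))
      (fun g _ => ?_) (Finset.mem_univ (0, 0)))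
    · rw [actParam_zero]
      exact Finset.prod_pos fun g _ => lt_of_le_of_ne (minorSq_nonneg _ _) (hne g).symm
    · exact Finset.prod_nonneg fun g _ => minorSq_nonneg _ _
  change F K / G K ≠ F K' / G K'
  rw [h0, zero_div]
  exact (div_pos h1 (hGpos K')).ne

/-- The homeomorphism between the two quotients. -/
def quotientHomeo : KillingQuotient ≃ₜ KSQuotient :=
  (Continuous.homeoOfEquivCompactToT2 (f := Equiv.ofBijective _ quotientMap_bijective)
    continuous_quotientMap).symm

theorem quotientHomeo_eq_iff (x : KillingQuotient) (y : KSQuotient) :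
    quotientHomeo x = y ↔ x = quotientMap y :=
  (Equiv.ofBijective _ quotientMap_bijective).symm_apply_eq

theorem isRegularKS_iff (F : KSQuotient → ℝ) :
    IsRegularKS F ↔ IsRegularKilling (F ∘ quotientHomeo) := by
  constructor
  · rintro ⟨d, p, q, ⟨hp, hpd, -⟩, ⟨hq, hqd, -⟩, hpq⟩
    obtain ⟨A, hA, hAv⟩ := exists_form (f := fun M => p M * q M) (n := d + d) (hp.mul hq)
      (fun c M => by rw [hpd, hqd, pow_add]; ring)
    obtain ⟨B, hB, hBv⟩ := exists_form (f := fun M => q M ^ 2) (n := d + d) (hq.pow 2)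
      (fun c M => by rw [hqd, pow_add]; ring)
    have hinv : ∀ {G : EndoField E4 → ℝ}, IsForm (d + d) G →
        ∀ x, ∀ n ∈ Submodule.span ℝ {metric E4}, G (x + n) = G x := fun hG x n hn => by
      obtain ⟨b, rfl⟩ := Submodule.mem_span_singleton.mp hn
      exact hG.inv x b
    refine ⟨d + d, A, B, ⟨hA.poly, hA.homog, hinv hA⟩, ⟨hB.poly, hB.homog, hinv hB⟩, fun K => ?_⟩
    obtain ⟨φ, M, hM⟩ := exists_mem_ksPunctured K
    have hact : ∀ g, actParam g M ∈ ksPunctured := fun g => actParam_mem_ksPunctured g M.2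
    have hFact : ∀ g, p (actParam g M) = F (Quotient.mk _ M) * q (actParam g M) ∧
        q (actParam g M) ≠ 0 := fun g => by
      obtain ⟨h1, h2⟩ := hpq ⟨_, hact g⟩
      rw [ksSetoid_actParam M g ⟨_, hact g⟩ ⟨1, by simp⟩]
      refine ⟨?_, h1⟩
      have h2' : F (Quotient.mk _ ⟨_, hact g⟩) = p (actParam g M) / q (actParam g M) := h2
      rw [h2', div_mul_cancel₀ _ h1]
    have hB0 : 0 < B K := by
      rw [hBv _ _ _ hM]
      exact Finset.sum_pos (fun g _ => by have := (hFact g).2; positivity) Finset.univ_nonempty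
    refine ⟨hB0.ne', ?_⟩
    have hΦ : quotientHomeo (Quotient.mk _ K) = Quotient.mk _ M :=
      (quotientHomeo_eq_iff _ _).mpr (quotient_eq_of_hasKSMatrix hM)
    change F (quotientHomeo (Quotient.mk _ K)) = A K / B K
    rw [hΦ, eq_div_iff hB0.ne', hBv _ _ _ hM, hAv _ _ _ hM, Finset.mul_sum]
    refine Finset.sum_congr rfl fun g _ => ?_
    rw [(hFact g).1]; ring
  · rintro ⟨d, p, q, ⟨hp, hpd, -⟩, ⟨hq, hqd, -⟩, hpq⟩
    refine ⟨d, fun M => p (ksField M), fun M => q (ksField M),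
      ⟨hp.comp_linear ksField, fun c M => by
        change p (ksField (c • M)) = _; rw [map_smul, hpd], fun x n hn => ?_⟩,
      ⟨hq.comp_linear ksField, fun c M => by
        change q (ksField (c • M)) = _; rw [map_smul, hqd], fun x n hn => ?_⟩, fun M => ?_⟩
    · rw [(Submodule.mem_bot ℝ).mp hn, add_zero]
    · rw [(Submodule.mem_bot ℝ).mp hn, add_zero]
    · obtain ⟨h1, h2⟩ := hpq ⟨_, ksField_mem_killingCone M⟩
      have h3 : F (quotientHomeo (quotientMap (Quotient.mk _ M))) =
        p (ksField M) / q (ksField M) := by rw [quotientMap_mk]; exact h2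
      rw [(quotientHomeo_eq_iff _ (Quotient.mk _ M)).mpr rfl] at h3
      exact ⟨h1, h3⟩

end Homeomorphism


open Matrix

section SpecialConformal

variable {V : Type*} [NormedAddCommGroup V] [InnerProductSpace ℝ V] [FiniteDimensional ℝ V]

theorem trace_rankOne (a b : V) :
    LinearMap.trace ℝ V (((innerSL ℝ a).smulRight b : V →L[ℝ] V) : V →ₗ[ℝ] V) = ⟪a, b⟫ := by
  rw [LinearMap.trace_eq_sum_inner _ (stdOrthonormalBasis ℝ V),
    ← (stdOrthonormalBasis ℝ V).sum_inner_mul_inner a b]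
  simp [real_inner_smul_right]

theorem inner_metric (x : Metric.sphere (0 : V) 1) (v w : V) :
    ⟪metric V x v, w⟫ = ⟪v, w⟫ - ⟪(x : V), v⟫ * ⟪(x : V), w⟫ := by
  rw [metric_apply, inner_sub_left, real_inner_smul_left]

theorem inner_metric_symm (x : Metric.sphere (0 : V) 1) (v w : V) :
    ⟪metric V x v, w⟫ = ⟪v, metric V x w⟫ := by
  linarith [inner_metric x v w, inner_metric x w v, real_inner_comm v (metric V x w),
    real_inner_comm v w]

/-- The trace as a continuous linear functional. -/
def traceCLM (V : Type*) [NormedAddCommGroup V] [InnerProductSpace ℝ V] [FiniteDimensional ℝ V] :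
    (V →L[ℝ] V) →L[ℝ] ℝ :=
  LinearMap.toContinuousLinearMap
    ((LinearMap.trace ℝ V).comp (ContinuousLinearMap.coeLM ℝ : (V →L[ℝ] V) →ₗ[ℝ] V →ₗ[ℝ] V))

theorem traceCLM_apply (A : V →L[ℝ] V) : traceCLM V A = LinearMap.trace ℝ V (A : V →ₗ[ℝ] V) := rfl

theorem dTrace_eq {L : EndoField V} (h : ContDiffOn ℝ ∞ (radialExt L) {0}ᶜ)
    (x : Metric.sphere (0 : V) 1) (v : V) :
    dTrace L x v = traceCLM V (fderiv ℝ (radialExt L) (x : V) v) := by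
  have hd := (differentiableAt_radialExt h (ne_zero_of_mem_unit_sphere x)).hasFDerivAt
  have h1 := (traceCLM V).hasFDerivAt.comp (x : V) hd
  have h2 : fderiv ℝ (fun y => LinearMap.trace ℝ V (radialExt L y : V →ₗ[ℝ] V)) (x : V) =
    (traceCLM V).comp (fderiv ℝ (radialExt L) (x : V)) := h1.fderiv
  rw [dTrace, h2]; rfl

theorem contDiffOn_radialExt_metric : ContDiffOn ℝ ∞ (radialExt (metric V)) {0}ᶜ :=
  isField_metric.contDiffOn

theorem fderiv_radialExt_metric (x : Metric.sphere (0 : V) 1) {u : V} (hu : IsTangent x u) (v : V) :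
    fderiv ℝ (radialExt (metric V)) (x : V) u v = -(⟪u, v⟫ • (x : V) + ⟪(x : V), v⟫ • u) := by
  refine ext_inner_right ℝ fun w => ?_
  rw [isField_metric.inner_fderiv x hu, gCurv_apply, gCurv_apply, inner_neg_left, inner_add_left,
    real_inner_smul_left, real_inner_smul_left, show ⟪(x : V), u⟫ = 0 from hu, real_inner_comm (x : V) u,
    show ⟪(x : V), u⟫ = 0 from hu, real_inner_comm u v, real_inner_comm (x : V) v]
  ring

/-- The tangential part of an endomorphism of the ambient space. -/
def tangentialPart (A : V →L[ℝ] V) : EndoField V := fun x => (metric V x).comp (A.comp (metric V x))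

theorem radialExt_tangentialPart (A : V →L[ℝ] V) : radialExt (tangentialPart A) =
    fun y => (radialExt (metric V) y).comp (A.comp (radialExt (metric V) y)) := by
  funext y
  by_cases hy : y ≠ 0
  · simp only [radialExt, dif_pos hy]; rfl
  · simp only [radialExt, dif_neg hy]; ext v; simp

theorem contDiffOn_tangentialPart (A : V →L[ℝ] V) :
    ContDiffOn ℝ ∞ (radialExt (tangentialPart A)) {0}ᶜ := by
  rw [radialExt_tangentialPart]
  exact contDiffOn_radialExt_metric.clm_comp (contDiffOn_const.clm_comp contDiffOn_radialExt_metric)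

theorem fderiv_tangentialPart (A : V →L[ℝ] V) (x : Metric.sphere (0 : V) 1) {u : V}
    (hu : IsTangent x u) (v : V) : fderiv ℝ (radialExt (tangentialPart A)) (x : V) u v =
      -(⟪u, A (metric V x v)⟫ • (x : V) + ⟪(x : V), A (metric V x v)⟫ • u)
        + -metric V x (A (⟪u, v⟫ • (x : V) + ⟪(x : V), v⟫ • u)) := by
  have hd := (differentiableAt_radialExt contDiffOn_radialExt_metric
    (ne_zero_of_mem_unit_sphere x)).hasFDerivAt
  have h := (hd.clm_comp ((hasFDerivAt_const A (x : V)).clm_comp hd))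
  rw [radialExt_tangentialPart, h.fderiv]
  simp only [_root_.add_apply, ContinuousLinearMap.comp_apply,
    ContinuousLinearMap.compL_apply, ContinuousLinearMap.flip_apply, radialExt_sphere,
    _root_.zero_apply, map_zero, add_zero,
    fderiv_radialExt_metric x hu, map_neg]
  abel

theorem trace_tangentialPart {A : V →L[ℝ] V} (hA : ∀ v w, ⟪A v, w⟫ = ⟪v, A w⟫)
    (x : Metric.sphere (0 : V) 1) :
    trace (tangentialPart A) x = traceCLM V A - ⟪A (x : V), (x : V)⟫ := by
  have h : tangentialPart A x = A - (innerSL ℝ (x : V)).smulRight (A (x : V))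
      - (innerSL ℝ (A (x : V))).smulRight (x : V)
      + ⟪A (x : V), (x : V)⟫ • (innerSL ℝ (x : V)).smulRight (x : V) := by
    ext v
    simp only [tangentialPart, ContinuousLinearMap.comp_apply, metric_apply, map_sub, map_smul,
      _root_.sub_apply, _root_.add_apply, _root_.smul_apply,
      ContinuousLinearMap.smulRight_apply, innerSL_apply_apply, hA]
    module
  change traceCLM V (tangentialPart A x) = _
  rw [h, map_add, map_sub, map_sub, map_smul]
  simp only [traceCLM_apply, trace_rankOne, sphere_inner_self]
  rw [real_inner_comm (x : V) (A x)]
  simp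

theorem isSpecialConformalKilling_tangentialPart {A : V →L[ℝ] V}
    (hA : ∀ v w, ⟪A v, w⟫ = ⟪v, A w⟫) : IsSpecialConformalKilling (tangentialPart A) := by
  have hm : ∀ (x : Metric.sphere (0 : V) 1) v w, ⟪metric V x v, w⟫ = ⟪v, metric V x w⟫ :=
    inner_metric_symm
  have hd : ∀ (x : Metric.sphere (0 : V) 1) u, IsTangent x u →
      dTrace (tangentialPart A) x u = -2 * ⟪A (x : V), u⟫ := fun x u hu => by
    have h : fderiv ℝ (radialExt (tangentialPart A)) (x : V) u =
        -((innerSL ℝ (metric V x (A u))).smulRight (x : V) +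
          (innerSL ℝ (metric V x (A x))).smulRight u
          + (innerSL ℝ u).smulRight (metric V x (A (x : V)))
          + (innerSL ℝ (x : V)).smulRight (metric V x (A u))) := by
      ext v
      rw [fderiv_tangentialPart A x hu, ← hA, ← hA, ← hm, ← hm]
      simp only [_root_.neg_apply, _root_.add_apply,
        ContinuousLinearMap.smulRight_apply, innerSL_apply_apply, map_add, map_smul]
      module
    rw [dTrace_eq (contDiffOn_tangentialPart A), h]
    simp only [map_neg, map_add, traceCLM_apply, trace_rankOne]
    rw [inner_metric_of_tangent x _ hu, real_inner_comm _ u, inner_metric_of_tangent x _ hu,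
      real_inner_comm _ (x : V), inner_metric, sphere_inner_self]
    linear_combination (-2) * real_inner_comm (x : V) (A u)
  refine ⟨⟨contDiffOn_tangentialPart A, fun x => ?_, fun x v w => ?_⟩, fun x u v w hu hv hw => ?_⟩
  · simp [tangentialPart, metric_apply]
  · simp only [tangentialPart, ContinuousLinearMap.comp_apply]
    rw [hm, hA, hm]
  · rw [hd x v hv, hd x w hw, nabla, inner_metric_of_tangent x _ hw, fderiv_tangentialPart A x hu]
    rw [show metric V x v = v by rw [metric_apply, show ⟪(x : V), v⟫ = 0 from hv]; simp]
    rw [show ⟪(x : V), v⟫ = 0 from hv, zero_smul, add_zero, inner_add_left, inner_neg_left,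
      inner_neg_left, inner_metric_of_tangent x _ hw, inner_add_left, real_inner_smul_left,
      real_inner_smul_left, map_smul, real_inner_smul_left, show ⟪(x : V), w⟫ = 0 from hw,
      ← hA, real_inner_comm u v, real_inner_comm u w]
    linear_combination ⟪u, w⟫ * hA x v

/-- The Kulkarni–Nomizu product of an endomorphism with the metric. -/
def kulkarniNomizu (A : V →L[ℝ] V) : Tensor4 V :=
  Tensor4.mk (fun a b c d => ⟪A a, c⟫ * ⟪b, d⟫ + ⟪a, c⟫ * ⟪A b, d⟫ - ⟪A a, d⟫ * ⟪b, c⟫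
      - ⟪a, d⟫ * ⟪A b, c⟫)
    (fun a a' b c d => by simp only [map_add, inner_add_left]; ring)
    (fun r a b c d => by simp only [map_smul, real_inner_smul_left]; ring)
    (fun a b b' c d => by simp only [map_add, inner_add_left]; ring)
    (fun r a b c d => by simp only [map_smul, real_inner_smul_left]; ring)
    (fun a b c c' d => by simp only [inner_add_right]; ring)
    (fun r a b c d => by simp only [real_inner_smul_right]; ring)
    (fun a b c d d' => by simp only [inner_add_right]; ring)
    (fun r a b c d => by simp only [real_inner_smul_right]; ring)

theorem kulkarniNomizu_apply (A : V →L[ℝ] V) (a b c d : V) : kulkarniNomizu A a b c d =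
    ⟪A a, c⟫ * ⟪b, d⟫ + ⟪a, c⟫ * ⟪A b, d⟫ - ⟪A a, d⟫ * ⟪b, c⟫ - ⟪a, d⟫ * ⟪A b, c⟫ := rfl

theorem isCurv_kulkarniNomizu {A : V →L[ℝ] V} (hA : ∀ v w, ⟪A v, w⟫ = ⟪v, A w⟫) :
    IsCurv (kulkarniNomizu A) where
  left a b c d := by simp only [kulkarniNomizu_apply]; ring
  right a b c d := by simp only [kulkarniNomizu_apply]; ring
  pair a b c d := by
    simp only [kulkarniNomizu_apply, hA a, hA b, real_inner_comm _ a, real_inner_comm _ b]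
    ring
  bianchi a b c d := by
    simp only [kulkarniNomizu_apply, hA a, hA b]
    rw [hA c d, hA c b, hA d b, hA d c, ← hA b c, ← hA b d, ← hA c d]
    rw [real_inner_comm c b, real_inner_comm d b, real_inner_comm c d,
      ← real_inner_comm (A b), ← real_inner_comm (A b)]
    linear_combination ⟪a, b⟫ * real_inner_comm (A c) d

end SpecialConformal


open Matrix

section SpecialKilling

variable {V : Type*} [NormedAddCommGroup V] [InnerProductSpace ℝ V] [FiniteDimensional ℝ V]

theorem radialExt_sub_trace {K L : EndoField V} (h : ∀ x, K x = L x - trace L x • metric V x) :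
    radialExt K = fun y => radialExt L y - traceCLM V (radialExt L y) • radialExt (metric V) y := by
  funext y
  by_cases hy : y ≠ 0
  · simp only [radialExt, dif_pos hy, h]; rfl
  · simp only [radialExt, dif_neg hy, map_zero, zero_smul, sub_zero]

theorem inner_nabla_of_sub_trace {K L : EndoField V} (hL : IsSpecialConformalKilling L)
    (h : ∀ x, K x = L x - trace L x • metric V x) (x : Metric.sphere (0 : V) 1) {u v w : V}
    (hu : IsTangent x u) (hv : IsTangent x v) (hw : IsTangent x w) :
    ⟪nabla K x u v, w⟫ = (1 / 2 : ℝ) * dTrace L x v * ⟪w, u⟫ + (1 / 2 : ℝ) * dTrace L x w * ⟪v, u⟫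
      - dTrace L x u * ⟪v, w⟫ := by
  have hx := ne_zero_of_mem_unit_sphere x
  have h1 := (differentiableAt_radialExt hL.1.1 hx).hasFDerivAt
  have h2 := (differentiableAt_radialExt (contDiffOn_radialExt_metric (V := V)) hx).hasFDerivAt
  have h3 := h1.sub (((traceCLM V).hasFDerivAt.comp (x : V) h1).smul h2)
  have h5 : fderiv ℝ (radialExt K) (x : V) u v = fderiv ℝ (radialExt L) (x : V) u v -
      (traceCLM V (radialExt L (x : V)) • fderiv ℝ (radialExt (metric V)) (x : V) u v +
        traceCLM V (fderiv ℝ (radialExt L) (x : V) u) • radialExt (metric V) (x : V) v) := by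
    rw [radialExt_sub_trace h]
    exact congrArg (fun T : V →L[ℝ] V →L[ℝ] V => T u v) h3.fderiv
  have h6 := hL.2 x u v w hu hv hw
  rw [nabla, inner_metric_of_tangent x _ hw] at h6 ⊢
  rw [h5, inner_sub_left, inner_add_left, real_inner_smul_left, real_inner_smul_left, h6,
    fderiv_radialExt_metric x hu, radialExt_sphere, radialExt_sphere, inner_metric_of_tangent x _ hw, inner_neg_left,
    inner_add_left, real_inner_smul_left, real_inner_smul_left, show ⟪(x : V), w⟫ = 0 from hw,
    show ⟪(x : V), v⟫ = 0 from hv, ← dTrace_eq hL.1.1]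
  ring

theorem IsSpecialKilling.isKilling {K : EndoField V} (h : IsSpecialKilling K) : IsKilling K := by
  obtain ⟨L, hL, h⟩ := h
  refine ⟨⟨?_, fun x => ?_, fun x v w => ?_⟩, fun x u v w hu hv hw => ?_⟩
  · rw [radialExt_sub_trace h]
    exact hL.1.1.sub (((traceCLM V).contDiff.comp_contDiffOn hL.1.1).smul contDiffOn_radialExt_metric)
  · rw [h, _root_.sub_apply, hL.1.2.1, _root_.smul_apply, metric_apply, sphere_inner_self]
    simp
  · simp only [h, _root_.sub_apply, _root_.smul_apply, inner_sub_left, inner_sub_right,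
      real_inner_smul_left, real_inner_smul_right, hL.1.2.2]
    rw [inner_metric_symm]
  · rw [inner_nabla_of_sub_trace hL h x hu hv hw, inner_nabla_of_sub_trace hL h x hv hw hu,
      inner_nabla_of_sub_trace hL h x hw hu hv, real_inner_comm w u, real_inner_comm u v,
      real_inner_comm v w]
    ring

theorem IsSpecialKilling.blocks_diag {C : Tensor4 E4} (hC : IsCurv C)
    (h : IsSpecialKilling (fieldOf C)) {f : Fin 4 → E4} (hf : Orthonormal ℝ f) (α : Fin 3) :
    blockP C f α α = blockD C f α α := by
  obtain ⟨L, hL, h⟩ := h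
  have key : ∀ i j k l : Fin 4, i ≠ j → i ≠ k → i ≠ l → j ≠ k → j ≠ l → k ≠ l →
      C (f j) (f k) (f i) (f l) + C (f i) (f k) (f j) (f l) = 0 := by
    intro i j k l hij hik hil hjk hjl hkl
    have ho := fun a b => orthonormal_iff_ite.mp hf a b
    have hn : ‖f i‖ = 1 := hf.1 i
    have hu : IsTangent (⟨f i, by simp [hn]⟩ : Metric.sphere (0 : E4) 1) (f j) := by
      change ⟪f i, f j⟫ = 0; rw [ho, if_neg hij]
    have hv : IsTangent (⟨f i, by simp [hn]⟩ : Metric.sphere (0 : E4) 1) (f k) := by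
      change ⟪f i, f k⟫ = 0; rw [ho, if_neg hik]
    have hw : IsTangent (⟨f i, by simp [hn]⟩ : Metric.sphere (0 : E4) 1) (f l) := by
      change ⟪f i, f l⟫ = 0; rw [ho, if_neg hil]
    have h1 := inner_nabla_of_sub_trace hL h _ hu hv hw
    rw [(isField_fieldOf C).inner_nabla _ hu hw, ho, ho, ho, if_neg hjl.symm, if_neg hjk.symm,
      if_neg hkl] at h1
    linarith
  have hb : bMat C f α α = 0 := by
    have ht := bMat_trace hC f
    have h1 := key 0 1 2 3 (by decide) (by decide) (by decide) (by decide) (by decide) (by decide)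
    have h2 := key 0 2 3 1 (by decide) (by decide) (by decide) (by decide) (by decide) (by decide)
    have e0 : bMat C f 0 0 = C (f 0) (f 1) (f 2) (f 3) := rfl
    have e1 : bMat C f 1 1 = C (f 0) (f 2) (f 3) (f 1) := rfl
    have e2 : bMat C f 2 2 = C (f 0) (f 3) (f 1) (f 2) := rfl
    have r1 := hC.pair (f 0) (f 3) (f 1) (f 2)
    have r2 := hC.right (f 0) (f 2) (f 1) (f 3)
    have r3 := hC.pair (f 0) (f 1) (f 2) (f 3)
    have r4 := hC.right (f 0) (f 3) (f 2) (f 1)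
    fin_cases α
    · change bMat C f 0 0 = 0; linarith
    · change bMat C f 1 1 = 0; linarith
    · change bMat C f 2 2 = 0; linarith
  rw [bMat_eq_blocks hC] at hb
  simp only [Matrix.add_apply, Matrix.sub_apply, Matrix.smul_apply, Matrix.transpose_apply,
    smul_eq_mul] at hb
  linarith

theorem blockP_eq_smul_one {C : Tensor4 E4} (hC : IsCurv C)
    (h : ∀ f : Fin 4 → E4, Orthonormal ℝ f → ∀ α, blockP C f α α = blockD C f α α)
    {f : Fin 4 → E4} (hf : Orthonormal ℝ f) :
    blockP C f = blockP C f 0 0 • (1 : Matrix (Fin 3) (Fin 3) ℝ) := by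
  have key : ∀ p : Fin 4 → ℝ, p 0 ^ 2 + p 1 ^ 2 + p 2 ^ 2 + p 3 ^ 2 = 1 → ∀ α,
      (rot p * blockP C f * (rot p)ᵀ) α α = blockP C f α α := fun p hp α => by
    rw [← blockP_leftFrame hC, h _ (orthonormal_leftFrame hp hf), blockD_leftFrame hC hp, h f hf]
  have k1 := key ![1 / 2, 1 / 2, 1 / 2, 1 / 2] (by simp; norm_num) 0
  have k2 := key ![1 / 2, 1 / 2, -1 / 2, 1 / 2] (by simp; norm_num) 0
  have k3 := key ![3 / 5, 0, 0, 4 / 5] (by simp; norm_num) 0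
  have k4 := key ![3 / 5, 0, 4 / 5, 0] (by simp; norm_num) 0
  have k5 := key ![3 / 5, 4 / 5, 0, 0] (by simp; norm_num) 1
  obtain ⟨a, b, c, d, e, g, hP⟩ := symm_eq (blockP_symm hC f)
  rw [hP] at k1 k2 k3 k4 k5 ⊢
  simp only [rot, Matrix.mul_apply, Fin.sum_univ_three, Matrix.transpose_apply, Matrix.of_apply,
    Matrix.cons_val', Matrix.cons_val] at k1 k2 k3 k4 k5
  norm_num at k1 k2 k3 k4 k5
  have hd : d = a := by linarith
  have hg : g = a := by linarith
  have hb : b = 0 := by linarith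
  have hc : c = 0 := by linarith
  have he : e = 0 := by linarith
  subst hd hg hb hc he
  ext i j
  fin_cases i <;> fin_cases j <;> simp

/-- The curvature tensor of a special Killing tensor is conformally flat. -/
theorem IsSpecialKilling.exists_scalar_blocks {K : EndoField E4} (h : IsSpecialKilling K) :
    ∃ (C : Tensor4 E4) (σ : ℝ), IsCurv C ∧ K = fieldOf C ∧
      blockP C e = σ • (1 : Matrix (Fin 3) (Fin 3) ℝ) ∧
      blockD C e = σ • (1 : Matrix (Fin 3) (Fin 3) ℝ) := by
  obtain ⟨C, hC, rfl⟩ := h.isKilling.exists_eq_fieldOf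
  have hd := fun f hf α => h.blocks_diag hC (f := f) hf α
  have hP := blockP_eq_smul_one hC hd orthonormal_e
  have hD := blockP_eq_smul_one hC hd (orthonormal_reflectFrame orthonormal_e)
  rw [blockP_reflectFrame, ← hd e orthonormal_e] at hD
  exact ⟨C, _, hC, rfl, hP, hD⟩

theorem IsSpecialKilling.isIntegrable {K : EndoField E4} (h : IsSpecialKilling K) :
    IsIntegrable K := by
  obtain ⟨C, σ, hC, rfl, hP, hD⟩ := h.exists_scalar_blocks
  exact isIntegrable_of_scalar_blocks hC (isField_fieldOf C) hP hD

theorem isSpecialKilling_kulkarniNomizu {B : E4 →L[ℝ] E4} (hB : ∀ v w, ⟪B v, w⟫ = ⟪v, B w⟫) :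
    IsSpecialKilling (fieldOf (kulkarniNomizu B)) := by
  set A := B - (traceCLM E4 B / 2) • ContinuousLinearMap.id ℝ E4 with hAdef
  have hA : ∀ v w, ⟪A v, w⟫ = ⟪v, A w⟫ := fun v w => by
    simp [hAdef, inner_sub_left, inner_sub_right, real_inner_smul_left, real_inner_smul_right, hB]
  have htr : traceCLM E4 A = -traceCLM E4 B := by
    have : traceCLM E4 (ContinuousLinearMap.id ℝ E4) = 4 := by
      rw [traceCLM_apply, ContinuousLinearMap.coe_id, LinearMap.trace_id, finrank_E4]; norm_num
    rw [hAdef, map_sub, map_smul, this, smul_eq_mul]; ring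
  refine ⟨tangentialPart A, isSpecialConformalKilling_tangentialPart hA, fun x => ?_⟩
  ext1 v
  refine ext_inner_right ℝ fun w => ?_
  rw [isField_fieldOf, kulkarniNomizu_apply, sphere_inner_self, trace_tangentialPart hA, htr,
    _root_.sub_apply, _root_.smul_apply, inner_sub_left, real_inner_smul_left, inner_metric,
    tangentialPart, ContinuousLinearMap.comp_apply, ContinuousLinearMap.comp_apply, inner_metric,
    metric_apply]
  simp only [hAdef, _root_.sub_apply, _root_.smul_apply, ContinuousLinearMap.id_apply, map_sub,
    map_smul, inner_sub_left, inner_sub_right, real_inner_smul_left, real_inner_smul_right,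
    sphere_inner_self, real_inner_comm (x : E4) v]
  rw [← hB x v, ← hB x x]
  linear_combination (-⟪(x : E4), w⟫) * (hB v x).trans (real_inner_comm _ _)

theorem kulkarniNomizu_pull (B : E4 →L[ℝ] E4) (φ : E4 ≃ₗᵢ[ℝ] E4) :
    (kulkarniNomizu B).pull (φ.toLinearEquiv : E4 →ₗ[ℝ] E4) =
      kulkarniNomizu ((φ.symm.toContinuousLinearEquiv : E4 →L[ℝ] E4).comp
        (B.comp (φ.toContinuousLinearEquiv : E4 →L[ℝ] E4))) := by
  ext a b c d
  have h : ∀ v w : E4, ⟪φ.symm (B (φ v)), w⟫ = ⟪B (φ v), φ w⟫ := fun v w =>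
    LinearIsometryEquiv.inner_map_eq_flip φ.symm _ _
  change kulkarniNomizu B (φ a) (φ b) (φ c) (φ d) = ⟪φ.symm (B (φ a)), c⟫ * ⟪b, d⟫ +
    ⟪a, c⟫ * ⟪φ.symm (B (φ b)), d⟫ - ⟪φ.symm (B (φ a)), d⟫ * ⟪b, c⟫
      - ⟪a, d⟫ * ⟪φ.symm (B (φ b)), c⟫
  rw [kulkarniNomizu_apply]
  simp only [h, LinearIsometryEquiv.inner_map_map]

theorem isSkew_ofParams_iff (p t : Fin 3 → ℝ) :
    (ofParams p t : Matrix (Fin 3) (Fin 3) ℝ)ᵀ = -(ofParams p t : Matrix (Fin 3) (Fin 3) ℝ) ↔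
      p 1 = p 0 ∧ p 2 = p 0 := by
  rw [coe_ofParams]
  constructor
  · intro h
    have h0 := congrFun (congrFun h 0) 0
    have h1 := congrFun (congrFun h 1) 1
    have h2 := congrFun (congrFun h 2) 2
    simp at h0 h1 h2
    constructor <;> linarith
  · rintro ⟨h1, h2⟩
    rw [h1, h2]
    ext i j
    fin_cases i <;> fin_cases j <;> simp

/-- The diagonal endomorphism with given eigenvalues. -/
def diagEnd (a : Fin 4 → ℝ) : E4 →L[ℝ] E4 := ∑ i, a i • (innerSL ℝ (e i)).smulRight (e i)

theorem inner_diagEnd (a : Fin 4 → ℝ) (v w : E4) :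
    ⟪diagEnd a v, w⟫ = ∑ i, a i * ⟪e i, v⟫ * ⟪e i, w⟫ := by
  simp [diagEnd, sum_inner, real_inner_smul_left, mul_assoc]

theorem diagEnd_symm (a : Fin 4 → ℝ) (v w : E4) : ⟪diagEnd a v, w⟫ = ⟪v, diagEnd a w⟫ := by
  rw [inner_diagEnd, real_inner_comm, inner_diagEnd]
  exact Finset.sum_congr rfl fun i _ => by ring

theorem inner_diagEnd_e (a : Fin 4 → ℝ) (i j : Fin 4) :
    ⟪diagEnd a (e i), e j⟫ = if i = j then a i else 0 := by
  rw [inner_diagEnd, Finset.sum_eq_single i (fun k _ hk => by simp [inner_e, hk]) (by simp), inner_e, inner_e,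
    if_pos rfl]
  simp

theorem kulkarniNomizu_diagEnd {s : Fin 4 → Fin 4 → ℝ} {a : Fin 4 → ℝ}
    (h : ∀ i j, i ≠ j → s i j = a i + a j) : kulkarniNomizu (diagEnd a) = diagCurv s := by
  refine IsDiagCurv.eq_diagCurv (fun i j k l hijkl => ?_)
    (isCurv_kulkarniNomizu (diagEnd_symm a)) fun i j hij => ?_
  · simp only [kulkarniNomizu_apply, inner_e, inner_diagEnd_e]
    have h1 : ¬ (i = k ∧ j = l) := by rintro ⟨rfl, rfl⟩; exact hijkl rfl
    have h2 : ¬ (i = l ∧ j = k) := by rintro ⟨rfl, rfl⟩; exact hijkl (Set.pair_comm _ _)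
    by_cases hik : i = k <;> by_cases hjl : j = l <;> by_cases hil : i = l <;>
      by_cases hjk : j = k <;> simp_all
  · rw [h i j hij]
    simp only [kulkarniNomizu_apply, inner_e, inner_diagEnd_e, if_pos, if_neg hij, if_neg hij.symm]
    ring

theorem isSpecialKilling_of_skew {K : EndoField E4} {M : KSSpace} {φ : E4 ≃ₗᵢ[ℝ] E4}
    (h : HasKSMatrix (pushforward φ K) M)
    (hM : (M : Matrix (Fin 3) (Fin 3) ℝ)ᵀ = -(M : Matrix (Fin 3) (Fin 3) ℝ)) :
    IsSpecialKilling K := by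
  obtain ⟨p, t, hK, rfl⟩ := hasKSMatrix_iff_params.mp h
  obtain ⟨h1, h2⟩ := (isSkew_ofParams_iff p t).mp hM
  have hd := kulkarniNomizu_diagEnd (s := secMat p t) (a := ![(p 0 + t 0 + t 1 + t 2) / 2,
    (p 0 + t 0 - t 1 - t 2) / 2, (p 0 - t 0 + t 1 - t 2) / 2, (p 0 - t 0 - t 1 + t 2) / 2])
    (fun i j hij => by
      fin_cases i <;> fin_cases j <;> simp [secMat, h1, h2] at hij ⊢ <;> ring)
  have hK' : K = pushforward φ.symm (pushforward φ K) := (pushforward_symm_pushforward φ K).symm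
  rw [hK, ← hd, pushforward_fieldOf, LinearIsometryEquiv.symm_symm, kulkarniNomizu_pull] at hK'
  rw [hK']
  refine isSpecialKilling_kulkarniNomizu fun v w => ?_
  change ⟪φ.symm (diagEnd _ (φ v)), w⟫ = ⟪v, φ.symm (diagEnd _ (φ w))⟫
  rw [LinearIsometryEquiv.inner_map_eq_flip, LinearIsometryEquiv.symm_symm, diagEnd_symm,
    real_inner_comm, ← LinearIsometryEquiv.symm_symm φ,
    ← LinearIsometryEquiv.inner_map_eq_flip, real_inner_comm, LinearIsometryEquiv.symm_symm]

theorem IsSpecialKilling.skew {K : EndoField E4} (hK : IsSpecialKilling K) {M : KSSpace}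
    {φ : E4 ≃ₗᵢ[ℝ] E4} (h : HasKSMatrix (pushforward φ K) M) :
    (M : Matrix (Fin 3) (Fin 3) ℝ)ᵀ = -(M : Matrix (Fin 3) (Fin 3) ℝ) := by
  obtain ⟨C, U, V, p, t, hC, rfl, rfl, hU, -, -, -, hP, -, -⟩ := exists_blocks_of_hasKSMatrix h
  obtain ⟨C', σ, hC', hCC', hP', -⟩ := hK.exists_scalar_blocks
  obtain rfl := fieldOf_injective hC hC' hCC'
  rw [hP'] at hP
  have h1 : diagonal p = σ • (1 : Matrix (Fin 3) (Fin 3) ℝ) := by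
    have hU' := mul_eq_one_comm.mp hU
    calc diagonal p = (Uᵀ * U) * diagonal p * (Uᵀ * U) := by rw [hU']; simp
      _ = Uᵀ * (U * diagonal p * Uᵀ) * U := by simp only [Matrix.mul_assoc]
      _ = _ := by rw [← hP]; simp [hU']
  have h2 : ∀ i, p i = σ := fun i => by
    have := congrFun (congrFun h1 i) i
    simpa using this
  rw [isSkew_ofParams_iff, h2, h2, h2]
  exact ⟨rfl, rfl⟩

theorem mem_ksCone_of_skew {M : KSSpace}
    (hM : (M : Matrix (Fin 3) (Fin 3) ℝ)ᵀ = -(M : Matrix (Fin 3) (Fin 3) ℝ)) : M ∈ ksCone := by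
  obtain ⟨p, t, rfl⟩ := exists_params M
  obtain ⟨h1, h2⟩ := (isSkew_ofParams_iff p t).mp hM
  change (ofParams p t : Matrix (Fin 3) (Fin 3) ℝ).det = 0
  rw [det_ofParams, h1, h2]
  ring

theorem isSpecialKilling_iff (K : EndoField E4) : IsSpecialKilling K ↔
    ∃ (φ : E4 ≃ₗᵢ[ℝ] E4) (M : KSSpace),
      (M : Matrix (Fin 3) (Fin 3) ℝ)ᵀ = -(M : Matrix (Fin 3) (Fin 3) ℝ) ∧
        HasKSMatrix (pushforward φ K) M := by
  constructor
  · intro h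
    obtain ⟨φ, M, hM⟩ := h.isIntegrable.exists_hasKSMatrix h.isKilling
    exact ⟨φ, M, h.skew hM, hM⟩
  · rintro ⟨φ, M, hM, h⟩
    exact isSpecialKilling_of_skew h hM

theorem HasKSMatrix.isSpecialKilling_iff {K : EndoField E4} {M : KSSpace} (h : HasKSMatrix K M) :
    IsSpecialKilling K ↔
      (M : Matrix (Fin 3) (Fin 3) ℝ)ᵀ = -(M : Matrix (Fin 3) (Fin 3) ℝ) := by
  rw [← pushforward_refl K] at h
  exact ⟨fun hK => hK.skew h, isSpecialKilling_of_skew h⟩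

end SpecialKilling


open Matrix

section CriticalPoints

/-- The diagonal entries of a matrix in `𝒜`. -/
def dVec (M : KSSpace) (i : Fin 3) : ℝ := (M : Matrix (Fin 3) (Fin 3) ℝ) i i

theorem sum_dVec (M : KSSpace) : dVec M 0 + dVec M 1 + dVec M 2 = 0 := ksSpace_trace M

theorem dVec_add (M N : KSSpace) (i : Fin 3) : dVec (M + N) i = dVec M i + dVec N i := rfl

theorem dVec_smul (c : ℝ) (M : KSSpace) (i : Fin 3) : dVec (c • M) i = c * dVec M i := rfl

theorem dVec_ofParams (p t : Fin 3 → ℝ) :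
    dVec (ofParams p t) = ![p 1 - p 2, p 2 - p 0, p 0 - p 1] := by
  ext i; fin_cases i <;> rfl

theorem ksSpace_ext {M N : KSSpace} (hd : dVec M = dVec N) (ht : tVec M = tVec N) : M = N := by
  have h0 := congrFun hd 0
  have h1 := congrFun hd 1
  have h2 := congrFun hd 2
  simp only [dVec] at h0 h1 h2
  rw [← ofParams_vec M, ← ofParams_vec N, ht]
  congr 1
  funext i
  fin_cases i <;> simp [wVec, h0, h1, h2]

/-- The determinant on `𝒜`. -/
def ksDet (M : KSSpace) : ℝ := dVec M 0 * dVec M 1 * dVec M 2 + dVec M 0 * tVec M 0 ^ 2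
  + dVec M 1 * tVec M 1 ^ 2 + dVec M 2 * tVec M 2 ^ 2

theorem mem_ksCone_iff_ksDet (M : KSSpace) : M ∈ ksCone ↔ ksDet M = 0 := by
  obtain ⟨p, t, rfl⟩ := exists_params M
  change (ofParams p t : Matrix (Fin 3) (Fin 3) ℝ).det = 0 ↔ _
  rw [det_ofParams, ksDet, dVec_ofParams, tVec_ofParams]
  rfl

/-- The differential of the determinant at `M` in the direction `N`. -/
def ksDeriv (M N : KSSpace) : ℝ :=
  dVec N 0 * (dVec M 1 * dVec M 2 + tVec M 0 ^ 2) + dVec N 1 * (dVec M 0 * dVec M 2 + tVec M 1 ^ 2)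
  + dVec N 2 * (dVec M 0 * dVec M 1 + tVec M 2 ^ 2) + 2 * (dVec M 0 * tVec M 0 * tVec N 0
  + dVec M 1 * tVec M 1 * tVec N 1 + dVec M 2 * tVec M 2 * tVec N 2)

theorem ksDet_add_smul (M N : KSSpace) (s : ℝ) : ksDet (M + s • N) =
    ksDet M + s * ksDeriv M N + s ^ 2 * ksDeriv N M + s ^ 3 * ksDet N := by
  simp only [ksDet, ksDeriv, dVec_add, dVec_smul, tVec_add, tVec_smul, Pi.add_apply, Pi.smul_apply,
    smul_eq_mul]
  ring

theorem ksDeriv_self (M : KSSpace) : ksDeriv M M = 3 * ksDet M := by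
  simp only [ksDet, ksDeriv]; ring

/-- The coordinates on `𝒜`. -/
def ksEquiv : KSSpace ≃ₗ[ℝ] (Fin 5 → ℝ) where
  toFun M := ![dVec M 0, dVec M 1, tVec M 0, tVec M 1, tVec M 2]
  map_add' M N := by
    ext i; fin_cases i <;> simp [dVec_add, tVec_add]
  map_smul' c M := by
    ext i; fin_cases i <;> simp [dVec_smul, tVec_smul]
  invFun x := ofParams ![0, x 0 + x 1, x 1] ![x 2, x 3, x 4]
  left_inv M := by
    have := sum_dVec M
    refine ksSpace_ext ?_ ?_
    · rw [dVec_ofParams]; ext i; fin_cases i <;> simp; linarith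
    · rw [tVec_ofParams]; ext i; fin_cases i <;> simp
  right_inv x := by
    ext i
    simp only [dVec_ofParams, tVec_ofParams]; fin_cases i <;> simp

theorem finrank_ksSpace : Module.finrank ℝ KSSpace = 5 := by
  rw [ksEquiv.finrank_eq]; simp

theorem isPolynomialFun_ksDet : IsPolynomialFun ksDet := by
  have hd : ∀ i, IsPolynomialFun fun M => dVec M i := fun i => isPolynomialFun_linear
    { toFun := fun M => dVec M i, map_add' := fun M N => rfl, map_smul' := fun c M => rfl }
  have ht : ∀ i, IsPolynomialFun fun M => tVec M i := fun i => isPolynomialFun_linear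
    { toFun := fun M => tVec M i, map_add' := fun M N => by rw [tVec_add]; rfl
      map_smul' := fun c M => by rw [tVec_smul]; rfl }
  exact (Algebra.adjoin ℝ _).add_mem ((Algebra.adjoin ℝ _).add_mem ((Algebra.adjoin ℝ _).add_mem
    (((hd 0).mul (hd 1)).mul (hd 2)) ((hd 0).mul ((ht 0).pow 2))) ((hd 1).mul ((ht 1).pow 2)))
    ((hd 2).mul ((ht 2).pow 2))

/-- The matrices of rank one in `𝒜`, up to multiples. -/
def rankOneMat (α : Fin 3) (ε : ℝ) : KSSpace := ofParams (Pi.single α 1) (Pi.single α ε)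

theorem dVec_rankOneMat (α : Fin 3) (ε : ℝ) : dVec (rankOneMat α ε) α = 0 ∧
    dVec (rankOneMat α ε) (α + 1) = -1 ∧ dVec (rankOneMat α ε) (α + 2) = 1 := by
  rw [rankOneMat, dVec_ofParams]
  fin_cases α <;> simp

theorem tVec_rankOneMat (α : Fin 3) (ε : ℝ) : tVec (rankOneMat α ε) = Pi.single α ε :=
  tVec_ofParams _ _

/-- The singular skew symmetric matrices, up to multiples. -/
def skewMat (i : Fin 4) : KSSpace :=
  ofParams 0 (![![-1, -1, -1], ![-1, 1, 1], ![1, -1, 1], ![1, 1, -1]] i)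

theorem dVec_skewMat (i : Fin 4) : dVec (skewMat i) = 0 := by
  rw [skewMat, dVec_ofParams]; ext j; fin_cases j <;> simp

theorem tVec_skewMat (i : Fin 4) :
    tVec (skewMat i) = ![![-1, -1, -1], ![-1, 1, 1], ![1, -1, 1], ![1, 1, -1]] i :=
  tVec_ofParams _ _

theorem ksDeriv_rankOneMat (α : Fin 3) {ε : ℝ} (hε : ε * ε = 1) (N : KSSpace) :
    ksDeriv (rankOneMat α ε) N = 0 := by
  have h := dVec_rankOneMat α ε
  simp only [ksDeriv, tVec_rankOneMat]
  fin_cases α <;> simp at h ⊢ <;> rw [h.1, h.2.1, h.2.2] <;>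
    [linear_combination (dVec N 0) * hε;
    linear_combination (dVec N 1) * hε; linear_combination (dVec N 2) * hε]

theorem ksDeriv_skewMat (i : Fin 4) (N : KSSpace) : ksDeriv (skewMat i) N = 0 := by
  simp only [ksDeriv, tVec_skewMat, dVec_skewMat]
  have := sum_dVec N
  fin_cases i <;> simp <;> linarith

/-- The critical points of the determinant. -/
theorem eq_rankOneMat_or_skewMat {M : KSSpace} (hM : M ≠ 0) (h : ∀ N, ksDeriv M N = 0) :
    (∃ c : ℝ, c ≠ 0 ∧ ∃ α ε, (ε = 1 ∨ ε = -1) ∧ M = c • rankOneMat α ε) ∨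
      ∃ c : ℝ, c ≠ 0 ∧ ∃ i, M = c • skewMat i := by
  have hs := sum_dVec M
  have e0 := h (ofParams 0 ![1, 0, 0])
  have e1 := h (ofParams 0 ![0, 1, 0])
  have e2 := h (ofParams 0 ![0, 0, 1])
  have e3 := h (ofParams ![1, 0, 0] 0)
  have e4 := h (ofParams ![0, 1, 0] 0)
  simp only [ksDeriv, dVec_ofParams, tVec_ofParams, Matrix.cons_val, Pi.zero_apply] at e0 e1 e2 e3 e4
  set d := dVec M with hd
  set t := tVec M with ht
  have hz : d 0 = 0 ∨ d 1 = 0 ∨ d 2 = 0 := by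
    by_contra hcon
    push Not at hcon
    obtain ⟨h0, h1, h2⟩ := hcon
    have t0 : t 0 = 0 := (mul_eq_zero.mp (show d 0 * t 0 = 0 by linarith)).resolve_left h0
    have t1 : t 1 = 0 := (mul_eq_zero.mp (show d 1 * t 1 = 0 by linarith)).resolve_left h1
    have t2 : t 2 = 0 := (mul_eq_zero.mp (show d 2 * t 2 = 0 by linarith)).resolve_left h2
    rw [t0, t1, t2] at e3 e4
    have h3 : d 2 = d 1 := mul_left_cancel₀ h0 (by linarith)
    have h4 : d 2 = d 0 := mul_left_cancel₀ h1 (by linarith)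
    exact h2 (by linarith)
  have hmul : ∀ {a b : ℝ}, a ≠ 0 → 0 - a * a + b ^ 2 = 0 → b / a = 1 ∨ b / a = -1 := fun ha hb => by
    rw [div_eq_iff ha, div_eq_iff ha, one_mul, neg_one_mul]
    exact sq_eq_sq_iff_eq_or_eq_neg.mp (by linear_combination hb)
  by_cases hall : d = 0
  · right
    simp only [hall, Pi.zero_apply] at e3 e4
    have h1 : t 1 = t 2 ∨ t 1 = -t 2 := sq_eq_sq_iff_eq_or_eq_neg.mp (by linarith)
    have h2 : t 0 = t 2 ∨ t 0 = -t 2 := sq_eq_sq_iff_eq_or_eq_neg.mp (by linarith)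
    have hc : t 2 ≠ 0 := fun h0 => hM (ksSpace_ext (hd.symm.trans hall) (by
      rw [← ht]
      have hz : tVec (0 : KSSpace) = 0 := by simpa using tVec_smul 0 0
      rw [hz]
      ext i; fin_cases i <;> simp [h0] at h1 h2 ⊢ <;> assumption))
    have main : ∀ (c : ℝ) (i : Fin 4), c ≠ 0 → t = c • tVec (skewMat i) →
        ∃ c : ℝ, c ≠ 0 ∧ ∃ i, M = c • skewMat i := fun c i hc h => ⟨c, hc, i, ksSpace_ext (by
          rw [← hd, hall]; ext j; rw [dVec_smul, dVec_skewMat]; simp) (by rw [tVec_smul, ← h])⟩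
    simp only [tVec_skewMat] at main
    rcases h1 with h1 | h1 <;> rcases h2 with h2 | h2
    · exact main (-t 2) 0 (neg_ne_zero.mpr hc) (by ext j; fin_cases j <;> simp [h1, h2])
    · exact main (t 2) 1 hc (by ext j; fin_cases j <;> simp [h1, h2])
    · exact main (t 2) 2 hc (by ext j; fin_cases j <;> simp [h1, h2])
    · exact main (-t 2) 3 (neg_ne_zero.mpr hc) (by ext j; fin_cases j <;> simp [h1, h2])
  · left
    have main : ∀ (α : Fin 3), d α = 0 → d (α + 1) = -d (α + 2) → d (α + 2) ≠ 0 →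
        t (α + 1) = 0 → t (α + 2) = 0 → 0 - d (α + 2) * d (α + 2) + t α ^ 2 = 0 →
        ∃ c : ℝ, c ≠ 0 ∧ ∃ α ε, (ε = 1 ∨ ε = -1) ∧ M = c • rankOneMat α ε := by
      intro α h0 h1 h2 h3 h4 h5
      refine ⟨d (α + 2), h2, α, t α / d (α + 2), hmul h2 h5, ksSpace_ext ?_ ?_⟩
      · obtain ⟨g0, g1, g2⟩ := dVec_rankOneMat α (t α / d (α + 2))
        ext i
        rw [dVec_smul, ← hd]
        fin_cases α <;> fin_cases i <;> simp at g0 g1 g2 h0 h1 ⊢ <;> simp [g0, g1, g2, h0, h1]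
      · rw [tVec_smul, tVec_rankOneMat, ← ht]
        ext i
        fin_cases α <;> fin_cases i <;> simp at h2 h3 h4 ⊢ <;> first | assumption | field_simp
    have hall' : ¬ (d 0 = 0 ∧ d 1 = 0 ∧ d 2 = 0) := fun h => hall (by
      ext i; fin_cases i <;> simp [h.1, h.2.1, h.2.2])
    rcases hz with h0 | h0 | h0
    · have h1 : d 1 = -d 2 := by linarith
      have h2 : d 2 ≠ 0 := fun h2 => hall' ⟨h0, by rw [h1, h2, neg_zero], h2⟩
      have h3 : t 1 = 0 := (mul_eq_zero.mp (show d 2 * t 1 = 0 by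
        linear_combination t 1 * h1 - e1 / 2)).resolve_left h2
      have h4 : t 2 = 0 := (mul_eq_zero.mp (show d 2 * t 2 = 0 by linarith)).resolve_left h2
      rw [h0, h1, h3, h4] at e4
      exact main 0 h0 h1 h2 h3 h4 (show 0 - d 2 * d 2 + t 0 ^ 2 = 0 by linarith)
    · have h1 : d 2 = -d 0 := by linarith
      have h2 : d 0 ≠ 0 := fun h2 => hall' ⟨h2, h0, by rw [h1, h2, neg_zero]⟩
      have h3 : t 2 = 0 := (mul_eq_zero.mp (show d 0 * t 2 = 0 by
        linear_combination t 2 * h1 - e2 / 2)).resolve_left h2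
      have h4 : t 0 = 0 := (mul_eq_zero.mp (show d 0 * t 0 = 0 by linarith)).resolve_left h2
      rw [h0, h1, h3, h4] at e3
      exact main 1 h0 h1 h2 h3 h4 (show 0 - d 0 * d 0 + t 1 ^ 2 = 0 by linarith)
    · have h1 : d 0 = -d 1 := by linarith
      have h2 : d 1 ≠ 0 := fun h2 => hall' ⟨by rw [h1, h2, neg_zero], h2, h0⟩
      have h3 : t 0 = 0 := (mul_eq_zero.mp (show d 1 * t 0 = 0 by
        linear_combination t 0 * h1 - e0 / 2)).resolve_left h2
      have h4 : t 1 = 0 := (mul_eq_zero.mp (show d 1 * t 1 = 0 by linarith)).resolve_left h2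
      rw [h0, h1, h3, h4] at e3
      exact main 2 h0 h1 h2 h3 h4 (show 0 - d 1 * d 1 + t 2 ^ 2 = 0 by linarith)

theorem zariskiTangent_eq_top {M : KSSpace} (h : ∀ N, ksDeriv M N = 0) :
    zariskiTangent ksCone M = ⊤ := by
  have hM : ksDet M = 0 := by linarith [h M, ksDeriv_self M]
  have key : ∀ α ε, ε * ε = 1 → rankOneMat α ε ∈ zariskiTangent ksCone M := fun α ε hε => by
    refine Submodule.subset_span fun f _ hf => ?_
    have : (fun s : ℝ => f (M + s • rankOneMat α ε)) = fun _ => 0 := by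
      funext s
      refine hf _ ((mem_ksCone_iff_ksDet _).mpr ?_)
      have h1 := ksDeriv_rankOneMat α hε
      have h2 : ksDet (rankOneMat α ε) = 0 := by linarith [h1 (rankOneMat α ε), ksDeriv_self (rankOneMat α ε)]
      rw [ksDet_add_smul, hM, h, h1, h2]; ring
    rw [this]; simp
  rw [eq_top_iff]
  rintro N -
  have hN : N = ∑ α : Fin 3, (((wVec N α + tVec N α) / 2) • rankOneMat α 1 +
      ((wVec N α - tVec N α) / 2) • rankOneMat α (-1)) := by
    have hs := sum_wVec N
    rw [Fin.sum_univ_three]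
    conv_lhs => rw [← ofParams_vec N]
    simp only [rankOneMat, ← ofParams_smul, ← ofParams_add]
    congr 1
    · ext i; fin_cases i <;> simp <;> ring
    · ext i; fin_cases i <;> simp <;> ring
  rw [hN]
  exact Submodule.sum_mem _ fun α _ => Submodule.add_mem _
    (Submodule.smul_mem _ _ (key α 1 (by norm_num))) (Submodule.smul_mem _ _ (key α (-1) (by norm_num)))

theorem four_lt_finrank_zariskiTangent_iff (M : KSSpace) :
    4 < Module.finrank ℝ (zariskiTangent ksCone M) ↔ ∀ N, ksDeriv M N = 0 := by
  constructor
  · intro h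
    by_contra hcon
    push Not at hcon
    obtain ⟨N, hN⟩ := hcon
    let l : KSSpace →ₗ[ℝ] ℝ :=
      { toFun := ksDeriv M
        map_add' := fun N N' => by
          simp only [ksDeriv, dVec_add, tVec_add, Pi.add_apply]; ring
        map_smul' := fun c N => by
          simp only [ksDeriv, dVec_smul, tVec_smul, Pi.smul_apply, smul_eq_mul, RingHom.id_apply]
          ring }
    have hle : zariskiTangent ksCone M ≤ LinearMap.ker l := by
      refine Submodule.span_le.mpr fun v hv => ?_
      have h1 := hv ksDet isPolynomialFun_ksDet fun y hy => (mem_ksCone_iff_ksDet y).mp hy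
      have h2 : HasDerivAt (fun s : ℝ => ksDet (M + s • v)) (ksDeriv M v) 0 := by
        have h0 : (fun s : ℝ => ksDet (M + s • v)) = fun s => ksDet M + s * ksDeriv M v
            + s ^ 2 * ksDeriv v M + s ^ 3 * ksDet v := funext fun s => ksDet_add_smul M v s
        rw [h0]
        have h3 := (((hasDerivAt_id (0 : ℝ)).mul_const (ksDeriv M v)).const_add (ksDet M)).add
          ((hasDerivAt_pow 2 (0 : ℝ)).mul_const (ksDeriv v M)) |>.add
          ((hasDerivAt_pow 3 (0 : ℝ)).mul_const (ksDet v))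
        exact h3.congr_deriv (by norm_num)
      rw [h2.deriv] at h1
      exact h1
    have hlt : LinearMap.ker l < ⊤ := lt_of_le_of_ne le_top fun htop =>
      hN (LinearMap.mem_ker.mp (htop ▸ Submodule.mem_top : N ∈ LinearMap.ker l))
    have h4 := Submodule.finrank_lt hlt.ne
    have h5 := Submodule.finrank_mono hle
    rw [finrank_ksSpace] at h4
    omega
  · intro h
    rw [zariskiTangent_eq_top h, finrank_top, finrank_ksSpace]
    norm_num

theorem isSingularPoint_iff (p : ℙ ℝ KSSpace) : IsSingularPoint p ↔
    ∀ N, ksDeriv p.rep N = 0 := by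
  constructor
  · rintro ⟨h1, h2⟩
    exact (four_lt_finrank_zariskiTangent_iff _).mp h2
  · intro h
    have h1 : p.rep ∈ ksCone := (mem_ksCone_iff_ksDet _).mpr
      (by linarith [h p.rep, ksDeriv_self p.rep])
    exact ⟨h1, (four_lt_finrank_zariskiTangent_iff _).mpr h⟩

end CriticalPoints


open Matrix

section Extensions

theorem isExtension_iff {V : Type*} [NormedAddCommGroup V] [InnerProductSpace ℝ V]
    [FiniteDimensional ℝ V] (W : Submodule ℝ V) (K₁ : EndoField W) (K : EndoField V) :
    IsExtension W K₁ K ↔ ∃ C : Tensor4 W, IsCurv C ∧ K₁ = fieldOf C ∧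
      K = fieldOf (C.pull (W.orthogonalProjectionOnto : V →ₗ[ℝ] W)) := by
  have hc : ∀ (C : Tensor4 W) (a b c d : V),
      ((toMulti C).compLinearMap fun _ => (W.orthogonalProjectionOnto : V →ₗ[ℝ] W)) ![a, b, c, d] =
        C.pull (W.orthogonalProjectionOnto : V →ₗ[ℝ] W) a b c d := fun _ _ _ _ _ => rfl
  constructor
  · rintro ⟨R, hR, h1, h2⟩
    have h1' : IsField (curry R) K₁ := h1
    refine ⟨curry R, isCurv_curry hR, h1'.eq_fieldOf, IsField.eq_fieldOf fun x v w => ?_⟩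
    rw [h2, ← hc, toMulti_curry]
  · rintro ⟨C, hC, rfl, rfl⟩
    refine ⟨toMulti C, isAlgCurvature_toMulti hC, isField_fieldOf C, fun x v w => ?_⟩
    rw [hc]
    exact isField_fieldOf _ x v w

theorem isExtension_metric_iff {V : Type*} [NormedAddCommGroup V] [InnerProductSpace ℝ V]
    [FiniteDimensional ℝ V] (W : Submodule ℝ V) (K : EndoField V) :
    IsExtension W (metric W) K ↔
      K = fieldOf ((gCurv W).pull (W.orthogonalProjectionOnto : V →ₗ[ℝ] W)) := by
  rw [isExtension_iff]
  constructor
  · rintro ⟨C, hC, h1, h2⟩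
    rwa [isField_metric.curv_unique isCurv_gCurv hC (h1 ▸ isField_fieldOf C)]
  · exact fun h => ⟨gCurv W, isCurv_gCurv, fieldOf_gCurv.symm, h⟩

theorem orthogonalProjection_coordSubspace_e (I : Finset (Fin 4)) (i : Fin 4) :
    (((coordSubspace I).orthogonalProjectionOnto (e i) : coordSubspace I) : E4) =
      if i ∈ I then e i else 0 := by
  split_ifs with h
  · exact congrArg Subtype.val (Submodule.orthogonalProjectionOnto_mem_subspace_eq_self
      (⟨e i, Submodule.subset_span ⟨i, h, rfl⟩⟩ : coordSubspace I))
  · rw [Submodule.orthogonalProjectionOnto_eq_zero_iff.mpr, Submodule.coe_zero]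
    rw [Submodule.mem_orthogonal]
    intro u hu
    induction hu using Submodule.span_induction with
    | mem x hx =>
      obtain ⟨j, hj, rfl⟩ := hx
      rw [inner_e, if_neg]
      rintro rfl
      exact h hj
    | zero => simp
    | add x y _ _ hx hy => rw [inner_add_left, hx, hy, add_zero]
    | smul c x _ hx => rw [real_inner_smul_left, hx, mul_zero]

/-- The sectional components of the extension of the metric of a coordinate subsphere. -/
def subsetMat (I : Finset (Fin 4)) (i j : Fin 4) : ℝ := if i ∈ I ∧ j ∈ I then 1 else 0

theorem gCurv_pull_coordSubspace (I : Finset (Fin 4)) : (gCurv (coordSubspace I)).pull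
    ((coordSubspace I).orthogonalProjectionOnto : E4 →ₗ[ℝ] coordSubspace I) =
      diagCurv (subsetMat I) := by
  have hi : ∀ i j, ⟪(coordSubspace I).orthogonalProjectionOnto (e i),
      (coordSubspace I).orthogonalProjectionOnto (e j)⟫ = if i = j ∧ i ∈ I then (1 : ℝ) else 0 := by
    intro i j
    rw [Submodule.coe_inner, orthogonalProjection_coordSubspace_e,
      orthogonalProjection_coordSubspace_e]
    by_cases hij : i = j
    · subst hij
      by_cases h : i ∈ I
      · simp only [h, if_true, inner_e, and_self]
      · simp only [h, if_false, inner_zero_left, and_false]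
    · rw [if_neg (c := i = j ∧ i ∈ I) fun h => hij h.1]
      split_ifs
      · rw [inner_e, if_neg hij]
      all_goals simp only [inner_zero_left, inner_zero_right]
  have hv : ∀ i j k l, (gCurv (coordSubspace I)).pull
      ((coordSubspace I).orthogonalProjectionOnto : E4 →ₗ[ℝ] coordSubspace I) (e i) (e j) (e k) (e l) =
      (if i = k ∧ i ∈ I then 1 else 0) * (if j = l ∧ j ∈ I then 1 else 0) -
      (if i = l ∧ i ∈ I then 1 else 0) * (if j = k ∧ j ∈ I then 1 else 0) := fun i j k l => by
    rw [Tensor4.pull_apply, gCurv_apply]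
    simp only [ContinuousLinearMap.coe_coe, hi]
  refine IsDiagCurv.eq_diagCurv (fun i j k l h => ?_) (isCurv_gCurv.pull _) fun i j hij => ?_
  · rw [hv]
    have h1 : ¬ (i = k ∧ j = l) := by rintro ⟨rfl, rfl⟩; exact h rfl
    have h2 : ¬ (i = l ∧ j = k) := by rintro ⟨rfl, rfl⟩; exact h (Set.pair_comm _ _)
    by_cases hik : i = k <;> by_cases hjl : j = l <;> by_cases hil : i = l <;>
      by_cases hjk : j = k <;> simp_all
  · rw [hv, subsetMat]
    by_cases h1 : i ∈ I <;> by_cases h2 : j ∈ I <;> simp [h1, h2, hij, hij.symm]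

theorem diagCurv_eq_secMat {s : Fin 4 → Fin 4 → ℝ} (hs : ∀ i j, s i j = s j i) : diagCurv s =
    diagCurv (secMat (fun α => (s 0 α.succ + s (α + 1).succ (α + 2).succ) / 2)
      fun α => (s 0 α.succ - s (α + 1).succ (α + 2).succ) / 2) := by
  refine (isDiagCurv_diagCurv s).eq_diagCurv (isCurv_diagCurv s) fun i j hij => ?_
  rw [diagCurv_sec hs hij]
  have h1 : s 3 1 = s 1 3 := hs 3 1
  fin_cases i <;> fin_cases j <;> simp [secMat] at hij ⊢ <;>
    linarith [hs 3 1, hs 1 0, hs 2 0, hs 3 0, hs 2 1, hs 3 2]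

/-- The matrix of the extension of the metric of a coordinate subsphere. -/
def subsetKS (I : Finset (Fin 4)) : KSSpace :=
  ofParams (fun α => (subsetMat I 0 α.succ + subsetMat I (α + 1).succ (α + 2).succ) / 2)
    fun α => (subsetMat I 0 α.succ - subsetMat I (α + 1).succ (α + 2).succ) / 2

theorem exists_isExtension_metric_iff (I : Finset (Fin 4)) {p : ℙ ℝ KSSpace} :
    (∃ K, IsExtension (coordSubspace I) (metric (coordSubspace I)) K ∧ Represents K p) ↔
      ∃ c : ℝ, p.rep = c • subsetKS I := by
  have h1 : HasKSMatrix (fieldOf (diagCurv (subsetMat I))) (subsetKS I) :=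
    hasKSMatrix_iff_params.mpr ⟨_, _, by
      rw [← diagCurv_eq_secMat fun i j => by simp only [subsetMat, and_comm]], rfl⟩
  simp only [isExtension_metric_iff, gCurv_pull_coordSubspace]
  have hp := Projectivization.submodule_eq p
  constructor
  · rintro ⟨K, rfl, M, hM, hMp, hK⟩
    obtain rfl := h1.unique hK
    rw [hp, Submodule.mem_span_singleton] at hMp
    obtain ⟨c, hc⟩ := hMp
    have hc0 : c ≠ 0 := fun h0 => hM (by rw [← hc, h0, zero_smul])
    exact ⟨c⁻¹, by rw [← hc, smul_smul, inv_mul_cancel₀ hc0, one_smul]⟩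
  · rintro ⟨c, hc⟩
    have hc0 : c ≠ 0 := fun h0 => p.rep_nonzero (by rw [hc, h0, zero_smul])
    refine ⟨_, rfl, subsetKS I, fun h0 => p.rep_nonzero (by rw [hc, h0, smul_zero]), ?_, h1⟩
    rw [hp, Submodule.mem_span_singleton]
    exact ⟨c⁻¹, by rw [hc, smul_smul, inv_mul_cancel₀ hc0, one_smul]⟩

end Extensions

section SingularPoints

theorem subsetKS_pair_zero (α : Fin 3) : (2 : ℝ) • subsetKS {0, α.succ} = rankOneMat α 1 := by
  rw [subsetKS, ← ofParams_smul, rankOneMat]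
  congr 1 <;> ext β <;> fin_cases α <;> fin_cases β <;> simp [subsetMat]

theorem subsetKS_pair_succ (α : Fin 3) :
    (2 : ℝ) • subsetKS {(α + 1).succ, (α + 2).succ} = rankOneMat α (-1) := by
  rw [subsetKS, ← ofParams_smul, rankOneMat]
  congr 1 <;> ext β <;> fin_cases α <;> fin_cases β <;> simp [subsetMat] <;> norm_num

theorem subsetKS_compl_singleton (i : Fin 4) : (2 : ℝ) • subsetKS {i}ᶜ = skewMat i := by
  rw [subsetKS, ← ofParams_smul, skewMat]
  rw [← ofParams_add_const 0 _ 1]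
  congr 1 <;> ext β <;> fin_cases i <;> fin_cases β <;> simp [subsetMat] <;> norm_num

theorem card_two_cases : ∀ I : Finset (Fin 4), I.card = 2 →
    ∃ α : Fin 3, I = {0, α.succ} ∨ I = {(α + 1).succ, (α + 2).succ} := by decide

theorem card_three_cases : ∀ I : Finset (Fin 4), I.card = 3 → ∃ i, I = {i}ᶜ := by decide

theorem rank_one_minors {M : Matrix (Fin 3) (Fin 3) ℝ} (hM : M.rank = 1) (i j k l : Fin 3) :
    M i k * M j l = M i l * M j k := by
  obtain ⟨⟨v, hv⟩, -, h⟩ := finrank_eq_one_iff'.mp hM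
  have key : ∀ k, ∃ c : ℝ, ∀ i, M i k = c * v i := fun k => by
    obtain ⟨c, hc⟩ := h ⟨M.mulVecLin (Pi.single k 1), ⟨_, rfl⟩⟩
    refine ⟨c, fun i => ?_⟩
    have := congrFun (congrArg Subtype.val hc) i
    simp at this
    exact this.symm
  obtain ⟨c, hc⟩ := key k
  obtain ⟨d, hd⟩ := key l
  rw [hc, hc, hd, hd]; ring

theorem ksDeriv_eq_zero_of_rank_one {M : KSSpace} (hM : (M : Matrix (Fin 3) (Fin 3) ℝ).rank = 1)
    (N : KSSpace) : ksDeriv M N = 0 := by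
  have h := rank_one_minors hM
  have h01 := h 0 1 0 1
  have h02 := h 0 2 0 2
  have h12 := h 1 2 1 2
  have a0 := h 0 2 0 1
  have b0 := h 0 1 0 2
  have a1 := h 1 2 0 1
  have b1 := h 0 1 1 2
  have a2 := h 0 2 1 2
  have b2 := h 1 2 0 2
  obtain ⟨p, t, rfl⟩ := exists_params M
  simp only [ksDeriv, dVec_ofParams, tVec_ofParams, coe_ofParams, Matrix.of_apply, Matrix.cons_val',
    Matrix.cons_val] at *
  linear_combination dVec N 0 * h12 + dVec N 1 * h02 + dVec N 2 * h01 +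
    tVec N 0 * (a0 - b0) + tVec N 1 * (a1 - b1) + tVec N 2 * (b2 - a2)

theorem rank_smul_rankOneMat {c ε : ℝ} (hc : c ≠ 0) (α : Fin 3) (hε : ε = 1 ∨ ε = -1) :
    ((c • rankOneMat α ε : KSSpace) : Matrix (Fin 3) (Fin 3) ℝ).rank = 1 := by
  have hεε : ε * ε = 1 := by rcases hε with rfl | rfl <;> norm_num
  have h : ((c • rankOneMat α ε : KSSpace) : Matrix (Fin 3) (Fin 3) ℝ) =
      vecMulVec (c • (Pi.single (α + 1) 1 + Pi.single (α + 2) (-ε)))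
        (Pi.single (α + 1) (-1) + Pi.single (α + 2) (-ε)) := by
    rw [rankOneMat, ← ofParams_smul, coe_ofParams]
    ext i j
    fin_cases α <;> fin_cases i <;> fin_cases j <;>
      simp [vecMulVec_apply, mul_assoc, hεε]
  rw [h]
  refine le_antisymm (rank_vecMulVec_le _ _) (Nat.one_le_iff_ne_zero.mpr fun h0 => ?_)
  rw [Matrix.rank, Submodule.finrank_eq_zero, LinearMap.range_eq_bot] at h0
  have h1 := congrFun (congrArg (fun f => f (Pi.single (α + 1) 1)) h0) (α + 1)
  fin_cases α <;> simp [vecMulVec_apply, hc] at h1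

theorem rank_smul_skewMat {c : ℝ} (hc : c ≠ 0) (i : Fin 4) :
    ((c • skewMat i : KSSpace) : Matrix (Fin 3) (Fin 3) ℝ).rank ≠ 1 := by
  intro h
  have h1 := rank_one_minors h 0 1 0 1
  have h2 : (c * dVec (skewMat i) 0) * (c * dVec (skewMat i) 1) =
    (c * (skewMat i : Matrix (Fin 3) (Fin 3) ℝ) 0 1) * (c * tVec (skewMat i) 2) := h1
  rw [(skewMat i).2.1 0 1 (by decide), dVec_skewMat] at h2
  have h3 : (skewMat i : Matrix (Fin 3) (Fin 3) ℝ) 1 0 = tVec (skewMat i) 2 := rfl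
  rw [h3, tVec_skewMat] at h2
  fin_cases i <;> simp [hc] at h2

theorem transpose_smul_skewMat (c : ℝ) (i : Fin 4) :
    ((c • skewMat i : KSSpace) : Matrix (Fin 3) (Fin 3) ℝ)ᵀ =
      -((c • skewMat i : KSSpace) : Matrix (Fin 3) (Fin 3) ℝ) := by
  rw [skewMat, ← ofParams_smul, isSkew_ofParams_iff]
  simp

theorem transpose_smul_rankOneMat {c : ℝ} (hc : c ≠ 0) (α : Fin 3) (ε : ℝ) :
    ((c • rankOneMat α ε : KSSpace) : Matrix (Fin 3) (Fin 3) ℝ)ᵀ ≠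
      -((c • rankOneMat α ε : KSSpace) : Matrix (Fin 3) (Fin 3) ℝ) := by
  rw [rankOneMat, ← ofParams_smul, Ne, isSkew_ofParams_iff]
  fin_cases α <;> simp [hc, hc.symm]

theorem mem_rankOnePoints_iff (p : ℙ ℝ KSSpace) : p ∈ rankOnePoints ↔
    ∃ I : Finset (Fin 4), I.card = 2 ∧ ∃ c : ℝ, p.rep = c • subsetKS I := by
  constructor
  · rintro ⟨-, h⟩
    rcases eq_rankOneMat_or_skewMat p.rep_nonzero (ksDeriv_eq_zero_of_rank_one h) with
      ⟨c, -, α, ε, rfl | rfl, hp⟩ | ⟨c, hc, i, hp⟩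
    · exact ⟨{0, α.succ}, by fin_cases α <;> rfl, c * 2, by rw [hp, ← subsetKS_pair_zero, smul_smul]⟩
    · exact ⟨{(α + 1).succ, (α + 2).succ}, by fin_cases α <;> rfl, c * 2, by
        rw [hp, ← subsetKS_pair_succ, smul_smul]⟩
    · rw [hp] at h
      exact absurd h (rank_smul_skewMat hc i)
  · rintro ⟨I, hI, c, hp⟩
    have hc : c ≠ 0 := fun h0 => p.rep_nonzero (by rw [hp, h0, zero_smul])
    have main : ∀ (α : Fin 3) (ε : ℝ), (ε = 1 ∨ ε = -1) → (2 : ℝ) • subsetKS I = rankOneMat α ε →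
        p ∈ rankOnePoints := fun α ε hε h => by
      have hr : (p.rep : Matrix (Fin 3) (Fin 3) ℝ).rank = 1 := by
        rw [hp, show c • subsetKS I = (c / 2) • rankOneMat α ε by rw [← h, smul_smul]; congr 1; ring]
        exact rank_smul_rankOneMat (div_ne_zero hc two_ne_zero) α hε
      exact ⟨((isSingularPoint_iff p).mpr (ksDeriv_eq_zero_of_rank_one hr)).1, hr⟩
    obtain ⟨α, rfl | rfl⟩ := card_two_cases I hI
    · exact main α 1 (Or.inl rfl) (subsetKS_pair_zero α)
    · exact main α (-1) (Or.inr rfl) (subsetKS_pair_succ α)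

theorem mem_skewSingularPoints_iff (p : ℙ ℝ KSSpace) : p ∈ skewSingularPoints ↔
    ∃ I : Finset (Fin 4), I.card = 3 ∧ ∃ c : ℝ, p.rep = c • subsetKS I := by
  constructor
  · rintro ⟨h1, h2⟩
    rcases eq_rankOneMat_or_skewMat p.rep_nonzero ((isSingularPoint_iff p).mp h1) with
      ⟨c, hc, α, ε, -, hp⟩ | ⟨c, -, i, hp⟩
    · rw [hp] at h2
      exact absurd h2 (transpose_smul_rankOneMat hc α ε)
    · exact ⟨{i}ᶜ, by fin_cases i <;> rfl, c * 2, by rw [hp, ← subsetKS_compl_singleton, smul_smul]⟩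
  · rintro ⟨I, hI, c, hp⟩
    obtain ⟨i, rfl⟩ := card_three_cases I hI
    have h : p.rep = (c / 2) • skewMat i := by
      rw [hp, ← subsetKS_compl_singleton, smul_smul]; congr 1; ring
    have hc : c / 2 ≠ 0 := fun h0 => p.rep_nonzero (by rw [h, h0, zero_smul])
    refine ⟨(isSingularPoint_iff p).mpr fun N => ?_, ?_⟩
    · have h1 := ksDeriv_skewMat i N
      have h2 : ksDeriv ((c / 2) • skewMat i) N = (c / 2) ^ 2 * ksDeriv (skewMat i) N := by
        simp only [ksDeriv, dVec_smul, tVec_smul, Pi.smul_apply, smul_eq_mul]; ring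
      rw [h, h2, h1, mul_zero]
    · rw [h]; exact transpose_smul_skewMat _ _

theorem setOf_isSingularPoint : {p | IsSingularPoint p} = rankOnePoints ∪ skewSingularPoints := by
  ext p
  constructor
  · intro h
    rcases eq_rankOneMat_or_skewMat p.rep_nonzero ((isSingularPoint_iff p).mp h) with
      ⟨c, hc, α, ε, hε, hp⟩ | ⟨c, -, i, hp⟩
    · exact Or.inl ⟨h.1, by rw [hp]; exact rank_smul_rankOneMat hc α hε⟩
    · exact Or.inr ⟨h, by rw [hp]; exact transpose_smul_skewMat _ _⟩
  · rintro (h | h)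
    · exact (isSingularPoint_iff p).mpr (ksDeriv_eq_zero_of_rank_one h.2)
    · exact h.1

theorem subsetMat_relation {I J : Finset (Fin 4)} {c : ℝ} (h : subsetKS J = c • subsetKS I) :
    ∃ b : ℝ, ∀ i j, i ≠ j → subsetMat J i j = c * subsetMat I i j + b := by
  rw [subsetKS, subsetKS, ← ofParams_smul] at h
  obtain ⟨b, h1, h2⟩ := eq_ofParams_add_const h.symm
  have k1 := fun α => congrFun h1 α
  have k2 := fun α => congrFun h2 α
  simp only [Pi.smul_apply, smul_eq_mul] at k1 k2
  refine ⟨b, fun i j hij => ?_⟩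
  have hs : ∀ I i j, subsetMat I i j = subsetMat I j i := fun I i j => by
    simp only [subsetMat, and_comm]
  have m0 := k1 0
  have m1 := k1 1
  have m2 := k1 2
  have n0 := k2 0
  have n1 := k2 1
  have n2 := k2 2
  simp only [Fin.isValue, Fin.succ_zero_eq_one, Fin.succ_one_eq_two, zero_add, Fin.reduceAdd,
    Fin.reduceSucc] at m0 m1 m2 n0 n1 n2
  fin_cases i <;> fin_cases j <;> simp at hij ⊢ <;>
    first
    | linarith
    | (rw [hs J, hs I]; linarith)

theorem exists_subsetMat_eq_one : ∀ I : Finset (Fin 4), 2 ≤ I.card →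
    ∃ i j, i ≠ j ∧ i ∈ I ∧ j ∈ I := by decide

theorem exists_subsetMat_eq_zero : ∀ I : Finset (Fin 4), I.card ≤ 3 →
    ∃ i j, i ≠ j ∧ ¬(i ∈ I ∧ j ∈ I) := by decide

theorem eq_of_pairs : ∀ I J : Finset (Fin 4), 2 ≤ I.card → 2 ≤ J.card →
    (∀ i j, i ≠ j → ((i ∈ J ∧ j ∈ J) ↔ (i ∈ I ∧ j ∈ I))) → I = J := by decide

theorem false_of_pairs : ∀ I J : Finset (Fin 4), I.card ≤ 3 → J.card ≤ 3 →
    (∀ i j, i ≠ j → ((i ∈ J ∧ j ∈ J) ↔ ¬(i ∈ I ∧ j ∈ I))) → False := by decide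

theorem subsetKS_ne_zero {I : Finset (Fin 4)} (hI : 2 ≤ I.card) (hI' : I.card ≤ 3) :
    subsetKS I ≠ 0 := by
  intro h
  obtain ⟨b, hb⟩ := subsetMat_relation (I := I) (J := I) (c := 0) (by rw [h, zero_smul])
  obtain ⟨i, j, hij, h1⟩ := exists_subsetMat_eq_one I hI
  obtain ⟨k, l, hkl, h2⟩ := exists_subsetMat_eq_zero I hI'
  have h3 := hb i j hij
  have h4 := hb k l hkl
  rw [subsetMat, if_pos h1] at h3
  rw [subsetMat, if_neg h2] at h4
  linarith

theorem eq_of_subsetKS_eq_smul {I J : Finset (Fin 4)} (hI : 2 ≤ I.card) (hI' : I.card ≤ 3)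
    (hJ : 2 ≤ J.card) (hJ' : J.card ≤ 3) {c : ℝ} (h : subsetKS J = c • subsetKS I) : I = J := by
  obtain ⟨b, hb⟩ := subsetMat_relation h
  have h01 : ∀ (I : Finset (Fin 4)) i j, subsetMat I i j = 0 ∨ subsetMat I i j = 1 := fun I i j => by
    rw [subsetMat]; split_ifs <;> simp
  have hone : ∀ (I : Finset (Fin 4)) i j, (i ∈ I ∧ j ∈ I) ↔ subsetMat I i j = 1 := fun I i j => by
    rw [subsetMat]; split_ifs <;> simp_all
  obtain ⟨i, j, hij, h1⟩ := exists_subsetMat_eq_one I hI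
  obtain ⟨k, l, hkl, h2⟩ := exists_subsetMat_eq_zero I hI'
  have h3 := hb i j hij
  have h4 := hb k l hkl
  rw [show subsetMat I i j = 1 from if_pos h1] at h3
  rw [show subsetMat I k l = 0 from if_neg h2] at h4
  rcases h01 J i j with h5 | h5 <;> rcases h01 J k l with h6 | h6
  · have hc : c = 0 := by linarith
    exact absurd (by rw [h, hc, zero_smul]) (subsetKS_ne_zero hJ hJ')
  · refine (false_of_pairs I J hI' hJ' fun m n hmn => ?_).elim
    rw [hone, hone, hb m n hmn]
    rcases h01 I m n with h7 | h7 <;> rw [h7] <;> constructor <;> intro h8 <;>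
      first
      | linarith
      | exact absurd rfl h8
  · refine eq_of_pairs I J hI hJ fun m n hmn => ?_
    rw [hone, hone, hb m n hmn]
    constructor <;> intro h8 <;> nlinarith
  · have hc : c = 0 := by linarith
    exact absurd (by rw [h, hc, zero_smul]) (subsetKS_ne_zero hJ hJ')

theorem ncard_points {n : ℕ} (h2 : 2 ≤ n) (h3 : n ≤ 3) : {p : ℙ ℝ KSSpace |
    ∃ I : Finset (Fin 4), I.card = n ∧ ∃ c : ℝ, p.rep = c • subsetKS I}.ncard =
      {I : Finset (Fin 4) | I.card = n}.ncard := by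
  have hne : ∀ I ∈ {I : Finset (Fin 4) | I.card = n}, subsetKS I ≠ 0 := fun I (hI : I.card = n) =>
    subsetKS_ne_zero (hI ▸ h2) (hI ▸ h3)
  refine (Set.ncard_congr (fun I hI => Projectivization.mk ℝ (subsetKS I) (hne I hI))
    (fun I hI => ?_) (fun I J hI hJ h => ?_) fun p hp => ?_).symm
  · obtain ⟨a, ha⟩ := Projectivization.exists_smul_eq_mk_rep ℝ (subsetKS I) (hne I hI)
    exact ⟨I, hI, a, ha.symm⟩
  · obtain ⟨a, ha⟩ := (Projectivization.mk_eq_mk_iff' ℝ _ _ (hne I hI) (hne J hJ)).mp h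
    have hI' : I.card = n := hI
    have hJ' : J.card = n := hJ
    exact (eq_of_subsetKS_eq_smul (hJ' ▸ h2) (hJ' ▸ h3) (hI' ▸ h2) (hI' ▸ h3) ha.symm).symm
  · obtain ⟨I, hI, c, hc⟩ := hp
    refine ⟨I, hI, ?_⟩
    rw [← p.mk_rep, eq_comm, Projectivization.mk_eq_mk_iff']
    exact ⟨c, hc.symm⟩

theorem ncard_rankOnePoints : rankOnePoints.ncard = 6 := by
  rw [show rankOnePoints = {p | _} from Set.ext mem_rankOnePoints_iff, ncard_points le_rfl (by norm_num),
    Set.ncard_eq_toFinset_card']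
  rfl

theorem ncard_skewSingularPoints : skewSingularPoints.ncard = 4 := by
  rw [show skewSingularPoints = {p | _} from Set.ext mem_skewSingularPoints_iff, ncard_points (by norm_num) le_rfl,
    Set.ncard_eq_toFinset_card']
  rfl

theorem ncard_singularPoints : {p | IsSingularPoint p}.ncard = 10 := by
  rw [setOf_isSingularPoint, Set.ncard_union_eq _ (Set.finite_of_ncard_ne_zero (by
    rw [ncard_rankOnePoints]; norm_num)) (Set.finite_of_ncard_ne_zero (by
    rw [ncard_skewSingularPoints]; norm_num)), ncard_rankOnePoints, ncard_skewSingularPoints]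
  rw [Set.disjoint_left]
  rintro p ⟨-, h⟩ h'
  obtain ⟨I, hI, c, hp⟩ := (mem_skewSingularPoints_iff p).mp h'
  obtain ⟨i, rfl⟩ := card_three_cases I hI
  have h1 : p.rep = (c / 2) • skewMat i := by
    rw [hp, ← subsetKS_compl_singleton, smul_smul]; congr 1; ring
  rw [h1] at h
  exact rank_smul_skewMat (fun h0 => p.rep_nonzero (by rw [h1, h0, zero_smul])) i h

end SingularPoints


open Matrix

section ExtensionsFromHyperplanes

theorem IsCurv.apply_eq_of_kernel {V : Type*} [NormedAddCommGroup V] [InnerProductSpace ℝ V]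
    {C : Tensor4 V} (hC : IsCurv C) {n : V} (hn : ∀ a b c, C n a b c = 0) {f : V → V}
    (hf : ∀ v, ∃ r : ℝ, v = f v + r • n) (a b c d : V) : C a b c d = C (f a) (f b) (f c) (f d) := by
  have h2 : ∀ a b c, C a n b c = 0 := fun a b c => by rw [hC.left, hn, neg_zero]
  have h3 : ∀ a b c, C a b n c = 0 := fun a b c => by rw [← hC.pair, hn]
  have h4 : ∀ a b c, C a b c n = 0 := fun a b c => by rw [← hC.pair, h2]
  obtain ⟨r, hr⟩ := hf a
  obtain ⟨s, hs⟩ := hf b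
  obtain ⟨t, ht⟩ := hf c
  obtain ⟨u, hu⟩ := hf d
  conv_lhs => rw [hr, hs, ht, hu]
  simp only [map_add, map_smul, LinearMap.add_apply, LinearMap.smul_apply, hn, h2, h3, h4,
    smul_zero, add_zero]

theorem isExtensionFrom_iff {W : Submodule ℝ E4} {n : E4} (hn : n ≠ 0) (hW : Wᗮ = Submodule.span ℝ {n})
    (K : EndoField E4) : IsExtensionFrom W K ↔
      ∃ (C : Tensor4 E4) (b : ℝ), IsCurv C ∧ (∀ v w u, C n v w u = 0) ∧
        K = fieldOf C + b • metric E4 := by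
  have hnW : n ∈ Wᗮ := by rw [hW]; exact Submodule.mem_span_singleton_self n
  constructor
  · rintro ⟨K₁, K₀, b, -, -, h, rfl⟩
    obtain ⟨C, hC, rfl, rfl⟩ := (isExtension_iff W K₁ K₀).mp h
    refine ⟨_, b, hC.pull _, fun v w u => ?_, rfl⟩
    rw [Tensor4.pull_apply, ContinuousLinearMap.coe_coe,
      Submodule.orthogonalProjectionOnto_eq_zero_iff.mpr hnW, map_zero]
    rfl
  · rintro ⟨C, b, hC, hCn, rfl⟩
    have hd : Module.finrank ℝ W = 3 := by
      have h1 := W.finrank_add_finrank_orthogonal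
      rw [hW, finrank_span_singleton hn, finrank_E4] at h1
      omega
    refine ⟨fieldOf (C.pull W.subtype), fieldOf C, b, isKilling_fieldOf (hC.pull _),
      isIntegrable_of_finrank_eq_three hd _, (isExtension_iff _ _ _).mpr
        ⟨_, hC.pull _, rfl, congrArg _ ?_⟩, rfl⟩
    ext x y z w
    refine hC.apply_eq_of_kernel hCn (f := fun v => (W.orthogonalProjectionOnto v : E4))
      (fun v => ?_) x y z w
    have h1 : v - (W.orthogonalProjectionOnto v : E4) ∈ Wᗮ :=
      Submodule.sub_starProjection_mem_orthogonal v
    rw [hW, Submodule.mem_span_singleton] at h1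
    obtain ⟨r, hr⟩ := h1
    exact ⟨r, by rw [hr, add_sub_cancel]⟩

theorem orthogonal_coordSubspace (i : Fin 4) :
    (coordSubspace {i}ᶜ)ᗮ = Submodule.span ℝ {e i} := by
  have h : coordSubspace {i}ᶜ = (Submodule.span ℝ {e i})ᗮ := by
    refine le_antisymm (Submodule.span_le.mpr ?_) fun v hv => ?_
    · rintro _ ⟨j, hj, rfl⟩
      have hj' : j ≠ i := by simpa using hj
      rw [SetLike.mem_coe, Submodule.mem_orthogonal_singleton_iff_inner_right, inner_e,
        if_neg hj'.symm]
    · rw [Submodule.mem_orthogonal_singleton_iff_inner_right] at hv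
      rw [sum_coord_e v]
      refine Submodule.sum_mem _ fun j _ => ?_
      by_cases hj : j = i
      · have : v i = 0 := by simpa [e, EuclideanSpace.inner_single_left] using hv
        rw [hj, this, zero_smul]
        exact Submodule.zero_mem _
      · exact Submodule.smul_mem _ _ (Submodule.subset_span ⟨j, by simpa using hj, rfl⟩)
  rw [h, Submodule.orthogonal_orthogonal]

theorem e_ne_zero (i : Fin 4) : e i ≠ 0 := orthonormal_e.ne_zero i

end ExtensionsFromHyperplanes

section IsokernelPlanes

/-- The kernel vectors of the isokernel planes. -/
def kernelVec (i : Fin 4) : Fin 3 → ℝ := ![![1, 1, 1], ![1, -1, -1], ![-1, 1, -1], ![-1, -1, 1]] i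

/-- Parametrisation of the isokernel planes. -/
def isokernelMap (i : Fin 4) : (Fin 3 → ℝ) →ₗ[ℝ] KSSpace where
  toFun x := ofParams x (-(kernelVec i * x))
  map_add' x y := by rw [← ofParams_add]; congr 1; ring
  map_smul' c x := by
    rw [RingHom.id_apply, ← ofParams_smul]
    congr 1
    ext j; simp

theorem kernelVec_mul_self (i : Fin 4) (j : Fin 3) : kernelVec i j * kernelVec i j = 1 := by
  fin_cases i <;> fin_cases j <;> simp [kernelVec]

theorem isokernelMap_injective (i : Fin 4) : Function.Injective (isokernelMap i) := by
  intro x y h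
  have h1 : -(kernelVec i * x) = -(kernelVec i * y) := by
    rw [← tVec_ofParams x (-(kernelVec i * x)), ← tVec_ofParams y (-(kernelVec i * y))]
    exact congrArg tVec h
  ext j
  have h2 := congrFun h1 j
  simp only [Pi.neg_apply, Pi.mul_apply] at h2
  linear_combination (-kernelVec i j) * h2 - (x j - y j) * kernelVec_mul_self i j

theorem finrank_range_isokernelMap (i : Fin 4) :
    Module.finrank ℝ (LinearMap.range (isokernelMap i)) = 3 := by
  rw [LinearMap.finrank_range_of_inj (isokernelMap_injective i)]; simp

theorem ofParams_mem_range_isokernelMap_iff (i : Fin 4) (p t : Fin 3 → ℝ) :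
    ofParams p t ∈ LinearMap.range (isokernelMap i) ↔ ∃ c, ∀ j, j ≠ i → secMat p t i j = c := by
  constructor
  · rintro ⟨x, hx⟩
    obtain ⟨c, rfl, rfl⟩ := eq_ofParams_add_const (show ofParams x (-(kernelVec i * x)) = _ from hx)
    refine ⟨c, fun j hj => ?_⟩
    fin_cases i <;> fin_cases j <;> simp [secMat, kernelVec] at hj ⊢
  · rintro ⟨c, hc⟩
    refine ⟨fun α => p α + -c, ?_⟩
    change ofParams (fun α => p α + -c) (-(kernelVec i * fun α => p α + -c)) = ofParams p t
    rw [ofParams_add_const]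
    congr 1
    have h0 := hc 0
    have h1 := hc 1
    have h2 := hc 2
    have h3 := hc 3
    ext α
    fin_cases i <;> fin_cases α <;> simp [secMat, kernelVec] at h0 h1 h2 h3 ⊢ <;> linarith

theorem ofParams_mulVec_kernelVec_iff (i : Fin 4) (p t : Fin 3 → ℝ) :
    (ofParams p t : Matrix (Fin 3) (Fin 3) ℝ) *ᵥ kernelVec i = 0 ↔
      ∃ c, ∀ j, j ≠ i → secMat p t i j = c := by
  rw [coe_ofParams]
  constructor
  · intro h
    have h0 := congrFun h 0
    have h1 := congrFun h 1
    refine ⟨secMat p t i (i + 1), fun j hj => ?_⟩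
    fin_cases i <;> fin_cases j <;>
      simp [secMat, kernelVec, mulVec, dotProduct, Fin.sum_univ_three] at hj h0 h1 ⊢ <;> linarith
  · rintro ⟨c, hc⟩
    have h0 := hc 0
    have h1 := hc 1
    have h2 := hc 2
    have h3 := hc 3
    ext α
    fin_cases i <;> fin_cases α <;>
      simp [secMat, kernelVec, mulVec, dotProduct, Fin.sum_univ_three] at h0 h1 h2 h3 ⊢ <;> linarith

theorem isIsokernelPlane_range (i : Fin 4) : IsIsokernelPlane (LinearMap.range (isokernelMap i)) := by
  have hk : ∀ M ∈ LinearMap.range (isokernelMap i),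
      (M : Matrix (Fin 3) (Fin 3) ℝ) *ᵥ kernelVec i = 0 := fun M hM => by
    obtain ⟨p, t, rfl⟩ := exists_params M
    rw [ofParams_mulVec_kernelVec_iff, ← ofParams_mem_range_isokernelMap_iff]
    exact hM
  have hn : kernelVec i ≠ 0 := fun h => by
    have := kernelVec_mul_self i 0
    rw [h] at this; simp at this
  exact ⟨finrank_range_isokernelMap i, fun M hM =>
    Matrix.exists_mulVec_eq_zero_iff.mp ⟨_, hn, hk M hM⟩, _, hn, hk⟩

theorem IsIsokernelPlane.exists_eq_range {L : Submodule ℝ KSSpace} (hL : IsIsokernelPlane L) :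
    ∃ i, L = LinearMap.range (isokernelMap i) := by
  obtain ⟨h3, -, n, hn, hk⟩ := hL
  let f : KSSpace →ₗ[ℝ] (Fin 3 → ℝ) :=
    { toFun := fun M => (M : Matrix (Fin 3) (Fin 3) ℝ) *ᵥ n
      map_add' := fun M N => Matrix.add_mulVec _ _ _
      map_smul' := fun c M => Matrix.smul_mulVec _ _ _ }
  have hlt : LinearMap.range f < ⊤ := by
    refine lt_top_iff_ne_top.mpr fun htop => ?_
    have h1 := f.finrank_range_add_finrank_ker
    have h2 := Submodule.finrank_mono (show L ≤ LinearMap.ker f from hk)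
    rw [htop, finrank_top, finrank_ksSpace] at h1
    simp at h1
    omega
  obtain ⟨l, hl, hl'⟩ := Submodule.exists_le_ker_of_lt_top _ hlt
  set a : Fin 3 → ℝ := fun i => l (Pi.single i 1) with ha
  have hla : ∀ v, l v = a 0 * v 0 + a 1 * v 1 + a 2 * v 2 := fun v => by
    conv_lhs => rw [← Finset.univ_sum_single v]
    have : ∀ i, (Pi.single i (v i) : Fin 3 → ℝ) = v i • Pi.single i 1 := fun i => by
      rw [← Pi.single_smul, smul_eq_mul, mul_one]
    simp only [this, Fin.sum_univ_three, map_add, map_smul, smul_eq_mul, ha]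
    ring
  have key : ∀ p t, l ((ofParams p t : Matrix (Fin 3) (Fin 3) ℝ) *ᵥ n) = 0 := fun p t =>
    hl' ⟨ofParams p t, rfl⟩
  have k0 := key ![1, 0, 0] 0
  have k1 := key ![0, 1, 0] 0
  have t0 := key 0 ![1, 0, 0]
  have t1 := key 0 ![0, 1, 0]
  have t2 := key 0 ![0, 0, 1]
  simp [hla, coe_ofParams, dotProduct, Fin.sum_univ_three] at k0 k1 t0 t1 t2
  have hne : ∃ (i : Fin 4) (c : ℝ), n = c • kernelVec i := by
    have ha0 : ∃ j, a j ≠ 0 := by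
      by_contra hcon
      push Not at hcon
      exact hl (LinearMap.ext fun v => by rw [hla, hcon, hcon, hcon]; simp)
    obtain ⟨j, hj⟩ := ha0
    have h1 : n 1 ^ 2 - n 0 ^ 2 = 0 := (mul_eq_zero.mp (show a j * (n 1 ^ 2 - n 0 ^ 2) = 0 by
      fin_cases j
      · change a 0 * _ = 0; linear_combination (-n 1) * t2 - n 0 * (k0 + k1)
      · change a 1 * _ = 0; linear_combination (-n 1) * (k0 + k1) - n 0 * t2
      · change a 2 * _ = 0; linear_combination n 1 * t0 - n 2 * (k0 + k1) + n 0 * t1)).resolve_left hj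
    have h2 : n 2 ^ 2 - n 0 ^ 2 = 0 := (mul_eq_zero.mp (show a j * (n 2 ^ 2 - n 0 ^ 2) = 0 by
      fin_cases j
      · change a 0 * _ = 0; linear_combination n 2 * t1 - n 0 * k1
      · change a 1 * _ = 0
        linear_combination (-n 2) * t0 - n 1 * k1 - n 0 * t2
      · change a 2 * _ = 0; linear_combination (-n 2) * k1 + n 0 * t1)).resolve_left hj
    have h1' : n 1 = n 0 ∨ n 1 = -n 0 := sq_eq_sq_iff_eq_or_eq_neg.mp (by linarith)
    have h2' : n 2 = n 0 ∨ n 2 = -n 0 := sq_eq_sq_iff_eq_or_eq_neg.mp (by linarith)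
    rcases h1' with h1' | h1' <;> rcases h2' with h2' | h2'
    · exact ⟨0, n 0, by ext j; fin_cases j <;> simp [kernelVec, h1', h2']⟩
    · exact ⟨3, -n 0, by ext j; fin_cases j <;> simp [kernelVec, h1', h2']⟩
    · exact ⟨2, -n 0, by ext j; fin_cases j <;> simp [kernelVec, h1', h2']⟩
    · exact ⟨1, n 0, by ext j; fin_cases j <;> simp [kernelVec, h1', h2']⟩
  obtain ⟨i, c, rfl⟩ := hne
  have hc : c ≠ 0 := fun h => hn (by rw [h, zero_smul])
  refine ⟨i, Submodule.eq_of_le_of_finrank_eq (fun M hM => ?_)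
    (by rw [h3, finrank_range_isokernelMap])⟩
  have h4 := hk M hM
  rw [Matrix.mulVec_smul, smul_eq_zero, or_iff_right hc] at h4
  obtain ⟨p, t, rfl⟩ := exists_params M
  rwa [ofParams_mulVec_kernelVec_iff, ← ofParams_mem_range_isokernelMap_iff] at h4

theorem HasKSMatrix.mem_range_isokernelMap_iff {K : EndoField E4} {M : KSSpace}
    (h : HasKSMatrix K M) (i : Fin 4) : M ∈ LinearMap.range (isokernelMap i) ↔
      IsExtensionFrom (coordSubspace {i}ᶜ) K := by
  obtain ⟨p, t, rfl, rfl⟩ := hasKSMatrix_iff_params.mp h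
  rw [isExtensionFrom_iff (e_ne_zero i) (orthogonal_coordSubspace i),
    ofParams_mem_range_isokernelMap_iff]
  constructor
  · rintro ⟨c, hc⟩
    refine ⟨diagCurv (secMat p t) + (-c) • gCurv E4, c, (isCurv_diagCurv _).add (isCurv_gCurv.smul _),
      fun v w u => ?_, ?_⟩
    · have hz : ∀ j k l, (diagCurv (secMat p t) + (-c) • gCurv E4) (e i) (e j) (e k) (e l) = 0 := by
        intro j k l
        have hand : ∀ (P Q : Prop) [Decidable P] [Decidable Q], (if P ∧ Q then (1 : ℝ) else 0) =
            (if P then 1 else 0) * if Q then 1 else 0 := fun P Q _ _ => by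
          rw [ite_and]; split_ifs <;> simp
        simp only [LinearMap.add_apply, LinearMap.smul_apply, smul_eq_mul, diagCurv_e, gCurv_apply,
          inner_e]
        by_cases hj : j = i
        · subst hj
          rw [hand, hand]; ring
        · rw [secMat_symm p t j i, hc j hj, hand, hand]; ring
      rw [sum_coord_e v, sum_coord_e w, sum_coord_e u]
      simp only [map_sum, LinearMap.sum_apply, map_smul, LinearMap.smul_apply, hz, smul_zero,
        Finset.sum_const_zero]
    · rw [map_add, map_smul, fieldOf_gCurv]; module
  · rintro ⟨C, b, hC, hCe, hK⟩
    rw [← fieldOf_gCurv, ← map_smul, ← map_add] at hK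
    have h1 := fieldOf_injective (isCurv_diagCurv _) (hC.add (isCurv_gCurv.smul b)) hK
    refine ⟨b, fun j hj => ?_⟩
    rw [← diagCurv_sec (secMat_symm p t) hj.symm, h1]
    simp only [LinearMap.add_apply, LinearMap.smul_apply, hCe, gCurv_apply, inner_e, smul_eq_mul,
      if_true, if_neg hj, if_neg hj.symm]
    ring

theorem range_isokernelMap_injective {i j : Fin 4}
    (h : LinearMap.range (isokernelMap i) = LinearMap.range (isokernelMap j)) : i = j := by
  have h1 : isokernelMap i (fun _ => 1) ∈ LinearMap.range (isokernelMap j) := h ▸ ⟨_, rfl⟩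
  obtain ⟨c, hc⟩ := (ofParams_mem_range_isokernelMap_iff j (fun _ => 1)
    (-(kernelVec i * fun _ => 1))).mp h1
  have h0 := hc 0
  have h1 := hc 1
  have h2 := hc 2
  have h3 := hc 3
  fin_cases i <;> fin_cases j <;> first | rfl | (simp [secMat, kernelVec] at h0 h1 h2 h3; linarith)

theorem IsIsokernelPlane.existsUnique {L : Submodule ℝ KSSpace} (hL : IsIsokernelPlane L) :
    ∃! i : Fin 4, ∀ K M, HasKSMatrix K M →
      (M ∈ L ↔ IsExtensionFrom (coordSubspace {i}ᶜ) K) := by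
  obtain ⟨i, rfl⟩ := hL.exists_eq_range
  refine ⟨i, fun K M h => h.mem_range_isokernelMap_iff i, fun j hj => ?_⟩
  refine range_isokernelMap_injective (SetLike.ext fun M => ?_)
  have h := hasKSMatrix_ksField M
  rw [hj _ _ h, h.mem_range_isokernelMap_iff]

theorem exists_hasKSMatrix_of_kernel {C : Tensor4 E4} (hC : IsCurv C) {n : E4} (hn : ‖n‖ = 1)
    (hCn : ∀ a b c, C n a b c = 0) : ∃ (φ : E4 ≃ₗᵢ[ℝ] E4) (x : Fin 3 → ℝ),
      HasKSMatrix (pushforward φ (fieldOf C)) (isokernelMap 0 x) := by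
  have hns : n 0 ^ 2 + n 1 ^ 2 + n 2 ^ 2 + n 3 ^ 2 = 1 :=
    sum_sq_sphere ⟨n, by simpa using hn⟩
  have hf := orthonormal_leftFrame (p := n) hns orthonormal_e
  have hC' := hC.pull ((frameIsometry hf).symm.toLinearEquiv : E4 →ₗ[ℝ] E4)
  have h1 : ∀ a b c, C.push (frameIsometry hf) (e 0) a b c = 0 := fun a b c => by
    have : (frameIsometry hf).symm (e 0) = n := by rw [frameIsometry_symm_e, leftFrame_e_zero]
    change C ((frameIsometry hf).symm (e 0)) _ _ _ = 0
    rw [this, hCn]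
  set C' := C.push (frameIsometry hf) with hC'def
  let S : Matrix (Fin 3) (Fin 3) ℝ := Matrix.of fun α β => (1 / 2) *
    C' (e (α + 1).succ) (e (α + 2).succ) (e (β + 1).succ) (e (β + 2).succ)
  have hb : ∀ σ τ, block C' e σ τ = (σ * τ) • S := fun σ τ => by
    ext α β
    have h2 : ∀ a b c, C' a b (e 0) c = 0 := fun a b c => by rw [← hC'.pair, h1]
    simp only [block, dualPair, Matrix.of_apply, h1, h2, Matrix.smul_apply, S, smul_eq_mul]
    ring
  have hS : Sᵀ = S := by ext α β; exact congrArg _ (hC'.pair _ _ _ _)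
  obtain ⟨U, p, -, hU, hp, -⟩ := exists_commuting_diagonalisation hS hS rfl
  obtain ⟨ε, hε, hd⟩ := exists_special_orthogonal_sign hU
  have hU' : (ε • U) * (ε • U)ᵀ = 1 := by
    rw [transpose_smul, Matrix.smul_mul, Matrix.mul_smul, hU, smul_smul, hε, one_smul]
  have hp' : (ε • U) * S * (ε • U)ᵀ = diagonal p := by
    rw [transpose_smul, Matrix.smul_mul, Matrix.smul_mul, Matrix.mul_smul, hp, smul_smul, hε,
      one_smul]
  obtain ⟨φ, hφ⟩ := exists_isometry_blocks hU' hd hU' hd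
  obtain ⟨b1, b2, b3⟩ := hφ C' hC'
  have hdiag : C'.push φ = diagCurv (secMat p (-(kernelVec 0 * p))) := by
    refine eq_of_blocks (hC'.pull _) (isCurv_diagCurv _) ?_ ?_ ?_
    · rw [b1, blockP_diagCurv, blockP, hb, mul_one, one_smul, hp']
    · have hk : kernelVec 0 * p = p := by ext α; fin_cases α <;> simp [kernelVec]
      rw [b2, blockT_diagCurv, blockT, hb, one_mul, neg_smul, one_smul, Matrix.mul_neg,
        Matrix.neg_mul, hp', hk, diagonal_neg]
      rfl
    · rw [b3, blockD_diagCurv, blockD, hb, neg_mul_neg, mul_one, one_smul, hp']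
  refine ⟨(frameIsometry hf).trans φ, p, ?_⟩
  rw [← pushforward_pushforward, pushforward_fieldOf, pushforward_fieldOf]
  change HasKSMatrix (fieldOf (C'.push φ)) _
  rw [hdiag]
  exact hasKSMatrix_iff_params.mpr ⟨_, _, rfl, rfl⟩

theorem exists_isExtensionFrom_iff (K : EndoField E4) :
    (∃ W : Submodule ℝ E4, Module.finrank ℝ W = 3 ∧ IsExtensionFrom W K) ↔
      ∃ (φ : E4 ≃ₗᵢ[ℝ] E4) (M : KSSpace) (L : Submodule ℝ KSSpace),
        IsIsokernelPlane L ∧ M ∈ L ∧ HasKSMatrix (pushforward φ K) M := by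
  constructor
  · rintro ⟨W, hW, h⟩
    have h1 : Module.finrank ℝ Wᗮ = 1 := by
      have := W.finrank_add_finrank_orthogonal
      rw [hW, finrank_E4] at this
      omega
    obtain ⟨⟨n, hnW⟩, hn, hspan⟩ := finrank_eq_one_iff'.mp h1
    have hn0 : n ≠ 0 := fun h => hn (Subtype.ext h)
    have hW' : Wᗮ = Submodule.span ℝ {n} := by
      refine le_antisymm (fun v hv => ?_) (Submodule.span_le.mpr (by simpa using hnW))
      obtain ⟨c, hc⟩ := hspan ⟨v, hv⟩
      exact Submodule.mem_span_singleton.mpr ⟨c, congrArg Subtype.val hc⟩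
    obtain ⟨C, b, hC, hCn, rfl⟩ := (isExtensionFrom_iff hn0 hW' K).mp h
    obtain ⟨y, hy⟩ := exists_eq_smul_sphere hn0
    have hCy : ∀ a b c, C (y : E4) a b c = 0 := fun a b c => by
      have h2 := hCn a b c
      rw [hy, map_smul, LinearMap.smul_apply, LinearMap.smul_apply, LinearMap.smul_apply,
        smul_eq_zero, or_iff_right (norm_ne_zero_iff.mpr hn0)] at h2
      exact h2
    obtain ⟨φ, x, hx⟩ := exists_hasKSMatrix_of_kernel hC (norm_eq_of_mem_sphere y) hCy
    refine ⟨φ, isokernelMap 0 x, _, isIsokernelPlane_range 0, ⟨x, rfl⟩, ?_⟩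
    have h3 := pushforward_affine φ (fieldOf C) 1 b
    rw [one_smul, one_smul] at h3
    rw [h3]
    simpa using hx.smul 1 b
  · rintro ⟨φ, M, L, hL, hM, h⟩
    obtain ⟨i, rfl⟩ := hL.exists_eq_range
    obtain ⟨C, b, hC, hCe, hK⟩ := (isExtensionFrom_iff (e_ne_zero i) (orthogonal_coordSubspace i) _).mp
      ((h.mem_range_isokernelMap_iff i).mp hM)
    have hn0 : φ.symm (e i) ≠ 0 := by simpa using e_ne_zero i
    refine ⟨(Submodule.span ℝ {φ.symm (e i)})ᗮ, ?_, (isExtensionFrom_iff hn0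
      (Submodule.orthogonal_orthogonal _) K).mpr ⟨C.pull (φ.toLinearEquiv : E4 →ₗ[ℝ] E4), b,
        hC.pull _, fun v w u => ?_, ?_⟩⟩
    · have : Fact (Module.finrank ℝ E4 = 3 + 1) := ⟨finrank_E4⟩
      exact Submodule.finrank_orthogonal_span_singleton hn0
    · change C (φ (φ.symm (e i))) _ _ _ = 0
      rw [LinearIsometryEquiv.apply_symm_apply, hCe]
    · have h1 := pushforward_affine φ.symm (fieldOf C) 1 b
      rw [one_smul, one_smul, ← hK, pushforward_symm_pushforward, pushforward_fieldOf,
        LinearIsometryEquiv.symm_symm] at h1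
      exact h1

end IsokernelPlanes


/-! ### Killing tensors commuting with a diagonal one -/

section Components

/-- Components `c` of an algebraic curvature tensor which commutes with the diagonal one given by `s`:
the last condition is the vanishing of the commutator of the fields at `x`. -/
structure IsCommutingArray (s : Fin 4 → Fin 4 → ℝ) (c : Fin 4 → Fin 4 → Fin 4 → Fin 4 → ℝ) :
    Prop where
  symm : ∀ i j, s i j = s j i
  diag : ∀ i, s i i = 0
  left : ∀ i j k l, c j i k l = -c i j k l
  right : ∀ i j k l, c i j l k = -c i j k l
  pair : ∀ i j k l, c k l i j = c i j k l
  bianchi : ∀ i j k l, c i j k l + c i k l j + c i l j k = 0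
  comm : ∀ (x : Fin 4 → ℝ) (i j : Fin 4),
    (∑ m, (s i m - s j m) * x m ^ 2) * (∑ k, ∑ l, x k * x l * c k i l j) -
      x i * (∑ m, s i m * x m * ∑ k, ∑ l, x k * x l * c k m l j) +
      x j * (∑ m, s j m * x m * ∑ k, ∑ l, x k * x l * c k i l m) = 0

namespace IsCommutingArray

variable {s : Fin 4 → Fin 4 → ℝ} {c : Fin 4 → Fin 4 → Fin 4 → Fin 4 → ℝ}

theorem perm (h : IsCommutingArray s c) (σ : Equiv.Perm (Fin 4)) :
    IsCommutingArray (fun i j => s (σ i) (σ j)) fun i j k l => c (σ i) (σ j) (σ k) (σ l) where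
  symm i j := h.symm _ _
  diag i := h.diag _
  left i j k l := h.left _ _ _ _
  right i j k l := h.right _ _ _ _
  pair i j k l := h.pair _ _ _ _
  bianchi i j k l := h.bianchi _ _ _ _
  comm x i j := by
    have hq : ∀ i j, ∑ k, ∑ l, x k * x l * c (σ k) i (σ l) j =
        ∑ k, ∑ l, x (σ.symm k) * x (σ.symm l) * c k i l j := fun i j =>
      Fintype.sum_equiv σ _ _ fun k => Fintype.sum_equiv σ _ _ fun l => by simp
    have h1 := h.comm (fun k => x (σ.symm k)) (σ i) (σ j)
    simp only [← hq, Equiv.symm_apply_apply] at h1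
    rw [← h1]
    congr 1
    · congr 1
      · congr 1
        exact Fintype.sum_equiv σ _ _ fun k => by simp
      · congr 1
        exact Fintype.sum_equiv σ _ _ fun k => by simp
    · congr 1
      exact Fintype.sum_equiv σ _ _ fun k => by simp

theorem self_left (h : IsCommutingArray s c) (i k l : Fin 4) : c i i k l = 0 := by
  linarith [h.left i i k l]

theorem self_right (h : IsCommutingArray s c) (i j k : Fin 4) : c i j k k = 0 := by
  linarith [h.right i j k k]

theorem left_lt (h : IsCommutingArray s c) {i j : Fin 4} (_ : j < i) (k l : Fin 4) :
    c i j k l = -c j i k l := h.left _ _ _ _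

theorem right_lt (h : IsCommutingArray s c) {k l : Fin 4} (_ : l < k) (i j : Fin 4) :
    c i j k l = -c i j l k := h.right _ _ _ _

theorem pair_lt (h : IsCommutingArray s c) {i j k l : Fin 4} (_ : k < i ∨ k = i ∧ l < j) :
    c i j k l = c k l i j := h.pair _ _ _ _

theorem symm_lt (h : IsCommutingArray s c) {i j : Fin 4} (_ : j < i) : s i j = s j i := h.symm _ _

theorem side_eq_of_ne (h : IsCommutingArray s c) (h0 : c 0 2 0 3 ≠ 0) :
    s 0 2 = s 0 3 ∧ s 0 2 = s 2 3 ∧ s 1 2 = s 1 3 ∧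
      (c 0 2 0 3 - c 1 2 1 3) * s 0 1 + c 1 2 1 3 * s 0 2 - c 0 2 0 3 * s 1 2 = 0 := by
  have e1 := h.comm ![1, 0, 0, 0] 2 3
  have e2 := h.comm ![1, 0, 1, 0] 2 3
  have e3 := h.comm ![1, 0, -1, 0] 2 3
  have e4 := h.comm ![1, 1, 0, 0] 2 3
  have e5 := h.comm ![1, -1, 0, 0] 2 3
  have e6 := h.comm ![0, 1, 0, 0] 2 3
  have f1 := h.comm ![1, 1, 1, 0] 0 3
  have f2 := h.comm ![1, -1, 1, 0] 0 3
  have f3 := h.comm ![1, 1, -1, 0] 0 3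
  have f4 := h.comm ![1, -1, -1, 0] 0 3
  simp [-mul_eq_zero, Fin.sum_univ_four, h.self_left, h.self_right, h.left_lt, h.right_lt,
    h.pair_lt, h.symm_lt, h.diag] at e1 e2 e3 e4 e5 e6 f1 f2 f3 f4
  have g1 : s 0 2 = s 0 3 := sub_eq_zero.mp ((mul_eq_zero.mp e1).resolve_right h0)
  rw [← g1] at e2 e3 e4 e5 f1 f2 f3 f4
  have g2 : s 0 2 = s 2 3 := sub_eq_zero.mp ((mul_eq_zero.mp
    (show (s 0 2 - s 2 3) * c 0 2 0 3 = 0 by linear_combination (e2 + e3) / 2)).resolve_right h0)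
  have g3 : s 1 2 = s 1 3 := sub_eq_zero.mp ((mul_eq_zero.mp
    (show (s 1 2 - s 1 3) * c 0 2 0 3 = 0 by linear_combination (e4 + e5) / 2 - e6)).resolve_right h0)
  refine ⟨g1, g2, g3, ?_⟩
  rw [← g2, ← g3] at f1 f2 f3 f4
  linear_combination (-1 / 4) * (f1 + f2 - f3 - f4)

/-- Components with four distinct indices can be nonzero only if four sides agree. -/
theorem side_eq_of_mixed_ne (h : IsCommutingArray s c) (h0 : c 0 2 1 3 + c 0 3 1 2 ≠ 0) :
    s 0 2 = s 0 3 ∧ s 1 2 = s 1 3 := by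
  have e1 := h.comm ![1, 1, 0, 0] 2 3
  have e2 := h.comm ![1, -1, 0, 0] 2 3
  have e3 := h.comm ![1, 2, 0, 0] 2 3
  have e4 := h.comm ![1, -2, 0, 0] 2 3
  simp [-mul_eq_zero, Fin.sum_univ_four, h.self_left, h.self_right, h.left_lt, h.right_lt,
    h.pair_lt, h.symm_lt, h.diag] at e1 e2 e3 e4
  have g1 : s 0 2 - s 0 3 + (s 1 2 - s 1 3) = 0 := (mul_eq_zero.mp
    (show _ * (c 0 2 1 3 + c 0 3 1 2) = 0 by linear_combination (e1 - e2) / 2)).resolve_right h0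
  have g2 : s 0 2 - s 0 3 + (s 1 2 - s 1 3) * 4 = 0 := (mul_eq_zero.mp
    (show _ * (c 0 2 1 3 + c 0 3 1 2) = 0 by linear_combination (e3 - e4) / 4)).resolve_right h0
  exact ⟨by linarith, by linarith⟩

/-- The relation between the components in a face. -/
theorem face_relation (h : IsCommutingArray s c) (h0 : c 0 1 0 2 = 0) (h1 : c 0 1 1 2 = 0)
    (h2 : c 0 2 1 2 = 0) :
    s 0 1 * (c 0 2 0 2 - c 1 2 1 2) + s 0 2 * (c 1 2 1 2 - c 0 1 0 1) +
      s 1 2 * (c 0 1 0 1 - c 0 2 0 2) = 0 := by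
  have e1 := h.comm ![1, 1, 1, 0] 0 1
  simp [-mul_eq_zero, Fin.sum_univ_four, h.self_left, h.self_right, h.left_lt, h.right_lt,
    h.pair_lt, h.symm_lt, h.diag, h0, h1, h2] at e1
  linear_combination e1

theorem exists_perm_fin_four {i j k l : Fin 4} (hij : i ≠ j) (hik : i ≠ k) (hil : i ≠ l) (hjk : j ≠ k)
    (hjl : j ≠ l) (hkl : k ≠ l) :
    ∃ σ : Equiv.Perm (Fin 4), σ 0 = i ∧ σ 1 = j ∧ σ 2 = k ∧ σ 3 = l := by
  have hinj : Function.Injective ![i, j, k, l] := by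
    intro a b
    fin_cases a <;> fin_cases b <;> simp [*, Ne.symm]
  exact ⟨Equiv.ofBijective _ (Finite.injective_iff_bijective.mp hinj), rfl, rfl, rfl, rfl⟩

theorem exists_fourth : ∀ i j k : Fin 4, ∃ l, l ≠ i ∧ l ≠ j ∧ l ≠ k := by decide

theorem triangle_of_ne (h : IsCommutingArray s c) {i j k l : Fin 4} (hij : i ≠ j) (hik : i ≠ k)
    (hil : i ≠ l) (hjk : j ≠ k) (hjl : j ≠ l) (hkl : k ≠ l) (h0 : c i k i l ≠ 0) :
    s i k = s i l ∧ s i k = s k l ∧ s j k = s j l ∧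
      (c i k i l - c j k j l) * s i j + c j k j l * s i k - c i k i l * s j k = 0 := by
  obtain ⟨σ, rfl, rfl, rfl, rfl⟩ := exists_perm_fin_four hij hik hil hjk hjl hkl
  exact (h.perm σ).side_eq_of_ne h0

theorem eq_zero_of_triangle (h : IsCommutingArray s c) {i k l : Fin 4} (hik : i ≠ k) (hil : i ≠ l)
    (hkl : k ≠ l) (hs : ¬(s i k = s i l ∧ s i k = s k l)) : c i k i l = 0 := by
  by_contra h0
  obtain ⟨j, h1, h2, h3⟩ := exists_fourth i k l
  have := h.triangle_of_ne h1.symm hik hil h2 h3 hkl h0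
  exact hs ⟨this.1, this.2.1⟩

/-- The sectional components `s` are not all equal. -/
def IsNonconstant (s : Fin 4 → Fin 4 → ℝ) : Prop := ¬∃ a, ∀ i j, i ≠ j → s i j = a

theorem eq_of_six {s : Fin 4 → Fin 4 → ℝ} (hs : ∀ i j, s i j = s j i) {f : Fin 4 → Fin 4 → ℝ}
    (hf : ∀ i j, f i j = f j i)
    (h01 : s 0 1 = f 0 1) (h02 : s 0 2 = f 0 2) (h03 : s 0 3 = f 0 3) (h12 : s 1 2 = f 1 2)
    (h13 : s 1 3 = f 1 3) (h23 : s 2 3 = f 2 3) (i j : Fin 4) (hij : i ≠ j) : s i j = f i j := by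
  fin_cases i <;> fin_cases j <;> first | exact absurd rfl hij | assumption | (rw [hs, hf]; assumption)

theorem mixed_add_eq_zero (h : IsCommutingArray s c) (hs : IsNonconstant s) :
    c 0 1 2 3 = 0 ∧ c 0 2 1 3 = 0 ∧ c 0 3 1 2 = 0 := by
  have key : ∀ i j k l : Fin 4, i ≠ j → i ≠ k → i ≠ l → j ≠ k → j ≠ l → k ≠ l →
      c i k j l + c i l j k ≠ 0 → s i k = s i l ∧ s j k = s j l := by
    intro i j k l hij hik hil hjk hjl hkl h0
    obtain ⟨σ, rfl, rfl, rfl, rfl⟩ := exists_perm_fin_four hij hik hil hjk hjl hkl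
    exact (h.perm σ).side_eq_of_mixed_ne h0
  have b := h.bianchi 0 1 2 3
  have q1 := key 0 1 2 3
  have q1' := key 2 3 0 1
  have q2 := key 0 2 1 3
  have q2' := key 1 3 0 2
  have q3 := key 0 3 1 2
  have q3' := key 1 2 0 3
  simp [h.left_lt, h.right_lt, h.pair_lt, h.symm_lt] at b q1 q1' q2 q2' q3 q3'
  have hne : ∀ a, ¬(s 0 1 = a ∧ s 0 2 = a ∧ s 0 3 = a ∧ s 1 2 = a ∧ s 1 3 = a ∧ s 2 3 = a) := by
    rintro a ⟨h1, h2, h3, h4, h5, h6⟩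
    exact hs ⟨a, eq_of_six h.symm (f := fun _ _ => a) (fun _ _ => rfl) h1 h2 h3 h4 h5 h6⟩
  have hne' := hne (s 0 1)
  by_cases h1 : c 0 2 1 3 + c 0 3 1 2 = 0 <;> by_cases h2 : c 0 1 2 3 + -c 0 3 1 2 = 0
  · refine ⟨?_, ?_, ?_⟩ <;> linarith
  · have h3 : ¬(-c 0 1 2 3 + -c 0 2 1 3 = 0) := fun h3 => h2 (by linarith)
    exact absurd ⟨by linarith [q2 h2, q3 h3], by linarith [q2 h2, q3 h3], by linarith [q2 h2, q3 h3],
      by linarith [q2' h2, q3 h3], by linarith [q3' h3, q3 h3], by linarith [q3' h3, q3 h3]⟩ hne'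
  · have h3 : ¬(-c 0 1 2 3 + -c 0 2 1 3 = 0) := fun h3 => h1 (by linarith)
    have a1 := q1 h1
    have a2 := q1' h1
    have a3 := q3 h3
    have a4 := q3' h3
    exact absurd ⟨rfl, by linarith, by linarith, by linarith, by linarith, by linarith⟩ hne'
  · have a1 := q1 h1
    have a2 := q1' h1
    have a3 := q2 h2
    have a4 := q2' h2
    exact absurd ⟨rfl, by linarith, by linarith, by linarith, by linarith, by linarith⟩ hne'

theorem mixed_eq_zero (h : IsCommutingArray s c) (hs : IsNonconstant s) {i j k l : Fin 4}
    (hij : i ≠ j) (hik : i ≠ k) (hil : i ≠ l) (hjk : j ≠ k) (hjl : j ≠ l) (hkl : k ≠ l) :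
    c i j k l = 0 := by
  obtain ⟨σ, rfl, rfl, rfl, rfl⟩ := exists_perm_fin_four hij hik hil hjk hjl hkl
  refine ((h.perm σ).mixed_add_eq_zero fun ⟨a, ha⟩ => hs ⟨a, fun i j hij => ?_⟩).1
  simpa using ha (σ.symm i) (σ.symm j) (by simpa using hij)

/-- The sectional components `s` are those of a constant plus a multiple of the metric of a
coordinate subsphere. -/
def IsDegenerate (s : Fin 4 → Fin 4 → ℝ) : Prop :=
  ∃ (I : Finset (Fin 4)) (a b : ℝ), (I.card = 2 ∨ I.card = 3) ∧
    ∀ i j, i ≠ j → s i j = a + b * subsetMat I i j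

theorem isDegenerate_of_ne (h : IsCommutingArray s c) {i k l : Fin 4} (hik : i ≠ k) (hil : i ≠ l)
    (hkl : k ≠ l) (h0 : c i k i l ≠ 0) : IsDegenerate s := by
  obtain ⟨j, h1, h2, h3⟩ := exists_fourth i k l
  obtain ⟨σ, rfl, rfl, rfl, rfl⟩ := exists_perm_fin_four h1.symm hik hil h2 h3 hkl
  have h' := h.perm σ
  obtain ⟨t1, t2, t3, t4⟩ := h'.side_eq_of_ne h0
  have key : ∀ J : Finset (Fin 4), (J.card = 2 ∨ J.card = 3) → ∀ a b,
      (∀ i j, i ≠ j → s (σ i) (σ j) = a + b * subsetMat J i j) → IsDegenerate s := by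
    intro J hJ a b hJ'
    refine ⟨J.map σ.toEmbedding, a, b, by simpa using hJ, fun i j hij => ?_⟩
    have := hJ' (σ.symm i) (σ.symm j) (by simpa using hij)
    simpa [subsetMat, Finset.mem_map_equiv] using this
  by_cases h4 : c (σ 1) (σ 2) (σ 1) (σ 3) = 0
  · have t5 : s (σ 0) (σ 1) = s (σ 1) (σ 2) := by
      rw [h4] at t4
      exact mul_left_cancel₀ h0 (by linear_combination t4)
    refine key {0, 2, 3} (Or.inr rfl) (s (σ 0) (σ 1)) (s (σ 0) (σ 2) - s (σ 0) (σ 1))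
      (eq_of_six h'.symm (fun i j => by simp only [subsetMat, and_comm]) ?_ ?_ ?_ ?_ ?_ ?_)
    all_goals simp [subsetMat]
    all_goals linarith
  · obtain ⟨t5, t6, -⟩ := h'.triangle_of_ne (i := 1) (j := 0) (k := 2) (l := 3) (by decide)
      (by decide) (by decide) (by decide) (by decide) (by decide) h4
    refine key {0, 1} (Or.inl rfl) (s (σ 0) (σ 2)) (s (σ 0) (σ 1) - s (σ 0) (σ 2))
      (eq_of_six h'.symm (fun i j => by simp only [subsetMat, and_comm]) ?_ ?_ ?_ ?_ ?_ ?_)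
    all_goals simp [subsetMat]
    all_goals linarith

theorem eq_zero_of_not_isDegenerate (h : IsCommutingArray s c) (hs : ¬IsDegenerate s) (i j k l : Fin 4)
    (hijkl : ({i, j} : Set (Fin 4)) ≠ {k, l}) : c i j k l = 0 := by
  have hs' : IsNonconstant s := fun ⟨a, ha⟩ => hs ⟨{0, 1}, a, 0, Or.inl rfl, by simpa using ha⟩
  have h1 : ∀ i k l, k ≠ l → c i k i l = 0 := fun i k l hkl => by
    by_cases hik : i = k
    · rw [hik, h.self_left]
    by_cases hil : i = l
    · rw [hil, h.self_right]
    by_contra h0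
    exact hs (h.isDegenerate_of_ne hik hil hkl h0)
  by_cases hij : i = j
  · rw [hij, h.self_left]
  by_cases hkl : k = l
  · rw [hkl, h.self_right]
  by_cases hik : i = k
  · subst hik; exact h1 _ _ _ fun e => hijkl (by rw [e])
  by_cases hjl : j = l
  · subst hjl
    rw [h.left, h.right, neg_neg] 
    exact h1 _ _ _ hik
  by_cases hil : i = l
  · subst hil
    rw [h.right, h1 _ _ _ fun e => hijkl (by rw [e, Set.pair_comm]), neg_zero]
  by_cases hjk : j = k
  · subst hjk
    rw [h.left, h1 _ _ _ hil, neg_zero]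
  exact h.mixed_eq_zero hs' hij hik hil hjk hjl hkl

/-- Tensors commuting with the metric of a great two-sphere. -/
theorem sphere_components (h : IsCommutingArray s c) {a b : ℝ} (hb : b ≠ 0)
    (hs : ∀ i j, i ≠ j → s i j = a + b * subsetMat {1, 2, 3} i j) :
    ∀ i j k : Fin 3, c 0 i.succ j.succ k.succ = 0 ∧
      c 0 i.succ 0 j.succ = if i = j then c 0 1 0 1 else 0 := by
  have hs' : IsNonconstant s := fun ⟨d, hd⟩ => hb (by
    have h1 := hs 0 1 (by decide)
    have h2 := hs 1 2 (by decide)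
    rw [hd _ _ (by decide)] at h1 h2
    simp [subsetMat] at h1 h2
    linarith)
  have v : ∀ i : Fin 3, s 0 i.succ = a := fun i => by
    rw [hs _ _ (Fin.succ_ne_zero i).symm]; simp [subsetMat]
  have v' : ∀ i j : Fin 3, i ≠ j → s i.succ j.succ = a + b := fun i j hij => by
    rw [hs _ _ (by simpa using hij)]; fin_cases i <;> fin_cases j <;> simp [subsetMat] at hij ⊢
  have e0 : ∀ i j : Fin 3, i ≠ j → c 0 i.succ 0 j.succ = 0 := fun i j hij =>
    h.eq_zero_of_triangle (Fin.succ_ne_zero i).symm (Fin.succ_ne_zero j).symm (by simpa using hij)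
      fun ⟨_, h2⟩ => hb (by rw [v, v' i j hij] at h2; linarith)
  have e1 : ∀ i j : Fin 3, i ≠ j → c 0 i.succ i.succ j.succ = 0 := fun i j hij => by
    rw [h.left, neg_eq_zero]
    exact h.eq_zero_of_triangle (Fin.succ_ne_zero i) (by simpa using hij) (Fin.succ_ne_zero j).symm
      fun ⟨h1, _⟩ => hb (by rw [h.symm, v, v' i j hij] at h1; linarith)
  have e2 : ∀ i j : Fin 3, i ≠ j → c 0 i.succ 0 i.succ = c 0 j.succ 0 j.succ := fun i j hij => by
    obtain ⟨l, h1, h2, h3⟩ := exists_fourth 0 i.succ j.succ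
    obtain ⟨σ, g0, g1, g2, -⟩ := exists_perm_fin_four (Fin.succ_ne_zero i).symm
      (Fin.succ_ne_zero j).symm h1.symm (by simpa using hij) h2.symm h3.symm
    have := (h.perm σ).face_relation
    simp only [g0, g1, g2, v, v' i j hij] at this
    have := this (e0 i j hij) (e1 i j hij) (by rw [h.right, e1 j i hij.symm, neg_zero])
    exact mul_left_cancel₀ hb (by linear_combination this)
  intro i j k
  constructor
  · by_cases hjk : j = k
    · rw [hjk, h.self_right]
    by_cases hij : i = j
    · rw [← hij]; exact e1 i k (hij ▸ hjk)
    by_cases hik : i = k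
    · rw [← hik, h.right, e1 i j hij, neg_zero]
    exact h.mixed_eq_zero hs' (Fin.succ_ne_zero i).symm (Fin.succ_ne_zero j).symm
      (Fin.succ_ne_zero k).symm (by simpa using hij) (by simpa using hik) (by simpa using hjk)
  · split_ifs with hij
    · subst hij
      by_cases hi : i = 0
      · subst hi; rfl
      · exact e2 i 0 hi
    · exact e0 i j hij

/-- Tensors commuting with the metric of a great circle. -/
theorem circle_components (h : IsCommutingArray s c) {a b : ℝ} (hb : b ≠ 0)
    (hs : ∀ i j, i ≠ j → s i j = a + b * subsetMat {0, 1} i j) :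
    c 0 1 0 2 = 0 ∧ c 0 1 0 3 = 0 ∧ c 0 1 1 2 = 0 ∧ c 0 1 1 3 = 0 ∧ c 0 1 2 3 = 0 ∧ c 0 2 1 3 = 0 ∧
      c 0 3 1 2 = 0 ∧ c 0 2 1 2 = 0 ∧ c 0 3 1 3 = 0 ∧ c 0 2 2 3 = 0 ∧ c 0 3 2 3 = 0 ∧
      c 1 2 2 3 = 0 ∧ c 1 3 2 3 = 0 ∧ c 1 2 1 3 = c 0 2 0 3 ∧ c 1 2 1 2 = c 0 2 0 2 ∧
      c 1 3 1 3 = c 0 3 0 3 := by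
  have hs' : IsNonconstant s := fun ⟨d, hd⟩ => hb (by
    have h1 := hs 0 1 (by decide)
    have h2 := hs 1 2 (by decide)
    rw [hd _ _ (by decide)] at h1 h2
    simp [subsetMat] at h1 h2
    linarith)
  have v : ∀ i j, i ≠ j → ¬(i ∈ ({0, 1} : Finset (Fin 4)) ∧ j ∈ ({0, 1} : Finset (Fin 4))) →
      s i j = a := fun i j hij hI => by rw [hs i j hij, subsetMat, if_neg hI]; ring
  have v01 : s 0 1 = a + b := by rw [hs _ _ (by decide)]; simp [subsetMat]
  have v10 : s 1 0 = a + b := by rw [h.symm, v01]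
  have e : ∀ i k l, i ≠ k → i ≠ l → k ≠ l → (s i k = a + b ∨ s i l = a + b) ∧ s k l = a ∨
      s i k = a ∧ s k l = a + b → c i k i l = 0 := fun i k l hik hil hkl hcase =>
    h.eq_zero_of_triangle hik hil hkl fun ⟨h1, h2⟩ => hb (by
      rcases hcase with ⟨h3 | h3, h4⟩ | ⟨h3, h4⟩ <;> linarith)
  have z1 : c 0 1 0 2 = 0 := e _ _ _ (by decide) (by decide) (by decide)
    (Or.inl ⟨Or.inl v01, v _ _ (by decide) (by decide)⟩)
  have z2 : c 0 1 0 3 = 0 := e _ _ _ (by decide) (by decide) (by decide)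
    (Or.inl ⟨Or.inl v01, v _ _ (by decide) (by decide)⟩)
  have z3 : c 1 0 1 2 = 0 := e _ _ _ (by decide) (by decide) (by decide)
    (Or.inl ⟨Or.inl v10, v _ _ (by decide) (by decide)⟩)
  have z4 : c 1 0 1 3 = 0 := e _ _ _ (by decide) (by decide) (by decide)
    (Or.inl ⟨Or.inl v10, v _ _ (by decide) (by decide)⟩)
  have z5 : c 2 0 2 1 = 0 := e _ _ _ (by decide) (by decide) (by decide)
    (Or.inr ⟨v _ _ (by decide) (by decide), v01⟩)
  have z6 : c 3 0 3 1 = 0 := e _ _ _ (by decide) (by decide) (by decide)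
    (Or.inr ⟨v _ _ (by decide) (by decide), v01⟩)
  have y : ∀ i j k l : Fin 4, i ≠ j → i ≠ k → i ≠ l → j ≠ k → j ≠ l → k ≠ l → s i j = a →
      s j k = a + b → c j k j l = 0 → c i k i l = 0 := fun i j k l hij hik hil hjk hjl hkl h1 h2 h3 => by
    by_contra h0
    have := (h.triangle_of_ne hij hik hil hjk hjl hkl h0).2.2.2
    rw [h3, h1, h2] at this
    exact mul_ne_zero h0 hb (by linear_combination -this)
  have z7 : c 2 0 2 3 = 0 := y 2 1 0 3 (by decide) (by decide) (by decide) (by decide) (by decide)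
    (by decide) (v _ _ (by decide) (by decide)) v10 z4
  have z8 : c 3 0 3 2 = 0 := y 3 1 0 2 (by decide) (by decide) (by decide) (by decide) (by decide)
    (by decide) (v _ _ (by decide) (by decide)) v10 z3
  have z9 : c 2 1 2 3 = 0 := y 2 0 1 3 (by decide) (by decide) (by decide) (by decide) (by decide)
    (by decide) (v _ _ (by decide) (by decide)) v01 z2
  have z10 : c 3 1 3 2 = 0 := y 3 0 1 2 (by decide) (by decide) (by decide) (by decide) (by decide)
    (by decide) (v _ _ (by decide) (by decide)) v01 z1
  have m := h.mixed_add_eq_zero hs'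
  have w : ∀ i j, i ≠ j → s i j = a + b → s j i = a + b → i ≠ 2 → i ≠ 3 → j ≠ 2 → j ≠ 3 →
      c i 2 i 3 ≠ 0 → c j 2 j 3 = c i 2 i 3 := fun i j hij h1 h2 h3 h4 h5 h6 h0 => by
    have := (h.triangle_of_ne hij h3 h4 h5 h6 (by decide) h0).2.2.2
    rw [h1, v i 2 h3 (fun hI => absurd hI.2 (by decide)), v j 2 h5 (fun hI => absurd hI.2 (by decide))] at this
    exact mul_left_cancel₀ hb (by linear_combination -this)
  have x1 : c 1 2 1 3 = c 0 2 0 3 := by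
    by_cases h0 : c 0 2 0 3 = 0
    · by_cases h1 : c 1 2 1 3 = 0
      · rw [h0, h1]
      · exact (w 1 0 (by decide) v10 v01 (by decide) (by decide) (by decide) (by decide) h1).symm
    · exact w 0 1 (by decide) v01 v10 (by decide) (by decide) (by decide) (by decide) h0
  simp only [h.left_lt, h.right_lt, Fin.isValue, Fin.reduceLT, neg_eq_zero, neg_neg, zero_lt_one] at z3 z4 z5 z6 z7 z8 z9 z10
  have f1 := h.face_relation z1 z3 z5
  have f2 := (h.perm (Equiv.swap 2 3)).face_relation
  simp [Equiv.swap_apply_def] at f2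
  have f2 := f2 z2 z4 z6
  rw [v01, v _ _ (by decide) (by decide), v _ _ (by decide) (by decide)] at f1 f2
  exact ⟨z1, z2, z3, z4, m.1, m.2.1, m.2.2, z5, z6, z7, z8, z9, z10, x1,
    mul_left_cancel₀ hb (by linear_combination -f1), mul_left_cancel₀ hb (by linear_combination -f2)⟩

end IsCommutingArray

end Components

end KillingStaeckel

end

noncomputable section

set_option linter.unusedSectionVars false

namespace KillingStaeckel

open Matrix

section CommutingFields

/-- The value of the field of a diagonal curvature tensor on a basis vector. -/
def diagVec (s : Fin 4 → Fin 4 → ℝ) (x : E4) (i : Fin 4) : E4 :=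
  (∑ m, s i m * x m ^ 2) • e i - x i • ∑ m, (s i m * x m) • e m

theorem inner_diagVec {s : Fin 4 → Fin 4 → ℝ} (hs : ∀ i j, s i j = s j i) (x w : E4) (i : Fin 4) :
    ⟪diagVec s x i, w⟫ = diagCurv s x (e i) x w := by
  have he : ∀ m, ⟪(e m : E4), w⟫ = w m := fun m => by
    rw [e, EuclideanSpace.inner_single_left]; simp
  simp only [diagVec, inner_sub_left, real_inner_smul_left, sum_inner, he, diagCurv_apply, e_apply]
  fin_cases i <;> simp [Fin.sum_univ_four, hs 1 0, hs 2 0, hs 3 0, hs 2 1, hs 3 1, hs 3 2] <;> ring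

theorem diagVec_smul (s : Fin 4 → Fin 4 → ℝ) (r : ℝ) (x : E4) (i : Fin 4) :
    diagVec s (r • x) i = r ^ 2 • diagVec s x i := by
  simp only [diagVec, PiLp.smul_apply, smul_eq_mul, smul_sub, Finset.smul_sum, smul_smul,
    Finset.mul_sum]
  congr 1
  · congr 1
    exact Finset.sum_congr rfl fun m _ => by ring
  · exact Finset.sum_congr rfl fun m _ => by congr 1; ring

theorem curv_diagVec {s : Fin 4 → Fin 4 → ℝ} (hs : ∀ i j, s i j = s j i) {C : Tensor4 E4}
    (hc : ∀ x, (fieldOf (diagCurv s) x).comp (fieldOf C x) =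
      (fieldOf C x).comp (fieldOf (diagCurv s) x)) (x : E4) (i j : Fin 4) :
    C x (diagVec s x i) x (e j) = C x (e i) x (diagVec s x j) := by
  have hunit : ∀ x : Metric.sphere (0 : E4) 1,
      C x (diagVec s x i) x (e j) = C x (e i) x (diagVec s x j) := fun x => by
    have h1 : fieldOf (diagCurv s) x (e i) = diagVec s x i := ext_inner_right ℝ fun w => by
      rw [inner_diagVec hs, isField_fieldOf]
    have h2 := congrArg (fun f => ⟪f (e i), e j⟫) (hc x)
    simp only [ContinuousLinearMap.comp_apply, h1] at h2
    rw [isField_fieldOf, isField_fieldOf, ← (isCurv_diagCurv s).pair, ← inner_diagVec hs,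
      real_inner_comm, isField_fieldOf] at h2
    exact h2.symm
  by_cases hx : x = 0
  · simp [hx]
  have h1 : ‖x‖ ≠ 0 := norm_ne_zero_iff.mpr hx
  have h2 := hunit ⟨‖x‖⁻¹ • x, by simp [norm_smul, hx]⟩
  simp only [diagVec_smul, map_smul, LinearMap.smul_apply, smul_eq_mul] at h2
  have h3 : ‖x‖⁻¹ ≠ 0 := inv_ne_zero h1
  have h4 : ‖x‖⁻¹ ^ 4 ≠ 0 := pow_ne_zero _ h3
  exact mul_left_cancel₀ h4 (by linear_combination h2)

theorem isCommutingArray {s : Fin 4 → Fin 4 → ℝ} (hs : ∀ i j, s i j = s j i) (hd : ∀ i, s i i = 0)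
    {C : Tensor4 E4} (hC : IsCurv C)
    (hc : ∀ x, (fieldOf (diagCurv s) x).comp (fieldOf C x) =
      (fieldOf C x).comp (fieldOf (diagCurv s) x)) :
    IsCommutingArray s fun i j k l => C (e i) (e j) (e k) (e l) where
  symm := hs
  diag := hd
  left _ _ _ _ := hC.left _ _ _ _
  right _ _ _ _ := hC.right _ _ _ _
  pair _ _ _ _ := hC.pair _ _ _ _
  bianchi _ _ _ _ := hC.bianchi _ _ _ _
  comm y i j := by
    set x : E4 := WithLp.toLp 2 y with hx
    have hxe : x = ∑ k, y k • e k := by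
      ext m; simp [hx, e_apply]
    have hq : ∀ i j, ∑ k, ∑ l, y k * y l * C (e k) (e i) (e l) (e j) = C x (e i) x (e j) :=
      fun i j => by
        rw [hxe]
        simp only [map_sum, map_smul, LinearMap.sum_apply, LinearMap.smul_apply, smul_eq_mul,
          Finset.mul_sum]
        rw [Finset.sum_comm]
        exact Finset.sum_congr rfl fun k _ => Finset.sum_congr rfl fun l _ => by ring
    have h1 := curv_diagVec hs hc x i j
    simp only [diagVec, map_sub, map_smul, map_sum, LinearMap.sub_apply, LinearMap.smul_apply,
      LinearMap.sum_apply, smul_eq_mul] at h1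
    have hxy : ∀ m, x m = y m := fun _ => rfl
    simp only [hxy] at h1
    simp only [hq, sub_mul, Finset.sum_sub_distrib]
    linear_combination h1

theorem secMat_self (p t : Fin 3 → ℝ) (i : Fin 4) : secMat p t i i = 0 := by
  fin_cases i <;> rfl

theorem IsDiagCurv.exists_hasKSMatrix {C : Tensor4 E4} (hd : IsDiagCurv C) (hC : IsCurv C) :
    ∃ M, HasKSMatrix (fieldOf C) M :=
  ⟨_, hasKSMatrix_iff_params.mpr ⟨_, _, congrArg _ (hd.eq_secMat hC), rfl⟩⟩

theorem eq_smul_subsetKS {p t : Fin 3 → ℝ} {I : Finset (Fin 4)} {a b : ℝ}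
    (h : ∀ i j, i ≠ j → secMat p t i j = a + b * subsetMat I i j) :
    ofParams p t = b • subsetKS I := by
  have h1 : ∀ α : Fin 3, p α + t α = a + b * subsetMat I 0 α.succ := fun α => by
    rw [← h _ _ (Fin.succ_ne_zero α).symm]; fin_cases α <;> rfl
  have h2 : ∀ α : Fin 3, p α - t α = a + b * subsetMat I (α + 1).succ (α + 2).succ := fun α => by
    rw [← h _ _ (by fin_cases α <;> decide)]; fin_cases α <;> rfl
  rw [subsetKS, ← ofParams_smul, ← ofParams_add_const _ _ (-a)]
  congr 1
  · ext α
    simp only [Pi.smul_apply, smul_eq_mul]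
    linarith [h1 α, h2 α]
  · ext α
    simp only [Pi.smul_apply, smul_eq_mul]
    linarith [h1 α, h2 α]

/-- The matrices of the metrics of coordinate subspheres, up to multiples. -/
def IsDegenerateMatrix (M : KSSpace) : Prop :=
  ∃ (I : Finset (Fin 4)) (b : ℝ), (I.card = 2 ∨ I.card = 3) ∧ M = b • subsetKS I

theorem HasKSMatrix.exists_of_comm {K K' : EndoField E4} {M : KSSpace} (h : HasKSMatrix K M)
    (hM : ¬IsDegenerateMatrix M) (hK' : IsKilling K')
    (hc : ∀ x, (K x).comp (K' x) = (K' x).comp (K x)) : ∃ M', HasKSMatrix K' M' := by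
  obtain ⟨p, t, rfl, rfl⟩ := hasKSMatrix_iff_params.mp h
  obtain ⟨C, hC, rfl⟩ := hK'.exists_eq_fieldOf
  have h1 := isCommutingArray (secMat_symm p t) (secMat_self p t) hC hc
  refine IsDiagCurv.exists_hasKSMatrix (fun i j k l hijkl => ?_) hC
  exact h1.eq_zero_of_not_isDegenerate
    (fun ⟨I, a, b, hI, hs⟩ => hM ⟨I, b, hI, eq_smul_subsetKS hs⟩) i j k l hijkl

/-- The components of a curvature tensor in a permuted frame. -/
theorem exists_isometry_comp_perm (σ : Equiv.Perm (Fin 4)) : ∃ φ : E4 ≃ₗᵢ[ℝ] E4,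
    ∀ i, φ.symm (e i) = e (σ i) :=
  ⟨frameIsometry (orthonormal_e.comp σ σ.injective), frameIsometry_symm_e _⟩

theorem exists_perm_of_card_two : ∀ I : Finset (Fin 4), I.card = 2 →
    ∃ i j k l : Fin 4, i ≠ j ∧ i ≠ k ∧ i ≠ l ∧ j ≠ k ∧ j ≠ l ∧ k ≠ l ∧ i ∈ I ∧ j ∈ I ∧ k ∉ I ∧ l ∉ I := by
  decide

theorem exists_perm_of_card_three : ∀ I : Finset (Fin 4), I.card = 3 →
    ∃ i j k l : Fin 4, i ≠ j ∧ i ≠ k ∧ i ≠ l ∧ j ≠ k ∧ j ≠ l ∧ k ≠ l ∧ i ∉ I ∧ j ∈ I ∧ k ∈ I ∧ l ∈ I := by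
  decide

theorem exists_perm_of_card {I : Finset (Fin 4)} (hI : I.card = 2 ∨ I.card = 3) :
    ∃ (J : Finset (Fin 4)) (σ : Equiv.Perm (Fin 4)), (J = {0, 1} ∨ J = {1, 2, 3}) ∧
      ∀ i, σ i ∈ I ↔ i ∈ J := by
  rcases hI with hI | hI
  · obtain ⟨i, j, k, l, hij, hik, hil, hjk, hjl, hkl, h0, h1, h2, h3⟩ := exists_perm_of_card_two I hI
    obtain ⟨σ, rfl, rfl, rfl, rfl⟩ :=
      IsCommutingArray.exists_perm_fin_four hij hik hil hjk hjl hkl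
    exact ⟨_, σ, Or.inl rfl, fun i => by fin_cases i <;> simp [h0, h1, h2, h3]⟩
  · obtain ⟨i, j, k, l, hij, hik, hil, hjk, hjl, hkl, h0, h1, h2, h3⟩ := exists_perm_of_card_three I hI
    obtain ⟨σ, rfl, rfl, rfl, rfl⟩ :=
      IsCommutingArray.exists_perm_fin_four hij hik hil hjk hjl hkl
    exact ⟨_, σ, Or.inr rfl, fun i => by fin_cases i <;> simp [h0, h1, h2, h3]⟩

/-- Curvature tensors whose blocks are combinations of two commuting symmetric matrices are
simultaneously diagonalisable. -/
theorem exists_isometry_isDiagCurv {E T : Matrix (Fin 3) (Fin 3) ℝ} (hE : Eᵀ = E) (hT : Tᵀ = T)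
    (hET : E * T = T * E) : ∃ φ : E4 ≃ₗᵢ[ℝ] E4, ∀ C : Tensor4 E4, IsCurv C →
      blockD C e = blockP C e → (∃ a b c : ℝ, blockP C e = a • 1 + b • E + c • T) →
      (∃ a b c : ℝ, blockT C e = a • 1 + b • E + c • T) → ∃ M, HasKSMatrix (pushforward φ (fieldOf C)) M := by
  obtain ⟨U, p, q, hU, hp, hq⟩ := exists_commuting_diagonalisation hE hT hET
  obtain ⟨ε, hε, hd⟩ := exists_special_orthogonal_sign hU
  have key : ∀ X, (ε • U) * X * (ε • U)ᵀ = U * X * Uᵀ := fun X => by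
    rw [transpose_smul, Matrix.smul_mul, Matrix.smul_mul, Matrix.mul_smul, smul_smul, hε, one_smul]
  have hU' : (ε • U) * (ε • U)ᵀ = 1 := by
    have := key 1
    rwa [Matrix.mul_one, Matrix.mul_one, hU] at this
  have hcomb : ∀ a b c : ℝ, U * (a • 1 + b • E + c • T) * Uᵀ = diagonal fun i => a + b * p i + c * q i :=
    fun a b c => by
      rw [Matrix.mul_add, Matrix.mul_add, Matrix.add_mul, Matrix.add_mul, Matrix.mul_smul,
        Matrix.mul_smul, Matrix.mul_smul, Matrix.smul_mul, Matrix.smul_mul, Matrix.smul_mul, hp, hq,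
        Matrix.mul_one, hU]
      ext i j
      by_cases hij : i = j <;> simp [hij]
  obtain ⟨φ, hφ⟩ := exists_isometry_blocks hU' hd hU' hd
  refine ⟨φ, fun C hC hDP ⟨a, b, c, hP⟩ ⟨a', b', c', hT'⟩ => ?_⟩
  obtain ⟨b1, b2, b3⟩ := hφ C hC
  rw [key, hP, hcomb] at b1
  rw [key, hT', hcomb] at b2
  rw [key, hDP, hP, hcomb] at b3
  refine ⟨_, hasKSMatrix_iff_params.mpr ⟨fun i => a + b * p i + c * q i,
    fun i => a' + b' * p i + c' * q i, ?_, rfl⟩⟩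
  rw [pushforward_fieldOf]
  congr 1
  refine eq_of_blocks (hC.pull _) (isCurv_diagCurv _) ?_ ?_ ?_
  · rw [b1, blockP_diagCurv]
  · rw [b2, blockT_diagCurv]
  · rw [b3, blockD_diagCurv]

theorem blocks_of_sphere {s : Fin 4 → Fin 4 → ℝ} {C : Tensor4 E4} (hC : IsCurv C)
    (h : IsCommutingArray s fun i j k l => C (e i) (e j) (e k) (e l)) {a b : ℝ} (hb : b ≠ 0)
    (hs : ∀ i j, i ≠ j → s i j = a + b * subsetMat {1, 2, 3} i j) :
    blockD C e = blockP C e ∧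
      blockP C e = C (e 0) (e 1) (e 0) (e 1) • 1 - blockT C e ∧ (blockT C e)ᵀ = blockT C e := by
  have hz := h.sphere_components hb hs
  have z1 : ∀ i j k : Fin 3, C (e 0) (e i.succ) (e j.succ) (e k.succ) = 0 := fun i j k => (hz i j k).1
  have z2 : ∀ i j k : Fin 3, C (e j.succ) (e k.succ) (e 0) (e i.succ) = 0 := fun i j k => by
    rw [hC.pair, z1]
  have z3 : ∀ i j : Fin 3, C (e 0) (e i.succ) (e 0) (e j.succ) =
    if i = j then C (e 0) (e 1) (e 0) (e 1) else 0 := fun i j => (hz i j 0).2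
  refine ⟨?_, ?_, ?_⟩
  · ext α β
    simp only [blockD, blockP, block, dualPair, Matrix.of_apply, z1, z2]
    ring
  · ext α β
    simp only [blockT, blockP, block, dualPair, Matrix.of_apply, z1, z2, z3, Matrix.sub_apply,
      Matrix.smul_apply, Matrix.one_apply, smul_eq_mul, mul_ite, mul_one, mul_zero]
    ring
  · ext α β
    simp only [blockT, block, dualPair, Matrix.of_apply, z1, z2, z3, Matrix.transpose_apply]
    rw [hC.pair (e (α + 1).succ)]
    simp only [eq_comm]

theorem blocks_of_circle {s : Fin 4 → Fin 4 → ℝ} {C : Tensor4 E4} (hC : IsCurv C)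
    (h : IsCommutingArray s fun i j k l => C (e i) (e j) (e k) (e l)) {a b : ℝ} (hb : b ≠ 0)
    (hs : ∀ i j, i ≠ j → s i j = a + b * subsetMat {0, 1} i j) :
    blockD C e = blockP C e ∧
      (∃ a b : ℝ, blockP C e = a • 1 + b • diagonal ![1, 0, 0]) ∧ (blockT C e)ᵀ = blockT C e ∧
      diagonal ![1, 0, 0] * blockT C e = blockT C e * diagonal ![1, 0, 0] := by
  obtain ⟨z1, z2, z3, z4, z5, z6, z7, z8, z9, z10, z11, z12, z13, z14, z15, z16⟩ :=
    h.circle_components hb hs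
  have hl : ∀ {i j : Fin 4} (_ : j < i) (k l : Fin 4), C (e i) (e j) (e k) (e l) =
    -C (e j) (e i) (e k) (e l) := h.left_lt
  have hr : ∀ {k l : Fin 4} (_ : l < k) (i j : Fin 4), C (e i) (e j) (e k) (e l) =
    -C (e i) (e j) (e l) (e k) := h.right_lt
  have p1 := hC.pair (e 0) (e 1) (e 0) (e 2)
  have p2 := hC.pair (e 0) (e 1) (e 0) (e 3)
  have p3 := hC.pair (e 0) (e 2) (e 0) (e 3)
  have p4 := hC.pair (e 1) (e 2) (e 1) (e 3)
  have p5 := hC.pair (e 1) (e 2) (e 2) (e 3)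
  have p6 := hC.pair (e 1) (e 3) (e 2) (e 3)
  have y1 : ∀ i j : Fin 3, C (e 0) (e i.succ) (e (j + 1).succ) (e (j + 2).succ) = 0 := by
    intro i j
    fin_cases i <;> fin_cases j <;> simp [hr, z3, z4, z5, z6, z7, z8, z9, z10, z11]
  have y2 : ∀ i j : Fin 3, C (e (j + 1).succ) (e (j + 2).succ) (e 0) (e i.succ) = 0 :=
    fun i j => by rw [hC.pair, y1]
  have y3 : ∀ i j : Fin 3, C (e 0) (e i.succ) (e 0) (e j.succ) =
      !![C (e 0) (e 1) (e 0) (e 1), 0, 0; 0, C (e 0) (e 2) (e 0) (e 2), C (e 0) (e 2) (e 0) (e 3);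
        0, C (e 0) (e 2) (e 0) (e 3), C (e 0) (e 3) (e 0) (e 3)] i j := by
    intro i j
    fin_cases i <;> fin_cases j <;> simp [p1, p2, p3, z1, z2]
  have y4 : ∀ i j : Fin 3, C (e (i + 1).succ) (e (i + 2).succ) (e (j + 1).succ) (e (j + 2).succ) =
      !![C (e 2) (e 3) (e 2) (e 3), 0, 0; 0, C (e 0) (e 3) (e 0) (e 3), -C (e 0) (e 2) (e 0) (e 3);
        0, -C (e 0) (e 2) (e 0) (e 3), C (e 0) (e 2) (e 0) (e 2)] i j := by
    intro i j
    fin_cases i <;> fin_cases j <;> simp [hl, hr, p4, p5, p6, z12, z13, z14, z15, z16]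
  refine ⟨?_, ⟨(C (e 0) (e 2) (e 0) (e 2) + C (e 0) (e 3) (e 0) (e 3)) / 2,
      (C (e 0) (e 1) (e 0) (e 1) + C (e 2) (e 3) (e 2) (e 3)) / 2 -
        (C (e 0) (e 2) (e 0) (e 2) + C (e 0) (e 3) (e 0) (e 3)) / 2, ?_⟩, ?_, ?_⟩
  · ext α β
    simp only [blockD, blockP, block, dualPair, Matrix.of_apply, y1, y2]
    ring
  · ext α β
    simp only [blockP, block, dualPair, Matrix.of_apply, y1, y2, y3, y4]
    fin_cases α <;> fin_cases β <;> simp <;> ring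
  · ext α β
    simp only [blockT, block, dualPair, Matrix.of_apply, y1, y2, y3, y4, Matrix.transpose_apply]
    fin_cases α <;> fin_cases β <;> simp
  · ext α β
    rw [diagonal_mul, mul_diagonal]
    simp only [blockT, block, dualPair, Matrix.of_apply, y1, y2, y3, y4]
    fin_cases α <;> fin_cases β <;> simp

/-- Two commuting Killing tensors, one of which is diagonal, are simultaneously diagonalisable. -/
theorem HasKSMatrix.exists_push_pair {K K' : EndoField E4} {M : KSSpace} (h : HasKSMatrix K M)
    (hM : M ≠ 0) (hK' : IsKilling K') (hc : ∀ x, (K x).comp (K' x) = (K' x).comp (K x)) :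
    ∃ φ : E4 ≃ₗᵢ[ℝ] E4, (∃ M, HasKSMatrix (pushforward φ K) M) ∧
      ∃ M, HasKSMatrix (pushforward φ K') M := by
  by_cases hdeg : IsDegenerateMatrix M
  swap
  · exact ⟨LinearIsometryEquiv.refl ℝ E4, ⟨M, h⟩, h.exists_of_comm hdeg hK' hc⟩
  obtain ⟨I, b, hI, hMI⟩ := hdeg
  have hb : b ≠ 0 := fun hb => hM (by rw [hMI, hb, zero_smul])
  obtain ⟨J, σ, hJ, hσ⟩ := exists_perm_of_card hI
  obtain ⟨φ, hφ⟩ := exists_isometry_comp_perm σ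
  obtain ⟨p, t, rfl, hM'⟩ := hasKSMatrix_iff_params.mp h
  obtain ⟨C, hC, rfl⟩ := hK'.exists_eq_fieldOf
  have hcomm := (isCommutingArray (secMat_symm p t) (secMat_self p t) hC hc).perm σ
  have hcomm' : IsCommutingArray (fun i j => secMat p t (σ i) (σ j))
      fun i j k l => C.push φ (e i) (e j) (e k) (e l) := by
    convert hcomm using 5
    simp [hφ]
  obtain ⟨a, hs⟩ : ∃ a, ∀ i j, i ≠ j → secMat p t i j = a + b * subsetMat I i j := by
    rw [hMI, subsetKS, ← ofParams_smul] at hM'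
    obtain ⟨a, h1, h2⟩ := eq_ofParams_add_const hM'
    have k1 := fun α => congrFun h1 α
    have k2 := fun α => congrFun h2 α
    simp only [Pi.smul_apply, smul_eq_mul] at k1 k2
    have hI' : ∀ i j, subsetMat I i j = subsetMat I j i := fun i j => by
      simp only [subsetMat, and_comm]
    have m0 := k1 0
    have m1 := k1 1
    have m2 := k1 2
    have n0 := k2 0
    have n1 := k2 1
    have n2 := k2 2
    simp only [Fin.isValue, Fin.succ_zero_eq_one, Fin.succ_one_eq_two, zero_add, Fin.reduceAdd,
      Fin.reduceSucc, hI' 3 1] at m0 m1 m2 n0 n1 n2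
    refine ⟨a, IsCommutingArray.eq_of_six (secMat_symm p t) (f := fun i j => a + b * subsetMat I i j)
      (fun i j => by rw [hI']) ?_ ?_ ?_ ?_ ?_ ?_⟩ <;> simp [secMat] <;> linarith
  have hs' : ∀ i j, i ≠ j → secMat p t (σ i) (σ j) = a + b * subsetMat J i j := fun i j hij => by
    rw [hs _ _ (by simpa using hij), subsetMat, subsetMat]
    simp only [hσ]
  have hsymm : ∀ i j, a + b * subsetMat J i j = a + b * subsetMat J j i := fun i j => by
    simp only [subsetMat, and_comm]
  have hC₁ : (diagCurv (secMat p t)).push φ = diagCurv fun i j => a + b * subsetMat J i j := by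
    refine IsDiagCurv.eq_diagCurv (fun i j k l hijkl => ?_) ((isCurv_diagCurv _).pull _) fun i j hij => ?_
    · rw [Tensor4.pull_apply]
      simp only [LinearEquiv.coe_coe, LinearIsometryEquiv.coe_toLinearEquiv, hφ]
      refine isDiagCurv_diagCurv _ _ _ _ _ fun h' => hijkl ?_
      rw [← Set.image_pair, ← Set.image_pair] at h'
      exact σ.injective.image_injective h'
    · rw [Tensor4.pull_apply]
      simp only [LinearEquiv.coe_coe, LinearIsometryEquiv.coe_toLinearEquiv, hφ]
      rw [diagCurv_sec (secMat_symm p t) (by simpa using hij), hs' i j hij]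
  have hD₁ : blockD (diagCurv fun i j => a + b * subsetMat J i j) e =
      blockP (diagCurv fun i j => a + b * subsetMat J i j) e := by
    rw [diagCurv_eq_secMat hsymm, blockD_diagCurv, blockP_diagCurv]
  have hred : (∃ ψ : E4 ≃ₗᵢ[ℝ] E4, (∃ M, HasKSMatrix (pushforward ψ (fieldOf (diagCurv fun i j =>
      a + b * subsetMat J i j))) M) ∧ ∃ M, HasKSMatrix (pushforward ψ (fieldOf (C.push φ))) M) →
      ∃ φ : E4 ≃ₗᵢ[ℝ] E4, (∃ M, HasKSMatrix (pushforward φ (fieldOf (diagCurv (secMat p t)))) M) ∧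
        ∃ M, HasKSMatrix (pushforward φ (fieldOf C)) M := by
    rintro ⟨ψ, h1, h2⟩
    refine ⟨φ.trans ψ, ?_, ?_⟩
    · rw [← pushforward_pushforward, (pushforward_fieldOf φ _).trans (congrArg fieldOf hC₁)]; exact h1
    · rw [← pushforward_pushforward, pushforward_fieldOf φ]; exact h2
  refine hred ?_
  have hC' : IsCurv (C.push φ) := hC.pull _
  rcases hJ with rfl | rfl
  · obtain ⟨g1, ⟨x, y, g2⟩, g3, g4⟩ := blocks_of_circle hC' hcomm' hb hs'
    obtain ⟨ψ, hψ⟩ := exists_isometry_isDiagCurv (diagonal_transpose _) g3 g4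
    refine ⟨ψ, hψ _ (isCurv_diagCurv _) hD₁ ⟨a, b / 2, 0, ?_⟩ ⟨0, b / 2, 0, ?_⟩,
      hψ _ hC' g1 ⟨x, y, 0, by rw [g2, zero_smul, add_zero]⟩ ⟨0, 0, 1, by simp⟩⟩
    · rw [diagCurv_eq_secMat hsymm, blockP_diagCurv]
      ext i j
      fin_cases i <;> fin_cases j <;> simp [subsetMat] <;> ring
    · rw [diagCurv_eq_secMat hsymm, blockT_diagCurv]
      ext i j
      fin_cases i <;> fin_cases j <;> simp [subsetMat]
  · obtain ⟨g1, g2, g3⟩ := blocks_of_sphere hC' hcomm' hb hs'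
    obtain ⟨ψ, hψ⟩ := exists_isometry_isDiagCurv (E := 0) (by simp) g3 (by simp)
    refine ⟨ψ, hψ _ (isCurv_diagCurv _) hD₁ ⟨a + b / 2, 0, 0, ?_⟩ ⟨-(b / 2), 0, 0, ?_⟩,
      hψ _ hC' g1 ⟨C.push φ (e 0) (e 1) (e 0) (e 1), 0, -1, by
        rw [g2, smul_zero, add_zero, neg_smul, one_smul, ← sub_eq_add_neg]⟩
        ⟨0, 0, 1, by simp⟩⟩
    · rw [diagCurv_eq_secMat hsymm, blockP_diagCurv]
      ext i j
      fin_cases i <;> fin_cases j <;> simp [subsetMat] <;> ring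
    · rw [diagCurv_eq_secMat hsymm, blockT_diagCurv]
      ext i j
      fin_cases i <;> fin_cases j <;> simp [subsetMat] <;> ring

end CommutingFields

end KillingStaeckel

end

noncomputable section

set_option linter.unusedSectionVars false

namespace KillingStaeckel

/-! ### Stäckel systems -/

section StaeckelLines

theorem HasKSMatrix.comm_relations {K K' : EndoField E4} {M M' : KSSpace} (h : HasKSMatrix K M)
    (h' : HasKSMatrix K' M') (hc : ∀ x, (K x).comp (K' x) = (K' x).comp (K x)) :
    dVec M 0 * dVec M' 1 = dVec M 1 * dVec M' 0 ∧
      ((∀ i, dVec M' i = 0) → (M : Matrix (Fin 3) (Fin 3) ℝ).mulVec (tVec M') = 0) := by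
  obtain ⟨p, t, rfl, rfl⟩ := hasKSMatrix_iff_params.mp h
  obtain ⟨p', t', rfl, rfl⟩ := hasKSMatrix_iff_params.mp h'
  have harr := isCommutingArray (secMat_symm p t) (secMat_self p t) (isCurv_diagCurv _) hc
  have key : ∀ i j k l : Fin 4, i ≠ j → i ≠ k → i ≠ l → j ≠ k → j ≠ l → k ≠ l →
      secMat p t i j * (secMat p' t' i k - secMat p' t' j k) +
        secMat p t i k * (secMat p' t' j k - secMat p' t' i j) +
        secMat p t j k * (secMat p' t' i j - secMat p' t' i k) = 0 := by
    intro i j k l hij hik hil hjk hjl hkl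
    obtain ⟨σ, rfl, rfl, rfl, rfl⟩ := IsCommutingArray.exists_perm_fin_four hij hik hil hjk hjl hkl
    have := (harr.perm σ).face_relation
    simp only [diagCurv_sec (secMat_symm p' t') hij, diagCurv_sec (secMat_symm p' t') hik,
      diagCurv_sec (secMat_symm p' t') hjk] at this
    refine this ?_ ?_ ?_ <;> rw [diagCurv_e] <;> simp
  have f1 := key 0 1 2 3 (by decide) (by decide) (by decide) (by decide) (by decide) (by decide)
  have f2 := key 0 1 3 2 (by decide) (by decide) (by decide) (by decide) (by decide) (by decide)
  have f3 := key 0 2 3 1 (by decide) (by decide) (by decide) (by decide) (by decide) (by decide)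
  have f4 := key 1 2 3 0 (by decide) (by decide) (by decide) (by decide) (by decide) (by decide)
  simp [secMat] at f1 f2 f3 f4
  constructor
  · simp [dVec, coe_ofParams]
    linear_combination (f1 - f2 + f3 - f4) / 4
  · intro hd
    have d0 := hd 0
    have d1 := hd 1
    simp [dVec, coe_ofParams] at d0 d1
    have e1 : p' 1 = p' 0 := by linarith
    have e2 : p' 2 = p' 0 := by linarith
    rw [e1, e2] at f1 f2 f3 f4
    rw [tVec_ofParams, coe_ofParams]
    ext i
    fin_cases i <;> simp [Matrix.mulVec, dotProduct, Fin.sum_univ_three]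
    · linear_combination (-1 / 4) * (f1 - f2 - f3 + f4)
    · linear_combination (-1 / 4) * (f1 + f2 + f3 + f4)
    · linear_combination (-1 / 4) * (-f1 - f2 + f3 + f4)

theorem mul_eq_mul_of_sum_eq_zero {a b : Fin 3 → ℝ} (ha : a 0 + a 1 + a 2 = 0)
    (hb : b 0 + b 1 + b 2 = 0) (hab : a 0 * b 1 = a 1 * b 0) (i j : Fin 3) :
    a i * b j = a j * b i := by
  have ha' : a 2 = -a 0 - a 1 := by linarith
  have hb' : b 2 = -b 0 - b 1 := by linarith
  fin_cases i <;> fin_cases j <;> simp [ha', hb'] <;> linarith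

/-- Spaces of matrices with the relations between the matrices of commuting Killing tensors. -/
theorem finrank_eq_two_of_comm_relations {L : Submodule ℝ KSSpace} (h2 : 2 ≤ Module.finrank ℝ L)
    (hL : ∀ M ∈ L, ∀ N ∈ L, dVec M 0 * dVec N 1 = dVec M 1 * dVec N 0 ∧
      ((∀ i, dVec N i = 0) → (M : Matrix (Fin 3) (Fin 3) ℝ).mulVec (tVec N) = 0)) :
    Module.finrank ℝ L = 2 ∧ HasCommonKernelVector L := by
  have hpar : ∀ M ∈ L, ∀ N ∈ L, ∀ i j, dVec M i * dVec N j = dVec M j * dVec N i :=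
    fun M hM N hN => mul_eq_mul_of_sum_eq_zero (sum_dVec M) (sum_dVec N) (hL M hM N hN).1
  have hsub : ∀ M ∈ L, ∀ N ∈ L, ∀ i j, dVec (dVec M i • N + (-dVec N i) • M) j = 0 :=
    fun M hM N hN i j => by
      rw [dVec_add, dVec_smul, dVec_smul]
      linarith [hpar M hM N hN i j]
  have hmem : ∀ M ∈ L, ∀ N ∈ L, ∀ i, dVec M i • N + (-dVec N i) • M ∈ L := fun M hM N hN i =>
    L.add_mem (L.smul_mem _ hN) (L.smul_mem _ hM)
  obtain ⟨N, hN, hN0, hNd⟩ : ∃ N ∈ L, N ≠ 0 ∧ ∀ i, dVec N i = 0 := by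
    have : 0 < Module.finrank ℝ L := by omega
    have : Nontrivial L := Module.finrank_pos_iff.mp this
    obtain ⟨x, hx⟩ := exists_ne (0 : L)
    obtain ⟨y, hxy⟩ := exists_linearIndependent_pair_of_one_lt_finrank (R := ℝ) (M := L) (by omega) hx
    by_cases hdx : ∀ i, dVec (x : KSSpace) i = 0
    · exact ⟨x, x.2, fun h => hx (Subtype.ext h), hdx⟩
    push Not at hdx
    obtain ⟨i, hi⟩ := hdx
    refine ⟨_, hmem x x.2 y y.2 i, fun h => hi ?_, hsub x x.2 y y.2 i⟩
    exact ((LinearIndependent.pair_iff (R := ℝ)).mp hxy (-dVec (y : KSSpace) i)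
      (dVec (x : KSSpace) i) (by rw [add_comm]; exact Subtype.ext h)).2
  have hker : ∀ M ∈ L, (M : Matrix (Fin 3) (Fin 3) ℝ).mulVec (tVec N) = 0 := fun M hM =>
    (hL M hM N hN).2 hNd
  have hNt : tVec N ≠ 0 := fun h => hN0 (ksSpace_ext (funext hNd)
    (by rw [h]; ext i; fin_cases i <;> simp [tVec]))
  have hskew : ∀ X ∈ L, (∀ i, dVec X i = 0) → ∃ c : ℝ, X = c • N := by
    intro X hX hXd
    have h0 := hker X hX
    obtain ⟨k, hk⟩ := Function.ne_iff.mp hNt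
    rw [Pi.zero_apply] at hk
    have hcross : ∀ i, tVec X i * tVec N k = tVec X k * tVec N i := by
      obtain ⟨p, t, rfl⟩ := exists_params X
      have h1 := congrFun h0 0
      have h2 := congrFun h0 1
      have h3 := congrFun h0 2
      have d0 := hXd 0
      have d1 := hXd 1
      have d2 := hXd 2
      simp [dVec, coe_ofParams] at d0 d1 d2
      simp [coe_ofParams, Matrix.mulVec, dotProduct, Fin.sum_univ_three, d0, d1, d2] at h1 h2 h3
      rw [tVec_ofParams]
      intro i
      fin_cases i <;> fin_cases k <;> simp <;> linarith
    refine ⟨tVec X k / tVec N k, ksSpace_ext (funext fun i => ?_) (funext fun i => ?_)⟩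
    · rw [dVec_smul, hXd, hNd, mul_zero]
    · rw [tVec_smul, Pi.smul_apply, smul_eq_mul]
      field_simp
      exact hcross i
  refine ⟨le_antisymm ?_ h2, tVec N, hNt, hker⟩
  have hspan : ∃ M₀, L ≤ Submodule.span ℝ {M₀, N} := by
    by_cases hall : ∀ M ∈ L, ∀ i, dVec M i = 0
    · refine ⟨0, fun M hM => ?_⟩
      obtain ⟨c, rfl⟩ := hskew M hM (hall M hM)
      exact Submodule.smul_mem _ _ (Submodule.subset_span (by simp))
    · push Not at hall
      obtain ⟨M₀, hM₀, i, hi⟩ := hall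
      refine ⟨M₀, fun M hM => ?_⟩
      obtain ⟨c, hc⟩ := hskew _ (hmem M₀ hM₀ M hM i) (hsub M₀ hM₀ M hM i)
      rw [Submodule.mem_span_pair]
      refine ⟨dVec M i / dVec M₀ i, c / dVec M₀ i, ?_⟩
      have h1 : (dVec M₀ i)⁻¹ • (dVec M₀ i • M + (-dVec M i) • M₀) = (dVec M₀ i)⁻¹ • c • N := by rw [hc]
      rw [smul_add, smul_smul, inv_mul_cancel₀ hi, one_smul] at h1
      rw [div_eq_inv_mul, div_eq_inv_mul, mul_smul (dVec M₀ i)⁻¹ c, ← h1]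
      module
  obtain ⟨M₀, hM₀⟩ := hspan
  classical
  have h3 := Submodule.finrank_mono hM₀
  have h4 := finrank_span_le_card (R := ℝ) ({M₀, N} : Set KSSpace)
  rw [Set.toFinset_insert, Set.toFinset_singleton] at h4
  exact h3.trans (h4.trans Finset.card_le_two)

end StaeckelLines

end KillingStaeckel

end

noncomputable section

set_option linter.unusedSectionVars false

namespace KillingStaeckel

section StaeckelSystems

theorem finite_octahedralGroup : Finite octahedralGroup := by
  refine Finite.of_injective (fun (Q : octahedralGroup) (i j : Fin 3) => SignType.sign
    (((Q : Matrix.specialOrthogonalGroup (Fin 3) ℝ) : Matrix (Fin 3) (Fin 3) ℝ) i j)) fun P Q h => ?_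
  have key : ∀ (Q : octahedralGroup) (i j : Fin 3), (SignType.sign
      (((Q : Matrix.specialOrthogonalGroup (Fin 3) ℝ) : Matrix (Fin 3) (Fin 3) ℝ) i j) : ℝ) =
      ((Q : Matrix.specialOrthogonalGroup (Fin 3) ℝ) : Matrix (Fin 3) (Fin 3) ℝ) i j := by
    intro Q i j
    obtain ⟨σ, η, hη, -, hQ⟩ := octahedralGroup_eq_signedPerm Q
    rw [hQ, signedPerm_apply]
    split_ifs
    · rcases mul_self_eq_one_iff.mp (hη i) with h | h <;> simp [h]
    · simp
  refine Subtype.ext (Subtype.ext (Matrix.ext fun i j => ?_))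
  rw [← key P, ← key Q]
  exact congrArg _ (congrFun (congrFun h i) j)

/-- Conjugation by a rotation of the octahedron, on all matrices. -/
def conjMat (Q : octahedralGroup) : Matrix (Fin 3) (Fin 3) ℝ →ₗ[ℝ] Matrix (Fin 3) (Fin 3) ℝ :=
  (LinearMap.mulLeft ℝ ((Q : Matrix.specialOrthogonalGroup (Fin 3) ℝ) : Matrix (Fin 3) (Fin 3) ℝ)) ∘ₗ
    LinearMap.mulRight ℝ (((Q⁻¹ : octahedralGroup) : Matrix.specialOrthogonalGroup (Fin 3) ℝ) :
        Matrix (Fin 3) (Fin 3) ℝ)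

theorem isConj_iff_conjMat {Q : octahedralGroup} {M M' : KSSpace} :
    IsConj Q M M' ↔ conjMat Q M = M' := by
  rw [IsConj, eq_comm, Matrix.mul_assoc]
  rfl

theorem conjMat_injective (Q : octahedralGroup) : Function.Injective (conjMat Q) := by
  have h1 : (((Q⁻¹ : octahedralGroup) : Matrix.specialOrthogonalGroup (Fin 3) ℝ) :
      Matrix (Fin 3) (Fin 3) ℝ) * ((Q : Matrix.specialOrthogonalGroup (Fin 3) ℝ) :
      Matrix (Fin 3) (Fin 3) ℝ) = 1 :=
    congrArg (fun P : octahedralGroup => ((P : Matrix.specialOrthogonalGroup (Fin 3) ℝ) :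
      Matrix (Fin 3) (Fin 3) ℝ)) (inv_mul_cancel Q)
  intro X Y h
  have h2 := congrArg (fun Z => (((Q⁻¹ : octahedralGroup) : Matrix.specialOrthogonalGroup (Fin 3) ℝ) :
      Matrix (Fin 3) (Fin 3) ℝ) * Z * ((Q : Matrix.specialOrthogonalGroup (Fin 3) ℝ) :
      Matrix (Fin 3) (Fin 3) ℝ)) h
  simp only [conjMat, LinearMap.comp_apply, LinearMap.mulLeft_apply, LinearMap.mulRight_apply] at h2
  rwa [← Matrix.mul_assoc, ← Matrix.mul_assoc, h1, Matrix.one_mul, Matrix.mul_assoc, h1,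
    Matrix.mul_one, ← Matrix.mul_assoc, ← Matrix.mul_assoc, h1, Matrix.one_mul, Matrix.mul_assoc, h1,
    Matrix.mul_one] at h2

theorem HasKSMatrix.add {K K' : EndoField E4} {M M' : KSSpace} (h : HasKSMatrix K M)
    (h' : HasKSMatrix K' M') : HasKSMatrix (K + K') (M + M') := by
  obtain ⟨b, rfl⟩ := hasKSMatrix_iff.mp h
  obtain ⟨b', rfl⟩ := hasKSMatrix_iff.mp h'
  exact hasKSMatrix_iff.mpr ⟨b + b', by rw [map_add]; module⟩

theorem HasKSMatrix.const_smul {K : EndoField E4} {M : KSSpace} (h : HasKSMatrix K M) (c : ℝ) :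
    HasKSMatrix (c • K) (c • M) := by
  have := h.smul c 0
  rwa [zero_smul, add_zero] at this

/-- The action of an isometry on fields as a linear map. -/
def pushforwardLM (φ : E4 ≃ₗᵢ[ℝ] E4) : EndoField E4 →ₗ[ℝ] EndoField E4 where
  toFun := pushforward φ
  map_add' K K' := by
    funext x; ext v : 1
    simp [pushforward_apply]
  map_smul' c K := by
    funext x; ext v : 1
    simp [pushforward_apply]

theorem pushforward_add (φ : E4 ≃ₗᵢ[ℝ] E4) (K K' : EndoField E4) :
    pushforward φ (K + K') = pushforward φ K + pushforward φ K' := (pushforwardLM φ).map_add K K'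

theorem pushforward_smul (φ : E4 ≃ₗᵢ[ℝ] E4) (c : ℝ) (K : EndoField E4) :
    pushforward φ (c • K) = c • pushforward φ K := (pushforwardLM φ).map_smul c K

theorem pushforward_comm {K K' : EndoField E4} (hc : ∀ x, (K x).comp (K' x) = (K' x).comp (K x))
    (φ : E4 ≃ₗᵢ[ℝ] E4) (x : Metric.sphere (0 : E4) 1) :
    (pushforward φ K x).comp (pushforward φ K' x) = (pushforward φ K' x).comp (pushforward φ K x) := by
  ext v : 1
  have := congrArg (fun f => φ (f (φ.symm v))) (hc ⟨φ.symm (x : E4), by simp⟩)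
  simpa [pushforward_apply] using this

theorem HasKSMatrix.eq_smul_metric {K : EndoField E4} {φ : E4 ≃ₗᵢ[ℝ] E4}
    (h : HasKSMatrix (pushforward φ K) 0) : ∃ b : ℝ, K = b • metric E4 := by
  obtain ⟨b, hb⟩ := hasKSMatrix_iff.mp h
  rw [map_zero, zero_add] at hb
  have hg := pushforward_affine φ.symm (0 : EndoField E4) 0 b
  rw [smul_zero, zero_smul, zero_add] at hg
  refine ⟨b, ?_⟩
  rw [← pushforward_symm_pushforward φ K, hb, hg]

/-- The matrices of the members of a space of Killing tensors which an isometry makes diagonal. -/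
def matrixSpace (S : Submodule ℝ (EndoField E4)) (φ : E4 ≃ₗᵢ[ℝ] E4) : Submodule ℝ KSSpace where
  carrier := {M | ∃ K ∈ S, HasKSMatrix (pushforward φ K) M}
  add_mem' := by
    rintro M M' ⟨K, hK, h⟩ ⟨K', hK', h'⟩
    exact ⟨K + K', S.add_mem hK hK', by rw [pushforward_add]; exact h.add h'⟩
  zero_mem' := ⟨0, S.zero_mem, hasKSMatrix_iff.mpr ⟨0, by
    rw [map_zero, zero_smul, add_zero]; exact (pushforwardLM φ).map_zero⟩⟩
  smul_mem' := by
    rintro c M ⟨K, hK, h⟩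
    exact ⟨c • K, S.smul_mem _ hK, by rw [pushforward_smul]; exact h.const_smul c⟩

theorem IsStaeckelSystem.finrank_eq {S : Submodule ℝ (EndoField E4)} (hS : IsStaeckelSystem S) :
    Module.finrank ℝ S = 3 := by
  have := hS.1
  rw [finrank_E4] at this
  omega

theorem IsDiagonalisedBy.two_le_finrank {S : Submodule ℝ (EndoField E4)} {φ : E4 ≃ₗᵢ[ℝ] E4}
    {L : Submodule ℝ KSSpace} (h : IsDiagonalisedBy S φ L) (hS : Module.finrank ℝ S = 3) :
    2 ≤ Module.finrank ℝ L := by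
  let Ψ : L × ℝ →ₗ[ℝ] EndoField E4 :=
    (ksField ∘ₗ L.subtype).coprod (LinearMap.toSpanSingleton ℝ _ (metric E4))
  have hinj : Function.Injective (pushforwardLM φ) := fun K K' hK => by
    have := congrArg (pushforward φ.symm) (show pushforward φ K = pushforward φ K' from hK)
    rwa [pushforward_symm_pushforward, pushforward_symm_pushforward] at this
  have hle : S.map (pushforwardLM φ) ≤ LinearMap.range Ψ := by
    rintro _ ⟨K, hK, rfl⟩
    obtain ⟨M, hM, hKM⟩ := h.1 K hK
    obtain ⟨b, hb⟩ := hasKSMatrix_iff.mp hKM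
    exact ⟨(⟨M, hM⟩, b), by
      change _ = pushforward φ K
      rw [hb]; simp [Ψ]⟩
  have h1 := Submodule.finrank_mono hle
  have h2 := LinearMap.finrank_range_le Ψ
  have h3 := (Submodule.equivMapOfInjective (pushforwardLM φ) hinj S).finrank_eq
  have : Module.Free ℝ L := Module.Free.of_divisionRing ℝ L
  rw [Module.finrank_prod, Module.finrank_self] at h2
  omega

theorem IsStaeckelSystem.finrank_eq_two {S : Submodule ℝ (EndoField E4)} (hS : IsStaeckelSystem S)
    {φ : E4 ≃ₗᵢ[ℝ] E4} {L : Submodule ℝ KSSpace} (h : IsDiagonalisedBy S φ L) :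
    Module.finrank ℝ L = 2 ∧ (L : Set KSSpace) ⊆ ksCone ∧ HasCommonKernelVector L := by
  obtain ⟨h1, h2⟩ := finrank_eq_two_of_comm_relations (h.two_le_finrank hS.finrank_eq)
    fun M hM N hN => by
      obtain ⟨K, hK, hKM⟩ := h.2 M hM
      obtain ⟨K', hK', hKN⟩ := h.2 N hN
      exact hKM.comm_relations hKN (pushforward_comm (hS.2.2 K hK K' hK') φ)
  exact ⟨h1, fun M hM => Matrix.exists_mulVec_eq_zero_iff.mp (h2.imp fun n hn => ⟨hn.1, hn.2 M hM⟩), h2⟩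

theorem IsDiagonalisedBy.exists_isConj {S : Submodule ℝ (EndoField E4)} {φ φ' : E4 ≃ₗᵢ[ℝ] E4}
    {L L' : Submodule ℝ KSSpace} (h : IsDiagonalisedBy S φ L) (h' : IsDiagonalisedBy S φ' L')
    (hL : Module.finrank ℝ L = Module.finrank ℝ L') :
    ∃ Q : octahedralGroup, ∀ M' : KSSpace, M' ∈ L' ↔ ∃ M ∈ L, IsConj Q M M' := by
  classical
  have := finite_octahedralGroup
  have := Fintype.ofFinite octahedralGroup
  let p : octahedralGroup → Submodule ℝ L := fun Q =>
    (L'.map KSSpace.subtype).comap (conjMat Q ∘ₗ KSSpace.subtype ∘ₗ L.subtype)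
  have hcover : ⋃ q ∈ Finset.univ.image p, (q : Set L) = Set.univ := by
    refine Set.eq_univ_of_forall fun M => ?_
    obtain ⟨K, hK, hM⟩ := h.2 M M.2
    obtain ⟨M', hM'L, hM'⟩ := h'.1 K hK
    obtain ⟨Q, s, hs, hQ⟩ := hM.exists_isConj hM'
    simp only [Finset.mem_image, Finset.mem_univ, true_and, Set.iUnion_exists,
      Set.iUnion_iUnion_eq', Set.mem_iUnion]
    refine ⟨Q, s⁻¹ • M', L'.smul_mem _ hM'L, ?_⟩
    have := (isConj_iff_conjMat.mp hQ)
    rw [Submodule.coe_smul, map_smul] at this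
    rw [map_smul, Submodule.subtype_apply, ← this, smul_smul, inv_mul_cancel₀ hs, one_smul]
    rfl
  have htop := Subspace.top_mem_of_biUnion_eq_univ (k := ℝ) (E := L) hcover
  simp only [Finset.mem_image, Finset.mem_univ, true_and] at htop
  obtain ⟨Q, hQ⟩ := htop
  have hle : L.map (conjMat Q ∘ₗ KSSpace.subtype) ≤ L'.map KSSpace.subtype := by
    rintro _ ⟨M, hM, rfl⟩
    have : (⟨M, hM⟩ : L) ∈ p Q := by rw [hQ]; trivial
    exact this
  have heq : L.map (conjMat Q ∘ₗ KSSpace.subtype) = L'.map KSSpace.subtype := by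
    refine Submodule.eq_of_le_of_finrank_eq hle ?_
    rw [← (Submodule.equivMapOfInjective _
      (show Function.Injective (conjMat Q ∘ₗ KSSpace.subtype) from
        (conjMat_injective Q).comp KSSpace.subtype_injective) L).finrank_eq,
      ← (Submodule.equivMapOfInjective _ (Submodule.subtype_injective _) L').finrank_eq, hL]
  refine ⟨Q, fun M' => ⟨fun hM' => ?_, ?_⟩⟩
  · have : (M' : Matrix (Fin 3) (Fin 3) ℝ) ∈ L.map (conjMat Q ∘ₗ KSSpace.subtype) := by
      rw [heq]; exact ⟨M', hM', rfl⟩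
    obtain ⟨M, hM, hMM'⟩ := this
    exact ⟨M, hM, isConj_iff_conjMat.mpr hMM'⟩
  · rintro ⟨M, hM, hMM'⟩
    obtain ⟨N, hN, hN'⟩ := hle ⟨M, hM, isConj_iff_conjMat.mp hMM'⟩
    rwa [← Subtype.ext (show (N : Matrix (Fin 3) (Fin 3) ℝ) = M' from hN')]

theorem exists_not_isDegenerateMatrix {L : Submodule ℝ KSSpace} (hL : 1 < Module.finrank ℝ L) :
    ∃ M ∈ L, ¬IsDegenerateMatrix M := by
  classical
  by_contra! hcon
  let p : Finset (Fin 4) → Submodule ℝ L := fun I => (Submodule.span ℝ {subsetKS I}).comap L.subtype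
  have hcover : ⋃ q ∈ Finset.univ.image p, (q : Set L) = Set.univ := by
    refine Set.eq_univ_of_forall fun M => ?_
    obtain ⟨I, b, -, hM⟩ := hcon M M.2
    simp only [Finset.mem_image, Finset.mem_univ, true_and, Set.iUnion_exists,
      Set.iUnion_iUnion_eq', Set.mem_iUnion]
    exact ⟨I, Submodule.mem_span_singleton.mpr ⟨b, hM.symm⟩⟩
  have htop := Subspace.top_mem_of_biUnion_eq_univ (k := ℝ) (E := L) hcover
  simp only [Finset.mem_image, Finset.mem_univ, true_and] at htop
  obtain ⟨I, hI⟩ := htop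
  have hle : L ≤ Submodule.span ℝ {subsetKS I} := fun M hM => by
    have : (⟨M, hM⟩ : L) ∈ p I := by rw [hI]; trivial
    exact this
  have h1 := Submodule.finrank_mono hle
  have h2 := finrank_span_le_card (R := ℝ) ({subsetKS I} : Set KSSpace)
  rw [Set.toFinset_singleton, Finset.card_singleton] at h2
  omega

theorem IsStaeckelSystem.exists_isDiagonalisedBy {S : Submodule ℝ (EndoField E4)}
    (hS : IsStaeckelSystem S) : ∃ φ L, IsDiagonalisedBy S φ L := by
  classical
  have h3 := hS.finrank_eq
  have hnle : ∀ K K', ¬ S ≤ Submodule.span ℝ {K, K'} := fun K K' hle => by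
    have := FiniteDimensional.span_of_finite ℝ (Set.toFinite {K, K'})
    have h1 := Submodule.finrank_mono hle
    have h2 := finrank_span_le_card (R := ℝ) ({K, K'} : Set (EndoField E4))
    rw [Set.toFinset_insert, Set.toFinset_singleton] at h2
    have := h2.trans Finset.card_le_two
    omega
  obtain ⟨K₁, hK₁, h1⟩ := SetLike.not_le_iff_exists.mp (hnle 0 (metric E4))
  obtain ⟨K₂, hK₂, h2⟩ := SetLike.not_le_iff_exists.mp (hnle K₁ (metric E4))
  obtain ⟨φ₀, M₀, hM₀⟩ := (hS.2.1 K₁ hK₁).2.exists_hasKSMatrix (hS.2.1 K₁ hK₁).1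
  have hM₀' : M₀ ≠ 0 := by
    rintro rfl
    obtain ⟨b, rfl⟩ := hM₀.eq_smul_metric
    exact h1 (Submodule.mem_span_pair.mpr ⟨0, b, by rw [smul_zero, zero_add]⟩)
  obtain ⟨ψ, ⟨M₁, hM₁⟩, M₂, hM₂⟩ := hM₀.exists_push_pair hM₀'
    ((hS.2.1 K₂ hK₂).1.pushforward φ₀) (pushforward_comm (hS.2.2 K₁ hK₁ K₂ hK₂) φ₀)
  rw [pushforward_pushforward] at hM₁ hM₂
  set φ := φ₀.trans ψ
  have hli : LinearIndependent ℝ ![M₁, M₂] := by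
    refine LinearIndependent.pair_iff.mpr fun a b hab => ?_
    have h := (hM₁.const_smul a).add (hM₂.const_smul b)
    rw [hab, ← pushforward_smul, ← pushforward_smul, ← pushforward_add] at h
    obtain ⟨c, hc⟩ := h.eq_smul_metric
    have hb : b = 0 := by
      by_contra hb
      refine h2 (Submodule.mem_span_pair.mpr ⟨-(b⁻¹ * a), b⁻¹ * c, ?_⟩)
      rw [mul_smul b⁻¹ c, ← hc, smul_add, smul_smul, smul_smul, inv_mul_cancel₀ hb]
      module
    refine ⟨?_, hb⟩
    by_contra ha
    refine h1 (Submodule.mem_span_pair.mpr ⟨0, a⁻¹ * c, ?_⟩)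
    rw [mul_smul a⁻¹ c, ← hc, hb, smul_add, smul_smul, inv_mul_cancel₀ ha]
    module
  have hspan := finrank_span_eq_card hli
  rw [Matrix.range_cons, Matrix.range_cons, Matrix.range_empty, Set.union_empty, Set.singleton_union,
    Fintype.card_fin] at hspan
  obtain ⟨M, hM, hMdeg⟩ := exists_not_isDegenerateMatrix (by rw [hspan]; norm_num)
  obtain ⟨a, b, rfl⟩ := Submodule.mem_span_pair.mp hM
  have hK := (hM₁.const_smul a).add (hM₂.const_smul b)
  rw [← pushforward_smul, ← pushforward_smul, ← pushforward_add] at hK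
  have hKS := S.add_mem (S.smul_mem a hK₁) (S.smul_mem b hK₂)
  refine ⟨φ, matrixSpace S φ, fun K' hK' => ?_, fun M hM => hM⟩
  obtain ⟨M', hM'⟩ := hK.exists_of_comm hMdeg ((hS.2.1 K' hK').1.pushforward φ)
    (pushforward_comm (hS.2.2 _ hKS K' hK') φ)
  exact ⟨M', ⟨K', hK', hM'⟩, hM'⟩

end StaeckelSystems

end KillingStaeckel

end

open KillingStaeckel in
theorem theorem4 :
    -- the matrices in `𝒜` parametrise the Killing tensors with diagonal algebraic curvature tensor, modulo
    -- the metric, and the KS-variety parametrises the integrable ones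
    ((∀ M : KSSpace, ∃ K, HasKSMatrix K M) ∧
      (∀ K M, HasKSMatrix K M → IsKilling K ∧ (IsIntegrable K ↔ M ∈ ksCone)) ∧
      (∀ K K' M M', HasKSMatrix K M → HasKSMatrix K' M' →
        ∀ c : ℝ, M' = c • M ↔ ∃ b : ℝ, K' = c • K + b • metric E4)) ∧
    -- the isomorphism of the quotients
    (∃ Φ : KillingQuotient ≃ₜ KSQuotient,
      (∀ (K : killingCone) (M : ksPunctured), Φ (Quotient.mk _ K) = Quotient.mk _ M ↔
        ∃ (φ : E4 ≃ₗᵢ[ℝ] E4) (c : ℝ), c ≠ 0 ∧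
          HasKSMatrix (pushforward φ (K : EndoField E4)) (c • (M : KSSpace))) ∧
      ∀ F : KSQuotient → ℝ, IsRegularKS F ↔ IsRegularKilling (F ∘ Φ)) ∧
    -- (i) the singularities
    ({p | IsSingularPoint p} = rankOnePoints ∪ skewSingularPoints ∧
      {p | IsSingularPoint p}.ncard = 10 ∧
      rankOnePoints.ncard = 6 ∧ skewSingularPoints.ncard = 4 ∧
      (∀ p, p ∈ rankOnePoints ↔ ∃ I : Finset (Fin 4), I.card = 2 ∧
        ∃ K, IsExtension (coordSubspace I) (metric (coordSubspace I)) K ∧ Represents K p) ∧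
      (∀ p, p ∈ skewSingularPoints ↔ ∃ I : Finset (Fin 4), I.card = 3 ∧
        ∃ K, IsExtension (coordSubspace I) (metric (coordSubspace I)) K ∧ Represents K p)) ∧
    -- (ii) Stäckel systems
    (∀ S : Submodule ℝ (EndoField E4), IsStaeckelSystem S →
      (∃ φ L, IsDiagonalisedBy S φ L) ∧
      (∀ φ L, IsDiagonalisedBy S φ L →
        Module.finrank ℝ L = 2 ∧ (L : Set KSSpace) ⊆ ksCone ∧ HasCommonKernelVector L) ∧
      (∀ φ L φ' L', IsDiagonalisedBy S φ L → IsDiagonalisedBy S φ' L' →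
        ∃ Q : octahedralGroup, ∀ M' : KSSpace, M' ∈ L' ↔ ∃ M ∈ L, IsConj Q M M')) ∧
    -- (iii) isokernel planes
    ((∀ L, IsIsokernelPlane L → ∃! i : Fin 4, ∀ K M, HasKSMatrix K M →
        (M ∈ L ↔ IsExtensionFrom (coordSubspace {i}ᶜ) K)) ∧
      (∀ i : Fin 4, ∃ L, IsIsokernelPlane L ∧ ∀ K M, HasKSMatrix K M →
        (M ∈ L ↔ IsExtensionFrom (coordSubspace {i}ᶜ) K)) ∧
      (∀ K, (∃ W : Submodule ℝ E4, Module.finrank ℝ W = 3 ∧ IsExtensionFrom W K) ↔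
        ∃ (φ : E4 ≃ₗᵢ[ℝ] E4) (M : KSSpace) (L : Submodule ℝ KSSpace),
          IsIsokernelPlane L ∧ M ∈ L ∧ HasKSMatrix (pushforward φ K) M)) ∧
    -- (iv) special Killing tensors
    ((∀ K : EndoField E4, IsSpecialKilling K → IsKilling K ∧ IsIntegrable K) ∧
      (∀ M : KSSpace, (M : Matrix (Fin 3) (Fin 3) ℝ).transpose = -M → M ∈ ksCone) ∧
      (∀ K M, HasKSMatrix K M →
        (IsSpecialKilling K ↔ (M : Matrix (Fin 3) (Fin 3) ℝ).transpose = -M)) ∧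
      (∀ K, IsSpecialKilling K ↔ ∃ (φ : E4 ≃ₗᵢ[ℝ] E4) (M : KSSpace),
        (M : Matrix (Fin 3) (Fin 3) ℝ).transpose = -M ∧ HasKSMatrix (pushforward φ K) M)) := by
  refine ⟨⟨fun M => ⟨_, hasKSMatrix_ksField M⟩, fun K M h => ⟨h.isKilling, h.isIntegrable_iff⟩,
      fun K K' M M' h h' c => h.smul_iff h' c⟩,
    ⟨quotientHomeo, fun K M => (quotientHomeo_eq_iff _ _).trans (mk_eq_quotientMap_iff K M),
      isRegularKS_iff⟩,
    ⟨setOf_isSingularPoint, ncard_singularPoints, ncard_rankOnePoints, ncard_skewSingularPoints,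
      fun p => ?_, fun p => ?_⟩,
    fun S hS => ⟨hS.exists_isDiagonalisedBy, fun φ L h => hS.finrank_eq_two h,
      fun φ L φ' L' h h' => h.exists_isConj h'
        ((hS.finrank_eq_two h).1.trans (hS.finrank_eq_two h').1.symm)⟩,
    ⟨fun L hL => hL.existsUnique, fun i => ⟨LinearMap.range (isokernelMap i),
      isIsokernelPlane_range i, fun K M h => h.mem_range_isokernelMap_iff i⟩,
      exists_isExtensionFrom_iff⟩,
    fun K h => ⟨h.isKilling, h.isIntegrable⟩, fun M hM => mem_ksCone_of_skew hM,
    fun K M h => h.isSpecialKilling_iff, isSpecialKilling_iff⟩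
  · simp only [mem_rankOnePoints_iff, exists_isExtension_metric_iff]
  · simp only [mem_skewSingularPoints_iff, exists_isExtension_metric_iff]
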